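/- Let $0<q<1$ and $[x]=(q^x-q^{-x})/(q-q^{-1})$. Let $\mathcal A(S^2_q)$ be the unital complex $*$-algebra generated by $A=A^*$, $B$, $B^*$ with relations $$AB=q^2BA,\quad AB^*=q^{-2}B^*A,\quad BB^*=q^{-2}A(1-A),\quad B^*B=A(1-q^2A).$$ For $N\in\frac12\mathbb Z$ let $\mathcal H_N$ be the Hilbert space with orthonormal basis $|l,m\rangle$, $l=|N|,|N|+1,\dots$, $m=-l,-l+1,\dots,l$ (so $\mathcal H_N$ and $\mathcal H_{-N}$ have the same labels), and let $$r^0(l)=q^{-\frac12}\frac{(q-q^{-1})[l+|N|+1][l-|N|]\pm q^{\pm1}[2|N|]}{[2l][2l+2]},\quad r^+(l)=\frac{q^{-l-\frac32-N}}{[2l+2]}\frac{\sqrt{[l+N+1][l-N+1]}}{\sqrt{[2l+1][2l+3]}},\quad r^-(l)=-q^{2l}r^+(l-1),$$ with the upper signs for $N\ge0$ and the lower ones for $N<0$ (and $r^0(0)=0$ if $N=0$). Vectors whose labels are not in the list are read as $0$. There is a $*$-representation $\pi_N$ of $\mathcal A(S^2_q)$ by bounded operators on $\mathcal H_N$ such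 that $$\begin{aligned} \pi_N(B)|l,m\rangle={}&q^m\sqrt{[l+m+1][l+m+2]}\,r^+(l)|l+1,m+1\rangle+q^m\sqrt{[l+m+1][l-m]}\,r^0(l)|l,m+1\rangle\\&+q^m\sqrt{[l-m][l-m-1]}\,r^-(l)|l-1,m+1\rangle,\\ \pi_N(B^*)|l,m\rangle={}&q^{m-1}\sqrt{[l-m+2][l-m+1]}\,r^-(l+1)|l+1,m-1\rangle+q^{m-1}\sqrt{[l+m][l-m+1]}\,r^0(l)|l,m-1\rangle\\&+q^{m-1}\sqrt{[l+m][l+m-1]}\,r^+(l-1)|l-1,m-1\rangle,\\ \pi_N(A)|l,m\rangle={}&-q^{m+l+\frac12}\sqrt{[l-m+1][l+m+1]}\,r^+(l)|l+1,m\rangle\\&+\frac{q^{-\frac12}}{1+q^2}\Big(\big([l-m+1][l+m]-q^2[l-m][l+m+1]\big)r^0(l)+q^{\frac12}\Big)|l,m\rangle\\&+q^{m-l-\frac12}\sqrt{[l-m][l+m]}\,r^-(l)|l-1,m\rangle. \end{aligned}$$ For every $N\in\frac12\mathbb Z$ let $d_N\in\mathbb C\setminus\{0\}$, and on $\mathcal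 H_N\oplus\mathcal H_{-N}$ let $\pi=\pi_N\oplus\pi_{-N}$, let $\gamma=1$ on $\mathcal H_N$ and $\gamma=-1$ on $\mathcal H_{-N}$, and let $D$ be the self-adjoint operator, with trivial kernel, given on its maximal domain by $D|l,m\rangle_N=d_N\,q^{-l}|l,m\rangle_{-N}$, $D|l,m\rangle_{-N}=\overline{d_N}\,q^{-l}|l,m\rangle_N$. Put $F=\operatorname{sign}D=D|D|^{-1}$. Then: 1. $(\mathcal A(S^2_q),\mathcal H_N\oplus\mathcal H_{-N},F,\gamma)$, with the representation $\pi$, is an even Fredholm module ($F=F^*$, $F^2=1$, $\gamma=\gamma^*$, $\gamma^2=1$, $\gamma F=-F\gamma$, $\gamma$ commutes with $\pi$, and all $[F,\pi(a)]$ are compact), and $[F,\pi(a)]$ is trace class for every $a\in\mathcal A(S^2_q)$. 2. $\phi_N(x)=\operatorname{Tr}\gamma F[F,\pi(x)]$ is a well-defined cyclic $0$-cocycle on $\mathcal A(S^2_q)$: it is linear and $\phi_N(xy)=\phi_N(yx)$. 3. The matrix $$p=\begin{pmatrix}1-A&qB\\qB^*&q^2A\end{pmatrix}\in M_2(\mathcal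 A(S^2_q))$$ is a self-adjoint projector, $p=p^*=p^2$. The pairing of the Chern character $\frac12\phi_N$ of the Fredholm module with $p$, that is $\frac12\phi_N(p_{11}+p_{22})$, is $-2N$. Equivalently, for $e=\frac12p$ one has $\phi_N(e_{11}+e_{22})=-2N$. 4. For $N\ne N'$ the Fredholm modules belonging to $N$ and $N'$ have different K-homology classes: they are not related by the equivalence relation on even Fredholm modules over $\mathcal A(S^2_q)$ generated by unitary equivalence, operator homotopy (norm-continuous paths of $F$ through Fredholm modules with fixed representation and grading), and addition of degenerate modules (those with $[F,\pi(a)]=0$ for all $a$). -/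

import Mathlib

open scoped ComplexConjugate

noncomputable section

/-! ### Trace class operators and their trace -/

section TraceClass

variable {H : Type*} [NormedAddCommGroup H] [InnerProductSpace ℂ H] [CompleteSpace H]

/-- `T` is trace class: the trace of the positive operator `|T| = (T* T)^{1/2}` in an orthonormal
basis is finite (that sum does not depend on the basis). -/
def IsTraceClass (T : H →L[ℂ] H) : Prop :=
  ∃ (s : Set H) (b : HilbertBasis s ℂ H),
    Summable fun i => (inner ℂ (b i) (CFC.abs T (b i))).re

/-- `T` is trace class with trace `t`. -/
def HasTrace (T : H →L[ℂ] H) (t : ℂ) : Prop :=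
  IsTraceClass T ∧ ∀ (s : Set H) (b : HilbertBasis s ℂ H),
    HasSum (fun i => inner ℂ (b i) (T (b i))) t

/-- `F` is the sign `D |D|⁻¹` of a self-adjoint operator `D` with trivial kernel: a self-adjoint
unitary that commutes with `D` and for which `F D` is positive (so that `F D = |D|`). -/
structure IsSignOf (F : H →L[ℂ] H) (D : H →ₗ.[ℂ] H) : Prop where
  isSelfAdjoint : IsSelfAdjoint F
  mul_self : F * F = 1
  mem_domain : ∀ x : D.domain, F x ∈ D.domain
  comm : ∀ x : D.domain, D ⟨F x, mem_domain x⟩ = F (D x)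
  nonneg : ∀ x : D.domain, 0 ≤ (inner ℂ (x : H) (F (D x))).re

end TraceClass

/-! ### Even Fredholm modules and K-homology classes -/

/-- An even Fredholm module over the `*`-algebra `𝒜` on the Hilbert space `H`.
The representation need not be unital. -/
structure EvenFredholmModule (𝒜 : Type) [Ring 𝒜] [StarRing 𝒜] [Algebra ℂ 𝒜]
    (H : Type) [NormedAddCommGroup H] [InnerProductSpace ℂ H] [CompleteSpace H] where
  /-- the representation -/
  π : 𝒜 →⋆ₙₐ[ℂ] (H →L[ℂ] H)
  /-- the Fredholm operator -/
  F : H →L[ℂ] H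
  /-- the grading -/
  γ : H →L[ℂ] H
  F_selfAdjoint : IsSelfAdjoint F
  F_mul_F : F * F = 1
  γ_selfAdjoint : IsSelfAdjoint γ
  γ_mul_γ : γ * γ = 1
  γ_mul_F : γ * F = -(F * γ)
  γ_mul_π : ∀ a, γ * π a = π a * γ
  compact_commutator : ∀ a, IsCompactOperator (F * π a - π a * F)

/-- An even Fredholm module over `𝒜`, bundled with its Hilbert space. -/
structure BundledFredholmModule (𝒜 : Type) [Ring 𝒜] [StarRing 𝒜] [Algebra ℂ 𝒜] where
  /-- the Hilbert space -/
  H : Type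
  [normedAddCommGroup : NormedAddCommGroup H]
  [innerProductSpace : InnerProductSpace ℂ H]
  [completeSpace : CompleteSpace H]
  /-- the module structure -/
  mod : EvenFredholmModule 𝒜 H

attribute [instance] BundledFredholmModule.normedAddCommGroup
  BundledFredholmModule.innerProductSpace BundledFredholmModule.completeSpace

section KHomology

variable {𝒜 : Type} [Ring 𝒜] [StarRing 𝒜] [Algebra ℂ 𝒜]

/-- Forget that the Hilbert space was given in advance. -/
def EvenFredholmModule.bundle {H : Type} [NormedAddCommGroup H] [InnerProductSpace ℂ H]
    [CompleteSpace H] (M : EvenFredholmModule 𝒜 H) : BundledFredholmModule 𝒜 :=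
  { H := H, mod := M }

/-- Operator homotopy: the representation and the grading are constant, and `F` moves along a
norm-continuous path of Fredholm modules. -/
def OperatorHomotopic {H : Type} [NormedAddCommGroup H] [InnerProductSpace ℂ H]
    [CompleteSpace H] (M M' : EvenFredholmModule 𝒜 H) : Prop :=
  ∃ P : unitInterval → EvenFredholmModule 𝒜 H,
    (∀ t, (P t).π = M.π ∧ (P t).γ = M.γ) ∧ Continuous (fun t => (P t).F) ∧
    P 0 = M ∧ P 1 = M'

/-- A Fredholm module is degenerate if `F` commutes with the whole algebra. -/
def BundledFredholmModule.Degenerate (x : BundledFredholmModule 𝒜) : Prop :=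
  ∀ a, x.mod.F * x.mod.π a = x.mod.π a * x.mod.F

/-- `x` and `y` are unitarily equivalent. -/
def BundledFredholmModule.UnitarilyEquivalent (x y : BundledFredholmModule 𝒜) : Prop :=
  ∃ U : x.H ≃ₗᵢ[ℂ] y.H,
    (∀ a u, y.mod.π a (U u) = U (x.mod.π a u)) ∧
    (∀ u, y.mod.F (U u) = U (x.mod.F u)) ∧
    (∀ u, y.mod.γ (U u) = U (x.mod.γ u))

/-- `y` is (up to unitary equivalence) the direct sum `x ⊕ w`. -/
def BundledFredholmModule.IsDirectSum (x w y : BundledFredholmModule 𝒜) : Prop :=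
  ∃ U : WithLp 2 (x.H × w.H) ≃ₗᵢ[ℂ] y.H,
    (∀ a u v, y.mod.π a (U (WithLp.toLp 2 (u, v))) =
      U (WithLp.toLp 2 (x.mod.π a u, w.mod.π a v))) ∧
    (∀ u v, y.mod.F (U (WithLp.toLp 2 (u, v))) =
      U (WithLp.toLp 2 (x.mod.F u, w.mod.F v))) ∧
    (∀ u v, y.mod.γ (U (WithLp.toLp 2 (u, v))) =
      U (WithLp.toLp 2 (x.mod.γ u, w.mod.γ v)))

/-- The elementary moves that do not change the K-homology class of an even Fredholm module. -/
inductive KHomologyStep : BundledFredholmModule 𝒜 → BundledFredholmModule 𝒜 → Prop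
  | unitary (x y : BundledFredholmModule 𝒜) (h : x.UnitarilyEquivalent y) : KHomologyStep x y
  | homotopy {H : Type} [NormedAddCommGroup H] [InnerProductSpace ℂ H] [CompleteSpace H]
      (M M' : EvenFredholmModule 𝒜 H) (h : OperatorHomotopic M M') :
      KHomologyStep M.bundle M'.bundle
  | addDegenerate (x w y : BundledFredholmModule 𝒜) (hw : w.Degenerate)
      (h : x.IsDirectSum w y) : KHomologyStep x y

/-- Two even Fredholm modules have the same class in the (even) K-homology of `𝒜`. -/
def SameKHomologyClass (x y : BundledFredholmModule 𝒜) : Prop :=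
  Relation.EqvGen KHomologyStep x y

/-- The pairing of a cyclic 0-cocycle `φ` with a matrix `e` over `𝒜`: `(φ ⊗ Tr)(e)`. -/
def cocyclePairing (φ : 𝒜 →ₗ[ℂ] ℂ) {k : ℕ} (e : Matrix (Fin k) (Fin k) 𝒜) : ℂ :=
  ∑ i, φ (e i i)

end KHomology

/-! ### The polynomial algebra of the standard Podleś sphere -/

/-- The generators `A`, `B`, `B*`. -/
inductive PodlesGen
  | A
  | B
  | Bstar

section Relations

open FreeAlgebra

/-- The defining relations. The second one is `A B* = q⁻² B* A` multiplied by `q²`. -/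
inductive PodlesRel (q : ℝ) : FreeAlgebra ℂ PodlesGen → FreeAlgebra ℂ PodlesGen → Prop
  | AB : PodlesRel q (ι ℂ .A * ι ℂ .B) (((q : ℂ) ^ 2) • (ι ℂ .B * ι ℂ .A))
  | ABstar : PodlesRel q (((q : ℂ) ^ 2) • (ι ℂ .A * ι ℂ .Bstar)) (ι ℂ .Bstar * ι ℂ .A)
  | BBstar : PodlesRel q (ι ℂ .B * ι ℂ .Bstar)
      ((((q : ℂ) ^ 2)⁻¹) • (ι ℂ .A * (1 - ι ℂ .A)))
  | BstarB : PodlesRel q (ι ℂ .Bstar * ι ℂ .B)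
      (ι ℂ .A * (1 - ((q : ℂ) ^ 2) • ι ℂ .A))

end Relations

/-- The polynomial algebra `𝒜(S²_q)` of the standard Podleś sphere. -/
def PodlesSphere (q : ℝ) : Type := RingQuot (PodlesRel q)

namespace PodlesSphere

variable (q : ℝ)

instance : Ring (PodlesSphere q) := inferInstanceAs (Ring (RingQuot (PodlesRel q)))

instance : Algebra ℂ (PodlesSphere q) := inferInstanceAs (Algebra ℂ (RingQuot (PodlesRel q)))

/-- The image of a generator. -/
def gen (g : PodlesGen) : PodlesSphere q :=
  RingQuot.mkAlgHom ℂ (PodlesRel q) (FreeAlgebra.ι ℂ g)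

/-- The generator `A`. -/
def A : PodlesSphere q := gen q .A

/-- The generator `B`. -/
def B : PodlesSphere q := gen q .B

/-- The generator `B*`. -/
def Bstar : PodlesSphere q := gen q .Bstar

theorem A_mul_B : A q * B q = ((q : ℂ) ^ 2) • (B q * A q) := by
  have h := RingQuot.mkAlgHom_rel ℂ (PodlesRel.AB (q := q))
  rw [map_mul, map_smul, map_mul] at h
  exact h

theorem A_mul_Bstar : ((q : ℂ) ^ 2) • (A q * Bstar q) = Bstar q * A q := by
  have h := RingQuot.mkAlgHom_rel ℂ (PodlesRel.ABstar (q := q))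
  rw [map_mul, map_smul, map_mul] at h
  exact h

theorem B_mul_Bstar : B q * Bstar q = (((q : ℂ) ^ 2)⁻¹) • (A q * (1 - A q)) := by
  have h := RingQuot.mkAlgHom_rel ℂ (PodlesRel.BBstar (q := q))
  rw [map_mul, map_smul, map_mul, map_sub, map_one] at h
  exact h

theorem Bstar_mul_B : Bstar q * B q = A q * (1 - ((q : ℂ) ^ 2) • A q) := by
  have h := RingQuot.mkAlgHom_rel ℂ (PodlesRel.BstarB (q := q))
  rw [map_mul, map_mul, map_sub, map_one, map_smul] at h
  exact h

/-- The opposite algebra with the conjugate complex structure, the target of the involution. -/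
def ConjOp : Type := (PodlesSphere q)ᵐᵒᵖ

instance : Ring (ConjOp q) := inferInstanceAs (Ring (PodlesSphere q)ᵐᵒᵖ)

instance : Algebra ℂ (ConjOp q) :=
  ((algebraMap ℂ (PodlesSphere q)ᵐᵒᵖ).comp (starRingEnd ℂ)).toAlgebra'
    (fun c x => Algebra.commutes (R := ℂ) (A := (PodlesSphere q)ᵐᵒᵖ) (conj c) x)

/-- The involution on generators: `A ↦ A`, `B ↦ B*`, `B* ↦ B`. -/
def genStar : PodlesGen → ConjOp q
  | .A => MulOpposite.op (A q)
  | .B => MulOpposite.op (Bstar q)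
  | .Bstar => MulOpposite.op (B q)

theorem smul_op (c : ℂ) (x : PodlesSphere q) :
    c • (show ConjOp q from MulOpposite.op x) =
      (show ConjOp q from MulOpposite.op (conj c • x)) := by
  rw [Algebra.smul_def, Algebra.smul_def]
  change MulOpposite.op (algebraMap ℂ (PodlesSphere q) (conj c)) * MulOpposite.op x = _
  rw [← MulOpposite.op_mul, ← Algebra.commutes]

theorem op_mul' (x y : PodlesSphere q) :
    (show ConjOp q from MulOpposite.op x) * (show ConjOp q from MulOpposite.op y) =
      (show ConjOp q from MulOpposite.op (y * x)) := rfl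

theorem one_sub_op (x : PodlesSphere q) :
    1 - (show ConjOp q from MulOpposite.op x) =
      (show ConjOp q from MulOpposite.op (1 - x)) := rfl

/-- The involution, as a homomorphism into the conjugate opposite algebra. -/
def starHom : PodlesSphere q →ₐ[ℂ] ConjOp q :=
  RingQuot.liftAlgHom ℂ ⟨FreeAlgebra.lift ℂ (genStar q), by
    intro x y h
    have hA : FreeAlgebra.lift ℂ (genStar q) (FreeAlgebra.ι ℂ .A) =
      (show ConjOp q from MulOpposite.op (A q)) := FreeAlgebra.lift_ι_apply _ _
    have hB : FreeAlgebra.lift ℂ (genStar q) (FreeAlgebra.ι ℂ .B) =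
      (show ConjOp q from MulOpposite.op (Bstar q)) := FreeAlgebra.lift_ι_apply _ _
    have hBs : FreeAlgebra.lift ℂ (genStar q) (FreeAlgebra.ι ℂ .Bstar) =
      (show ConjOp q from MulOpposite.op (B q)) := FreeAlgebra.lift_ι_apply _ _
    have hq : conj ((q : ℂ) ^ 2) = (q : ℂ) ^ 2 := by simp
    have hq' : conj (((q : ℂ) ^ 2)⁻¹) = ((q : ℂ) ^ 2)⁻¹ := by simp
    have hc : (1 - A q) * A q = A q * (1 - A q) := by
      rw [sub_mul, mul_sub, one_mul, mul_one]
    have hc' : (1 - ((q : ℂ) ^ 2) • A q) * A q = A q * (1 - ((q : ℂ) ^ 2) • A q) := by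
      rw [sub_mul, mul_sub, one_mul, mul_one, smul_mul_assoc, mul_smul_comm]
    cases h with
    | AB => rw [map_mul, map_smul, map_mul, hA, hB, op_mul', op_mul', smul_op, hq, A_mul_Bstar]
    | ABstar => rw [map_smul, map_mul, map_mul, hA, hBs, op_mul', op_mul', smul_op, hq, A_mul_B]
    | BBstar =>
      rw [map_smul, map_mul, map_mul, map_sub, map_one, hA, hB, hBs, one_sub_op, op_mul', op_mul',
        smul_op, hq', hc, B_mul_Bstar]
    | BstarB =>
      rw [map_mul, map_mul, map_sub, map_one, map_smul, hA, hB, hBs, smul_op, one_sub_op, op_mul',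
        op_mul', hq, hc', Bstar_mul_B]⟩

/-- The involution as a function. -/
def starFun (x : PodlesSphere q) : PodlesSphere q :=
  MulOpposite.unop (show (PodlesSphere q)ᵐᵒᵖ from starHom q x)

theorem starFun_mul (x y : PodlesSphere q) : starFun q (x * y) = starFun q y * starFun q x := by
  unfold starFun
  rw [map_mul]
  rfl

theorem starFun_add (x y : PodlesSphere q) : starFun q (x + y) = starFun q x + starFun q y := by
  unfold starFun
  rw [map_add]
  rfl

theorem starFun_algebraMap (c : ℂ) :
    starFun q (algebraMap ℂ _ c) = algebraMap ℂ _ (conj c) := by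
  unfold starFun
  rw [AlgHom.commutes]
  rfl

theorem starFun_gen (g : PodlesGen) :
    starFun q (gen q g) = MulOpposite.unop (show (PodlesSphere q)ᵐᵒᵖ from genStar q g) := by
  have h : starHom q (gen q g) = genStar q g := by
    refine (RingQuot.liftAlgHom_mkAlgHom_apply ℂ _ _ _).trans ?_
    exact FreeAlgebra.lift_ι_apply _ _
  unfold starFun
  rw [h]

theorem starFun_starFun (x : PodlesSphere q) : starFun q (starFun q x) = x := by
  obtain ⟨y, rfl⟩ := RingQuot.mkAlgHom_surjective ℂ (PodlesRel q) x
  induction y using FreeAlgebra.induction with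
  | grade0 c =>
    have h : RingQuot.mkAlgHom ℂ (PodlesRel q) (algebraMap ℂ _ c) =
      algebraMap ℂ (PodlesSphere q) c := AlgHom.commutes _ _
    refine (congrArg (fun z => starFun q (starFun q z)) h).trans ?_
    rw [starFun_algebraMap, starFun_algebraMap, Complex.conj_conj]
    exact h.symm
  | grade1 g =>
    change starFun q (starFun q (gen q g)) = gen q g
    rw [starFun_gen]
    cases g
    · exact starFun_gen q .A
    · exact starFun_gen q .Bstar
    · exact starFun_gen q .B
  | mul a b ha hb =>
    have h : RingQuot.mkAlgHom ℂ (PodlesRel q) (a * b) =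
      (show PodlesSphere q from RingQuot.mkAlgHom ℂ (PodlesRel q) a) *
      (show PodlesSphere q from RingQuot.mkAlgHom ℂ (PodlesRel q) b) := map_mul _ _ _
    refine (congrArg (fun z => starFun q (starFun q z)) h).trans ?_
    rw [starFun_mul, starFun_mul, ha, hb]
    exact h.symm
  | add a b ha hb =>
    have h : RingQuot.mkAlgHom ℂ (PodlesRel q) (a + b) =
      (show PodlesSphere q from RingQuot.mkAlgHom ℂ (PodlesRel q) a) +
      (show PodlesSphere q from RingQuot.mkAlgHom ℂ (PodlesRel q) b) := map_add _ _ _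
    refine (congrArg (fun z => starFun q (starFun q z)) h).trans ?_
    rw [starFun_add, starFun_add, ha, hb]
    exact h.symm

/-- The involution of `𝒜(S²_q)`: conjugate linear and antimultiplicative, with `A* = A` and
`(B)* = B*`. -/
instance : StarRing (PodlesSphere q) where
  star := starFun q
  star_involutive := starFun_starFun q
  star_mul := starFun_mul q
  star_add := starFun_add q

instance : StarModule ℂ (PodlesSphere q) where
  star_smul c x := by
    change starFun q (c • x) = conj c • starFun q x
    rw [Algebra.smul_def, starFun_mul, starFun_algebraMap, ← Algebra.commutes, ← Algebra.smul_def]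

theorem star_A : star (A q) = A q := starFun_gen q .A

theorem star_B : star (B q) = Bstar q := starFun_gen q .B

/-- The Podleś projector. -/
def projector : Matrix (Fin 2) (Fin 2) (PodlesSphere q) :=
  !![1 - A q, (q : ℂ) • B q; (q : ℂ) • Bstar q, ((q : ℂ) ^ 2) • A q]

end PodlesSphere

/-! ### The representations `π_N` -/

/-- The labels `(2l, 2m)` of the basis vectors `|l,m⟩` with `l = n/2, n/2 + 1, …` and
`m = -l, -l + 1, …, l`. -/
def SpinIdx (n : ℕ) : Type :=
  {p : ℤ × ℤ // ((n : ℤ) ≤ p.1 ∧ (2 : ℤ) ∣ p.1 - n) ∧ |p.2| ≤ p.1 ∧ (2 : ℤ) ∣ p.1 - p.2}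

/-- The label `l` of a basis vector. -/
def SpinIdx.l {n : ℕ} (i : SpinIdx n) : ℝ := (i.1.1 : ℝ) / 2

/-- The label `m` of a basis vector. -/
def SpinIdx.m {n : ℕ} (i : SpinIdx n) : ℝ := (i.1.2 : ℝ) / 2

/-- The Hilbert space `ℋ_N = ℋ_{-N}`, `|N| = n/2`: the completion of the direct sum of the
`(2l+1)`-dimensional spaces `V_l`, `l = n/2, n/2 + 1, …`. -/
abbrev SpinSpace (n : ℕ) : Type := lp (fun _ : SpinIdx n => ℂ) 2

open scoped Classical in
/-- The vector `|l + a, m + b⟩`, where `|l,m⟩` is the basis vector with label `i`;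
it is `0` if there is no such basis vector. -/
def ket {n : ℕ} (i : SpinIdx n) (a b : ℤ) : SpinSpace n :=
  if h : (((n : ℤ) ≤ i.1.1 + 2 * a ∧ (2 : ℤ) ∣ i.1.1 + 2 * a - n) ∧
      |i.1.2 + 2 * b| ≤ i.1.1 + 2 * a ∧ (2 : ℤ) ∣ i.1.1 + 2 * a - (i.1.2 + 2 * b))
  then lp.single 2 (⟨(i.1.1 + 2 * a, i.1.2 + 2 * b), h⟩ : SpinIdx n) (1 : ℂ)
  else 0

/-- The `q`-number `[x] = (q^x - q^{-x}) / (q - q⁻¹)`. -/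
def qNum (q x : ℝ) : ℝ := (q ^ x - q ^ (-x)) / (q - q⁻¹)

/-- The coefficient `r⁰(l)`; the upper sign is for `N ≥ 0`, the lower one for `N < 0`. -/
def rZero (q N l : ℝ) : ℝ :=
  q ^ (-(1 / 2) : ℝ) *
    ((q - q⁻¹) * qNum q (l + |N| + 1) * qNum q (l - |N|) +
      (if 0 ≤ N then q * qNum q (2 * |N|) else -(q⁻¹ * qNum q (2 * |N|)))) /
    (qNum q (2 * l) * qNum q (2 * l + 2))

/-- The coefficient `r⁺(l)`. -/
def rPlus (q N l : ℝ) : ℝ :=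
  q ^ (-l - 3 / 2 - N) / qNum q (2 * l + 2) *
    (√(qNum q (l + N + 1) * qNum q (l - N + 1)) / √(qNum q (2 * l + 1) * qNum q (2 * l + 3)))

/-- The coefficient `r⁻(l) = -q^{2l} r⁺(l-1)`. -/
def rMinus (q N l : ℝ) : ℝ := -(q ^ (2 * l) * rPlus q N (l - 1))

/-- `ρ` is the representation `π_N` of `𝒜(S²_q)` on `ℋ_N`, where `|N| = n/2`. -/
structure IsPodlesRep (q : ℝ) (n : ℕ) (N : ℝ)
    (ρ : PodlesSphere q →⋆ₐ[ℂ] (SpinSpace n →L[ℂ] SpinSpace n)) : Prop where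
  apply_B : ∀ i : SpinIdx n, ρ (PodlesSphere.B q) (ket i 0 0) =
    ((q ^ i.m * √(qNum q (i.l + i.m + 1) * qNum q (i.l + i.m + 2)) * rPlus q N i.l : ℝ) : ℂ)
      • ket i 1 1 +
    ((q ^ i.m * √(qNum q (i.l + i.m + 1) * qNum q (i.l - i.m)) * rZero q N i.l : ℝ) : ℂ)
      • ket i 0 1 +
    ((q ^ i.m * √(qNum q (i.l - i.m) * qNum q (i.l - i.m - 1)) * rMinus q N i.l : ℝ) : ℂ)
      • ket i (-1) 1
  apply_Bstar : ∀ i : SpinIdx n, ρ (PodlesSphere.Bstar q) (ket i 0 0) =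
    ((q ^ (i.m - 1) * √(qNum q (i.l - i.m + 2) * qNum q (i.l - i.m + 1)) *
      rMinus q N (i.l + 1) : ℝ) : ℂ) • ket i 1 (-1) +
    ((q ^ (i.m - 1) * √(qNum q (i.l + i.m) * qNum q (i.l - i.m + 1)) *
      rZero q N i.l : ℝ) : ℂ) • ket i 0 (-1) +
    ((q ^ (i.m - 1) * √(qNum q (i.l + i.m) * qNum q (i.l + i.m - 1)) *
      rPlus q N (i.l - 1) : ℝ) : ℂ) • ket i (-1) (-1)
  apply_A : ∀ i : SpinIdx n, ρ (PodlesSphere.A q) (ket i 0 0) =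
    ((-(q ^ (i.m + i.l + 1 / 2) * √(qNum q (i.l - i.m + 1) * qNum q (i.l + i.m + 1)) *
      rPlus q N i.l) : ℝ) : ℂ) • ket i 1 0 +
    ((q ^ (-(1 / 2) : ℝ) / (1 + q ^ 2) *
      ((qNum q (i.l - i.m + 1) * qNum q (i.l + i.m) -
        q ^ 2 * (qNum q (i.l - i.m) * qNum q (i.l + i.m + 1))) * rZero q N i.l +
        q ^ (1 / 2 : ℝ)) : ℝ) : ℂ) • ket i 0 0 +
    ((q ^ (i.m - i.l - 1 / 2) * √(qNum q (i.l - i.m) * qNum q (i.l + i.m)) *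
      rMinus q N i.l : ℝ) : ℂ) • ket i (-1) 0

/-! ### The Dirac operator and the Fredholm module on `ℋ_N ⊕ ℋ_{-N}` -/

/-- The Hilbert space `ℋ_N ⊕ ℋ_{-N}`, `|N| = n/2`. -/
abbrev DoubleSpace (n : ℕ) : Type := WithLp 2 (SpinSpace n × SpinSpace n)

/-- The self-adjoint operator `|l,m⟩ ↦ q^{-l} |l,m⟩` on its maximal domain. -/
def growth (q : ℝ) (n : ℕ) : SpinSpace n →ₗ.[ℂ] SpinSpace n where
  domain :=
    { carrier := {x | Memℓp (fun i : SpinIdx n => ((q ^ (-i.l) : ℝ) : ℂ) * x i) 2}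
      zero_mem' := by
        have h : Memℓp (0 : SpinIdx n → ℂ) 2 := zero_memℓp
        refine (congrArg (fun f => Memℓp f 2) ?_).mp h
        funext i
        simp
      add_mem' := by
        intro x y hx hy
        have h := Memℓp.add hx hy
        refine (congrArg (fun f => Memℓp f 2) ?_).mp h
        funext i
        simp [mul_add]
      smul_mem' := by
        intro c x hx
        have h := Memℓp.const_smul hx c
        refine (congrArg (fun f => Memℓp f 2) ?_).mp h
        funext i
        simp [mul_left_comm] }
  toFun :=
    { toFun := fun x => ⟨fun i => ((q ^ (-i.l) : ℝ) : ℂ) * x.1 i, x.2⟩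
      map_add' := by
        intro x y
        ext i
        exact mul_add _ _ _
      map_smul' := by
        intro c x
        ext i
        exact mul_left_comm _ _ _ }

/-- The domain of the Dirac operator. -/
def diracDomain (q : ℝ) (n : ℕ) : Submodule ℂ (DoubleSpace n) :=
  ((growth q n).domain.prod (growth q n).domain).comap
    (WithLp.linearEquiv 2 ℂ (SpinSpace n × SpinSpace n)).toLinearMap

/-- The Dirac operator on `ℋ_N ⊕ ℋ_{-N}`:
`D |l,m⟩_N = d q^{-l} |l,m⟩_{-N}` and `D |l,m⟩_{-N} = d̄ q^{-l} |l,m⟩_N`. -/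
def dirac (q : ℝ) (d : ℂ) (n : ℕ) : DoubleSpace n →ₗ.[ℂ] DoubleSpace n where
  domain := diracDomain q n
  toFun := (WithLp.linearEquiv 2 ℂ (SpinSpace n × SpinSpace n)).symm.toLinearMap ∘ₗ
    LinearMap.prod
      (conj d • (growth q n).toFun ∘ₗ
        LinearMap.restrict (p := diracDomain q n) (q := (growth q n).domain)
          (LinearMap.snd ℂ (SpinSpace n) (SpinSpace n) ∘ₗ
            (WithLp.linearEquiv 2 ℂ (SpinSpace n × SpinSpace n)).toLinearMap)
          (fun _ hx => (Submodule.mem_prod.mp hx).2))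
      (d • (growth q n).toFun ∘ₗ
        LinearMap.restrict (p := diracDomain q n) (q := (growth q n).domain)
          (LinearMap.fst ℂ (SpinSpace n) (SpinSpace n) ∘ₗ
            (WithLp.linearEquiv 2 ℂ (SpinSpace n × SpinSpace n)).toLinearMap)
          (fun _ hx => (Submodule.mem_prod.mp hx).1))

/-- `M` is the Fredholm module `(𝒜(S²_q), ℋ_N ⊕ ℋ_{-N}, F = sign D, γ)` with `N = z/2`:
the algebra acts by `π_N ⊕ π_{-N}`, and `γ` is `1` on `ℋ_N` and `-1` on `ℋ_{-N}`. -/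
structure IsPodlesFredholmModule (q : ℝ) (d : ℂ) (z : ℤ)
    (M : EvenFredholmModule (PodlesSphere q) (DoubleSpace z.natAbs)) : Prop where
  rep : ∃ ρ₁ ρ₂ : PodlesSphere q →⋆ₐ[ℂ] (SpinSpace z.natAbs →L[ℂ] SpinSpace z.natAbs),
    IsPodlesRep q z.natAbs ((z : ℝ) / 2) ρ₁ ∧ IsPodlesRep q z.natAbs (-((z : ℝ) / 2)) ρ₂ ∧
    ∀ a u v, M.π a (WithLp.toLp 2 (u, v)) = WithLp.toLp 2 (ρ₁ a u, ρ₂ a v)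
  sign : IsSignOf M.F (dirac q d z.natAbs)
  grading : ∀ u v, M.γ (WithLp.toLp 2 (u, v)) = WithLp.toLp 2 (u, -v)

end

/-! The operator `D` is multiplication by `q^{-l}` times a constant that swaps the two summands, so
its sign is `F = [0, w̄; w, 0]` with `w` the phase of `d_N`. Every commutator `[F, π(a)]` is then
off-diagonal, with entries a unimodular constant times `δ(a) = π_N(a) - π_{-N}(a)`, and the first
three claims about the module are claims about `δ` (`repDiff`).

Analysis. On the generators, the coefficients that change `l` are themselves `O(q^l)`. Those that
keep `l` need not decay, but `N` enters `r⁰` only through a term linear in `q^{-2N}` which is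
`O(q^{4l})`, so their difference is again `O(q^l)`. The twisted Leibniz rule `δ(xy) = δ(x) π_N(y) +
π_{-N}(x) δ(y)` carries the estimate to the whole algebra (`hasDecay_repDiff`). Level `l` has only
`2l+1` vectors and `∑ (2l+1) q^l` converges, so `δ(a)` is nuclear, hence compact and trace class.

Cocycle. The operator `γF[F, π(x)]` is `δ(x) ⊕ δ(x)`, so `φ_N = 2 Tr δ`; the Leibniz rule and
cyclicity of the trace give `φ_N(xy) = φ_N(yx)`. The trace of `δ(A)` is a sum over the levels which
telescopes (`div_qNum_sub_div_qNum`) to `2N/(1 - q²)`. Since `p₁₁ + p₂₂ = 1 - (1 - q²)A` and `δ(1) =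
0`, it follows that `φ_N(p₁₁ + p₂₂) = -4N`.

K-homology. The separating invariant is the index of `P F` from the even to the odd part of the
range of `P = π(p)`. It is locally constant along operator homotopies
(`IsFredholmCorner.exists_index_eq`), a degenerate summand contributes no kernel
(`BundledFredholmModule.IsDirectSum.index_eq`), and by Fedosov's formula it equals half of `Tr γF[F,
P]` when the commutator is nuclear (`IsGradedPair.two_mul_gradedIndex_eq_trace`). Here it is `-2N`,
so different `N` give different classes.

Existence of `π_N`. The operators are sums of weighted shifts of the labels. Each defining relation,
compared on a basis vector, splits by the change of `l` into scalar identities, which are monomial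
or reduce to rational identities in `q`, `q^{2l}`, `q^{2m}`, `q^{-2N}` (namespace `PodlesIdentity`);
for `l` so small that denominators vanish these are checked separately. Boundedness is read off from
the diagonal part of `B*B = A(1 - q²A)`. -/

/-! ### Nuclear operators between Hilbert spaces -/

section Nuclear

set_option linter.unusedSectionVars false

open InnerProductSpace ContinuousLinearMap
open scoped InnerProduct

variable {X Y Z : Type*}
  [NormedAddCommGroup X] [InnerProductSpace ℂ X] [CompleteSpace X]
  [NormedAddCommGroup Y] [InnerProductSpace ℂ Y] [CompleteSpace Y]
  [NormedAddCommGroup Z] [InnerProductSpace ℂ Z] [CompleteSpace Z]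

/-- A nuclear operator: an absolutely convergent sum of operators of rank one. -/
def IsNuclear (T : X →L[ℂ] Y) : Prop :=
  ∃ (ι : Type) (y : ι → Y) (x : ι → X), Summable (fun k => ‖y k‖ * ‖x k‖) ∧
    HasSum (fun k => rankOne ℂ (y k) (x k)) T

theorem IsNuclear.zero : IsNuclear (0 : X →L[ℂ] Y) :=
  ⟨Empty, Empty.elim, Empty.elim, summable_empty, by simp⟩

theorem IsNuclear.add {S T : X →L[ℂ] Y} (hS : IsNuclear S) (hT : IsNuclear T) :
    IsNuclear (S + T) := by
  obtain ⟨ι, y, x, hs, h⟩ := hS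
  obtain ⟨κ, v, u, hs', h'⟩ := hT
  refine ⟨ι ⊕ κ, Sum.elim y v, Sum.elim x u, ?_, ?_⟩
  · exact (HasSum.sum (f := fun k => ‖Sum.elim y v k‖ * ‖Sum.elim x u k‖)
      hs.hasSum hs'.hasSum).summable
  · exact HasSum.sum (f := fun k => InnerProductSpace.rankOne ℂ (Sum.elim y v k) (Sum.elim x u k))
      h h'

theorem IsNuclear.clm_comp {T : X →L[ℂ] Y} (hT : IsNuclear T) (S : Y →L[ℂ] Z) :
    IsNuclear (S ∘L T) := by
  obtain ⟨ι, y, x, hs, h⟩ := hT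
  refine ⟨ι, fun k => S (y k), x, ?_, ?_⟩
  · refine Summable.of_nonneg_of_le (fun k => by positivity) (fun k => ?_) (hs.mul_left ‖S‖)
    rw [← mul_assoc]
    exact mul_le_mul_of_nonneg_right (S.le_opNorm _) (norm_nonneg _)
  · have := h.mapL (ContinuousLinearMap.compL ℂ X Y Z S)
    simpa [comp_rankOne] using this

theorem rankOne_comp_clm (y : Z) (x : Y) (S : X →L[ℂ] Y) :
    InnerProductSpace.rankOne ℂ y x ∘L S = InnerProductSpace.rankOne ℂ y ((S†) x) := by
  ext v
  simp [adjoint_inner_left]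

theorem IsNuclear.comp_clm {T : Y →L[ℂ] Z} (hT : IsNuclear T) (S : X →L[ℂ] Y) :
    IsNuclear (T ∘L S) := by
  obtain ⟨ι, y, x, hs, h⟩ := hT
  refine ⟨ι, y, fun k => (S†) (x k), ?_, ?_⟩
  · refine Summable.of_nonneg_of_le (fun k => by positivity) (fun k => ?_) (hs.mul_left ‖S†‖)
    calc ‖y k‖ * ‖(S†) (x k)‖ ≤ ‖y k‖ * (‖S†‖ * ‖x k‖) := by gcongr; exact le_opNorm _ _
      _ = _ := by ring
  · have := h.mapL ((ContinuousLinearMap.compL ℂ X Y Z).flip S)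
    simpa [rankOne_comp_clm] using this

theorem IsNuclear.smul {T : X →L[ℂ] Y} (hT : IsNuclear T) (c : ℂ) : IsNuclear (c • T) := by
  have := hT.clm_comp (c • ContinuousLinearMap.id ℂ Y)
  rwa [smul_comp, id_comp] at this

theorem IsNuclear.neg {T : X →L[ℂ] Y} (hT : IsNuclear T) : IsNuclear (-T) := by
  simpa using hT.smul (-1)

theorem IsNuclear.sub {S T : X →L[ℂ] Y} (hS : IsNuclear S) (hT : IsNuclear T) :
    IsNuclear (S - T) := by
  rw [sub_eq_add_neg]
  exact hS.add hT.neg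

theorem IsNuclear.mul_left {T : X →L[ℂ] X} (hT : IsNuclear T) (S : X →L[ℂ] X) :
    IsNuclear (S * T) := hT.clm_comp S

theorem IsNuclear.mul_right {T : X →L[ℂ] X} (hT : IsNuclear T) (S : X →L[ℂ] X) :
    IsNuclear (T * S) := hT.comp_clm S

/-- The partial sums have finite rank and converge in operator norm. -/
theorem IsNuclear.isCompactOperator {T : X →L[ℂ] Y} (hT : IsNuclear T) : IsCompactOperator T := by
  obtain ⟨ι, y, x, hs, h⟩ := hT
  refine isCompactOperator_of_tendsto h (Filter.Eventually.of_forall fun s => ?_)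
  have : ∀ s : Finset ι, IsCompactOperator
      (∑ k ∈ s, InnerProductSpace.rankOne ℂ (y k) (x k) : X →L[ℂ] Y) := by
    classical
    intro s
    induction s using Finset.induction_on with
    | empty => simpa using! (isCompactOperator_zero : IsCompactOperator (0 : X → Y))
    | insert a s ha ih =>
      rw [Finset.sum_insert ha]
      refine IsCompactOperator.add ?_ ih
      have h1 : IsCompactOperator (toSpanSingleton ℂ (y a)) :=
        isCompactOperator_of_locallyCompactSpace_rng _
      exact h1.comp_clm (innerSL ℂ (x a))
  exact this s

/-- A bounded operator that is absolutely summable on a Hilbert basis is nuclear. -/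
theorem IsNuclear.of_summable_norm {ι : Type} (e : HilbertBasis ι ℂ X) {T : X →L[ℂ] Y}
    (h : Summable fun i => ‖T (e i)‖) : IsNuclear T := by
  have h1 : ∀ i, ‖e i‖ = 1 := e.orthonormal.1
  refine ⟨ι, fun i => T (e i), e, by simpa [h1] using h, ?_⟩
  have hs : Summable fun i => InnerProductSpace.rankOne ℂ (T (e i)) (e i) :=
    Summable.of_norm (by simpa [h1] using h)
  convert hs.hasSum using 1
  ext v
  -- At `v`, the rank-one series and `T` applied to the basis expansion of `v` are the same series.
  have h2 := hs.hasSum.mapL (ContinuousLinearMap.apply ℂ Y v)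
  have h3 := (e.hasSum_repr v).mapL T
  simp only [apply_apply, rankOne_apply] at h2
  simp only [map_smul, e.repr_apply_apply] at h3
  exact h3.unique h2

theorem HilbertBasis.hasSum_norm_inner_sq {κ : Type*} (b : HilbertBasis κ ℂ X) (v : X) :
    HasSum (fun i => ‖(inner ℂ (b i) v : ℂ)‖ ^ 2) (‖v‖ ^ 2) := by
  have h2 := b.hasSum_inner_mul_inner v v
  have h3 : ∀ i, inner ℂ v (b i) * inner ℂ (b i) v =
      ((‖(inner ℂ (b i) v : ℂ)‖ ^ 2 : ℝ) : ℂ) := by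
    intro i
    rw [← inner_conj_symm v (b i), ← Complex.normSq_eq_conj_mul_self,
      Complex.normSq_eq_norm_sq]
  have h4 : inner ℂ v v = ((‖v‖ ^ 2 : ℝ) : ℂ) := by
    rw [inner_self_eq_norm_sq_to_K]
    simp
  simp only [h3, h4] at h2
  exact Complex.hasSum_ofReal.1 h2

/-- The trace of a nuclear operator can be computed in every Hilbert basis. -/
theorem hasSum_inner_of_hasSum_rankOne {ι κ : Type*} {y x : ι → X}
    (hs : Summable fun k => ‖y k‖ * ‖x k‖) {T : X →L[ℂ] X}
    (h : HasSum (fun k => rankOne ℂ (y k) (x k)) T) (b : HilbertBasis κ ℂ X) :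
    HasSum (fun i => inner ℂ (b i) (T (b i))) (∑' k, inner ℂ (x k) (y k)) := by
  -- A double family to which Fubini is applied: summing over the basis first gives `⟨x k, y k⟩` by
  -- Parseval, summing over `k` first gives the diagonal entry of `T`.
  obtain ⟨f, hfdef⟩ : ∃ f : ι × κ → ℂ,
      ∀ k i, f (k, i) = inner ℂ (x k) (b i) * inner ℂ (b i) (y k) :=
    ⟨fun p => inner ℂ (x p.1) (b p.2) * inner ℂ (b p.2) (y p.1), fun _ _ => rfl⟩
  have hrow : ∀ k, HasSum (fun i => f (k, i)) (inner ℂ (x k) (y k)) := by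
    intro k
    simp only [hfdef]
    exact b.hasSum_inner_mul_inner (x k) (y k)
  have hnorm : ∀ v : X, HasSum (fun i => ‖inner ℂ (b i) v‖ ^ 2) (‖v‖ ^ 2) :=
    fun v => b.hasSum_norm_inner_sq v
  have hle : ∀ k, ∀ i, ‖f (k, i)‖ ≤ ‖inner ℂ (b i) (x k)‖ * ‖inner ℂ (b i) (y k)‖ := by
    intro k i
    rw [hfdef, norm_mul, norm_inner_symm]
  -- Cauchy–Schwarz and Parseval bound the absolute row sums by `‖y k‖ * ‖x k‖`, which is summable
  -- in `k`: this is the absolute summability that Fubini needs.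
  have hcs : ∀ k, Summable (fun i => ‖f (k, i)‖) ∧ ∑' i, ‖f (k, i)‖ ≤ ‖y k‖ * ‖x k‖ := by
    intro k
    have h1 := Real.summable_and_inner_le_Lp_mul_Lq_tsum_of_nonneg (Real.HolderConjugate.two_two)
      (f := fun i => ‖inner ℂ (b i) (x k)‖) (g := fun i => ‖inner ℂ (b i) (y k)‖)
      (fun i => norm_nonneg _) (fun i => norm_nonneg _)
      (by simpa using (hnorm (x k)).summable) (by simpa using (hnorm (y k)).summable)
    have e1 : ∀ v : X, (∑' i, ‖inner ℂ (b i) v‖ ^ (2 : ℝ)) ^ (1 / 2 : ℝ) = ‖v‖ := by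
      intro v
      have : ∑' i, ‖inner ℂ (b i) v‖ ^ (2 : ℝ) = ‖v‖ ^ 2 := by simpa using (hnorm v).tsum_eq
      rw [this, ← Real.sqrt_eq_rpow, Real.sqrt_sq (norm_nonneg _)]
    rw [e1, e1] at h1
    have h2 := Summable.of_nonneg_of_le (fun i => norm_nonneg _) (hle k) h1.1
    exact ⟨h2, (h2.tsum_le_tsum (hle k) h1.1).trans (by linarith [mul_comm ‖x k‖ ‖y k‖])⟩
  have hf : Summable f := by
    refine Summable.of_norm ?_
    refine (summable_prod_of_nonneg (fun _ => norm_nonneg _)).2 ⟨fun k => (hcs k).1, ?_⟩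
    exact Summable.of_nonneg_of_le (fun k => tsum_nonneg fun i => norm_nonneg _)
      (fun k => (hcs k).2) hs
  have htot : HasSum f (∑' k, inner ℂ (x k) (y k)) := by
    have := hf.hasSum.prod_fiberwise hrow
    rw [this.tsum_eq]
    exact hf.hasSum
  have hsw : HasSum (fun p : κ × ι => f (p.2, p.1)) (∑' k, inner ℂ (x k) (y k)) :=
    (Equiv.prodComm κ ι).hasSum_iff.2 htot
  refine hsw.prod_fiberwise fun i => ?_
  have h4 := h.mapL ((innerSL ℂ (b i)) ∘L (ContinuousLinearMap.apply ℂ X (b i)))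
  simpa [hfdef, mul_comm] using h4

/-- The trace of a nuclear operator. -/
noncomputable def nuclearTrace (T : X →L[ℂ] X) : ℂ :=
  ∑' i, inner ℂ ((exists_hilbertBasis ℂ X).choose_spec.choose i)
    (T ((exists_hilbertBasis ℂ X).choose_spec.choose i))

/-- The basis picked in the definition plays no role: every representing series computes the same
number. -/
theorem nuclearTrace_eq_tsum {ι : Type*} {y x : ι → X}
    (hs : Summable fun k => ‖y k‖ * ‖x k‖) {T : X →L[ℂ] X}
    (h : HasSum (fun k => rankOne ℂ (y k) (x k)) T) :
    nuclearTrace T = ∑' k, inner ℂ (x k) (y k) :=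
  (hasSum_inner_of_hasSum_rankOne hs h _).tsum_eq

theorem IsNuclear.hasSum_trace {T : X →L[ℂ] X} (hT : IsNuclear T) {κ : Type*}
    (b : HilbertBasis κ ℂ X) :
    HasSum (fun i => inner ℂ (b i) (T (b i))) (nuclearTrace T) := by
  obtain ⟨ι, y, x, hs, h⟩ := hT
  rw [nuclearTrace_eq_tsum hs h]
  exact hasSum_inner_of_hasSum_rankOne hs h b

theorem nuclearTrace_add {S T : X →L[ℂ] X} (hS : IsNuclear S) (hT : IsNuclear T) :
    nuclearTrace (S + T) = nuclearTrace S + nuclearTrace T := by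
  obtain ⟨w, b, -⟩ := exists_hilbertBasis ℂ X
  refine ((hS.add hT).hasSum_trace b).unique ?_
  simpa [inner_add_right] using (hS.hasSum_trace b).add (hT.hasSum_trace b)

theorem nuclearTrace_smul {T : X →L[ℂ] X} (hT : IsNuclear T) (c : ℂ) :
    nuclearTrace (c • T) = c * nuclearTrace T := by
  obtain ⟨w, b, -⟩ := exists_hilbertBasis ℂ X
  refine ((hT.smul c).hasSum_trace b).unique ?_
  simpa [inner_smul_right] using (hT.hasSum_trace b).mul_left c

theorem nuclearTrace_neg {T : X →L[ℂ] X} (hT : IsNuclear T) :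
    nuclearTrace (-T) = -nuclearTrace T := by
  simpa using nuclearTrace_smul hT (-1)

theorem nuclearTrace_sub {S T : X →L[ℂ] X} (hS : IsNuclear S) (hT : IsNuclear T) :
    nuclearTrace (S - T) = nuclearTrace S - nuclearTrace T := by
  rw [sub_eq_add_neg, nuclearTrace_add hS hT.neg, nuclearTrace_neg hT, sub_eq_add_neg]

theorem nuclearTrace_zero : nuclearTrace (0 : X →L[ℂ] X) = 0 := by
  simp [nuclearTrace]

/-- On a rank-one term both sides are `⟨x, S y⟩ = ⟨S* x, y⟩`. Two different spaces are allowed so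
that coordinate maps of direct sums can also be moved around the trace. -/
theorem nuclearTrace_comp_comm {T : X →L[ℂ] Y} (hT : IsNuclear T) (S : Y →L[ℂ] X) :
    nuclearTrace (S ∘L T) = nuclearTrace (T ∘L S) := by
  obtain ⟨ι, y, x, hs, h⟩ := hT
  have h1 : HasSum (fun k => InnerProductSpace.rankOne ℂ (S (y k)) (x k)) (S ∘L T) := by
    simpa [comp_rankOne] using h.mapL (ContinuousLinearMap.compL ℂ X Y X S)
  have h2 : HasSum (fun k => InnerProductSpace.rankOne ℂ (y k) ((S†) (x k))) (T ∘L S) := by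
    simpa [rankOne_comp_clm] using h.mapL ((ContinuousLinearMap.compL ℂ Y X Y).flip S)
  have s1 : Summable fun k => ‖S (y k)‖ * ‖x k‖ := by
    refine Summable.of_nonneg_of_le (fun k => by positivity) (fun k => ?_) (hs.mul_left ‖S‖)
    rw [← mul_assoc]
    exact mul_le_mul_of_nonneg_right (S.le_opNorm _) (norm_nonneg _)
  have s2 : Summable fun k => ‖y k‖ * ‖(S†) (x k)‖ := by
    refine Summable.of_nonneg_of_le (fun k => by positivity) (fun k => ?_) (hs.mul_left ‖S†‖)
    calc ‖y k‖ * ‖(S†) (x k)‖ ≤ ‖y k‖ * (‖S†‖ * ‖x k‖) := by gcongr; exact le_opNorm _ _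
      _ = _ := by ring
  rw [nuclearTrace_eq_tsum s1 h1, nuclearTrace_eq_tsum s2 h2]
  simp [adjoint_inner_left]

theorem nuclearTrace_mul_comm {T : X →L[ℂ] X} (hT : IsNuclear T) (S : X →L[ℂ] X) :
    nuclearTrace (S * T) = nuclearTrace (T * S) :=
  nuclearTrace_comp_comm hT S

/-- Because `|T|² = T*T`, both squared norms equal `⟨v, T*T v⟩`. -/
theorem norm_cfcAbs_apply (T : X →L[ℂ] X) (v : X) : ‖CFC.abs T v‖ = ‖T v‖ := by
  have h1 : (CFC.abs T)† = CFC.abs T := (CFC.abs_nonneg T).isSelfAdjoint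
  have h : inner ℂ (CFC.abs T v) (CFC.abs T v) = inner ℂ (T v) (T v) := by
    rw [← adjoint_inner_right (CFC.abs T), h1, ← adjoint_inner_right T]
    have := congrArg (fun S : X →L[ℂ] X => S v) (CFC.abs_mul_abs T)
    simp only [mul_apply_eq_comp] at this
    rw [this]
    rfl
  rw [inner_self_eq_norm_sq_to_K, inner_self_eq_norm_sq_to_K] at h
  have h2 : ‖CFC.abs T v‖ ^ 2 = ‖T v‖ ^ 2 := by exact_mod_cast h
  exact (pow_left_inj₀ (norm_nonneg _) (norm_nonneg _) two_ne_zero).1 h2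

/-- Polar decomposition, in the form `|T| = W T`. -/
theorem exists_comp_eq_cfcAbs (T : X →L[ℂ] X) : ∃ W : X →L[ℂ] X, W ∘L T = CFC.abs T := by
  -- `T v ↦ |T| v` is well defined and isometric on the range of `T`; it extends to the closure `R`
  -- of the range and is then set to zero on the orthogonal complement.
  let R : Submodule ℂ X := (LinearMap.range T.toLinearMap).topologicalClosure
  have hR : ∀ v, T v ∈ R := fun v => Submodule.le_topologicalClosure _ ⟨v, rfl⟩
  let e : X →ₗ[ℂ] R := T.toLinearMap.codRestrict R hR
  have hd : DenseRange e := by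
    rw [DenseRange, Subtype.dense_iff]
    intro x hx
    have : ((fun r : R => (r : X)) '' Set.range e : Set X) = LinearMap.range T.toLinearMap := by
      ext z
      simp [e]
    change x ∈ closure ((fun r : R => (r : X)) '' Set.range e)
    rw [this]
    exact hx
  have : CompleteSpace R := (Submodule.isClosed_topologicalClosure _).completeSpace_coe
  let W : R →L[ℂ] X := (CFC.abs T).toLinearMap.extendOfNorm e
  refine ⟨W ∘L R.orthogonalProjectionOnto, ?_⟩
  ext v
  have h1 : R.orthogonalProjectionOnto (T v) = e v :=
    Submodule.orthogonalProjectionOnto_mem_subspace_eq_self (e v)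
  rw [comp_apply, comp_apply, h1]
  exact LinearMap.extendOfNorm_eq hd ⟨1, fun x => by
    rw [one_mul]; exact (norm_cfcAbs_apply T x).le⟩ v

/-- By polar decomposition `|T| = W T` is nuclear too, so its trace series converges in any basis.
-/
theorem IsNuclear.isTraceClass {T : X →L[ℂ] X} (hT : IsNuclear T) : IsTraceClass T := by
  obtain ⟨W, hW⟩ := exists_comp_eq_cfcAbs T
  obtain ⟨s, b, -⟩ := exists_hilbertBasis ℂ X
  refine ⟨s, b, ?_⟩
  have := (hT.clm_comp W).hasSum_trace b
  rw [hW] at this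
  exact (Complex.hasSum_re this).summable

theorem IsNuclear.hasTrace {T : X →L[ℂ] X} (hT : IsNuclear T) : HasTrace T (nuclearTrace T) :=
  ⟨hT.isTraceClass, fun _ b => hT.hasSum_trace b⟩

end Nuclear

/-! ### Fredholm operators between the ranges of two projections -/

section Fredholm

set_option linter.unusedSectionVars false

open ContinuousLinearMap

variable {H : Type*} [NormedAddCommGroup H] [InnerProductSpace ℂ H] [CompleteSpace H]

/-- The kernel of `T` on the range of the projection `P`. -/
def cornerKer (P T : H →L[ℂ] H) : Submodule ℂ H :=
  LinearMap.ker (1 - P).toLinearMap ⊓ LinearMap.ker T.toLinearMap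

theorem mem_cornerKer {P T : H →L[ℂ] H} {v : H} : v ∈ cornerKer P T ↔ P v = v ∧ T v = 0 := by
  rw [cornerKer, Submodule.mem_inf, LinearMap.mem_ker, LinearMap.mem_ker]
  refine and_congr_left' ?_
  change v - P v = 0 ↔ _
  rw [sub_eq_zero, eq_comm]

/-- The index of `T`, viewed as an operator from the range of `P` to the range of `Q`. -/
noncomputable def cornerIndex (P Q T : H →L[ℂ] H) : ℤ :=
  (Module.finrank ℂ (cornerKer P T) : ℤ) - Module.finrank ℂ (cornerKer Q (star T))

/-- `T` maps the range of the projection `P` to the range of the projection `Q`, and it is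
unitary modulo compact operators. -/
structure IsFredholmCorner (P Q T : H →L[ℂ] H) : Prop where
  left_proj : IsStarProjection P
  right_proj : IsStarProjection Q
  mul_left : Q * T = T
  mul_right : T * P = T
  compact_left : IsCompactOperator (P - star T * T)
  compact_right : IsCompactOperator (Q - T * star T)

namespace IsFredholmCorner

variable {P Q T : H →L[ℂ] H}

theorem star_mul_right (h : IsFredholmCorner P Q T) : star T * Q = star T := by
  have := congrArg star h.mul_left
  rwa [star_mul, h.right_proj.isSelfAdjoint.star_eq] at this

theorem star_mul_left (h : IsFredholmCorner P Q T) : P * star T = star T := by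
  have := congrArg star h.mul_right
  rwa [star_mul, h.left_proj.isSelfAdjoint.star_eq] at this

theorem symm (h : IsFredholmCorner P Q T) : IsFredholmCorner Q P (star T) :=
  ⟨h.right_proj, h.left_proj, h.star_mul_left, h.star_mul_right, by
    simpa using h.compact_right, by simpa using h.compact_left⟩

/-- On the kernel the compact operator `P - T*T` is the identity, and a space with compact identity
is finite-dimensional. -/
theorem finiteDimensional (h : IsFredholmCorner P Q T) :
    FiniteDimensional ℂ (cornerKer P T) := by
  have hfix : ∀ v ∈ cornerKer P T, (P - star T * T) v = v := by
    intro v hv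
    obtain ⟨h1, h2⟩ := mem_cornerKer.1 hv
    simp [h1, h2]
  have hcl : IsClosed (cornerKer P T : Set H) := by
    have : (cornerKer P T : Set H) = {v | P v = v} ∩ {v | T v = 0} := by
      ext v
      exact mem_cornerKer
    rw [this]
    exact (isClosed_eq P.continuous continuous_id).inter (isClosed_eq T.continuous continuous_const)
  have hc := IsCompactOperator.restrict (f := (P - star T * T).toLinearMap) h.compact_left
    (V := cornerKer P T) (fun v hv => by
      change (P - star T * T) v ∈ _
      rwa [hfix v hv]) hcl
  refine FiniteDimensional.of_isCompactOperator_id (𝕜 := ℂ) ?_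
  have hid : ⇑((P - star T * T).toLinearMap.restrict (p := cornerKer P T) (q := cornerKer P T)
      (fun v hv => by
        change (P - star T * T) v ∈ _
        rwa [hfix v hv])) = id := by
    funext v
    exact Subtype.ext (hfix v v.2)
  rw [hid] at hc
  exact hc

theorem mul_starProjection (hP : IsStarProjection P) [FiniteDimensional ℂ (cornerKer P T)] :
    P * (cornerKer P T).starProjection = (cornerKer P T).starProjection ∧
    (cornerKer P T).starProjection * P = (cornerKer P T).starProjection ∧
    T * (cornerKer P T).starProjection = 0 ∧
    (cornerKer P T).starProjection * star T = 0 := by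
  have hs : star (cornerKer P T).starProjection = (cornerKer P T).starProjection :=
    isStarProjection_starProjection.isSelfAdjoint.star_eq
  have h1 : P * (cornerKer P T).starProjection = (cornerKer P T).starProjection := by
    ext v
    exact (mem_cornerKer.1 ((cornerKer P T).starProjection_apply_mem v)).1
  have h2 : T * (cornerKer P T).starProjection = 0 := by
    ext v
    exact (mem_cornerKer.1 ((cornerKer P T).starProjection_apply_mem v)).2
  refine ⟨h1, ?_, h2, ?_⟩
  · have := congrArg star h1
    rwa [star_mul, hs, hP.isSelfAdjoint.star_eq] at this
  · have := congrArg star h2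
    rwa [star_mul, hs, star_zero] at this

/-- The projection is the finite sum of `b i ⊗ b i` over an orthonormal basis. This is how
dimensions of kernels turn into traces. -/
theorem isNuclear_starProjection (K : Submodule ℂ H) [FiniteDimensional ℂ K] :
    IsNuclear K.starProjection ∧ nuclearTrace K.starProjection = Module.finrank ℂ K := by
  let b := stdOrthonormalBasis ℂ K
  have hb : K.starProjection = ∑ i, InnerProductSpace.rankOne ℂ (b i : H) (b i : H) :=
    b.starProjection_eq_sum_rankOne
  have h1 : ∀ i, ‖(b i : H)‖ = 1 := fun i => b.norm_eq_one i
  have hsum : HasSum (fun i => InnerProductSpace.rankOne ℂ (b i : H) (b i : H))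
      K.starProjection := hb ▸ hasSum_fintype _
  have hs : Summable fun i => ‖(b i : H)‖ * ‖(b i : H)‖ := (hasSum_fintype _).summable
  refine ⟨⟨Fin (Module.finrank ℂ K), _, _, hs, hsum⟩, ?_⟩
  rw [nuclearTrace_eq_tsum hs hsum, tsum_fintype]
  simp [inner_self_eq_norm_sq_to_K, h1]

/-- The operator `T*T + Π + (1 - P)`, where `Π` projects onto the kernel, is invertible. -/
theorem isUnit_aux (h : IsFredholmCorner P Q T) [FiniteDimensional ℂ (cornerKer P T)] :
    IsUnit (star T * T + (cornerKer P T).starProjection + (1 - P)) := by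
  set K := cornerKer P T
  set p := K.starProjection
  set C := (P - star T * T) - p
  have hp : IsStarProjection p := isStarProjection_starProjection
  have hC : IsCompactOperator C :=
    h.compact_left.sub (isNuclear_starProjection K).1.isCompactOperator
  have hD : star T * T + p + (1 - P) = algebraMap ℂ _ 1 - C := by
    rw [map_one]
    simp only [C]
    abel
  rw [hD]
  -- The operator is `1 - C` with `C` compact; by the Fredholm alternative it is invertible unless
  -- `1` is an eigenvalue of `C`.
  rcases hC.hasEigenvalue_or_mem_resolventSet one_ne_zero with hev | hres
  · exfalso
    obtain ⟨v, hv⟩ := hev.exists_hasEigenvector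
    have hCv : C v = v := by simpa using hv.apply_eq_smul
    have hDv : star T (T v) + p v + (v - P v) = 0 := by
      have : (star T * T + p + (1 - P)) v = 0 := by
        rw [hD, map_one, _root_.sub_apply, hCv, one_apply_eq_self, sub_self]
      simpa using this
    have hproj : ∀ R : H →L[ℂ] H, IsStarProjection R → inner ℂ v (R v) = ((‖R v‖ ^ 2 : ℝ) : ℂ) := by
      intro R hR
      have h1 : R v = star R (R v) := by
        rw [hR.isSelfAdjoint.star_eq, ← mul_apply_eq_comp, hR.isIdempotentElem.eq]
      rw [h1, star_eq_adjoint, adjoint_inner_right, ← star_eq_adjoint, ← h1,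
        inner_self_eq_norm_sq_to_K]
      simp
    have h3 : inner ℂ v (star T (T v)) = ((‖T v‖ ^ 2 : ℝ) : ℂ) := by
      rw [star_eq_adjoint, adjoint_inner_right, inner_self_eq_norm_sq_to_K]
      simp
    -- Pairing with `v` gives `‖Tv‖² + ‖pv‖² + ‖v - Pv‖² = 0`, so the eigenvector would lie in the
    -- kernel and be orthogonal to it.
    have h4 := congrArg (inner ℂ v) hDv
    have h5 := hproj (1 - P) h.left_proj.one_sub
    rw [_root_.sub_apply, one_apply_eq_self] at h5
    rw [inner_add_right, inner_add_right, h3, hproj p hp, h5, inner_zero_right] at h4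
    have h6 : ‖T v‖ ^ 2 + ‖p v‖ ^ 2 + ‖v - P v‖ ^ 2 = 0 := by exact_mod_cast h4
    have h7 : T v = 0 := by
      rw [← norm_eq_zero]
      nlinarith [sq_nonneg ‖T v‖, sq_nonneg ‖p v‖, sq_nonneg ‖v - P v‖]
    have h8 : p v = 0 := by
      rw [← norm_eq_zero]
      nlinarith [sq_nonneg ‖T v‖, sq_nonneg ‖p v‖, sq_nonneg ‖v - P v‖]
    have h9 : v - P v = 0 := by
      rw [← norm_eq_zero]
      nlinarith [sq_nonneg ‖T v‖, sq_nonneg ‖p v‖, sq_nonneg ‖v - P v‖]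
    have hvK : v ∈ K := mem_cornerKer.2 ⟨(sub_eq_zero.1 h9).symm, h7⟩
    exact hv.2 ((Submodule.starProjection_eq_self_iff.2 hvK).symm.trans h8)
  · exact hres

/-- Take `S = D⁻¹ T*` with `D = T*T + Π + (1 - P)` from `isUnit_aux`. It inverts `T` exactly up to
the orthogonal projections onto the two kernels, so the error terms have the dimensions of the
kernels as traces. -/
theorem exists_parametrix (h : IsFredholmCorner P Q T) [FiniteDimensional ℂ (cornerKer P T)]
    [FiniteDimensional ℂ (cornerKer Q (star T))] :
    ∃ S : H →L[ℂ] H, P * S = S ∧ S * Q = S ∧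
      P - S * T = (cornerKer P T).starProjection ∧
      Q - T * S = (cornerKer Q (star T)).starProjection ∧
      (cornerKer P T).starProjection * S = 0 ∧
      S * (cornerKer Q (star T)).starProjection = 0 := by
  obtain ⟨hP1, hP2, hP3, hP4⟩ := mul_starProjection (T := T) h.left_proj
  obtain ⟨hQ1, hQ2, hQ3, hQ4⟩ := mul_starProjection (T := star T) h.right_proj
  obtain ⟨u, hu⟩ := h.isUnit_aux
  set p := (cornerKer P T).starProjection
  set r := (cornerKer Q (star T)).starProjection
  have hpp : p * p = p := (isStarProjection_starProjection (U := cornerKer P T)).isIdempotentElem.eq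
  have hps : star p = p := isStarProjection_starProjection.isSelfAdjoint.star_eq
  have hrs : star r = r := isStarProjection_starProjection.isSelfAdjoint.star_eq
  have hPs : star P = P := h.left_proj.isSelfAdjoint.star_eq
  have hQs : star Q = Q := h.right_proj.isSelfAdjoint.star_eq
  have hPP : P * P = P := h.left_proj.isIdempotentElem.eq
  obtain ⟨D, hDdef⟩ : ∃ D, D = star T * T + p + (1 - P) := ⟨_, rfl⟩
  obtain ⟨I, hI⟩ : ∃ I, I = (↑u⁻¹ : H →L[ℂ] H) := ⟨_, rfl⟩
  have hDI : D * I = 1 := by rw [hDdef, hI, ← hu, Units.mul_inv]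
  have hID : I * D = 1 := by rw [hDdef, hI, ← hu, Units.inv_mul]
  have hDs : star D = D := by
    rw [hDdef]
    simp only [star_add, star_sub, star_mul, star_star, star_one, hps, hPs]
  have hIs : star I = I := by
    have h1 := congrArg star hDI
    rw [star_mul, hDs, star_one] at h1
    calc star I = star I * (D * I) := by rw [hDI, mul_one]
      _ = I := by rw [← mul_assoc, h1, one_mul]
  -- `D` is the identity on the ranges of `p` and of `1 - P`, hence so is its inverse, and by
  -- self-adjointness the same holds for multiplication from the other side.
  have hDp : D * p = p := by
    rw [hDdef]
    linear_combination (norm := noncomm_ring) star T * hP3 + hpp - hP1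
  have hpD : p * D = p := by
    have := congrArg star hDp
    rwa [star_mul, hDs, hps] at this
  have hDP : D * (1 - P) = 1 - P := by
    rw [hDdef]
    linear_combination (norm := noncomm_ring) (-1 : H →L[ℂ] H) * star T * h.mul_right - hP2 + hPP
  have hPD : (1 - P) * D = 1 - P := by
    have := congrArg star hDP
    rwa [star_mul, hDs, star_sub, star_one, hPs] at this
  have hIp : I * p = p := by
    calc I * p = I * (D * p) := by rw [hDp]
      _ = p := by rw [← mul_assoc, hID, one_mul]
  have hpI : p * I = p := by
    calc p * I = (p * D) * I := by rw [hpD]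
      _ = p := by rw [mul_assoc, hDI, mul_one]
  have hIP : I * (1 - P) = 1 - P := by
    calc I * (1 - P) = I * (D * (1 - P)) := by rw [hDP]
      _ = 1 - P := by rw [← mul_assoc, hID, one_mul]
  have hPI : (1 - P) * I = 1 - P := by
    calc (1 - P) * I = ((1 - P) * D) * I := by rw [hPD]
      _ = 1 - P := by rw [mul_assoc, hDI, mul_one]
  have hTT : star T * T = D - p - (1 - P) := by rw [hDdef]; abel
  have hST : P - I * star T * T = p := by
    rw [mul_assoc, hTT]
    linear_combination (norm := noncomm_ring) -hID + hIp + hIP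
  refine ⟨I * star T, ?_, ?_, hST, ?_, ?_, ?_⟩
  · linear_combination (norm := noncomm_ring) -hPI * star T + h.star_mul_left
  · rw [mul_assoc, h.star_mul_right]
  -- The error `R` is self-adjoint, maps into the kernel of `T*` on the range of `Q`, and is the
  -- identity there; so it is the orthogonal projection onto that kernel.
  · obtain ⟨R, hR⟩ : ∃ R, R = Q - T * (I * star T) := ⟨_, rfl⟩
    rw [← hR]
    have hRs : star R = R := by
      rw [hR]
      simp only [star_sub, star_mul, star_star, hIs, hQs, mul_assoc]
    have hTR : star T * R = 0 := by
      have h1 : star T * T * I = P - p := by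
        rw [hTT]
        linear_combination (norm := noncomm_ring) hDI - hpI - hPI
      rw [hR]
      linear_combination (norm := noncomm_ring) h.star_mul_right - h1 * star T - h.star_mul_left +
        hP4
    have hQR : Q * R = R := by
      rw [hR]
      linear_combination (norm := noncomm_ring) h.right_proj.isIdempotentElem.eq -
        h.mul_left * (I * star T)
    have hrR : r * R = R := by
      ext v
      refine Submodule.starProjection_eq_self_iff.2 (mem_cornerKer.2 ⟨?_, ?_⟩)
      · exact congrArg (fun S : H →L[ℂ] H => S v) hQR
      · exact congrArg (fun S : H →L[ℂ] H => S v) hTR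
    have hRr : R * r = r := by
      rw [hR]
      linear_combination (norm := noncomm_ring) hQ1 - T * I * hQ3
    calc R = star (r * R) := by rw [hrR, hRs]
      _ = R * r := by rw [star_mul, hRs, hrs]
      _ = r := hRr
  · rw [← mul_assoc, hpI, hP4]
  · rw [mul_assoc, hQ3, mul_zero]

/-- Fedosov's formula for the index. -/
theorem trace_sub_trace_eq_index (h : IsFredholmCorner P Q T) {S : H →L[ℂ] H}
    (hPS : P * S = S) (hr : IsNuclear (Q - T * S)) :
    nuclearTrace (P - S * T) - nuclearTrace (Q - T * S) = (cornerIndex P Q T : ℂ) := by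
  have := h.finiteDimensional
  have := h.symm.finiteDimensional
  obtain ⟨S₀, -, h2, h3, h4, h5, h6⟩ := h.exists_parametrix
  obtain ⟨hp, hpt⟩ := isNuclear_starProjection (cornerKer P T)
  obtain ⟨hr', hrt⟩ := isNuclear_starProjection (cornerKer Q (star T))
  set p := (cornerKer P T).starProjection
  set r := (cornerKer Q (star T)).starProjection
  -- The given parametrix differs from the exact one by a nuclear operator. The correction changes
  -- the two errors by `(S₀ - S) T` and `T (S₀ - S)`, whose traces agree and cancel in the
  -- difference.
  have hdiff : S₀ - S = S₀ * (Q - T * S) - p * S := by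
    linear_combination (norm := noncomm_ring) -h2 - h3 * S + hPS
  have hN : IsNuclear (S₀ - S) := by
    rw [hdiff]
    exact (hr.mul_left S₀).sub (hp.mul_right S)
  have e1 : P - S * T = p + (S₀ - S) * T := by
    rw [← h3]
    noncomm_ring
  have e2 : Q - T * S = r + T * (S₀ - S) := by
    rw [← h4]
    noncomm_ring
  rw [e1, e2, nuclearTrace_add hp (hN.mul_right T), nuclearTrace_add hr' (hN.mul_left T),
    nuclearTrace_mul_comm hN T, hpt, hrt, cornerIndex]
  push_cast
  ring

/-- The index is locally constant. -/
theorem exists_index_eq (h : IsFredholmCorner P Q T) : ∃ ε > 0, ∀ T' : H →L[ℂ] H,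
    IsFredholmCorner P Q T' → ‖T' - T‖ < ε → cornerIndex P Q T' = cornerIndex P Q T := by
  have := h.finiteDimensional
  have := h.symm.finiteDimensional
  obtain ⟨S₀, h1, h2, h3, h4, h5, h6⟩ := h.exists_parametrix
  obtain ⟨hp, hpt⟩ := isNuclear_starProjection (cornerKer P T)
  obtain ⟨hr, hrt⟩ := isNuclear_starProjection (cornerKer Q (star T))
  -- This radius makes `‖S₀ δ‖ < 1` for the perturbation `δ`, so that `1 + S₀ δ` is invertible by
  -- the Neumann series.
  refine ⟨(‖S₀‖ + 1)⁻¹, by positivity, fun T' h' hT' => ?_⟩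
  have hcorner : cornerIndex P Q T = (Module.finrank ℂ (cornerKer P T) : ℤ) -
    Module.finrank ℂ (cornerKer Q (star T)) := rfl
  rw [hcorner]
  set p := (cornerKer P T).starProjection
  set r := (cornerKer Q (star T)).starProjection
  obtain ⟨δ, hδ⟩ : ∃ δ, δ = T' - T := ⟨_, rfl⟩
  have hT'δ : T' = T + δ := by rw [hδ]; abel
  have hδP : δ * P = δ := by
    rw [hδ]
    linear_combination (norm := noncomm_ring) h'.mul_right - h.mul_right
  have hδQ : Q * δ = δ := by
    rw [hδ]
    linear_combination (norm := noncomm_ring) h'.mul_left - h.mul_left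
  have hsmall : ‖-(S₀ * δ)‖ < 1 := by
    rw [norm_neg]
    rw [← hδ] at hT'
    have hpos : 0 < ‖S₀‖ + 1 := by positivity
    calc ‖S₀ * δ‖ ≤ ‖S₀‖ * ‖δ‖ := norm_mul_le _ _
      _ ≤ (‖S₀‖ + 1) * ‖δ‖ := by gcongr; linarith
      _ < (‖S₀‖ + 1) * (‖S₀‖ + 1)⁻¹ := by gcongr
      _ = 1 := mul_inv_cancel₀ hpos.ne'
  obtain ⟨w, hw⟩ := isUnit_one_sub_of_norm_lt_one hsmall
  rw [sub_neg_eq_add] at hw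
  -- With `u = (1 + S₀ δ)⁻¹`, the operator `u S₀` is a parametrix of `T'` with errors `u p` and `r -
  -- r δ u S₀`. Their traces are those of `p` and `r`, because `p u = p` and `S₀ r = 0`; Fedosov's
  -- formula then gives the old index.
  obtain ⟨u, hu⟩ : ∃ u, u = (↑w⁻¹ : H →L[ℂ] H) := ⟨_, rfl⟩
  have hu1 : (1 + S₀ * δ) * u = 1 := by rw [hu, ← hw, Units.mul_inv]
  have hu2 : u * (1 + S₀ * δ) = 1 := by rw [hu, ← hw, Units.inv_mul]
  have huP : u * (1 - P) = 1 - P := by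
    linear_combination (norm := noncomm_ring) hu2 * (1 - P) + u * S₀ * hδP
  have eP : P - u * S₀ * T' = u * p := by
    rw [hT'δ, ← h3]
    linear_combination (norm := noncomm_ring) -hu2 + huP
  have huS : u * S₀ = S₀ - S₀ * δ * u * S₀ := by
    linear_combination (norm := noncomm_ring) hu1 * S₀
  have eQ : Q - T' * (u * S₀) = r - r * (δ * u * S₀) := by
    have e3 : T * (u * S₀) = T * S₀ - T * S₀ * δ * u * S₀ := by rw [huS]; noncomm_ring
    have h4' : T * S₀ = Q - r := by rw [← h4]; abel
    rw [hT'δ, add_mul, e3, h4']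
    linear_combination (norm := noncomm_ring) hδQ * u * S₀
  have hPu : P * (u * S₀) = u * S₀ := by
    rw [huS]
    linear_combination (norm := noncomm_ring) h1 - h1 * δ * u * S₀
  have hpu : p * u = p := by
    linear_combination (norm := noncomm_ring) p * hu1 - h5 * δ * u
  have hpp : p * p = p := (isStarProjection_starProjection (U := cornerKer P T)).isIdempotentElem.eq
  have t1 : nuclearTrace (u * p) = Module.finrank ℂ (cornerKer P T) := by
    rw [← hpt]
    calc nuclearTrace (u * p) = nuclearTrace (p * u) := nuclearTrace_mul_comm hp u
      _ = nuclearTrace p := by rw [hpu]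
  have t2 : nuclearTrace (r - r * (δ * u * S₀)) = Module.finrank ℂ (cornerKer Q (star T)) := by
    rw [nuclearTrace_sub hr (hr.mul_right _), ← nuclearTrace_mul_comm hr, mul_assoc, h6, mul_zero,
      nuclearTrace_zero, sub_zero, hrt]
  have key := h'.trace_sub_trace_eq_index (S := u * S₀) hPu
    (by rw [eQ]; exact hr.sub (hr.mul_right _))
  rw [eP, eQ, t1, t2] at key
  exact_mod_cast key.symm

end IsFredholmCorner

end Fredholm

/-! ### The graded index -/

section GradedIndex

open ContinuousLinearMap

set_option linter.unusedSectionVars false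

variable {H : Type*} [NormedAddCommGroup H] [InnerProductSpace ℂ H]

/-- The kernel of `P F` on the part of the range of `P` where `γ` is the scalar `s`. -/
def gradedKer (P F γ : H →L[ℂ] H) (s : ℂ) : Submodule ℂ H :=
  LinearMap.ker (1 - P).toLinearMap ⊓ LinearMap.ker (γ - s • 1).toLinearMap ⊓
    LinearMap.ker (P * F).toLinearMap

theorem mem_gradedKer {P F γ : H →L[ℂ] H} {s : ℂ} {v : H} :
    v ∈ gradedKer P F γ s ↔ P v = v ∧ γ v = s • v ∧ P (F v) = 0 := by
  rw [gradedKer, Submodule.mem_inf, Submodule.mem_inf, LinearMap.mem_ker, LinearMap.mem_ker,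
    LinearMap.mem_ker, and_assoc]
  change v - P v = 0 ∧ γ v - s • v = 0 ∧ _ ↔ _
  rw [sub_eq_zero, sub_eq_zero, eq_comm (a := v)]
  rfl

/-- The index of `P F` as an operator from the even to the odd part of the range of `P`. -/
noncomputable def gradedIndex (P F γ : H →L[ℂ] H) : ℤ :=
  (Module.finrank ℂ (gradedKer P F γ 1) : ℤ) - Module.finrank ℂ (gradedKer P F γ (-1))

/-- An intertwiner need not be onto: it suffices that it reaches the kernel in the target. This lets
one injection handle unitary equivalences and added degenerate summands alike. -/
theorem finrank_gradedKer_eq {H' : Type*} [NormedAddCommGroup H'] [InnerProductSpace ℂ H']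
    {P F γ : H →L[ℂ] H} {P' F' γ' : H' →L[ℂ] H'} (Φ : H →ₗ[ℂ] H') (hΦ : Function.Injective Φ)
    (hP : ∀ v, P' (Φ v) = Φ (P v)) (hF : ∀ v, F' (Φ v) = Φ (F v)) (hγ : ∀ v, γ' (Φ v) = Φ (γ v))
    (s : ℂ) (hs : ∀ w ∈ gradedKer P' F' γ' s, ∃ v, Φ v = w) :
    Module.finrank ℂ (gradedKer P F γ s) = Module.finrank ℂ (gradedKer P' F' γ' s) := by
  have hmem : ∀ v, Φ v ∈ gradedKer P' F' γ' s ↔ v ∈ gradedKer P F γ s := by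
    intro v
    rw [mem_gradedKer, mem_gradedKer, hP, hF, hP, hγ, hΦ.eq_iff, ← map_smul, hΦ.eq_iff,
      ← map_zero Φ, hΦ.eq_iff]
  have : gradedKer P' F' γ' s = (gradedKer P F γ s).map Φ := by
    ext w
    rw [Submodule.mem_map]
    constructor
    · intro hw
      obtain ⟨v, rfl⟩ := hs w hw
      exact ⟨v, (hmem v).1 hw, rfl⟩
    · rintro ⟨v, hv, rfl⟩
      exact (hmem v).2 hv
  rw [this]
  exact (Submodule.equivMapOfInjective Φ hΦ _).finrank_eq

variable [CompleteSpace H]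

/-- A graded Hilbert space with an odd self-adjoint unitary and an even projection that commute
modulo compact operators. -/
structure IsGradedPair (P F γ : H →L[ℂ] H) : Prop where
  proj : IsStarProjection P
  F_selfAdjoint : IsSelfAdjoint F
  F_mul_F : F * F = 1
  γ_selfAdjoint : IsSelfAdjoint γ
  γ_mul_γ : γ * γ = 1
  γ_mul_F : γ * F = -(F * γ)
  γ_mul_P : γ * P = P * γ
  compact : IsCompactOperator (F * P - P * F)

namespace IsGradedPair

variable {P F γ : H →L[ℂ] H}

/-- `(1 + sγ)/2` is the projection onto the `s`-eigenspace of `γ`, and it commutes with `P`. The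
sign `s` is a parameter so that the even and the odd part are treated at once. -/
theorem isStarProjection_half (h : IsGradedPair P F γ) {s : ℝ} (hs : s * s = 1) :
    IsStarProjection (((1 / 2 : ℂ) • (1 + (s : ℂ) • γ)) * P) := by
  have hs' : (s : ℂ) * s = 1 := by exact_mod_cast hs
  have hPP := h.proj.isIdempotentElem.eq
  have hc : P * ((1 / 2 : ℂ) • (1 + (s : ℂ) • γ)) = ((1 / 2 : ℂ) • (1 + (s : ℂ) • γ)) * P := by
    rw [mul_smul_comm, smul_mul_assoc, mul_add, add_mul, mul_smul_comm, smul_mul_assoc, h.γ_mul_P,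
      one_mul, mul_one]
  have he : ((1 / 2 : ℂ) • (1 + (s : ℂ) • γ)) * ((1 / 2 : ℂ) • (1 + (s : ℂ) • γ)) =
      (1 / 2 : ℂ) • (1 + (s : ℂ) • γ) := by
    rw [smul_mul_smul_comm, mul_add, add_mul, add_mul, smul_mul_smul_comm, h.γ_mul_γ, hs']
    simp only [one_mul, mul_one]
    module
  constructor
  · rw [IsIdempotentElem, mul_assoc, ← mul_assoc P, hc, mul_assoc, hPP, ← mul_assoc, he]
  · rw [isSelfAdjoint_iff, star_mul, h.proj.isSelfAdjoint.star_eq, star_smul, star_add, star_smul,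
      star_one, h.γ_selfAdjoint.star_eq, ← hc]
    simp

/-- A vector fixed by `½(1 + sγ)P` is fixed by `P` and lies in the `s`-eigenspace of `γ`; on such
vectors the corner acts as `P F`. -/
theorem cornerKer_eq (h : IsGradedPair P F γ) {s : ℝ} (hs : s * s = 1) {P₂ T : H →L[ℂ] H}
    (hT : T = P * F * (((1 / 2 : ℂ) • (1 + (s : ℂ) • γ)) * P))
    (hP₂ : P₂ = ((1 / 2 : ℂ) • (1 + (s : ℂ) • γ)) * P) :
    cornerKer P₂ T = gradedKer P F γ s := by
  have hs' : (s : ℂ) * s = 1 := by exact_mod_cast hs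
  have hγγ : ∀ v, γ (γ v) = v := fun v => congrArg (fun S : H →L[ℂ] H => S v) h.γ_mul_γ
  have hPP : ∀ v, P (P v) = P v :=
    fun v => congrArg (fun S : H →L[ℂ] H => S v) h.proj.isIdempotentElem.eq
  have hγP : ∀ v, γ (P v) = P (γ v) := fun v => congrArg (fun S : H →L[ℂ] H => S v) h.γ_mul_P
  have hP₂v : ∀ v, P₂ v = (1 / 2 : ℂ) • (P v + (s : ℂ) • γ (P v)) := by
    intro v
    rw [hP₂]
    simp
  have hiff : ∀ v, P₂ v = v ↔ P v = v ∧ γ v = (s : ℂ) • v := by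
    intro v
    rw [hP₂v]
    constructor
    · intro hv
      have h1 : P v = v := by
        conv_lhs => rw [← hv]
        rw [map_smul, map_add, map_smul, hPP, ← hγP (P v), hPP, hv]
      refine ⟨h1, ?_⟩
      rw [h1] at hv
      calc γ v = γ ((1 / 2 : ℂ) • (v + (s : ℂ) • γ v)) := by rw [hv]
        _ = (1 / 2 : ℂ) • (((s : ℂ) * s) • γ v + (s : ℂ) • v) := by
          rw [map_smul, map_add, map_smul, hγγ, hs', one_smul]
        _ = (s : ℂ) • ((1 / 2 : ℂ) • (v + (s : ℂ) • γ v)) := by module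
        _ = (s : ℂ) • v := by rw [hv]
    · rintro ⟨h1, h2⟩
      rw [h1, h2, smul_smul, hs', one_smul]
      module
  ext v
  rw [mem_cornerKer, mem_gradedKer, hiff, and_assoc]
  refine and_congr_right fun h1 => and_congr_right fun h2 => ?_
  have : T v = P (F (P₂ v)) := by rw [hT, ← hP₂]; rfl
  rw [this, (hiff v).2 ⟨h1, h2⟩]

/-- The even and the odd part of `P`. -/
theorem exists_corner (h : IsGradedPair P F γ) : ∃ P₁ P₂ : H →L[ℂ] H,
    P₁ = ((1 / 2 : ℂ) • (1 + γ)) * P ∧ P₂ = ((1 / 2 : ℂ) • (1 - γ)) * P ∧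
    star (P * F * P₁) = P * F * P₂ ∧
    IsFredholmCorner P₁ P₂ (P * F * P₁) ∧
    cornerIndex P₁ P₂ (P * F * P₁) = gradedIndex P F γ := by
  obtain ⟨e₁, he₁⟩ : ∃ e, e = (1 / 2 : ℂ) • (1 + γ) := ⟨_, rfl⟩
  obtain ⟨e₂, he₂⟩ : ∃ e, e = (1 / 2 : ℂ) • (1 - γ) := ⟨_, rfl⟩
  have e1 : e₁ = (1 / 2 : ℂ) • (1 + ((1 : ℝ) : ℂ) • γ) := by simp [he₁]
  have e2 : e₂ = (1 / 2 : ℂ) • (1 + ((-1 : ℝ) : ℂ) • γ) := by simp [he₂, sub_eq_add_neg]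
  have hproj₁ := h.isStarProjection_half (s := 1) (by norm_num)
  have hproj₂ := h.isStarProjection_half (s := -1) (by norm_num)
  rw [← e1] at hproj₁
  rw [← e2] at hproj₂
  have hPP := h.proj.isIdempotentElem.eq
  have hPs := h.proj.isSelfAdjoint.star_eq
  have hFs := h.F_selfAdjoint.star_eq
  have hFF := h.F_mul_F
  have hc₁ : P * e₁ = e₁ * P := by
    rw [he₁, mul_smul_comm, smul_mul_assoc, mul_add, add_mul, h.γ_mul_P, one_mul, mul_one]
  have hc₂ : P * e₂ = e₂ * P := by
    rw [he₂, mul_smul_comm, smul_mul_assoc, mul_sub, sub_mul, h.γ_mul_P, one_mul, mul_one]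
  -- Since `F` is odd, it exchanges the two eigenprojections of `γ`.
  have hF₁ : F * e₁ = e₂ * F := by
    rw [he₁, he₂, mul_smul_comm, smul_mul_assoc, mul_add, sub_mul, h.γ_mul_F, one_mul, mul_one,
      sub_neg_eq_add]
  have hF₂ : F * e₂ = e₁ * F := by
    rw [he₁, he₂, mul_smul_comm, smul_mul_assoc, mul_sub, add_mul, h.γ_mul_F, one_mul, mul_one,
      sub_eq_add_neg]
  have hstar : star (P * F * (e₁ * P)) = P * F * (e₂ * P) := by
    rw [star_mul, hproj₁.isSelfAdjoint.star_eq, star_mul, hPs, hFs]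
    calc e₁ * P * (F * P) = P * (e₁ * F) * P := by rw [← hc₁]; noncomm_ring
      _ = P * F * (e₂ * P) := by rw [← hF₂]; noncomm_ring
  have hee₂ : e₂ * P * (e₂ * P) = e₂ * P := hproj₂.isIdempotentElem.eq
  have hee₁ : e₁ * P * (e₁ * P) = e₁ * P := hproj₁.isIdempotentElem.eq
  have hT' : P * F * (e₁ * P) = e₂ * P * F * P := by
    calc P * F * (e₁ * P) = P * (F * e₁) * P := by noncomm_ring
      _ = (P * e₂) * F * P := by rw [hF₁]; noncomm_ring
      _ = _ := by rw [hc₂]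
  have hS' : P * F * (e₂ * P) = e₁ * P * F * P := by
    calc P * F * (e₂ * P) = P * (F * e₂) * P := by noncomm_ring
      _ = (P * e₁) * F * P := by rw [hF₂]; noncomm_ring
      _ = _ := by rw [hc₁]
  -- The defect from unitarity contains the commutator `[F, P]` as a factor, which is compact by
  -- hypothesis.
  have hl : e₁ * P - P * F * (e₂ * P) * (P * F * (e₁ * P)) =
      e₁ * P * F * (F * P - P * F) * P := by
    have h1 : P * F * (e₂ * P) * (P * F * (e₁ * P)) = e₁ * P * F * P * F * P := by
      calc P * F * (e₂ * P) * (P * F * (e₁ * P))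
          = P * F * (e₂ * P * (e₂ * P)) * F * P := by rw [hT']; noncomm_ring [hPP]
        _ = (P * F * (e₂ * P)) * F * P := by rw [hee₂]
        _ = _ := by rw [hS']
    rw [h1]
    linear_combination (norm := noncomm_ring) - e₁ * P * hFF * P * P - e₁ * hPP * P - e₁ * hPP
  have hr : e₂ * P - P * F * (e₁ * P) * (P * F * (e₂ * P)) =
      e₂ * P * F * (F * P - P * F) * P := by
    have h1 : P * F * (e₁ * P) * (P * F * (e₂ * P)) = e₂ * P * F * P * F * P := by
      calc P * F * (e₁ * P) * (P * F * (e₂ * P))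
          = P * F * (e₁ * P * (e₁ * P)) * F * P := by rw [hS']; noncomm_ring [hPP]
        _ = (P * F * (e₁ * P)) * F * P := by rw [hee₁]
        _ = _ := by rw [hT']
    rw [h1]
    linear_combination (norm := noncomm_ring) - e₂ * P * hFF * P * P - e₂ * hPP * P - e₂ * hPP
  refine ⟨e₁ * P, e₂ * P, by rw [he₁], by rw [he₂], hstar, ⟨hproj₁, hproj₂, ?_, ?_, ?_, ?_⟩, ?_⟩
  · rw [hT', ← mul_assoc, ← mul_assoc, hee₂]
  · rw [mul_assoc, hee₁]
  · rw [hstar, hl]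
    exact (h.compact.comp_clm P).clm_comp (e₁ * P * F)
  · rw [hstar, hr]
    exact (h.compact.comp_clm P).clm_comp (e₂ * P * F)
  · rw [cornerIndex, gradedIndex, hstar,
      h.cornerKer_eq (s := 1) (by norm_num) (by rw [← e1]) (by rw [← e1]),
      h.cornerKer_eq (s := -1) (by norm_num) (by rw [← e2]) (by rw [← e2]),
      Complex.ofReal_neg, Complex.ofReal_one]

/-- The index as a trace, when the commutator is nuclear. -/
theorem two_mul_gradedIndex_eq_trace (h : IsGradedPair P F γ) (hN : IsNuclear (F * P - P * F)) :
    (2 * gradedIndex P F γ : ℂ) = nuclearTrace (γ * F * (F * P - P * F)) := by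
  obtain ⟨P₁, P₂, hP₁, hP₂, hstar, hcorner, hidx⟩ := h.exists_corner
  have hPP := h.proj.isIdempotentElem.eq
  have hFF := h.F_mul_F
  have hγF := h.γ_mul_F
  have hγP := h.γ_mul_P
  -- `C = F [F, P]` is the nuclear operator whose graded trace is wanted; only its compression `R =
  -- P C P` appears in the index.
  obtain ⟨C, hC⟩ : ∃ C, C = P - F * P * F := ⟨_, rfl⟩
  have hCN : IsNuclear C := by
    have : C = F * (F * P - P * F) := by
      rw [hC]
      linear_combination (norm := noncomm_ring) -hFF * P
    rw [this]
    exact hN.mul_left F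
  have hγC : γ * F * (F * P - P * F) = γ * C := by
    rw [hC]
    linear_combination (norm := noncomm_ring) γ * hFF * P
  obtain ⟨R, hR⟩ : ∃ R, R = P * C * P := ⟨_, rfl⟩
  have hRN : IsNuclear R := hR ▸ (hCN.mul_left P).mul_right P
  have hRP : R = P - P * F * P * F * P := by
    rw [hR, hC]
    linear_combination (norm := noncomm_ring) hPP * P + hPP
  have hc : ∀ s : ℂ, P * ((1 / 2 : ℂ) • (1 + s • γ)) = ((1 / 2 : ℂ) • (1 + s • γ)) * P := by
    intro s
    rw [mul_smul_comm, smul_mul_assoc, mul_add, add_mul, mul_smul_comm, smul_mul_assoc, hγP,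
      one_mul, mul_one]
  have hF₁ : F * ((1 / 2 : ℂ) • (1 + γ)) = ((1 / 2 : ℂ) • (1 - γ)) * F := by
    rw [mul_smul_comm, smul_mul_assoc, mul_add, sub_mul, hγF, one_mul, mul_one, sub_neg_eq_add]
  have hF₂ : F * ((1 / 2 : ℂ) • (1 - γ)) = ((1 / 2 : ℂ) • (1 + γ)) * F := by
    rw [mul_smul_comm, smul_mul_assoc, mul_sub, add_mul, hγF, one_mul, mul_one, sub_eq_add_neg]
  have hc₁ : P * ((1 / 2 : ℂ) • (1 + γ)) = ((1 / 2 : ℂ) • (1 + γ)) * P := by simpa using hc 1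
  have hc₂ : P * ((1 / 2 : ℂ) • (1 - γ)) = ((1 / 2 : ℂ) • (1 - γ)) * P := by
    simpa [sub_eq_add_neg] using hc (-1)
  have hI₁ : P₁ * P₁ = P₁ := hcorner.left_proj.isIdempotentElem.eq
  have hI₂ : P₂ * P₂ = P₂ := hcorner.right_proj.isIdempotentElem.eq
  have hP₁P : P₁ * P = P₁ := by rw [hP₁, mul_assoc, hPP]
  have hP₂P : P₂ * P = P₂ := by rw [hP₂, mul_assoc, hPP]
  have hx₁ : P * F * P₁ = P₂ * F * P := by
    calc P * F * P₁ = P * (F * ((1 / 2 : ℂ) • (1 + γ))) * P := by rw [hP₁]; noncomm_ring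
      _ = _ := by rw [hF₁, ← mul_assoc, hc₂, hP₂]
  have hx₂ : P * F * P₂ = P₁ * F * P := by
    calc P * F * P₂ = P * (F * ((1 / 2 : ℂ) • (1 - γ))) * P := by rw [hP₂]; noncomm_ring
      _ = _ := by rw [hF₂, ← mul_assoc, hc₁, hP₁]
  -- With the adjoint corner as parametrix the errors in Fedosov's formula are `½(1 ± γ)R`, so their
  -- difference is `γ R` and the index is `Tr γR`.
  have hl : P₁ - P * F * P₂ * (P * F * P₁) = ((1 / 2 : ℂ) • (1 + γ)) * R := by
    have h1 : P * F * P₂ * (P * F * P₁) = P₁ * F * P * F * P := by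
      calc P * F * P₂ * (P * F * P₁) = P * F * (P₂ * P₂) * F * P := by rw [hx₁]; noncomm_ring
        _ = _ := by rw [hI₂, hx₂]
    rw [h1, hRP, mul_sub, ← hP₁]
    congr 1
    rw [hP₁]
    noncomm_ring
  have hr : P₂ - P * F * P₁ * (P * F * P₂) = ((1 / 2 : ℂ) • (1 - γ)) * R := by
    have h1 : P * F * P₁ * (P * F * P₂) = P₂ * F * P * F * P := by
      calc P * F * P₁ * (P * F * P₂) = P * F * (P₁ * P₁) * F * P := by rw [hx₂]; noncomm_ring
        _ = _ := by rw [hI₁, hx₁]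
    rw [h1, hRP, mul_sub, ← hP₂]
    congr 1
    rw [hP₂]
    noncomm_ring
  have key := hcorner.trace_sub_trace_eq_index (S := P * F * P₂)
    (by rw [hx₂, ← mul_assoc, ← mul_assoc, hI₁]) (by rw [hr]; exact hRN.mul_left _)
  rw [hidx, hl, hr, ← nuclearTrace_sub (hRN.mul_left _) (hRN.mul_left _), ← sub_mul] at key
  have hγ' : (1 / 2 : ℂ) • (1 + γ) - (1 / 2 : ℂ) • (1 - γ) = γ := by module
  rw [hγ'] at key
  have hCP : IsNuclear (P * C) := hCN.mul_left P
  have t1 : nuclearTrace (γ * R) = nuclearTrace (γ * (P * C)) := by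
    calc nuclearTrace (γ * R) = nuclearTrace (γ * (P * C) * P) := by rw [hR]; noncomm_ring
      _ = nuclearTrace (P * (γ * (P * C))) := (nuclearTrace_mul_comm (hCP.mul_left γ) P).symm
      _ = nuclearTrace (γ * (P * C)) := by
        congr 1
        linear_combination (norm := noncomm_ring) -hγP * P * C + γ * hPP * C
  have t2 : nuclearTrace (γ * (C * P)) = nuclearTrace (γ * (P * C)) := by
    calc nuclearTrace (γ * (C * P)) = nuclearTrace ((γ * C) * P) := by rw [mul_assoc]
      _ = nuclearTrace (P * (γ * C)) := (nuclearTrace_mul_comm (hCN.mul_left γ) P).symm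
      _ = nuclearTrace (γ * (P * C)) := by rw [← mul_assoc, ← hγP, mul_assoc]
  have t3 : nuclearTrace (γ * (F * P * C * F)) = -nuclearTrace (γ * (P * C)) := by
    calc nuclearTrace (γ * (F * P * C * F)) = nuclearTrace ((γ * F * (P * C)) * F) := by
          noncomm_ring
      _ = nuclearTrace (F * (γ * F * (P * C))) :=
        (nuclearTrace_mul_comm (hCP.mul_left (γ * F)) F).symm
      _ = nuclearTrace (-(γ * (P * C))) := by
        congr 1
        linear_combination (norm := noncomm_ring) F * hγF * P * C - hFF * γ * P * C
      _ = _ := nuclearTrace_neg (hCP.mul_left γ)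
  -- Using `F² = 1` and `P² = P`, one has `C = PC - F(PC)F + (CP - PC)`. The last bracket has graded
  -- trace zero; the first two terms contribute `Tr γPC` each, because `F` anticommutes with `γ`.
  -- This is the factor `2`.
  have hdec : γ * C = γ * (P * C) - γ * (F * P * C * F) + (γ * (C * P) - γ * (P * C)) := by
    rw [hC]
    linear_combination (norm := noncomm_ring)
      -γ * hPP + γ * F * hPP * F - γ * F * P * F * P * hFF
  have hN3 : IsNuclear (γ * (F * P * C * F)) := by
    have : F * P * C * F = F * ((P * C) * F) := by noncomm_ring
    rw [this]
    exact ((hCP.mul_right F).mul_left F).mul_left γ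
  rw [hγC, hdec, nuclearTrace_add ((hCP.mul_left γ).sub hN3)
    (((hCN.mul_right P).mul_left γ).sub (hCP.mul_left γ)),
    nuclearTrace_sub (hCP.mul_left γ) hN3,
    nuclearTrace_sub ((hCN.mul_right P).mul_left γ) (hCP.mul_left γ), t2, t3, ← key, t1]
  ring

end IsGradedPair

/-- The index is invariant under operator homotopy. -/
theorem gradedIndex_eq_of_path {P γ : H →L[ℂ] H} {F : unitInterval → H →L[ℂ] H}
    (hF : Continuous F) (h : ∀ t, IsGradedPair P (F t) γ) (s t : unitInterval) :
    gradedIndex P (F s) γ = gradedIndex P (F t) γ := by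
  -- An integer that is locally constant along the path is constant, the interval being connected.
  have hlc : IsLocallyConstant fun t => gradedIndex P (F t) γ := by
    rw [IsLocallyConstant.iff_eventually_eq]
    intro t
    obtain ⟨P₁, P₂, hP₁, hP₂, -, hc, hi⟩ := (h t).exists_corner
    obtain ⟨ε, hε, hε'⟩ := hc.exists_index_eq
    have hcont : Continuous fun t => P * F t * P₁ := by fun_prop
    filter_upwards [Metric.continuous_iff'.1 hcont t ε hε] with s hs
    obtain ⟨P₁', P₂', hP₁', hP₂', -, hc', hi'⟩ := (h s).exists_corner
    -- The even and odd parts depend only on `P` and `γ`, so along the path only the operator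
    -- between them moves.
    obtain rfl : P₁' = P₁ := hP₁'.trans hP₁.symm
    obtain rfl : P₂' = P₂ := hP₂'.trans hP₂.symm
    rw [← hi, ← hi']
    exact hε' _ hc' (by rwa [← dist_eq_norm])
  exact hlc.apply_eq_of_isPreconnected isPreconnected_univ (Set.mem_univ _) (Set.mem_univ _)

end GradedIndex

/-! ### Matrices of operators -/

section Amplification

open ContinuousLinearMap

variable {H : Type*} [NormedAddCommGroup H] [InnerProductSpace ℂ H] [CompleteSpace H]

variable (H) in
/-- The space `H ⊕ H`. -/
abbrev TwoCopies : Type _ := PiLp 2 (fun _ : Fin 2 => H)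

variable (H) in
/-- The coordinate projections of `H ⊕ H`. -/
noncomputable def coordL (i : Fin 2) : TwoCopies H →L[ℂ] H := PiLp.proj 2 (fun _ : Fin 2 => H) i

theorem adjoint_coordL_apply (i : Fin 2) (u : H) :
    adjoint (coordL H i) u = WithLp.toLp 2 (Pi.single i u) := by
  refine ext_inner_left ℂ fun v => ?_
  rw [adjoint_inner_right, PiLp.inner_apply]
  have hz : ∀ j, inner ℂ (v j) ((Pi.single i u : Fin 2 → H) j) =
      if j = i then inner ℂ (v j) u else 0 := by
    intro j
    by_cases h : j = i
    · subst h
      simp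
    · simp [h]
  simp only [hz, Finset.sum_ite_eq', Finset.mem_univ, if_true]
  rfl

theorem coordL_comp_adjoint (i j : Fin 2) :
    coordL H i ∘L adjoint (coordL H j) = if i = j then 1 else 0 := by
  ext u
  rw [comp_apply, adjoint_coordL_apply]
  change (Pi.single j u : Fin 2 → H) i = _
  by_cases h : i = j
  · subst h
    simp
  · simp [h]

/-- The operator on `H ⊕ H` given by a `2 × 2` matrix of operators on `H`. -/
noncomputable def amp (M : Matrix (Fin 2) (Fin 2) (H →L[ℂ] H)) :
    TwoCopies H →L[ℂ] TwoCopies H :=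
  ∑ i, ∑ j, adjoint (coordL H i) ∘L M i j ∘L coordL H j

theorem amp_apply (M : Matrix (Fin 2) (Fin 2) (H →L[ℂ] H)) (v : TwoCopies H) (i : Fin 2) :
    amp M v i = ∑ j, M i j (v j) := by
  have h : ∀ a b, (adjoint (coordL H a) (M a b (v b))) i =
      (if i = a then M a b (v b) else 0) := by
    intro a b
    rw [adjoint_coordL_apply]
    change (Pi.single a _ : Fin 2 → H) i = _
    by_cases h : i = a
    · subst h
      simp
    · simp [h]
  change coordL H i (amp M v) = _
  rw [amp, sum_apply, map_sum]
  have h2 : ∀ a, coordL H i ((∑ j, adjoint (coordL H a) ∘L M a j ∘L coordL H j) v) =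
      if i = a then ∑ j, M a j (v j) else 0 := by
    intro a
    rw [sum_apply, map_sum]
    refine (Finset.sum_congr rfl fun b _ => h a b).trans ?_
    split_ifs <;> simp
  rw [Finset.sum_congr rfl fun a _ => h2 a]
  simp

theorem amp_mul (M N : Matrix (Fin 2) (Fin 2) (H →L[ℂ] H)) : amp (M * N) = amp M * amp N := by
  ext v i
  change amp (M * N) v i = amp M (amp N v) i
  simp only [amp_apply, Matrix.mul_apply, sum_apply, map_sum, mul_apply_eq_comp]
  exact Finset.sum_comm

theorem amp_sub (M N : Matrix (Fin 2) (Fin 2) (H →L[ℂ] H)) : amp (M - N) = amp M - amp N := by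
  ext v i
  change amp (M - N) v i = amp M v i - amp N v i
  simp [amp_apply, Finset.sum_sub_distrib]

theorem star_amp (M : Matrix (Fin 2) (Fin 2) (H →L[ℂ] H)) : star (amp M) = amp (star M) := by
  rw [star_eq_adjoint, amp, amp, map_sum]
  refine (Finset.sum_congr rfl fun i _ => (map_sum _ _ _)).trans ?_
  rw [Finset.sum_comm]
  refine Finset.sum_congr rfl fun j _ => Finset.sum_congr rfl fun i _ => ?_
  rw [adjoint_comp, adjoint_comp, adjoint_adjoint, comp_assoc]
  rfl

theorem continuous_amp : Continuous (amp : Matrix (Fin 2) (Fin 2) (H →L[ℂ] H) → _) := by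
  unfold amp
  fun_prop

theorem isNuclear_amp {M : Matrix (Fin 2) (Fin 2) (H →L[ℂ] H)} (hM : ∀ i j, IsNuclear (M i j)) :
    IsNuclear (amp M) := by
  have h : ∀ i j, IsNuclear (adjoint (coordL H i) ∘L M i j ∘L coordL H j) :=
    fun i j => ((hM i j).comp_clm _).clm_comp _
  rw [amp, Fin.sum_univ_two, Fin.sum_univ_two, Fin.sum_univ_two]
  exact ((h 0 0).add (h 0 1)).add ((h 1 0).add (h 1 1))

theorem isCompactOperator_amp {M : Matrix (Fin 2) (Fin 2) (H →L[ℂ] H)}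
    (hM : ∀ i j, IsCompactOperator (M i j)) : IsCompactOperator (amp M) := by
  have h : ∀ i j, IsCompactOperator (adjoint (coordL H i) ∘L M i j ∘L coordL H j) :=
    fun i j => (IsCompactOperator.comp_clm (f := ⇑(M i j)) (hM i j) (coordL H j)).continuous_comp
      (adjoint (coordL H i)).continuous
  rw [amp, Fin.sum_univ_two, Fin.sum_univ_two, Fin.sum_univ_two]
  exact ((h 0 0).add (h 0 1)).add ((h 1 0).add (h 1 1))

/-- Cyclicity brings the coordinate projection next to the coordinate embedding; their composite is
`δ_ij`, so only the diagonal blocks survive. -/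
theorem nuclearTrace_amp {M : Matrix (Fin 2) (Fin 2) (H →L[ℂ] H)}
    (hM : ∀ i j, IsNuclear (M i j)) : nuclearTrace (amp M) = ∑ i, nuclearTrace (M i i) := by
  have h : ∀ i j, IsNuclear (adjoint (coordL H i) ∘L M i j ∘L coordL H j) :=
    fun i j => ((hM i j).comp_clm _).clm_comp _
  have ht : ∀ i j, nuclearTrace (adjoint (coordL H i) ∘L M i j ∘L coordL H j) =
      if i = j then nuclearTrace (M i j) else 0 := by
    intro i j
    rw [nuclearTrace_comp_comm ((hM i j).comp_clm _), comp_assoc, coordL_comp_adjoint]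
    by_cases hij : i = j
    · subst hij
      simp [one_def]
    · simp [hij, Ne.symm hij, nuclearTrace_zero]
  rw [amp, Fin.sum_univ_two, Fin.sum_univ_two, Fin.sum_univ_two,
    nuclearTrace_add ((h 0 0).add (h 0 1)) ((h 1 0).add (h 1 1)),
    nuclearTrace_add (h 0 0) (h 0 1), nuclearTrace_add (h 1 0) (h 1 1), ht, ht, ht, ht,
    Fin.sum_univ_two]
  simp

end Amplification

/-! ### The pairing of an even Fredholm module with a projection -/

section IndexPairing

open ContinuousLinearMap

variable {𝒜 : Type} [Ring 𝒜] [StarRing 𝒜] [Algebra ℂ 𝒜]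

/-- The representation of `M₂(𝒜)` on `H ⊕ H`. -/
noncomputable def ampRep {H : Type} [NormedAddCommGroup H] [InnerProductSpace ℂ H] [CompleteSpace H]
    (π : 𝒜 →⋆ₙₐ[ℂ] (H →L[ℂ] H)) (p : Matrix (Fin 2) (Fin 2) 𝒜) :
    TwoCopies H →L[ℂ] TwoCopies H :=
  amp (p.map π)

/-- The diagonal operator `T ⊕ T`. -/
noncomputable def ampDiag {H : Type} [NormedAddCommGroup H] [InnerProductSpace ℂ H]
    [CompleteSpace H] (T : H →L[ℂ] H) : TwoCopies H →L[ℂ] TwoCopies H :=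
  amp (Matrix.diagonal fun _ => T)

section

variable {H : Type} [NormedAddCommGroup H] [InnerProductSpace ℂ H] [CompleteSpace H]

theorem ampDiag_apply (T : H →L[ℂ] H) (v : TwoCopies H) (i : Fin 2) :
    ampDiag T v i = T (v i) := by
  rw [ampDiag, amp_apply, Finset.sum_eq_single i]
  · simp
  · intro j _ hj
    simp [Matrix.diagonal_apply_ne _ hj.symm]
  · simp

theorem ampDiag_mul (S T : H →L[ℂ] H) : ampDiag (S * T) = ampDiag S * ampDiag T := by
  ext v i
  change ampDiag (S * T) v i = ampDiag S (ampDiag T v) i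
  simp [ampDiag_apply]

theorem ampDiag_one : ampDiag (1 : H →L[ℂ] H) = 1 := by
  ext v i
  exact ampDiag_apply _ _ _

theorem ampDiag_neg (T : H →L[ℂ] H) : ampDiag (-T) = -ampDiag T := by
  ext v i
  change ampDiag (-T) v i = -ampDiag T v i
  simp [ampDiag_apply]

theorem isSelfAdjoint_ampDiag {T : H →L[ℂ] H} (hT : IsSelfAdjoint T) :
    IsSelfAdjoint (ampDiag T) := by
  rw [isSelfAdjoint_iff, ampDiag, star_amp, Matrix.star_eq_conjTranspose,
    Matrix.diagonal_conjTranspose]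
  congr 2
  funext i
  exact hT.star_eq

/-- Only products and adjoints are used, so the representation need not be unital. -/
theorem isStarProjection_ampRep (π : 𝒜 →⋆ₙₐ[ℂ] (H →L[ℂ] H)) {p : Matrix (Fin 2) (Fin 2) 𝒜}
    (hp : IsStarProjection p) : IsStarProjection (ampRep π p) := by
  constructor
  · rw [IsIdempotentElem, ampRep, ← amp_mul]
    congr 1
    conv_rhs => rw [← hp.isIdempotentElem.eq]
    ext i j : 1
    simp [Matrix.mul_apply]
  · rw [isSelfAdjoint_iff, ampRep, star_amp]
    congr 1
    conv_rhs => rw [← hp.isSelfAdjoint.star_eq]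
    ext i j : 1
    simpa [Matrix.star_apply] using (map_star π _).symm

theorem ampDiag_commutator (T : H →L[ℂ] H) (π : 𝒜 →⋆ₙₐ[ℂ] (H →L[ℂ] H))
    (p : Matrix (Fin 2) (Fin 2) 𝒜) :
    ampDiag T * ampRep π p - ampRep π p * ampDiag T =
      amp (Matrix.of fun i j => T * π (p i j) - π (p i j) * T) := by
  rw [ampDiag, ampRep, ← amp_mul, ← amp_mul, ← amp_sub]
  congr 1
  ext i j : 1
  simp [Matrix.diagonal_mul, Matrix.mul_diagonal]

/-- The bridge from a module and a projection over the algebra to the operator-theoretic data of the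
graded index; compactness is checked entry by entry. -/
theorem EvenFredholmModule.isGradedPair (M : EvenFredholmModule 𝒜 H)
    {p : Matrix (Fin 2) (Fin 2) 𝒜} (hp : IsStarProjection p) :
    IsGradedPair (ampRep M.π p) (ampDiag M.F) (ampDiag M.γ) where
  proj := isStarProjection_ampRep _ hp
  F_selfAdjoint := isSelfAdjoint_ampDiag M.F_selfAdjoint
  F_mul_F := by rw [← ampDiag_mul, M.F_mul_F, ampDiag_one]
  γ_selfAdjoint := isSelfAdjoint_ampDiag M.γ_selfAdjoint
  γ_mul_γ := by rw [← ampDiag_mul, M.γ_mul_γ, ampDiag_one]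
  γ_mul_F := by rw [← ampDiag_mul, ← ampDiag_mul, M.γ_mul_F, ampDiag_neg]
  γ_mul_P := by
    rw [ampDiag, ampRep, ← amp_mul, ← amp_mul]
    congr 1
    ext i j : 1
    simpa [Matrix.diagonal_mul, Matrix.mul_diagonal] using M.γ_mul_π (p i j)
  compact := by
    rw [ampDiag_commutator]
    exact isCompactOperator_amp fun i j => M.compact_commutator (p i j)

end

/-- The index pairing of an even Fredholm module with a projection. -/
noncomputable def BundledFredholmModule.index (x : BundledFredholmModule 𝒜)
    (p : Matrix (Fin 2) (Fin 2) 𝒜) : ℤ :=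
  gradedIndex (ampRep x.mod.π p) (ampDiag x.mod.F) (ampDiag x.mod.γ)

/-- The index pairing is half the pairing with the trace cocycle. -/
theorem EvenFredholmModule.two_mul_index {H : Type} [NormedAddCommGroup H] [InnerProductSpace ℂ H]
    [CompleteSpace H] (M : EvenFredholmModule 𝒜 H) {p : Matrix (Fin 2) (Fin 2) 𝒜}
    (hp : IsStarProjection p) (hN : ∀ a, IsNuclear (M.F * M.π a - M.π a * M.F)) :
    (2 * M.bundle.index p : ℂ) =
      ∑ i, nuclearTrace (M.γ * M.F * (M.F * M.π (p i i) - M.π (p i i) * M.F)) := by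
  have hN' : IsNuclear (ampDiag M.F * ampRep M.π p - ampRep M.π p * ampDiag M.F) := by
    rw [ampDiag_commutator]
    exact isNuclear_amp fun i j => hN (p i j)
  refine ((M.isGradedPair hp).two_mul_gradedIndex_eq_trace hN').trans ?_
  rw [ampDiag_commutator, ← ampDiag_mul, ampDiag, ← amp_mul, nuclearTrace_amp]
  · simp [Matrix.diagonal_mul]
  · intro i j
    rw [Matrix.diagonal_mul]
    exact (hN (p i j)).mul_left _

section Maps

set_option linter.unusedSectionVars false

variable {H H' : Type} [NormedAddCommGroup H] [InnerProductSpace ℂ H] [CompleteSpace H]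
  [NormedAddCommGroup H'] [InnerProductSpace ℂ H'] [CompleteSpace H']

/-- The map `Φ ⊕ Φ`. -/
def ampMap (Φ : H →ₗ[ℂ] H') : TwoCopies H →ₗ[ℂ] TwoCopies H' where
  toFun v := WithLp.toLp 2 fun i => Φ (v i)
  map_add' u v := by
    ext i
    simp
  map_smul' c v := by
    ext i
    simp

theorem ampMap_apply (Φ : H →ₗ[ℂ] H') (v : TwoCopies H) (i : Fin 2) :
    ampMap Φ v i = Φ (v i) := rfl

theorem amp_ampMap (Φ : H →ₗ[ℂ] H') {M : Matrix (Fin 2) (Fin 2) (H →L[ℂ] H)}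
    {M' : Matrix (Fin 2) (Fin 2) (H' →L[ℂ] H')} (h : ∀ i j v, M' i j (Φ v) = Φ (M i j v))
    (v : TwoCopies H) : amp M' (ampMap Φ v) = ampMap Φ (amp M v) := by
  ext i
  rw [ampMap_apply, amp_apply, amp_apply, map_sum]
  exact Finset.sum_congr rfl fun j _ => h i j (v j)

theorem ampRep_ampMap (Φ : H →ₗ[ℂ] H') {π : 𝒜 →⋆ₙₐ[ℂ] (H →L[ℂ] H)}
    {π' : 𝒜 →⋆ₙₐ[ℂ] (H' →L[ℂ] H')} (h : ∀ a v, π' a (Φ v) = Φ (π a v))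
    (p : Matrix (Fin 2) (Fin 2) 𝒜) (v : TwoCopies H) :
    ampRep π' p (ampMap Φ v) = ampMap Φ (ampRep π p v) :=
  amp_ampMap Φ (fun i j v => h (p i j) v) v

theorem ampDiag_ampMap (Φ : H →ₗ[ℂ] H') {T : H →L[ℂ] H} {T' : H' →L[ℂ] H'}
    (h : ∀ v, T' (Φ v) = Φ (T v)) (v : TwoCopies H) :
    ampDiag T' (ampMap Φ v) = ampMap Φ (ampDiag T v) := by
  ext i
  rw [ampMap_apply, ampDiag_apply, ampDiag_apply, ampMap_apply, h]

theorem ampMap_injective {Φ : H →ₗ[ℂ] H'} (h : Function.Injective Φ) :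
    Function.Injective (ampMap Φ) := by
  intro u v huv
  ext i
  exact h (congrArg (fun w : TwoCopies H' => w i) huv)

end Maps

theorem BundledFredholmModule.UnitarilyEquivalent.index_eq {x y : BundledFredholmModule 𝒜}
    (h : x.UnitarilyEquivalent y) (p : Matrix (Fin 2) (Fin 2) 𝒜) : x.index p = y.index p := by
  obtain ⟨U, h1, h2, h3⟩ := h
  let Φ : x.H →ₗ[ℂ] y.H := U.toLinearEquiv.toLinearMap
  have key : ∀ s, Module.finrank ℂ
      (gradedKer (ampRep x.mod.π p) (ampDiag x.mod.F) (ampDiag x.mod.γ) s) =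
      Module.finrank ℂ
      (gradedKer (ampRep y.mod.π p) (ampDiag y.mod.F) (ampDiag y.mod.γ) s) := by
    intro s
    refine finrank_gradedKer_eq (ampMap Φ) (ampMap_injective U.injective)
      (ampRep_ampMap Φ h1 p) (ampDiag_ampMap Φ h2) (ampDiag_ampMap Φ h3) s
      fun w _ => ⟨WithLp.toLp 2 fun i => U.symm (w i), ?_⟩
    ext i
    exact U.apply_symm_apply (w i)
  rw [index, index, gradedIndex, gradedIndex, key, key]

/-- In a degenerate summand `F` commutes with the projection, so `P F b = F b` for `b` in its range,
and this is nonzero unless `b = 0`. Hence all of the kernel sits in the other summand. -/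
theorem BundledFredholmModule.IsDirectSum.index_eq {x w y : BundledFredholmModule 𝒜}
    (h : x.IsDirectSum w y) (hw : w.Degenerate) (p : Matrix (Fin 2) (Fin 2) 𝒜) :
    x.index p = y.index p := by
  obtain ⟨U, h1, h2, h3⟩ := h
  let Φ : x.H →ₗ[ℂ] y.H := U.toLinearEquiv.toLinearMap ∘ₗ
    (WithLp.linearEquiv 2 ℂ (x.H × w.H)).symm.toLinearMap ∘ₗ LinearMap.inl ℂ x.H w.H
  let Ψ : w.H →ₗ[ℂ] y.H := U.toLinearEquiv.toLinearMap ∘ₗ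
    (WithLp.linearEquiv 2 ℂ (x.H × w.H)).symm.toLinearMap ∘ₗ LinearMap.inr ℂ x.H w.H
  have hΦ : ∀ u, Φ u = U (WithLp.toLp 2 (u, 0)) := fun _ => rfl
  have hΨ : ∀ u, Ψ u = U (WithLp.toLp 2 (0, u)) := fun _ => rfl
  have hadd : ∀ a b, Φ a + Ψ b = U (WithLp.toLp 2 (a, b)) := by
    intro a b
    rw [hΦ, hΨ, ← map_add, ← WithLp.toLp_add, Prod.mk_add_mk, add_zero, zero_add]
  have hzero : ∀ a b, Φ a + Ψ b = 0 → b = 0 := by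
    intro a b hab
    rw [hadd, LinearIsometryEquiv.map_eq_zero_iff] at hab
    exact congrArg (fun z : WithLp 2 (x.H × w.H) => z.snd) hab
  have hinj : Function.Injective Φ := by
    intro a b hab
    rw [hΦ, hΦ] at hab
    exact congrArg (fun z : WithLp 2 (x.H × w.H) => z.fst) (U.injective hab)
  have hΦπ : ∀ a u, y.mod.π a (Φ u) = Φ (x.mod.π a u) := fun a u => by
    rw [hΦ, h1, map_zero, hΦ]
  have hΦF : ∀ u, y.mod.F (Φ u) = Φ (x.mod.F u) := fun u => by rw [hΦ, h2, map_zero, hΦ]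
  have hΦγ : ∀ u, y.mod.γ (Φ u) = Φ (x.mod.γ u) := fun u => by rw [hΦ, h3, map_zero, hΦ]
  have hΨπ : ∀ a u, y.mod.π a (Ψ u) = Ψ (w.mod.π a u) := fun a u => by
    rw [hΨ, h1, map_zero, hΨ]
  have hΨF : ∀ u, y.mod.F (Ψ u) = Ψ (w.mod.F u) := fun u => by rw [hΨ, h2, map_zero, hΨ]
  have hcomm : ampDiag w.mod.F * ampRep w.mod.π p = ampRep w.mod.π p * ampDiag w.mod.F := by
    rw [← sub_eq_zero, ampDiag_commutator]
    have : (Matrix.of fun i j => w.mod.F * w.mod.π (p i j) - w.mod.π (p i j) * w.mod.F) =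
        (1 : Matrix (Fin 2) (Fin 2) (w.H →L[ℂ] w.H)) - 1 := by
      ext i j : 1
      simp [hw (p i j)]
    rw [this, amp_sub, sub_self]
  have hFF : ampDiag w.mod.F * ampDiag w.mod.F = 1 := by
    rw [← ampDiag_mul, w.mod.F_mul_F, ampDiag_one]
  have key : ∀ s, Module.finrank ℂ
      (gradedKer (ampRep x.mod.π p) (ampDiag x.mod.F) (ampDiag x.mod.γ) s) =
      Module.finrank ℂ
      (gradedKer (ampRep y.mod.π p) (ampDiag y.mod.F) (ampDiag y.mod.γ) s) := by
    intro s
    refine finrank_gradedKer_eq (ampMap Φ) (ampMap_injective hinj)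
      (ampRep_ampMap Φ hΦπ p) (ampDiag_ampMap Φ hΦF) (ampDiag_ampMap Φ hΦγ) s
      fun z hz => ?_
    obtain ⟨hz1, -, hz3⟩ := mem_gradedKer.1 hz
    -- The components of `z` in the two summands; the goal is that the degenerate component `b`
    -- vanishes.
    let a : TwoCopies x.H := WithLp.toLp 2 fun i => (U.symm (z i)).fst
    let b : TwoCopies w.H := WithLp.toLp 2 fun i => (U.symm (z i)).snd
    have hab : ampMap Φ a + ampMap Ψ b = z := by
      ext i
      exact (hadd _ _).trans (U.apply_symm_apply (z i))
    have hz0 : ∀ (c : TwoCopies x.H) (d : TwoCopies w.H), ampMap Φ c + ampMap Ψ d = 0 → d = 0 := by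
      intro c d hcd
      ext i
      exact hzero (c i) (d i) (congrArg (fun v : TwoCopies y.H => v i) hcd)
    have hPb : ampRep w.mod.π p b = b := by
      rw [← sub_eq_zero]
      refine hz0 (ampRep x.mod.π p a - a) _ ?_
      rw [map_sub, map_sub, ← sub_eq_zero.2 hz1, ← hab, map_add]
      rw [ampRep_ampMap Φ hΦπ, ampRep_ampMap Ψ hΨπ]
      abel
    have hPFb : ampRep w.mod.π p (ampDiag w.mod.F b) = 0 := by
      refine hz0 (ampRep x.mod.π p (ampDiag x.mod.F a)) _ ?_
      rw [← ampRep_ampMap Φ hΦπ, ← ampRep_ampMap Ψ hΨπ, ← ampDiag_ampMap Φ hΦF,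
        ← ampDiag_ampMap Ψ hΨF, ← map_add, ← map_add, hab]
      exact hz3
    -- As `F` commutes with the projection and `b` is fixed by it, the kernel condition reads `F b =
    -- 0`; then `F² = 1` gives `b = 0`.
    have hFb : ampDiag w.mod.F b = 0 := by
      rw [← hPFb]
      conv_lhs => rw [← hPb]
      exact congrArg (fun S : TwoCopies w.H →L[ℂ] TwoCopies w.H => S b) hcomm
    have hb : b = 0 := by
      calc b = ampDiag w.mod.F (ampDiag w.mod.F b) :=
            (congrArg (fun S : TwoCopies w.H →L[ℂ] TwoCopies w.H => S b) hFF).symm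
        _ = 0 := by rw [hFb, map_zero]
    refine ⟨a, ?_⟩
    rw [← hab, hb, map_zero, add_zero]
  rw [index, index, gradedIndex, gradedIndex, key, key]

/-- Representation and grading are constant along the homotopy, so one projection and one grading
serve for the whole path. -/
theorem OperatorHomotopic.index_eq {H : Type} [NormedAddCommGroup H] [InnerProductSpace ℂ H]
    [CompleteSpace H] {M M' : EvenFredholmModule 𝒜 H} (h : OperatorHomotopic M M')
    {p : Matrix (Fin 2) (Fin 2) 𝒜} (hp : IsStarProjection p) :
    M.bundle.index p = M'.bundle.index p := by
  obtain ⟨P, hπγ, hF, rfl, rfl⟩ := h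
  have hc : Continuous fun t => ampDiag (P t).F := by
    unfold ampDiag
    refine continuous_amp.comp ?_
    fun_prop
  have hpair : ∀ t, IsGradedPair (ampRep (P 0).π p) (ampDiag (P t).F) (ampDiag (P 0).γ) := by
    intro t
    have := (P t).isGradedPair hp
    rwa [(hπγ t).1, (hπγ t).2] at this
  have := gradedIndex_eq_of_path hc hpair 0 1
  change gradedIndex (ampRep (P 0).π p) (ampDiag (P 0).F) (ampDiag (P 0).γ) =
    gradedIndex (ampRep (P 1).π p) (ampDiag (P 1).F) (ampDiag (P 1).γ)
  rw [this, (hπγ 1).1, (hπγ 1).2]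

/-- The index pairing only depends on the K-homology class. -/
theorem SameKHomologyClass.index_eq {x y : BundledFredholmModule 𝒜} (h : SameKHomologyClass x y)
    {p : Matrix (Fin 2) (Fin 2) 𝒜} (hp : IsStarProjection p) : x.index p = y.index p := by
  induction h with
  | rel x y h =>
    cases h with
    | unitary _ _ h => exact h.index_eq p
    | homotopy M M' h => exact h.index_eq hp
    | addDegenerate _ w _ hw h => exact h.index_eq hw p
  | refl x => rfl
  | symm x y _ ih => exact ih.symm
  | trans x y z _ _ ih1 ih2 => exact ih1.trans ih2

end IndexPairing

/-! ### Rational identities behind the relations of the Podleś sphere -/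

namespace PodlesIdentity

/-- The coefficient `q^{1/2} r⁰(l)` in terms of `C = q^{-2N}` and `u = q^{2l}`. -/
noncomputable def R (q C u : ℝ) : ℝ :=
  (q - q⁻¹) * (u * q + (u * q)⁻¹ - C * (q + q⁻¹)) / ((u - u⁻¹) * (u * q ^ 2 - (u * q ^ 2)⁻¹))

/-- The square of `r⁺(l)`. -/
noncomputable def P (q C u : ℝ) : ℝ :=
  C * (q - q⁻¹) ^ 2 * (u * q ^ 2 + (u * q ^ 2)⁻¹ - C - C⁻¹) /
    (u * q ^ 3 * (u * q ^ 2 - (u * q ^ 2)⁻¹) ^ 2 *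
      ((u * q - (u * q)⁻¹) * (u * q ^ 3 - (u * q ^ 3)⁻¹)))

/-- The diagonal coefficient of `A`, where `r` stands for `q^{1/2} r⁰(l)` and `Y = q^{2m}`. -/
noncomputable def α (q r u Y : ℝ) : ℝ :=
  (1 + q / (1 - q ^ 2) * (u * q + (u * q)⁻¹ - Y * (q + q⁻¹)) * r) / (1 + q ^ 2)

variable {q C u Y : ℝ}

/-- In these identities `u` and `Y` stand for powers `q^{2l}` and `q^{2m}`, and the suffix is the
change of `l` in the component being compared. For components joining two neighbouring levels, `u`
belongs to the lower one and `u q²` to the upper one. -/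
theorem AB_one (hq : q ≠ 0) (hq1 : 1 - q ^ 2 ≠ 0) (hq2 : 1 + q ^ 2 ≠ 0) (hu : u ≠ 0)
    (h0 : u ^ 2 - 1 ≠ 0) (h2 : u ^ 2 * q ^ 4 - 1 ≠ 0) (h4 : u ^ 2 * q ^ 8 - 1 ≠ 0) :
    α q (R q C (u * q ^ 2)) (u * q ^ 2) (Y * q ^ 2) - q ^ 2 * α q (R q C u) u Y =
      (q * (u - Y) * R q C u - q ^ 2 * (u * q - Y * q⁻¹) * R q C (u * q ^ 2)) / (q - q⁻¹) := by
  -- The denominators become atoms, so that `field_simp` clears them without expanding; they are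
  -- reinserted before the polynomial identity is left to `ring`. The identities below follow the
  -- same pattern.
  obtain ⟨a, ha⟩ : ∃ a, a = 1 - q ^ 2 := ⟨_, rfl⟩
  obtain ⟨b, hb⟩ : ∃ b, b = 1 + q ^ 2 := ⟨_, rfl⟩
  obtain ⟨d0, hd0⟩ : ∃ d, d = u ^ 2 - 1 := ⟨_, rfl⟩
  obtain ⟨d2, hd2⟩ : ∃ d, d = u ^ 2 * q ^ 4 - 1 := ⟨_, rfl⟩
  obtain ⟨d4, hd4⟩ : ∃ d, d = u ^ 2 * q ^ 8 - 1 := ⟨_, rfl⟩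
  rw [← ha] at hq1
  rw [← hb] at hq2
  rw [← hd0] at h0
  rw [← hd2] at h2
  rw [← hd4] at h4
  have e0 : u - u⁻¹ = d0 / u := by rw [hd0]; field_simp
  have e2 : u * q ^ 2 - (u * q ^ 2)⁻¹ = d2 / (u * q ^ 2) := by rw [hd2]; field_simp
  have e4 : u * q ^ 2 * q ^ 2 - (u * q ^ 2 * q ^ 2)⁻¹ = d4 / (u * q ^ 4) := by rw [hd4]; field_simp
  have eq : q - q⁻¹ = -a / q := by rw [ha]; field_simp; ring
  unfold α R
  rw [← ha, ← hb, e0, e2, e4, eq]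
  field_simp
  simp only [hb, hd0, hd2, hd4]
  ring

theorem AB_neg_one (hq : q ≠ 0) (hq1 : 1 - q ^ 2 ≠ 0) (hq2 : 1 + q ^ 2 ≠ 0) (hu : u ≠ 0)
    (h0 : u ^ 2 - 1 ≠ 0) (h2 : u ^ 2 * q ^ 4 - 1 ≠ 0) (h4 : u ^ 2 * q ^ 8 - 1 ≠ 0) :
    α q (R q C u) u (Y * q ^ 2) + (Y * q - (u * q ^ 2)⁻¹ * q⁻¹) / (q - q⁻¹) * R q C (u * q ^ 2) =
      q ^ 2 * (q⁻¹ * ((Y - (u * q ^ 2)⁻¹) / (q - q⁻¹)) * R q C u +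
        α q (R q C (u * q ^ 2)) (u * q ^ 2) Y) := by
  obtain ⟨a, ha⟩ : ∃ a, a = 1 - q ^ 2 := ⟨_, rfl⟩
  obtain ⟨b, hb⟩ : ∃ b, b = 1 + q ^ 2 := ⟨_, rfl⟩
  obtain ⟨d0, hd0⟩ : ∃ d, d = u ^ 2 - 1 := ⟨_, rfl⟩
  obtain ⟨d2, hd2⟩ : ∃ d, d = u ^ 2 * q ^ 4 - 1 := ⟨_, rfl⟩
  obtain ⟨d4, hd4⟩ : ∃ d, d = u ^ 2 * q ^ 8 - 1 := ⟨_, rfl⟩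
  rw [← ha] at hq1
  rw [← hb] at hq2
  rw [← hd0] at h0
  rw [← hd2] at h2
  rw [← hd4] at h4
  have e0 : u - u⁻¹ = d0 / u := by rw [hd0]; field_simp
  have e2 : u * q ^ 2 - (u * q ^ 2)⁻¹ = d2 / (u * q ^ 2) := by rw [hd2]; field_simp
  have e4 : u * q ^ 2 * q ^ 2 - (u * q ^ 2 * q ^ 2)⁻¹ = d4 / (u * q ^ 4) := by rw [hd4]; field_simp
  have eq : q - q⁻¹ = -a / q := by rw [ha]; field_simp; ring
  unfold α R
  rw [← ha, ← hb, e0, e2, e4, eq]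
  field_simp
  simp only [hb, hd0, hd2, hd4]
  ring

theorem BBstar_one (hq : q ≠ 0) (hq1 : 1 - q ^ 2 ≠ 0) (hq2 : 1 + q ^ 2 ≠ 0) (hu : u ≠ 0)
    (h0 : u ^ 2 - 1 ≠ 0) (h2 : u ^ 2 * q ^ 4 - 1 ≠ 0) (h4 : u ^ 2 * q ^ 8 - 1 ≠ 0) :
    -((u * q ^ 2 - Y * (q ^ 2)⁻¹) / (q - q⁻¹) * R q C (u * q ^ 2)) +
      u⁻¹ * (q ^ 2)⁻¹ * ((u * Y - 1) / (q - q⁻¹)) * R q C u =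
      -(q⁻¹ * (1 - α q (R q C u) u Y - α q (R q C (u * q ^ 2)) (u * q ^ 2) Y)) := by
  obtain ⟨a, ha⟩ : ∃ a, a = 1 - q ^ 2 := ⟨_, rfl⟩
  obtain ⟨b, hb⟩ : ∃ b, b = 1 + q ^ 2 := ⟨_, rfl⟩
  obtain ⟨d0, hd0⟩ : ∃ d, d = u ^ 2 - 1 := ⟨_, rfl⟩
  obtain ⟨d2, hd2⟩ : ∃ d, d = u ^ 2 * q ^ 4 - 1 := ⟨_, rfl⟩
  obtain ⟨d4, hd4⟩ : ∃ d, d = u ^ 2 * q ^ 8 - 1 := ⟨_, rfl⟩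
  rw [← ha] at hq1
  rw [← hb] at hq2
  rw [← hd0] at h0
  rw [← hd2] at h2
  rw [← hd4] at h4
  have e0 : u - u⁻¹ = d0 / u := by rw [hd0]; field_simp
  have e2 : u * q ^ 2 - (u * q ^ 2)⁻¹ = d2 / (u * q ^ 2) := by rw [hd2]; field_simp
  have e4 : u * q ^ 2 * q ^ 2 - (u * q ^ 2 * q ^ 2)⁻¹ = d4 / (u * q ^ 4) := by rw [hd4]; field_simp
  have eq : q - q⁻¹ = -a / q := by rw [ha]; field_simp; ring
  unfold α R
  rw [← ha, ← hb, e0, e2, e4, eq]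
  field_simp
  simp only [hb, hd0, hd2, hd4]
  ring

/-- Here `u` is `q^{2(l-1)}` and `u q²` is `q^{2l}`: a component with unchanged `l` arises by
passing through the level above or below, so both squares `r⁺(l)² = P(u q²)` and `r⁺(l-1)² = P(u)`
occur. The same convention holds for the other identities with suffix `zero`. -/
theorem AB_zero (hq : q ≠ 0) (hq1 : 1 - q ^ 2 ≠ 0) (hq2 : 1 + q ^ 2 ≠ 0) (hu : u ≠ 0) (hC : C ≠ 0)
    (h1 : u ^ 2 * q ^ 2 - 1 ≠ 0) (h2 : u ^ 2 * q ^ 4 - 1 ≠ 0)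
    (h3 : u ^ 2 * q ^ 6 - 1 ≠ 0) (h4 : u ^ 2 * q ^ 8 - 1 ≠ 0) (h5 : u ^ 2 * q ^ 10 - 1 ≠ 0) :
    -(q ^ 2 * ((u * q ^ 2 * Y * q ^ 2 - (q ^ 2)⁻¹) / (q - q⁻¹)) * P q C (u * q ^ 2)) +
      R q C (u * q ^ 2) * α q (R q C (u * q ^ 2)) (u * q ^ 2) (Y * q ^ 2) +
      u * q ^ 2 * q * ((u * q ^ 2 * q⁻¹ - Y * q) / (q - q⁻¹)) * P q C u =
    q ^ 2 * (q ^ 3 * (u * q ^ 2) * ((u * q ^ 2 * q - Y * q⁻¹) / (q - q⁻¹)) * P q C (u * q ^ 2) +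
      α q (R q C (u * q ^ 2)) (u * q ^ 2) Y * R q C (u * q ^ 2) -
      (u * q ^ 2 * Y - 1) / (q - q⁻¹) * P q C u) := by
  obtain ⟨a, ha⟩ : ∃ a, a = 1 - q ^ 2 := ⟨_, rfl⟩
  obtain ⟨b, hb⟩ : ∃ b, b = 1 + q ^ 2 := ⟨_, rfl⟩
  obtain ⟨d1, hd1⟩ : ∃ d, d = u ^ 2 * q ^ 2 - 1 := ⟨_, rfl⟩
  obtain ⟨d2, hd2⟩ : ∃ d, d = u ^ 2 * q ^ 4 - 1 := ⟨_, rfl⟩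
  obtain ⟨d3, hd3⟩ : ∃ d, d = u ^ 2 * q ^ 6 - 1 := ⟨_, rfl⟩
  obtain ⟨d4, hd4⟩ : ∃ d, d = u ^ 2 * q ^ 8 - 1 := ⟨_, rfl⟩
  obtain ⟨d5, hd5⟩ : ∃ d, d = u ^ 2 * q ^ 10 - 1 := ⟨_, rfl⟩
  rw [← ha] at hq1
  rw [← hb] at hq2
  rw [← hd1] at h1
  rw [← hd2] at h2
  rw [← hd3] at h3
  rw [← hd4] at h4
  rw [← hd5] at h5
  have e1 : u * q - (u * q)⁻¹ = d1 / (u * q) := by rw [hd1]; field_simp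
  have e2 : u * q ^ 2 - (u * q ^ 2)⁻¹ = d2 / (u * q ^ 2) := by rw [hd2]; field_simp
  have e3 : u * q ^ 3 - (u * q ^ 3)⁻¹ = d3 / (u * q ^ 3) := by rw [hd3]; field_simp
  have e3' : u * q ^ 2 * q - (u * q ^ 2 * q)⁻¹ = d3 / (u * q ^ 3) := by rw [hd3]; field_simp
  have e4 : u * q ^ 2 * q ^ 2 - (u * q ^ 2 * q ^ 2)⁻¹ = d4 / (u * q ^ 4) := by rw [hd4]; field_simp
  have e5 : u * q ^ 2 * q ^ 3 - (u * q ^ 2 * q ^ 3)⁻¹ = d5 / (u * q ^ 5) := by rw [hd5]; field_simp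
  have eq : q - q⁻¹ = -a / q := by rw [ha]; field_simp; ring
  unfold α R P
  rw [← ha, ← hb, e1, e2, e3, e3', e4, e5, eq]
  field_simp
  simp only [hb, hd1, hd2, hd3, hd4, hd5]
  ring

theorem BstarB_one (hq : q ≠ 0) (hq1 : 1 - q ^ 2 ≠ 0) (hq2 : 1 + q ^ 2 ≠ 0) (hu : u ≠ 0)
    (h0 : u ^ 2 - 1 ≠ 0) (h2 : u ^ 2 * q ^ 4 - 1 ≠ 0) (h4 : u ^ 2 * q ^ 8 - 1 ≠ 0) :
    (u * Y * q ^ 2 - (q ^ 2)⁻¹) / (q - q⁻¹) * R q C (u * q ^ 2) -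
      (u - Y) / (q - q⁻¹) * u * q ^ 2 * R q C u =
      -(u * q * (1 - q ^ 2 * (α q (R q C u) u Y + α q (R q C (u * q ^ 2)) (u * q ^ 2) Y))) := by
  obtain ⟨a, ha⟩ : ∃ a, a = 1 - q ^ 2 := ⟨_, rfl⟩
  obtain ⟨b, hb⟩ : ∃ b, b = 1 + q ^ 2 := ⟨_, rfl⟩
  obtain ⟨d0, hd0⟩ : ∃ d, d = u ^ 2 - 1 := ⟨_, rfl⟩
  obtain ⟨d2, hd2⟩ : ∃ d, d = u ^ 2 * q ^ 4 - 1 := ⟨_, rfl⟩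
  obtain ⟨d4, hd4⟩ : ∃ d, d = u ^ 2 * q ^ 8 - 1 := ⟨_, rfl⟩
  rw [← ha] at hq1
  rw [← hb] at hq2
  rw [← hd0] at h0
  rw [← hd2] at h2
  rw [← hd4] at h4
  have e0 : u - u⁻¹ = d0 / (u) := by rw [hd0]; field_simp
  have e2 : u * q ^ 2 - (u * q ^ 2)⁻¹ = d2 / (u * q ^ 2) := by rw [hd2]; field_simp
  have e4 : u * q ^ 2 * q ^ 2 - (u * q ^ 2 * q ^ 2)⁻¹ = d4 / (u * q ^ 4) := by rw [hd4]; field_simp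
  have eq : q - q⁻¹ = -a / q := by rw [ha]; field_simp; ring
  unfold α R
  rw [← ha, ← hb, e0, e2, e4, eq]
  field_simp
  simp only [hb, hd0, hd2, hd4]
  ring

theorem BBstar_zero (hq : q ≠ 0) (hq1 : 1 - q ^ 2 ≠ 0) (hq2 : 1 +
  q ^ 2 ≠ 0) (hu : u ≠ 0) (hC : C ≠ 0)
    (h1 : u ^ 2 * q ^ 2 - 1 ≠ 0) (h2 : u ^ 2 * q ^ 4 - 1 ≠ 0) (h3 : u ^ 2 * q ^ 6 - 1 ≠ 0)
    (h4 : u ^ 2 * q ^ 8 - 1 ≠ 0) (h5 : u ^ 2 * q ^ 10 - 1 ≠ 0) :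
    ((u * q ^ 4 - Y * (q ^ 2)⁻¹) * (u * q ^ 3 - Y * q⁻¹) * (u * q ^ 2) ^ 2 * q ^ 4 * P q C (u *
      q ^ 2) +
      (u * Y * q ^ 2 - 1) * (u * q ^ 3 - Y * q⁻¹) * q⁻¹ * R q C (u * q ^ 2) ^ 2 +
      (u * Y * q ^ 2 - 1) * (u * Y * q - q) * P q C u) / ((q - q⁻¹) ^ 2 * (u * q ^ 2)) =
      α q (R q C (u * q ^ 2)) (u * q ^ 2) Y - α q (R q C (u * q ^ 2)) (u * q ^ 2) Y ^ 2 -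
      (q * (u * q ^ 3 - Y * q⁻¹) * (u * Y * q ^ 3 - q⁻¹) * P q C (u * q ^ 2) + q⁻¹ * (u *
        q ^ 2 - Y) * (u * Y * q ^ 2 - 1) * P q C u) / (q - q⁻¹) ^ 2 := by
  obtain ⟨a, ha⟩ : ∃ a, a = 1 - q ^ 2 := ⟨_, rfl⟩
  obtain ⟨b, hb⟩ : ∃ b, b = 1 + q ^ 2 := ⟨_, rfl⟩
  obtain ⟨d1, hd1⟩ : ∃ d, d = u ^ 2 * q ^ 2 - 1 := ⟨_, rfl⟩
  obtain ⟨d2, hd2⟩ : ∃ d, d = u ^ 2 * q ^ 4 - 1 := ⟨_, rfl⟩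
  obtain ⟨d3, hd3⟩ : ∃ d, d = u ^ 2 * q ^ 6 - 1 := ⟨_, rfl⟩
  obtain ⟨d4, hd4⟩ : ∃ d, d = u ^ 2 * q ^ 8 - 1 := ⟨_, rfl⟩
  obtain ⟨d5, hd5⟩ : ∃ d, d = u ^ 2 * q ^ 10 - 1 := ⟨_, rfl⟩
  rw [← ha] at hq1
  rw [← hb] at hq2
  rw [← hd1] at h1
  rw [← hd2] at h2
  rw [← hd3] at h3
  rw [← hd4] at h4
  rw [← hd5] at h5
  have e1 : u * q - (u * q)⁻¹ = d1 / (u * q) := by rw [hd1]; field_simp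
  have e2 : u * q ^ 2 - (u * q ^ 2)⁻¹ = d2 / (u * q ^ 2) := by rw [hd2]; field_simp
  have e3 : u * q ^ 3 - (u * q ^ 3)⁻¹ = d3 / (u * q ^ 3) := by rw [hd3]; field_simp
  have e3' : u * q ^ 2 * q - (u * q ^ 2 * q)⁻¹ = d3 / (u * q ^ 3) := by rw [hd3]; field_simp
  have e4 : u * q ^ 2 * q ^ 2 - (u * q ^ 2 * q ^ 2)⁻¹ = d4 / (u * q ^ 4) := by rw [hd4]; field_simp
  have e5 : u * q ^ 2 * q ^ 3 - (u * q ^ 2 * q ^ 3)⁻¹ = d5 / (u * q ^ 5) := by rw [hd5]; field_simp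
  have eq : q - q⁻¹ = -a / q := by rw [ha]; field_simp; ring
  unfold α R P
  rw [← ha, ← hb, e1, e2, e3, e3', e4, e5, eq]
  field_simp
  simp only [hb, hd1, hd2, hd3, hd4, hd5]
  ring

theorem BstarB_zero (hq : q ≠ 0) (hq1 : 1 - q ^ 2 ≠ 0) (hq2 : 1 +
  q ^ 2 ≠ 0) (hu : u ≠ 0) (hC : C ≠ 0)
    (h1 : u ^ 2 * q ^ 2 - 1 ≠ 0) (h2 : u ^ 2 * q ^ 4 - 1 ≠ 0) (h3 : u ^ 2 * q ^ 6 - 1 ≠ 0)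
    (h4 : u ^ 2 * q ^ 8 - 1 ≠ 0) (h5 : u ^ 2 * q ^ 10 - 1 ≠ 0) :
    ((u * Y * q ^ 3 - q⁻¹) * (u * Y * q ^ 4 - (q ^ 2)⁻¹) * P q C (u * q ^ 2) +
      (u * Y * q ^ 3 - q⁻¹) * (u * q ^ 2 - Y) * q⁻¹ * R q C (u * q ^ 2) ^ 2 +
      (u * q ^ 2 - Y) * (u * q - Y * q) * (u * q ^ 2) ^ 2 * P q C u) / ((q - q⁻¹) ^ 2 * (u *
        q ^ 2)) =
      α q (R q C (u * q ^ 2)) (u * q ^ 2) Y - q ^ 2 * (α q (R q C (u * q ^ 2)) (u * q ^ 2) Y ^ 2 +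
      (q * (u * q ^ 3 - Y * q⁻¹) * (u * Y * q ^ 3 - q⁻¹) * P q C (u * q ^ 2) + q⁻¹ * (u *
        q ^ 2 - Y) * (u * Y * q ^ 2 - 1) * P q C u) / (q - q⁻¹) ^ 2) := by
  obtain ⟨a, ha⟩ : ∃ a, a = 1 - q ^ 2 := ⟨_, rfl⟩
  obtain ⟨b, hb⟩ : ∃ b, b = 1 + q ^ 2 := ⟨_, rfl⟩
  obtain ⟨d1, hd1⟩ : ∃ d, d = u ^ 2 * q ^ 2 - 1 := ⟨_, rfl⟩
  obtain ⟨d2, hd2⟩ : ∃ d, d = u ^ 2 * q ^ 4 - 1 := ⟨_, rfl⟩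
  obtain ⟨d3, hd3⟩ : ∃ d, d = u ^ 2 * q ^ 6 - 1 := ⟨_, rfl⟩
  obtain ⟨d4, hd4⟩ : ∃ d, d = u ^ 2 * q ^ 8 - 1 := ⟨_, rfl⟩
  obtain ⟨d5, hd5⟩ : ∃ d, d = u ^ 2 * q ^ 10 - 1 := ⟨_, rfl⟩
  rw [← ha] at hq1
  rw [← hb] at hq2
  rw [← hd1] at h1
  rw [← hd2] at h2
  rw [← hd3] at h3
  rw [← hd4] at h4
  rw [← hd5] at h5
  have e1 : u * q - (u * q)⁻¹ = d1 / (u * q) := by rw [hd1]; field_simp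
  have e2 : u * q ^ 2 - (u * q ^ 2)⁻¹ = d2 / (u * q ^ 2) := by rw [hd2]; field_simp
  have e3 : u * q ^ 3 - (u * q ^ 3)⁻¹ = d3 / (u * q ^ 3) := by rw [hd3]; field_simp
  have e3' : u * q ^ 2 * q - (u * q ^ 2 * q)⁻¹ = d3 / (u * q ^ 3) := by rw [hd3]; field_simp
  have e4 : u * q ^ 2 * q ^ 2 - (u * q ^ 2 * q ^ 2)⁻¹ = d4 / (u * q ^ 4) := by rw [hd4]; field_simp
  have e5 : u * q ^ 2 * q ^ 3 - (u * q ^ 2 * q ^ 3)⁻¹ = d5 / (u * q ^ 5) := by rw [hd5]; field_simp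
  have eq : q - q⁻¹ = -a / q := by rw [ha]; field_simp; ring
  unfold α R P
  rw [← ha, ← hb, e1, e2, e3, e3', e4, e5, eq]
  field_simp
  simp only [hb, hd1, hd2, hd3, hd4, hd5]
  ring

/-- The case `l = 1/2`, where `u q = 1` and a denominator of the general identity vanishes. The
level below does not exist, and `P(u)` is indeed `0` by the convention on division by zero. Only `m
= -1/2` is needed, since `m + 1` has to be a label as well. -/
theorem AB_zero_half (hq : q ≠ 0) (hb : 1 + q ^ 2 ≠ 0) (h2 : q ^ 2 - 1 ≠ 0) (h4 : q ^ 4 - 1 ≠ 0)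
    (h6 : q ^ 6 - 1 ≠ 0) (h8 : q ^ 8 - 1 ≠ 0) (hu : u = q⁻¹) (hC : C = q ∨ C = q⁻¹)
    (hY : Y = q⁻¹) :
    -(q ^ 2 * ((u * q ^ 2 * Y * q ^ 2 - (q ^ 2)⁻¹) / (q - q⁻¹)) * P q C (u * q ^ 2)) +
      R q C (u * q ^ 2) * α q (R q C (u * q ^ 2)) (u * q ^ 2) (Y * q ^ 2) +
      u * q ^ 2 * q * ((u * q ^ 2 * q⁻¹ - Y * q) / (q - q⁻¹)) * P q C u =
    q ^ 2 * (q ^ 3 * (u * q ^ 2) * ((u * q ^ 2 * q - Y * q⁻¹) / (q - q⁻¹)) * P q C (u * q ^ 2) +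
      α q (R q C (u * q ^ 2)) (u * q ^ 2) Y * R q C (u * q ^ 2) -
      (u * q ^ 2 * Y - 1) / (q - q⁻¹) * P q C u) := by
  have hP : P q C u = 0 := by simp [P, hu, hq]
  have w2 : u * q ^ 2 = q := by rw [hu]; field_simp
  simp only [hP, w2]
  clear hP w2 hu
  have e1 : q - q⁻¹ = (q ^ 2 - 1) / q := by field_simp
  have e2 : q * q - (q * q)⁻¹ = (q ^ 4 - 1) / q ^ 2 := by field_simp
  have e3 : q * q ^ 2 - (q * q ^ 2)⁻¹ = (q ^ 6 - 1) / q ^ 3 := by field_simp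
  have e4 : q * q ^ 3 - (q * q ^ 3)⁻¹ = (q ^ 8 - 1) / q ^ 4 := by field_simp
  have e5 : 1 - q ^ 2 = -(q ^ 2 - 1) := by ring
  unfold α R P
  rw [e1, e2, e3, e4, e5]
  obtain ⟨b, hb'⟩ : ∃ b, b = 1 + q ^ 2 := ⟨_, rfl⟩
  obtain ⟨d2, hd2⟩ : ∃ d, d = q ^ 2 - 1 := ⟨_, rfl⟩
  obtain ⟨d4, hd4⟩ : ∃ d, d = q ^ 4 - 1 := ⟨_, rfl⟩
  obtain ⟨d6, hd6⟩ : ∃ d, d = q ^ 6 - 1 := ⟨_, rfl⟩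
  obtain ⟨d8, hd8⟩ : ∃ d, d = q ^ 8 - 1 := ⟨_, rfl⟩
  rw [← hb'] at hb
  rw [← hd2] at h2
  rw [← hd4] at h4
  rw [← hd6] at h6
  rw [← hd8] at h8
  rw [← hb', ← hd2, ← hd4, ← hd6, ← hd8]
  subst hY <;> rcases hC with rfl | rfl <;> field_simp <;>
    simp only [hb', hd2, hd4, hd6, hd8] <;> ring

theorem BBstar_zero_half (hq : q ≠ 0) (hb : 1 + q ^ 2 ≠ 0) (h2 : q ^ 2 - 1 ≠ 0) (h4 : q ^ 4 - 1 ≠ 0)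
    (h6 : q ^ 6 - 1 ≠ 0) (h8 : q ^ 8 - 1 ≠ 0) (hu : u = q⁻¹) (hC : C = q ∨ C = q⁻¹)
    (hY : Y = q ∨ Y = q⁻¹) :
    ((u * q ^ 4 - Y * (q ^ 2)⁻¹) * (u * q ^ 3 - Y * q⁻¹) * (u * q ^ 2) ^ 2 * q ^ 4 * P q C (u *
      q ^ 2) +
      (u * Y * q ^ 2 - 1) * (u * q ^ 3 - Y * q⁻¹) * q⁻¹ * R q C (u * q ^ 2) ^ 2 +
      (u * Y * q ^ 2 - 1) * (u * Y * q - q) * P q C u) / ((q - q⁻¹) ^ 2 * (u * q ^ 2)) =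
      α q (R q C (u * q ^ 2)) (u * q ^ 2) Y - α q (R q C (u * q ^ 2)) (u * q ^ 2) Y ^ 2 -
      (q * (u * q ^ 3 - Y * q⁻¹) * (u * Y * q ^ 3 - q⁻¹) * P q C (u * q ^ 2) + q⁻¹ * (u *
        q ^ 2 - Y) * (u * Y * q ^ 2 - 1) * P q C u) / (q - q⁻¹) ^ 2 := by
  have hP : P q C u = 0 := by simp [P, hu, hq]
  have w2 : u * q ^ 2 = q := by rw [hu]; field_simp
  have w3 : u * q ^ 3 = q ^ 2 := by rw [hu]; field_simp
  have w4 : u * q ^ 4 = q ^ 3 := by rw [hu]; field_simp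
  have v2 : u * Y * q ^ 2 = q * Y := by rw [hu]; field_simp
  have v3 : u * Y * q ^ 3 = q ^ 2 * Y := by rw [hu]; field_simp
  simp only [hP, w2, w3, w4, v2, v3]
  clear hP w2 w3 w4 v2 v3 hu
  have e1 : q - q⁻¹ = (q ^ 2 - 1) / q := by field_simp
  have e2 : q * q - (q * q)⁻¹ = (q ^ 4 - 1) / q ^ 2 := by field_simp
  have e3 : q * q ^ 2 - (q * q ^ 2)⁻¹ = (q ^ 6 - 1) / q ^ 3 := by field_simp
  have e4 : q * q ^ 3 - (q * q ^ 3)⁻¹ = (q ^ 8 - 1) / q ^ 4 := by field_simp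
  have e5 : 1 - q ^ 2 = -(q ^ 2 - 1) := by ring
  unfold α R P
  rw [e1, e2, e3, e4, e5]
  obtain ⟨b, hb'⟩ : ∃ b, b = 1 + q ^ 2 := ⟨_, rfl⟩
  obtain ⟨d2, hd2⟩ : ∃ d, d = q ^ 2 - 1 := ⟨_, rfl⟩
  obtain ⟨d4, hd4⟩ : ∃ d, d = q ^ 4 - 1 := ⟨_, rfl⟩
  obtain ⟨d6, hd6⟩ : ∃ d, d = q ^ 6 - 1 := ⟨_, rfl⟩
  obtain ⟨d8, hd8⟩ : ∃ d, d = q ^ 8 - 1 := ⟨_, rfl⟩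
  rw [← hb'] at hb
  rw [← hd2] at h2
  rw [← hd4] at h4
  rw [← hd6] at h6
  rw [← hd8] at h8
  rw [← hb', ← hd2, ← hd4, ← hd6, ← hd8]
  rcases hY with rfl | rfl <;> rcases hC with rfl | rfl <;> field_simp <;>
    simp only [hb', hd2, hd4, hd6, hd8] <;> ring

theorem BstarB_zero_half (hq : q ≠ 0) (hb : 1 + q ^ 2 ≠ 0) (h2 : q ^ 2 - 1 ≠ 0) (h4 : q ^ 4 - 1 ≠ 0)
    (h6 : q ^ 6 - 1 ≠ 0) (h8 : q ^ 8 - 1 ≠ 0) (hu : u = q⁻¹) (hC : C = q ∨ C = q⁻¹)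
    (hY : Y = q ∨ Y = q⁻¹) :
    ((u * Y * q ^ 3 - q⁻¹) * (u * Y * q ^ 4 - (q ^ 2)⁻¹) * P q C (u * q ^ 2) +
      (u * Y * q ^ 3 - q⁻¹) * (u * q ^ 2 - Y) * q⁻¹ * R q C (u * q ^ 2) ^ 2 +
      (u * q ^ 2 - Y) * (u * q - Y * q) * (u * q ^ 2) ^ 2 * P q C u) / ((q - q⁻¹) ^ 2 * (u *
        q ^ 2)) =
      α q (R q C (u * q ^ 2)) (u * q ^ 2) Y - q ^ 2 * (α q (R q C (u * q ^ 2)) (u * q ^ 2) Y ^ 2 +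
      (q * (u * q ^ 3 - Y * q⁻¹) * (u * Y * q ^ 3 - q⁻¹) * P q C (u * q ^ 2) + q⁻¹ * (u *
        q ^ 2 - Y) * (u * Y * q ^ 2 - 1) * P q C u) / (q - q⁻¹) ^ 2) := by
  have hP : P q C u = 0 := by simp [P, hu, hq]
  have w2 : u * q ^ 2 = q := by rw [hu]; field_simp
  have w3 : u * q ^ 3 = q ^ 2 := by rw [hu]; field_simp
  have w1 : u * q = 1 := by rw [hu]; field_simp
  have v2 : u * Y * q ^ 2 = q * Y := by rw [hu]; field_simp
  have v3 : u * Y * q ^ 3 = q ^ 2 * Y := by rw [hu]; field_simp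
  have v4 : u * Y * q ^ 4 = q ^ 3 * Y := by rw [hu]; field_simp
  simp only [hP, w2, w3, w1, v2, v3, v4]
  clear hP w1 w2 w3 v2 v3 v4 hu
  have e1 : q - q⁻¹ = (q ^ 2 - 1) / q := by field_simp
  have e2 : q * q - (q * q)⁻¹ = (q ^ 4 - 1) / q ^ 2 := by field_simp
  have e3 : q * q ^ 2 - (q * q ^ 2)⁻¹ = (q ^ 6 - 1) / q ^ 3 := by field_simp
  have e4 : q * q ^ 3 - (q * q ^ 3)⁻¹ = (q ^ 8 - 1) / q ^ 4 := by field_simp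
  have e5 : 1 - q ^ 2 = -(q ^ 2 - 1) := by ring
  unfold α R P
  rw [e1, e2, e3, e4, e5]
  obtain ⟨b, hb'⟩ : ∃ b, b = 1 + q ^ 2 := ⟨_, rfl⟩
  obtain ⟨d2, hd2⟩ : ∃ d, d = q ^ 2 - 1 := ⟨_, rfl⟩
  obtain ⟨d4, hd4⟩ : ∃ d, d = q ^ 4 - 1 := ⟨_, rfl⟩
  obtain ⟨d6, hd6⟩ : ∃ d, d = q ^ 6 - 1 := ⟨_, rfl⟩
  obtain ⟨d8, hd8⟩ : ∃ d, d = q ^ 8 - 1 := ⟨_, rfl⟩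
  rw [← hb'] at hb
  rw [← hd2] at h2
  rw [← hd4] at h4
  rw [← hd6] at h6
  rw [← hd8] at h8
  rw [← hb', ← hd2, ← hd4, ← hd6, ← hd8]
  rcases hY with rfl | rfl <;> rcases hC with rfl | rfl <;> field_simp <;>
    simp only [hb', hd2, hd4, hd6, hd8] <;> ring

/-- The case `l = 0`, which forces `N = m = 0`. The convention on division by zero yields `R = 0` at
`u q² = 1`, in agreement with the prescribed `r⁰(0) = 0`, and it kills the term of the missing level
below. -/
theorem BBstar_zero_null (hq : q ≠ 0) (hq1 : 1 - q ^ 2 ≠ 0) (hb : 1 +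
  q ^ 2 ≠ 0) (h4 : q ^ 4 - 1 ≠ 0)
    (h6 : q ^ 6 - 1 ≠ 0) (hu : u = (q ^ 2)⁻¹) (hC : C = 1) (hY : Y = 1) :
    ((u * q ^ 4 - Y * (q ^ 2)⁻¹) * (u * q ^ 3 - Y * q⁻¹) * (u * q ^ 2) ^ 2 * q ^ 4 * P q C (u *
      q ^ 2) +
      (u * Y * q ^ 2 - 1) * (u * q ^ 3 - Y * q⁻¹) * q⁻¹ * R q C (u * q ^ 2) ^ 2 +
      (u * Y * q ^ 2 - 1) * (u * Y * q - q) * P q C u) / ((q - q⁻¹) ^ 2 * (u * q ^ 2)) =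
      α q (R q C (u * q ^ 2)) (u * q ^ 2) Y - α q (R q C (u * q ^ 2)) (u * q ^ 2) Y ^ 2 -
      (q * (u * q ^ 3 - Y * q⁻¹) * (u * Y * q ^ 3 - q⁻¹) * P q C (u * q ^ 2) + q⁻¹ * (u *
        q ^ 2 - Y) * (u * Y * q ^ 2 - 1) * P q C u) / (q - q⁻¹) ^ 2 := by
  have hP : P q C u = 0 := by simp [P, hu, hq]
  have hw : u * q ^ 2 = 1 := by rw [hu]; field_simp
  have hR : R q C 1 = 0 := by simp [R]
  have w3 : u * q ^ 3 = q := by rw [hu]; field_simp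
  have w4 : u * q ^ 4 = q ^ 2 := by rw [hu]; field_simp
  rw [hY, mul_one, hP, hw, hR, w3, w4, hC]
  clear hP hw hR w3 w4 hu hC hY
  have e1 : q - q⁻¹ = -(1 - q ^ 2) / q := by field_simp; ring
  have e2 : q ^ 2 - (q ^ 2)⁻¹ = (q ^ 4 - 1) / q ^ 2 := by field_simp
  have e3 : q ^ 3 - (q ^ 3)⁻¹ = (q ^ 6 - 1) / q ^ 3 := by field_simp
  unfold α P
  simp only [one_mul]
  rw [e1, e2, e3]
  obtain ⟨a, ha⟩ : ∃ a, a = 1 - q ^ 2 := ⟨_, rfl⟩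
  obtain ⟨b, hb'⟩ : ∃ b, b = 1 + q ^ 2 := ⟨_, rfl⟩
  obtain ⟨d4, hd4⟩ : ∃ d, d = q ^ 4 - 1 := ⟨_, rfl⟩
  obtain ⟨d6, hd6⟩ : ∃ d, d = q ^ 6 - 1 := ⟨_, rfl⟩
  rw [← ha] at hq1
  rw [← hb'] at hb
  rw [← hd4] at h4
  rw [← hd6] at h6
  rw [← ha, ← hb', ← hd4, ← hd6]
  field_simp
  simp only [ha, hb', hd4, hd6]
  ring

theorem BstarB_zero_null (hq : q ≠ 0) (hq1 : 1 - q ^ 2 ≠ 0) (hb : 1 +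
  q ^ 2 ≠ 0) (h4 : q ^ 4 - 1 ≠ 0)
    (h6 : q ^ 6 - 1 ≠ 0) (hu : u = (q ^ 2)⁻¹) (hC : C = 1) (hY : Y = 1) :
    ((u * Y * q ^ 3 - q⁻¹) * (u * Y * q ^ 4 - (q ^ 2)⁻¹) * P q C (u * q ^ 2) +
      (u * Y * q ^ 3 - q⁻¹) * (u * q ^ 2 - Y) * q⁻¹ * R q C (u * q ^ 2) ^ 2 +
      (u * q ^ 2 - Y) * (u * q - Y * q) * (u * q ^ 2) ^ 2 * P q C u) / ((q - q⁻¹) ^ 2 * (u *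
        q ^ 2)) =
      α q (R q C (u * q ^ 2)) (u * q ^ 2) Y - q ^ 2 * (α q (R q C (u * q ^ 2)) (u * q ^ 2) Y ^ 2 +
      (q * (u * q ^ 3 - Y * q⁻¹) * (u * Y * q ^ 3 - q⁻¹) * P q C (u * q ^ 2) + q⁻¹ * (u *
        q ^ 2 - Y) * (u * Y * q ^ 2 - 1) * P q C u) / (q - q⁻¹) ^ 2) := by
  have hP : P q C u = 0 := by simp [P, hu, hq]
  have hw : u * q ^ 2 = 1 := by rw [hu]; field_simp
  have hR : R q C 1 = 0 := by simp [R]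
  have w3 : u * q ^ 3 = q := by rw [hu]; field_simp
  have w4 : u * q ^ 4 = q ^ 2 := by rw [hu]; field_simp
  rw [hY, mul_one, hP, hw, hR, w3, w4, hC]
  clear hP hw hR w3 w4 hu hC hY
  have e1 : q - q⁻¹ = -(1 - q ^ 2) / q := by field_simp; ring
  have e2 : q ^ 2 - (q ^ 2)⁻¹ = (q ^ 4 - 1) / q ^ 2 := by field_simp
  have e3 : q ^ 3 - (q ^ 3)⁻¹ = (q ^ 6 - 1) / q ^ 3 := by field_simp
  unfold α P
  simp only [one_mul]
  rw [e1, e2, e3]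
  obtain ⟨a, ha⟩ : ∃ a, a = 1 - q ^ 2 := ⟨_, rfl⟩
  obtain ⟨b, hb'⟩ : ∃ b, b = 1 + q ^ 2 := ⟨_, rfl⟩
  obtain ⟨d4, hd4⟩ : ∃ d, d = q ^ 4 - 1 := ⟨_, rfl⟩
  obtain ⟨d6, hd6⟩ : ∃ d, d = q ^ 6 - 1 := ⟨_, rfl⟩
  rw [← ha] at hq1
  rw [← hb'] at hb
  rw [← hd4] at h4
  rw [← hd6] at h6
  rw [← ha, ← hb', ← hd4, ← hd6]
  field_simp
  simp only [ha, hb', hd4, hd6]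
  ring

/-- The step between the levels `0` and `1` with `N = 0`; here `u = 1` is the zero of the
denominator `u - u⁻¹` of `r⁰`. -/
theorem AB_one_null (hq : q ≠ 0) (hq1 : 1 - q ^ 2 ≠ 0) (hb : 1 + q ^ 2 ≠ 0) (h4 : q ^ 4 - 1 ≠ 0)
    (h8 : q ^ 8 - 1 ≠ 0) (hu : u = 1) (hC : C = 1) (hY : Y = 1) :
    α q (R q C (u * q ^ 2)) (u * q ^ 2) (Y * q ^ 2) - q ^ 2 * α q (R q C u) u Y =
      (q * (u - Y) * R q C u - q ^ 2 * (u * q - Y * q⁻¹) * R q C (u * q ^ 2)) / (q - q⁻¹) := by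
  have hR : R q C 1 = 0 := by simp [R]
  rw [hu, hY, hR, hC]
  clear hR hu hC hY
  simp only [one_mul, mul_zero, sub_self]
  have e1 : q - q⁻¹ = -(1 - q ^ 2) / q := by field_simp; ring
  have e2 : q ^ 2 - (q ^ 2)⁻¹ = (q ^ 4 - 1) / q ^ 2 := by field_simp
  have e4 : q ^ 2 * q ^ 2 - (q ^ 2 * q ^ 2)⁻¹ = (q ^ 8 - 1) / q ^ 4 := by field_simp
  unfold α R
  rw [e1, e2, e4]
  obtain ⟨a, ha⟩ : ∃ a, a = 1 - q ^ 2 := ⟨_, rfl⟩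
  obtain ⟨b, hb'⟩ : ∃ b, b = 1 + q ^ 2 := ⟨_, rfl⟩
  obtain ⟨d4, hd4⟩ : ∃ d, d = q ^ 4 - 1 := ⟨_, rfl⟩
  obtain ⟨d8, hd8⟩ : ∃ d, d = q ^ 8 - 1 := ⟨_, rfl⟩
  rw [← ha] at hq1
  rw [← hb'] at hb
  rw [← hd4] at h4
  rw [← hd8] at h8
  rw [← ha, ← hb', ← hd4, ← hd8]
  field_simp
  simp only [ha, hb', hd4, hd8]
  ring

theorem AB_neg_one_null (hq : q ≠ 0) (hq1 : 1 - q ^ 2 ≠ 0) (hb : 1 + q ^ 2 ≠ 0) (h4 : q ^ 4 - 1 ≠ 0)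
    (h8 : q ^ 8 - 1 ≠ 0) (hu : u = 1) (hC : C = 1) (hY : Y = (q ^ 2)⁻¹) :
    α q (R q C u) u (Y * q ^ 2) + (Y * q - (u * q ^ 2)⁻¹ * q⁻¹) / (q - q⁻¹) * R q C (u * q ^ 2) =
      q ^ 2 * (q⁻¹ * ((Y - (u * q ^ 2)⁻¹) / (q - q⁻¹)) * R q C u +
        α q (R q C (u * q ^ 2)) (u * q ^ 2) Y) := by
  have hR : R q C 1 = 0 := by simp [R]
  rw [hu, hY, hR, hC]
  clear hR hu hC hY
  simp only [one_mul, mul_zero, sub_self, zero_div]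
  have e1 : q - q⁻¹ = -(1 - q ^ 2) / q := by field_simp; ring
  have e2 : q ^ 2 - (q ^ 2)⁻¹ = (q ^ 4 - 1) / q ^ 2 := by field_simp
  have e4 : q ^ 2 * q ^ 2 - (q ^ 2 * q ^ 2)⁻¹ = (q ^ 8 - 1) / q ^ 4 := by field_simp
  unfold α R
  rw [e1, e2, e4]
  obtain ⟨a, ha⟩ : ∃ a, a = 1 - q ^ 2 := ⟨_, rfl⟩
  obtain ⟨b, hb'⟩ : ∃ b, b = 1 + q ^ 2 := ⟨_, rfl⟩
  obtain ⟨d4, hd4⟩ : ∃ d, d = q ^ 4 - 1 := ⟨_, rfl⟩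
  obtain ⟨d8, hd8⟩ : ∃ d, d = q ^ 8 - 1 := ⟨_, rfl⟩
  rw [← ha] at hq1
  rw [← hb'] at hb
  rw [← hd4] at h4
  rw [← hd8] at h8
  rw [← ha, ← hb', ← hd4, ← hd8]
  field_simp
  simp only [ha, hb', hd4, hd8]
  ring

theorem BBstar_one_null (hq : q ≠ 0) (hq1 : 1 - q ^ 2 ≠ 0) (hb : 1 + q ^ 2 ≠ 0) (h4 : q ^ 4 - 1 ≠ 0)
    (h8 : q ^ 8 - 1 ≠ 0) (hu : u = 1) (hC : C = 1) (hY : Y = 1) :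
    -((u * q ^ 2 - Y * (q ^ 2)⁻¹) / (q - q⁻¹) * R q C (u * q ^ 2)) +
      u⁻¹ * (q ^ 2)⁻¹ * ((u * Y - 1) / (q - q⁻¹)) * R q C u =
      -(q⁻¹ * (1 - α q (R q C u) u Y - α q (R q C (u * q ^ 2)) (u * q ^ 2) Y)) := by
  have hR : R q C 1 = 0 := by simp [R]
  rw [hu, hY, hR, hC]
  clear hR hu hC hY
  simp only [one_mul, mul_one, mul_zero, add_zero, sub_self, zero_div]
  have e1 : q - q⁻¹ = -(1 - q ^ 2) / q := by field_simp; ring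
  have e2 : q ^ 2 - (q ^ 2)⁻¹ = (q ^ 4 - 1) / q ^ 2 := by field_simp
  have e4 : q ^ 2 * q ^ 2 - (q ^ 2 * q ^ 2)⁻¹ = (q ^ 8 - 1) / q ^ 4 := by field_simp
  unfold α R
  rw [e1, e2, e4]
  obtain ⟨a, ha⟩ : ∃ a, a = 1 - q ^ 2 := ⟨_, rfl⟩
  obtain ⟨b, hb'⟩ : ∃ b, b = 1 + q ^ 2 := ⟨_, rfl⟩
  obtain ⟨d4, hd4⟩ : ∃ d, d = q ^ 4 - 1 := ⟨_, rfl⟩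
  obtain ⟨d8, hd8⟩ : ∃ d, d = q ^ 8 - 1 := ⟨_, rfl⟩
  rw [← ha] at hq1
  rw [← hb'] at hb
  rw [← hd4] at h4
  rw [← hd8] at h8
  rw [← ha, ← hb', ← hd4, ← hd8]
  field_simp
  simp only [ha, hb', hd4, hd8]
  ring

theorem BstarB_one_null (hq : q ≠ 0) (hq1 : 1 - q ^ 2 ≠ 0) (hb : 1 + q ^ 2 ≠ 0) (h4 : q ^ 4 - 1 ≠ 0)
    (h8 : q ^ 8 - 1 ≠ 0) (hu : u = 1) (hC : C = 1) (hY : Y = 1) :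
    (u * Y * q ^ 2 - (q ^ 2)⁻¹) / (q - q⁻¹) * R q C (u * q ^ 2) -
      (u - Y) / (q - q⁻¹) * u * q ^ 2 * R q C u =
      -(u * q * (1 - q ^ 2 * (α q (R q C u) u Y + α q (R q C (u * q ^ 2)) (u * q ^ 2) Y))) := by
  have hR : R q C 1 = 0 := by simp [R]
  rw [hu, hY, hR, hC]
  clear hR hu hC hY
  simp only [one_mul, mul_one, mul_zero, sub_self, zero_div, zero_mul]
  have e1 : q - q⁻¹ = -(1 - q ^ 2) / q := by field_simp; ring
  have e2 : q ^ 2 - (q ^ 2)⁻¹ = (q ^ 4 - 1) / q ^ 2 := by field_simp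
  have e4 : q ^ 2 * q ^ 2 - (q ^ 2 * q ^ 2)⁻¹ = (q ^ 8 - 1) / q ^ 4 := by field_simp
  unfold α R
  rw [e1, e2, e4]
  obtain ⟨a, ha⟩ : ∃ a, a = 1 - q ^ 2 := ⟨_, rfl⟩
  obtain ⟨b, hb'⟩ : ∃ b, b = 1 + q ^ 2 := ⟨_, rfl⟩
  obtain ⟨d4, hd4⟩ : ∃ d, d = q ^ 4 - 1 := ⟨_, rfl⟩
  obtain ⟨d8, hd8⟩ : ∃ d, d = q ^ 8 - 1 := ⟨_, rfl⟩
  rw [← ha] at hq1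
  rw [← hb'] at hb
  rw [← hd4] at h4
  rw [← hd8] at h8
  rw [← ha, ← hb', ← hd4, ← hd8]
  field_simp
  simp only [ha, hb', hd4, hd8]
  ring

end PodlesIdentity

/-! ### The coefficients of the representations and the relations between them -/

section Coefficients

open PodlesIdentity

theorem rpow_sub_rpow_ne_zero {q : ℝ} (hq0 : 0 < q) (hq1 : q < 1) : q - q⁻¹ ≠ 0 := by
  have : q < q⁻¹ := lt_trans hq1 ((one_lt_inv₀ hq0).mpr hq1)
  linarith

theorem qNum_eq {q : ℝ} (hq0 : 0 < q) (t : ℝ) : qNum q t = (q ^ t - (q ^ t)⁻¹) / (q - q⁻¹) := by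
  rw [qNum, Real.rpow_neg hq0.le]

theorem qNum_nonneg {q : ℝ} (hq0 : 0 < q) (hq1 : q < 1) {t : ℝ} (ht : 0 ≤ t) : 0 ≤ qNum q t := by
  have h1 : q < q⁻¹ := lt_trans hq1 ((one_lt_inv₀ hq0).mpr hq1)
  have h2 : q ^ t ≤ q ^ (-t) := Real.rpow_le_rpow_of_exponent_ge hq0 hq1.le (by linarith)
  exact div_nonneg_of_nonpos (by linarith) (by linarith)

theorem qNum_zero (q : ℝ) : qNum q 0 = 0 := by simp [qNum]

/-- The square root of a `q`-number. -/
noncomputable def sqrtNum (q t : ℝ) : ℝ := √(qNum q t)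

theorem sqrtNum_zero (q : ℝ) : sqrtNum q 0 = 0 := by simp [sqrtNum, qNum_zero]

theorem sqrtNum_sq {q : ℝ} (hq0 : 0 < q) (hq1 : q < 1) {t : ℝ} (ht : 0 ≤ t) :
    sqrtNum q t ^ 2 = qNum q t := Real.sq_sqrt (qNum_nonneg hq0 hq1 ht)

/-- Only one factor has to be nonnegative: if the other is negative, both sides are `0`. This
matters at the edge of the label range, where arguments such as `l + m - 1` can be `-1`. -/
theorem sqrt_qNum_mul {q : ℝ} (hq0 : 0 < q) (hq1 : q < 1) {s : ℝ} (hs : 0 ≤ s) (t : ℝ) :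
    √(qNum q s * qNum q t) = sqrtNum q s * sqrtNum q t := Real.sqrt_mul (qNum_nonneg hq0 hq1 hs) _

/-- The factor `q^{l+m}` clears the odd powers: what remains is a polynomial in `q^{2l}` and
`q^{2m}`, up to the common denominator, as in the rational identities. -/
theorem sqrtNum_sq_add {q : ℝ} (hq0 : 0 < q) (hq1 : q < 1) {l m t K : ℝ}
    (ht : q ^ t = q ^ l * q ^ m * K) (h0 : 0 ≤ t) :
    q ^ l * q ^ m * sqrtNum q t ^ 2 =
      ((q ^ l) ^ 2 * (q ^ m) ^ 2 * K - K⁻¹) / (q - q⁻¹) := by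
  have hl := (Real.rpow_pos_of_pos hq0 l).ne'
  have hm := (Real.rpow_pos_of_pos hq0 m).ne'
  have hd := rpow_sub_rpow_ne_zero hq0 hq1
  rw [sqrtNum_sq hq0 hq1 h0, qNum_eq hq0, ht, mul_inv, mul_inv]
  generalize q - q⁻¹ = d at *
  have hK : K ≠ 0 := by
    rintro rfl
    exact (Real.rpow_pos_of_pos hq0 t).ne' (by rw [ht, mul_zero])
  field_simp

theorem sqrtNum_sq_sub {q : ℝ} (hq0 : 0 < q) (hq1 : q < 1) {l m t K : ℝ}
    (ht : q ^ t * q ^ m = q ^ l * K) (h0 : 0 ≤ t) :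
    q ^ l * q ^ m * sqrtNum q t ^ 2 =
      ((q ^ l) ^ 2 * K - (q ^ m) ^ 2 * K⁻¹) / (q - q⁻¹) := by
  have hl := (Real.rpow_pos_of_pos hq0 l).ne'
  have hm := (Real.rpow_pos_of_pos hq0 m).ne'
  have hd := rpow_sub_rpow_ne_zero hq0 hq1
  have hK : K ≠ 0 := by
    rintro rfl
    exact mul_ne_zero (Real.rpow_pos_of_pos hq0 t).ne' hm (by rw [ht, mul_zero])
  have ht' : q ^ t = q ^ l * K / q ^ m := by rw [← ht]; field_simp
  rw [sqrtNum_sq hq0 hq1 h0, qNum_eq hq0, ht', inv_div]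
  generalize q - q⁻¹ = d at *
  field_simp

/-- The matrix coefficient of `B` from `|l,m⟩` to `|l+1,m+1⟩`. -/
noncomputable def bPlus (q N l m : ℝ) : ℝ :=
  q ^ m * √(qNum q (l + m + 1) * qNum q (l + m + 2)) * rPlus q N l

/-- The matrix coefficient of `B` from `|l,m⟩` to `|l,m+1⟩`. -/
noncomputable def bZero (q N l m : ℝ) : ℝ :=
  q ^ m * √(qNum q (l + m + 1) * qNum q (l - m)) * rZero q N l

/-- The matrix coefficient of `B` from `|l,m⟩` to `|l-1,m+1⟩`. -/
noncomputable def bMinus (q N l m : ℝ) : ℝ :=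
  q ^ m * √(qNum q (l - m) * qNum q (l - m - 1)) * rMinus q N l

/-- The matrix coefficient of `A` from `|l,m⟩` to `|l+1,m⟩`. -/
noncomputable def aPlus (q N l m : ℝ) : ℝ :=
  -(q ^ (m + l + 1 / 2) * √(qNum q (l - m + 1) * qNum q (l + m + 1)) * rPlus q N l)

/-- The diagonal matrix coefficient of `A` at `|l,m⟩`. -/
noncomputable def aZero (q N l m : ℝ) : ℝ :=
  q ^ (-(1 / 2) : ℝ) / (1 + q ^ 2) *
    ((qNum q (l - m + 1) * qNum q (l + m) - q ^ 2 * (qNum q (l - m) * qNum q (l + m + 1))) *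
      rZero q N l + q ^ (1 / 2 : ℝ))

variable {q : ℝ} (hq0 : 0 < q) (hq1 : q < 1) {N l m : ℝ}
include hq0

theorem rpow_half_sq : q ^ (1 / 2 : ℝ) * q ^ (1 / 2 : ℝ) = q := by
  rw [← Real.rpow_add hq0]; norm_num

/-- Both sign branches of `r⁰` are the same rational function of `C = q^{-2N}`. From here on no
distinction by the sign of `N` is needed. -/
theorem rpow_half_mul_rZero : q ^ (1 / 2 : ℝ) * rZero q N l = R q (q ^ (-(2 * N))) ((q ^ l) ^ 2) :=
  by
  have h1 : q ^ (-(1 / 2) : ℝ) = (q ^ (1 / 2 : ℝ))⁻¹ := Real.rpow_neg hq0.le _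
  have hh : q ^ (1 / 2 : ℝ) ≠ 0 := (Real.rpow_pos_of_pos hq0 _).ne'
  have hx : q ^ l ≠ 0 := (Real.rpow_pos_of_pos hq0 _).ne'
  have hc : q ^ |N| ≠ 0 := (Real.rpow_pos_of_pos hq0 _).ne'
  have e1 : q ^ (2 * l) = (q ^ l) ^ 2 := by rw [two_mul, Real.rpow_add hq0, sq]
  have e2 : q ^ (2 * l + 2) = (q ^ l) ^ 2 * q ^ 2 := by
    rw [Real.rpow_add hq0, e1]; norm_num
  have e3 : q ^ (l + |N| + 1) = q ^ l * q ^ |N| * q := by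
    rw [Real.rpow_add hq0, Real.rpow_add hq0, Real.rpow_one]
  have e4 : q ^ (l - |N|) = q ^ l / q ^ |N| := Real.rpow_sub hq0 _ _
  have e5 : q ^ (2 * |N|) = (q ^ |N|) ^ 2 := by rw [two_mul, Real.rpow_add hq0, sq]
  have key : (q - q⁻¹) * qNum q (l + |N| + 1) * qNum q (l - |N|) +
      (if 0 ≤ N then q * qNum q (2 * |N|) else -(q⁻¹ * qNum q (2 * |N|))) =
      ((q ^ l) ^ 2 * q + ((q ^ l) ^ 2 * q)⁻¹ - q ^ (-(2 * N)) * (q + q⁻¹)) / (q - q⁻¹) := by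
    by_cases hd : q - q⁻¹ = 0
    · simp [qNum, hd]
    rw [qNum_eq hq0, qNum_eq hq0, qNum_eq hq0, e3, e4, e5]
    have hq := hq0.ne'
    -- With `c = q^{|N|}`, the product of `q`-numbers contributes `-c² q - c⁻² q⁻¹`. For `N ≥ 0` the
    -- correction cancels `c² q` and leaves `-c⁻² (q + q⁻¹)`; for `N < 0` it cancels the other term
    -- and leaves `-c² (q + q⁻¹)`.
    split_ifs with hN
    · have e6 : q ^ (-(2 * N)) = ((q ^ |N|) ^ 2)⁻¹ :=
      by rw [abs_of_nonneg hN] at *; rw [Real.rpow_neg hq0.le, e5]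
      rw [e6]
      generalize q ^ |N| = c at *
      generalize q ^ l = x at *
      rw [eq_div_iff hd]
      have : (q - q⁻¹) * ((x * c * q - (x * c * q)⁻¹) / (q - q⁻¹)) *
        ((x / c - (x / c)⁻¹) / (q - q⁻¹)) = (x * c * q - (x * c * q)⁻¹) *
          (x / c - (x / c)⁻¹) / (q - q⁻¹) := by
        generalize q - q⁻¹ = d at *
        field_simp
      rw [this]
      have h2 : ∀ a b c : ℝ, (a / (q - q⁻¹) + b * (c / (q - q⁻¹))) * (q - q⁻¹) = a + b * c := by
        intro a b c
        generalize q - q⁻¹ = d at *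
        field_simp
      rw [h2]
      field_simp
      ring
    · have e6 : q ^ (-(2 * N)) = (q ^ |N|) ^ 2 := by
        rw [← e5, abs_of_neg (not_le.mp hN)]; congr 1; ring
      rw [e6]
      generalize q ^ |N| = c at *
      generalize q ^ l = x at *
      rw [eq_div_iff hd]
      have : (q - q⁻¹) * ((x * c * q - (x * c * q)⁻¹) / (q - q⁻¹)) *
        ((x / c - (x / c)⁻¹) / (q - q⁻¹)) = (x * c * q - (x * c * q)⁻¹) *
          (x / c - (x / c)⁻¹) / (q - q⁻¹) := by
        generalize q - q⁻¹ = d at *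
        field_simp
      rw [this]
      have h2 : ∀ a b c : ℝ, (a / (q - q⁻¹) + -(b * (c / (q - q⁻¹)))) * (q - q⁻¹) = a - b * c := by
        intro a b c
        generalize q - q⁻¹ = d at *
        field_simp
        ring
      rw [h2]
      field_simp
      ring
  rw [rZero, key, h1, qNum_eq hq0, qNum_eq hq0, e1, e2, R]
  generalize q ^ (-(2 * N)) = C
  generalize (q ^ l) ^ 2 = u
  by_cases hd : q - q⁻¹ = 0
  · simp [hd]
  by_cases h0 : u - u⁻¹ = 0
  · simp [h0]
  by_cases h2 : u * q ^ 2 - (u * q ^ 2)⁻¹ = 0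
  · simp only [h2, zero_div, mul_zero, div_zero]
  generalize q - q⁻¹ = d at *
  generalize u - u⁻¹ = a at *
  generalize u * q ^ 2 - (u * q ^ 2)⁻¹ = b at *
  field_simp

include hq1

/-- The combination of `q`-numbers in the diagonal of `A` is affine in `q^{2m}`, which produces the
bracket in `α`. -/
theorem aZero_eq : aZero q N l m =
    α q (R q (q ^ (-(2 * N))) ((q ^ l) ^ 2)) ((q ^ l) ^ 2) ((q ^ m) ^ 2) := by
  rw [← rpow_half_mul_rZero hq0, aZero, α]
  have h1 : q ^ (-(1 / 2) : ℝ) = (q ^ (1 / 2 : ℝ))⁻¹ := Real.rpow_neg hq0.le _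
  have hh : q ^ (1 / 2 : ℝ) ≠ 0 := (Real.rpow_pos_of_pos hq0 _).ne'
  have hsq := rpow_half_sq hq0
  have hx : q ^ l ≠ 0 := (Real.rpow_pos_of_pos hq0 _).ne'
  have hy : q ^ m ≠ 0 := (Real.rpow_pos_of_pos hq0 _).ne'
  have hd := rpow_sub_rpow_ne_zero hq0 hq1
  have h2 : 1 - q ^ 2 ≠ 0 := by nlinarith
  have h3 : q - q⁻¹ = -(1 - q ^ 2) / q := by have := hq0.ne'; field_simp; ring
  rw [h1, qNum_eq hq0, qNum_eq hq0, qNum_eq hq0, qNum_eq hq0]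
  simp only [Real.rpow_add hq0, Real.rpow_sub hq0, Real.rpow_one]
  generalize rZero q N l = r
  generalize q ^ (1 / 2 : ℝ) = h at *
  generalize q ^ l = x at *
  generalize q ^ m = y at *
  have h4 : 1 + q ^ 2 ≠ 0 := by positivity
  rw [h3]
  have hq := hq0.ne'
  have hqh : q = h * h := hsq.symm
  obtain ⟨a, ha⟩ : ∃ a, a = 1 - q ^ 2 := ⟨_, rfl⟩
  rw [← ha] at h2 ⊢
  field_simp
  subst ha
  rw [hqh]
  ring

omit hq0 hq1 in
theorem rPlus_neg_one : rPlus q N (-1) = 0 := by simp [rPlus, qNum_zero]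

/-- The hypotheses make both radicands nonnegative, so that the square roots disappear. -/
theorem rPlus_sq (hl : -(1 / 2) ≤ l) (hN : |N| ≤ l + 1) :
    rPlus q N l ^ 2 = P q (q ^ (-(2 * N))) ((q ^ l) ^ 2) := by
  obtain ⟨hN1, hN2⟩ := abs_le.mp hN
  have p1 : 0 ≤ qNum q (l + N + 1) * qNum q (l - N + 1) :=
    mul_nonneg (qNum_nonneg hq0 hq1 (by linarith)) (qNum_nonneg hq0 hq1 (by linarith))
  have p2 : 0 ≤ qNum q (2 * l + 1) * qNum q (2 * l + 3) :=
    mul_nonneg (qNum_nonneg hq0 hq1 (by linarith)) (qNum_nonneg hq0 hq1 (by linarith))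
  have hx : q ^ l ≠ 0 := (Real.rpow_pos_of_pos hq0 _).ne'
  have hc : q ^ N ≠ 0 := (Real.rpow_pos_of_pos hq0 _).ne'
  have e1 : q ^ (2 * l) = (q ^ l) ^ 2 := by rw [two_mul, Real.rpow_add hq0, sq]
  have e2 : q ^ (2 * N) = (q ^ N) ^ 2 := by rw [two_mul, Real.rpow_add hq0, sq]
  have e3 : (q ^ (-l - 3 / 2 - N)) ^ 2 = ((q ^ l) ^ 2)⁻¹ * (q ^ 3)⁻¹ * ((q ^ N) ^ 2)⁻¹ := by
    rw [sq, ← Real.rpow_add hq0, ← e1, ← e2, ← Real.rpow_natCast q 3, ← Real.rpow_neg hq0.le,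
      ← Real.rpow_neg hq0.le, ← Real.rpow_neg hq0.le, ← Real.rpow_add hq0, ← Real.rpow_add hq0]
    congr 1
    push_cast
    ring
  have e4 : q ^ (-(2 * N)) = ((q ^ N) ^ 2)⁻¹ := by rw [Real.rpow_neg hq0.le, e2]
  have n1 : q ^ (1 : ℝ) = q := Real.rpow_one q
  have n2 : q ^ (2 : ℝ) = q ^ 2 := by norm_num
  have n3 : q ^ (3 : ℝ) = q ^ 3 := by norm_num
  have hd := rpow_sub_rpow_ne_zero hq0 hq1
  have hq := hq0.ne'
  rw [rPlus, P, mul_pow, div_pow, div_pow, Real.sq_sqrt p1, Real.sq_sqrt p2, e3, e4]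
  simp only [qNum_eq hq0, Real.rpow_add hq0, Real.rpow_sub hq0, e1, n1, n2, n3]
  generalize q ^ l = x at *
  generalize q ^ N = c at *
  -- Where a denominator vanishes, both sides are `0` by the convention on division by zero.
  by_cases h1 : x ^ 2 * q - (x ^ 2 * q)⁻¹ = 0
  · simp only [h1, zero_div, zero_mul, mul_zero, div_zero]
  by_cases h2 : x ^ 2 * q ^ 2 - (x ^ 2 * q ^ 2)⁻¹ = 0
  · simp only [h2, zero_div, zero_mul, mul_zero, div_zero, ne_eq, OfNat.ofNat_ne_zero,
    not_false_eq_true,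
      zero_pow]
  by_cases h3 : x ^ 2 * q ^ 3 - (x ^ 2 * q ^ 3)⁻¹ = 0
  · simp only [h3, zero_div, mul_zero, div_zero]
  have h4 : (x * c * q - (x * c * q)⁻¹) * (x / c * q - (x / c * q)⁻¹) =
      x ^ 2 * q ^ 2 + (x ^ 2 * q ^ 2)⁻¹ - (c ^ 2)⁻¹ - (c ^ 2)⁻¹⁻¹ := by
    field_simp
    ring
  rw [← h4]
  generalize x * c * q - (x * c * q)⁻¹ = f at *
  generalize x / c * q - (x / c * q)⁻¹ = g at *
  generalize x ^ 2 * q - (x ^ 2 * q)⁻¹ = d1 at *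
  generalize x ^ 2 * q ^ 2 - (x ^ 2 * q ^ 2)⁻¹ = d2 at *
  generalize x ^ 2 * q ^ 3 - (x ^ 2 * q ^ 3)⁻¹ = d3 at *
  generalize q - q⁻¹ = d at *
  field_simp

theorem bPlus_eq {a b : ℝ} (ha : l + m + 1 = a) (hb : l + m + 2 = b) (h : 0 ≤ a) :
    bPlus q N l m = q ^ m * (sqrtNum q a * sqrtNum q b) * rPlus q N l := by
  subst ha hb
  rw [bPlus, sqrt_qNum_mul hq0 hq1 h]

/-- The variant for the arrow that ends at `(l, m)`: there only the second argument, `l + m`, is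
known to be nonnegative. -/
theorem bPlus_eq' {a b : ℝ} (ha : l + m + 1 = a) (hb : l + m + 2 = b) (h : 0 ≤ b) :
    bPlus q N l m = q ^ m * (sqrtNum q a * sqrtNum q b) * rPlus q N l := by
  subst ha hb
  rw [bPlus, mul_comm (qNum q _) (qNum q _), sqrt_qNum_mul hq0 hq1 h, mul_comm (sqrtNum q _)]

theorem bZero_eq {a b : ℝ} (ha : l + m + 1 = a) (hb : l - m = b) (h : 0 ≤ a) :
    bZero q N l m = q ^ m * (sqrtNum q a * sqrtNum q b) * rZero q N l := by
  subst ha hb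
  rw [bZero, sqrt_qNum_mul hq0 hq1 h]

theorem bMinus_eq {a b k : ℝ} (ha : l - m = a) (hb : l - m - 1 = b) (hk : l - 1 = k) (h : 0 ≤ a) :
    bMinus q N l m = -(q ^ m * (sqrtNum q a * sqrtNum q b) * ((q ^ l) ^ 2 * rPlus q N k)) := by
  subst ha hb hk
  have e1 : q ^ (2 * l) = (q ^ l) ^ 2 := by rw [two_mul, Real.rpow_add hq0, sq]
  rw [bMinus, sqrt_qNum_mul hq0 hq1 h, rMinus, e1]
  ring

theorem aPlus_eq {a b : ℝ} (ha : l - m + 1 = a) (hb : l + m + 1 = b) (h : 0 ≤ a) :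
    aPlus q N l m =
      -(q ^ m * q ^ l * q ^ (1 / 2 : ℝ) * (sqrtNum q a * sqrtNum q b) * rPlus q N l) := by
  subst ha hb
  rw [aPlus, sqrt_qNum_mul hq0 hq1 h, Real.rpow_add hq0, Real.rpow_add hq0]

end Coefficients

/-! ### The scalar identities behind the defining relations -/

section Relations

open PodlesIdentity

/-- `|l,m⟩` is a basis vector of the representation belonging to `N`. -/
structure IsWeight (N l m : ℝ) : Prop where
  N_le : |N| ≤ l
  m_le : |m| ≤ l
  cases : l = 0 ∨ (l = 1 / 2 ∧ (N = 1 / 2 ∨ N = -(1 / 2)) ∧ (m = 1 / 2 ∨ m = -(1 / 2))) ∨ 1 ≤ l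
  add_cases : l + m = 0 ∨ 1 ≤ l + m
  sub_cases : l - m = 0 ∨ 1 ≤ l - m

theorem IsWeight.nonneg {N l m : ℝ} (h : IsWeight N l m) : 0 ≤ l := (abs_nonneg _).trans h.N_le

theorem IsWeight.eq_zero {N l m : ℝ} (h : IsWeight N l m) (hl : l = 0) : N = 0 ∧ m = 0 :=
  ⟨abs_eq_zero.mp (le_antisymm (hl ▸ h.N_le) (abs_nonneg _)),
    abs_eq_zero.mp (le_antisymm (hl ▸ h.m_le) (abs_nonneg _))⟩

variable {q : ℝ} (hq0 : 0 < q) (hq1 : q < 1) {N l m : ℝ}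
include hq0 hq1

theorem one_sub_sq_ne_zero : 1 - q ^ 2 ≠ 0 := by nlinarith

theorem pow_sub_one_ne_zero {k : ℕ} (hk : k ≠ 0) : q ^ k - 1 ≠ 0 :=
  (sub_neg.mpr (pow_lt_one₀ hq0.le hq1 hk)).ne

/-- All denominators of the rational identities are of this form; the condition on the exponent is
what singles out the smallest values of `l`. -/
theorem rpow_mul_pow_sub_one_ne_zero {k : ℕ} (h : 0 < 4 * l + k) :
    ((q ^ l) ^ 2) ^ 2 * q ^ k - 1 ≠ 0 := by
  have : ((q ^ l) ^ 2) ^ 2 * q ^ k = q ^ (4 * l + k) := by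
    rw [← pow_mul, ← Real.rpow_natCast (q ^ l), ← Real.rpow_natCast q k, ← Real.rpow_mul hq0.le,
      ← Real.rpow_add hq0]
    congr 1
    push_cast
    ring
  rw [this]
  exact (sub_neg.mpr (Real.rpow_lt_one hq0.le hq1 h)).ne

theorem rpow_sq_sub_one_ne_zero (h : 0 < l) : ((q ^ l) ^ 2) ^ 2 - 1 ≠ 0 := by
  have := rpow_mul_pow_sub_one_ne_zero hq0 hq1 (l := l) (k := 0) (by push_cast; linarith)
  rwa [pow_zero, mul_one] at this

omit hq1 in
theorem rpow_sub_one_sq : (q ^ l) ^ 2 = (q ^ (l - 1)) ^ 2 * q ^ 2 := by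
  rw [Real.rpow_sub hq0, Real.rpow_one]
  have := hq0.ne'
  field_simp

omit hq1 in
theorem rpow_add_one_sq : (q ^ (l + 1)) ^ 2 = (q ^ l) ^ 2 * q ^ 2 := by
  rw [Real.rpow_add hq0, Real.rpow_one, mul_pow]

omit hq1 in
theorem rpow_sq_cases (h : m = 1 / 2 ∨ m = -(1 / 2)) : (q ^ m) ^ 2 = q ∨ (q ^ m) ^ 2 = q⁻¹ := by
  rcases h with rfl | rfl
  · left
    rw [sq, ← Real.rpow_add hq0]
    norm_num
  · right
    rw [sq, ← Real.rpow_add hq0, ← Real.rpow_neg_one]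
    norm_num

omit hq0 hq1 in
theorem rpow_neg_two_mul_cases (h : N = 1 / 2 ∨ N = -(1 / 2)) :
    q ^ (-(2 * N)) = q ∨ q ^ (-(2 * N)) = q⁻¹ := by
  rcases h with rfl | rfl
  · right
    rw [← Real.rpow_neg_one]
    norm_num
  · left
    norm_num

/-- At `l = 0` both sides vanish because of a zero denominator; otherwise `l - 1 ≥ -1/2` and the
general formula applies. -/
theorem IsWeight.rPlus_pred_sq (h : IsWeight N l m) :
    rPlus q N (l - 1) ^ 2 = P q (q ^ (-(2 * N))) ((q ^ (l - 1)) ^ 2) := by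
  rcases h.cases with rfl | ⟨rfl, -, -⟩ | hl
  · rw [zero_sub, rPlus_neg_one, Real.rpow_neg_one]
    simp [P]
  · exact rPlus_sq hq0 hq1 (by norm_num) (by simpa using h.N_le)
  · exact rPlus_sq hq0 hq1 (by linarith) (by simpa using h.N_le)

theorem IsWeight.rPlus_sq (h : IsWeight N l m) :
    rPlus q N l ^ 2 = P q (q ^ (-(2 * N))) ((q ^ (l - 1)) ^ 2 * q ^ 2) := by
  rw [← rpow_sub_one_sq hq0]
  exact _root_.rPlus_sq hq0 hq1 (by linarith [h.nonneg]) (by linarith [h.N_le])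

/-- Normal form of `[l+m+k]`. -/
theorem IsWeight.sqrtNum_add {k K t : ℝ} (hK : q ^ k = K) (ht : t = l + m + k) (h0 : 0 ≤ t) :
    q ^ l * q ^ m * sqrtNum q t ^ 2 = ((q ^ l) ^ 2 * (q ^ m) ^ 2 * K - K⁻¹) / (q - q⁻¹) :=
  sqrtNum_sq_add hq0 hq1 (by rw [ht, ← hK, Real.rpow_add hq0, Real.rpow_add hq0]) h0

/-- Normal form of `[l-m+k]`. -/
theorem IsWeight.sqrtNum_sub {k K t : ℝ} (hK : q ^ k = K) (ht : t = l - m + k) (h0 : 0 ≤ t) :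
    q ^ l * q ^ m * sqrtNum q t ^ 2 = ((q ^ l) ^ 2 * K - (q ^ m) ^ 2 * K⁻¹) / (q - q⁻¹) :=
  sqrtNum_sq_sub hq0 hq1 (by
    rw [ht, ← hK, ← Real.rpow_add hq0, ← Real.rpow_add hq0]; congr 1; ring) h0

/-! The relation `A B = q² B A`. -/

/-- The suffix is the change of `l`. At the extreme changes `±2` a single path contributes to each
side, so monomials with the same square roots are compared. -/
theorem IsWeight.AB_two (h : IsWeight N l m) :
    aPlus q N (l + 1) (m + 1) * bPlus q N l m = q ^ 2 * (bPlus q N (l + 1) m * aPlus q N l m) := by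
  obtain ⟨h1, h2⟩ := abs_le.mp h.m_le
  rw [aPlus_eq hq0 hq1 (l := l + 1) (m := m + 1) (a := l - m + 1) (b := l + m + 3) (by ring)
      (by ring) (by linarith),
    bPlus_eq hq0 hq1 (a := l + m + 1) (b := l + m + 2) (by ring) (by ring) (by linarith),
    bPlus_eq hq0 hq1 (l := l + 1) (a := l + m + 2) (b := l + m + 3) (by ring) (by ring)
      (by linarith),
    aPlus_eq hq0 hq1 (a := l - m + 1) (b := l + m + 1) (by ring) (by ring) (by linarith)]
  simp only [Real.rpow_add hq0, Real.rpow_one]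
  ring

/-- The hypothesis says that the target label `(l - 2, m + 1)` satisfies `m + 1 ≤ l - 2`. -/
theorem IsWeight.AB_neg_two (h2 : 0 ≤ l - m - 3) :
    aPlus q N (l - 2) (m + 1) * bMinus q N l m =
      q ^ 2 * (bMinus q N (l - 1) m * aPlus q N (l - 1) m) := by
  rw [aPlus_eq hq0 hq1 (l := l - 2) (m := m + 1) (a := l - m - 2) (b := l + m) (by ring)
      (by ring) (by linarith),
    bMinus_eq hq0 hq1 (a := l - m) (b := l - m - 1) (k := l - 1) (by ring) (by ring) (by ring)
      (by linarith),
    bMinus_eq hq0 hq1 (l := l - 1) (a := l - m - 1) (b := l - m - 2) (k := l - 2) (by ring)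
      (by ring) (by ring) (by linarith),
    aPlus_eq hq0 hq1 (l := l - 1) (a := l - m) (b := l + m) (by ring) (by ring) (by linarith)]
  have e : q ^ (2 : ℝ) = q ^ 2 := by norm_num
  simp only [Real.rpow_add hq0, Real.rpow_sub hq0, Real.rpow_one, e]
  have := hq0.ne'
  field_simp

theorem IsWeight.AB_one (h : IsWeight N l m) :
    aPlus q N l (m + 1) * bZero q N l m + aZero q N (l + 1) (m + 1) * bPlus q N l m =
      q ^ 2 * (bZero q N (l + 1) m * aPlus q N l m + bPlus q N l m * aZero q N l m) := by
  obtain ⟨h1, h2⟩ := abs_le.mp h.m_le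
  -- The rational identity left after dividing by the common square roots and `r⁺(l)`. At `l = 0`
  -- the general version has a zero denominator and the special one takes over.
  have key : α q (R q (q ^ (-(2 * N))) ((q ^ l) ^ 2 * q ^ 2)) ((q ^ l) ^ 2 * q ^ 2)
        ((q ^ m) ^ 2 * q ^ 2) -
      q ^ 2 * α q (R q (q ^ (-(2 * N))) ((q ^ l) ^ 2)) ((q ^ l) ^ 2) ((q ^ m) ^ 2) =
      (q * ((q ^ l) ^ 2 - (q ^ m) ^ 2) * R q (q ^ (-(2 * N))) ((q ^ l) ^ 2) -
        q ^ 2 * ((q ^ l) ^ 2 * q - (q ^ m) ^ 2 * q⁻¹) *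
          R q (q ^ (-(2 * N))) ((q ^ l) ^ 2 * q ^ 2)) / (q - q⁻¹) := by
    have ha := one_sub_sq_ne_zero hq0 hq1
    have hx := (Real.rpow_pos_of_pos hq0 l).ne'
    rcases h.nonneg.eq_or_lt' with hl | hl
    · obtain ⟨rfl, rfl⟩ := h.eq_zero hl
      exact AB_one_null hq0.ne' ha (by positivity) (pow_sub_one_ne_zero hq0 hq1 (by norm_num))
        (pow_sub_one_ne_zero hq0 hq1 (by norm_num)) (by simp [hl]) (by simp) (by simp)
    · exact PodlesIdentity.AB_one hq0.ne' ha (by positivity) (by positivity)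
        (rpow_sq_sub_one_ne_zero hq0 hq1 hl)
        (rpow_mul_pow_sub_one_ne_zero hq0 hq1 (by push_cast; linarith))
        (rpow_mul_pow_sub_one_ne_zero hq0 hq1 (by push_cast; linarith))
  have t0 := sqrtNum_sub hq0 hq1 (l := l) (m := m) (k := 0) (K := 1) (Real.rpow_zero q)
    (t := l - m) (by ring) (by linarith)
  have t1 := sqrtNum_sub hq0 hq1 (l := l) (m := m) (k := 1) (K := q) (Real.rpow_one q)
    (t := l - m + 1) (by ring) (by linarith)
  rw [aPlus_eq hq0 hq1 (m := m + 1) (a := l - m) (b := l + m + 2) (by ring)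
      (by ring) (by linarith),
    bZero_eq hq0 hq1 (a := l + m + 1) (b := l - m) (by ring) (by ring) (by linarith),
    bPlus_eq hq0 hq1 (a := l + m + 1) (b := l + m + 2) (by ring) (by ring) (by linarith),
    bZero_eq hq0 hq1 (l := l + 1) (a := l + m + 2) (b := l - m + 1) (by ring) (by ring)
      (by linarith),
    aPlus_eq hq0 hq1 (a := l - m + 1) (b := l + m + 1) (by ring) (by ring) (by linarith),
    aZero_eq hq0 hq1, aZero_eq hq0 hq1, rpow_add_one_sq hq0, rpow_add_one_sq hq0]
  rw [← rpow_half_mul_rZero hq0, ← rpow_add_one_sq hq0, ← rpow_half_mul_rZero hq0] at key ⊢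
  simp only [Real.rpow_add hq0, Real.rpow_one] at key ⊢
  generalize α q _ _ _ = a0 at *
  generalize α q _ _ _ = a1 at *
  -- `t0` and `t1` replace the squared roots of `[l - m]` and `[l - m + 1]` by their normal forms,
  -- which turns `key` into the goal.
  linear_combination (sqrtNum q (l + m + 1) * sqrtNum q (l + m + 2) * rPlus q N l * q ^ m) * key -
    (sqrtNum q (l + m + 1) * sqrtNum q (l + m + 2) * rPlus q N l * q ^ m * q *
      (q ^ (1 / 2 : ℝ) * rZero q N l)) * t0 +
    (sqrtNum q (l + m + 1) * sqrtNum q (l + m + 2) * rPlus q N l * q ^ m * q ^ 2 *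
      (q ^ (1 / 2 : ℝ) * rZero q N (l + 1))) * t1

end Relations

section Relations

open PodlesIdentity

variable {q : ℝ} (hq0 : 0 < q) (hq1 : q < 1) {N l m : ℝ}
include hq0 hq1

/-- Stated from the target: the arrow goes from `(l + 1, m)` to `(l, m + 1)`, so the weight
condition is imposed on the lower level, and only `r⁺(l)` occurs. -/
theorem IsWeight.AB_neg_one (h : IsWeight N l (m + 1)) :
    aZero q N l (m + 1) * bMinus q N (l + 1) m + aPlus q N l (m + 1) * bZero q N (l + 1) m =
      q ^ 2 * (bMinus q N (l + 1) m * aZero q N (l + 1) m + bZero q N l m * aPlus q N l m) := by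
  obtain ⟨h1, h2⟩ := abs_le.mp h.m_le
  have key : α q (R q (q ^ (-(2 * N))) ((q ^ l) ^ 2)) ((q ^ l) ^ 2) ((q ^ m) ^ 2 * q ^ 2) +
      ((q ^ m) ^ 2 * q - ((q ^ l) ^ 2 * q ^ 2)⁻¹ * q⁻¹) / (q - q⁻¹) *
        R q (q ^ (-(2 * N))) ((q ^ l) ^ 2 * q ^ 2) =
      q ^ 2 * (q⁻¹ * (((q ^ m) ^ 2 - ((q ^ l) ^ 2 * q ^ 2)⁻¹) / (q - q⁻¹)) *
          R q (q ^ (-(2 * N))) ((q ^ l) ^ 2) +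
        α q (R q (q ^ (-(2 * N))) ((q ^ l) ^ 2 * q ^ 2)) ((q ^ l) ^ 2 * q ^ 2) ((q ^ m) ^ 2)) := by
    have ha := one_sub_sq_ne_zero hq0 hq1
    have hx := (Real.rpow_pos_of_pos hq0 l).ne'
    rcases h.nonneg.eq_or_lt' with hl | hl
    · obtain ⟨rfl, hm⟩ := h.eq_zero hl
      refine AB_neg_one_null hq0.ne' ha (by positivity)
        (pow_sub_one_ne_zero hq0 hq1 (by norm_num)) (pow_sub_one_ne_zero hq0 hq1 (by norm_num))
        (by simp [hl]) (by simp) ?_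
      rw [show m = -1 by linarith, Real.rpow_neg_one, inv_pow]
    · exact PodlesIdentity.AB_neg_one hq0.ne' ha (by positivity) (by positivity)
        (rpow_sq_sub_one_ne_zero hq0 hq1 hl)
        (rpow_mul_pow_sub_one_ne_zero hq0 hq1 (by push_cast; linarith))
        (rpow_mul_pow_sub_one_ne_zero hq0 hq1 (by push_cast; linarith))
  have s1 := sqrtNum_add hq0 hq1 (l := l) (m := m) (k := 1) (K := q) (Real.rpow_one q)
    (t := l + m + 1) (by ring) (by linarith)
  have s2 := sqrtNum_add hq0 hq1 (l := l) (m := m) (k := 2) (K := q ^ 2) (by norm_num)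
    (t := l + m + 2) (by ring) (by linarith)
  rw [aPlus_eq hq0 hq1 (m := m + 1) (a := l - m) (b := l + m + 2) (by ring)
      (by ring) (by linarith),
    bMinus_eq hq0 hq1 (l := l + 1) (a := l - m + 1) (b := l - m) (k := l) (by ring) (by ring)
      (by ring) (by linarith),
    bZero_eq hq0 hq1 (l := l + 1) (a := l + m + 2) (b := l - m + 1) (by ring) (by ring)
      (by linarith),
    bZero_eq hq0 hq1 (a := l + m + 1) (b := l - m) (by ring) (by ring) (by linarith),
    aPlus_eq hq0 hq1 (a := l - m + 1) (b := l + m + 1) (by ring) (by ring) (by linarith),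
    aZero_eq hq0 hq1, aZero_eq hq0 hq1, rpow_add_one_sq hq0, rpow_add_one_sq hq0]
  rw [← rpow_half_mul_rZero hq0, ← rpow_add_one_sq hq0 (l := l), ← rpow_half_mul_rZero hq0] at key ⊢
  have hx : (q ^ (l + 1)) ^ 2 * ((q ^ (l + 1)) ^ 2)⁻¹ = 1 := mul_inv_cancel₀
    (pow_ne_zero _ (Real.rpow_pos_of_pos hq0 _).ne')
  have hqi : q * q⁻¹ = 1 := mul_inv_cancel₀ hq0.ne'
  rw [rpow_add_one_sq hq0 (l := l)] at key hx ⊢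
  simp only [Real.rpow_add hq0, Real.rpow_one] at key ⊢
  generalize ((q ^ l) ^ 2 * q ^ 2)⁻¹ = w at *
  generalize α q _ _ _ = a0 at *
  generalize α q _ _ _ = a1 at *
  generalize q ^ (1 / 2 : ℝ) = h at *
  simp only [div_eq_mul_inv] at *
  generalize (q - q⁻¹)⁻¹ = d at *
  rw [← inv_pow] at s2
  generalize q⁻¹ = p at *
  generalize sqrtNum q (l - m + 1) = T1 at *
  generalize sqrtNum q (l - m) = T0 at *
  generalize rPlus q N l = ρ at *
  linear_combination (-(q ^ m * T1 * T0 * ρ * (q ^ l) ^ 2 * q ^ 2)) * key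
    - q ^ m * T1 * T0 * ρ * q * (h * rZero q N (l + 1)) * s2 + q ^ m * T1 * T0 * ρ * q ^ 2 * (h *
      rZero q N l) * s1
    - q ^ m * T1 * T0 * ρ * p * d * (h * rZero q N (l + 1)) * (hx - hqi)
    + q ^ m * T1 * T0 * ρ * q ^ 2 * p * d * (h * rZero q N l) * hx
    - q ^ m * T1 * T0 * ρ * q ^ 3 * (q ^ l) ^ 2 * (q ^ m) ^ 2 * d * (h * rZero q N l) * hqi

theorem IsWeight.AB_zero (h : IsWeight N l m) (hm : m + 1 ≤ l) :
    aPlus q N (l - 1) (m + 1) * bMinus q N l m + aZero q N l (m + 1) * bZero q N l m +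
        aPlus q N l (m + 1) * bPlus q N l m =
      q ^ 2 * (bMinus q N (l + 1) m * aPlus q N l m + bZero q N l m * aZero q N l m +
        bPlus q N (l - 1) m * aPlus q N (l - 1) m) := by
  obtain ⟨h1, h2⟩ := abs_le.mp h.m_le
  have key := PodlesIdentity.AB_zero (q := q) (C := q ^ (-(2 * N))) (u := (q ^ (l - 1)) ^ 2)
    (Y := (q ^ m) ^ 2) hq0.ne' (one_sub_sq_ne_zero hq0 hq1) (by positivity)
    (by have := Real.rpow_pos_of_pos hq0 (l - 1); positivity) (Real.rpow_pos_of_pos hq0 _).ne'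
  have key : -(q ^ 2 * (((q ^ (l - 1)) ^ 2 * q ^ 2 * (q ^ m) ^ 2 * q ^ 2 - (q ^ 2)⁻¹) / (q - q⁻¹)) *
        P q (q ^ (-(2 * N))) ((q ^ (l - 1)) ^ 2 * q ^ 2)) +
      R q (q ^ (-(2 * N))) ((q ^ (l - 1)) ^ 2 * q ^ 2) *
        α q (R q (q ^ (-(2 * N))) ((q ^ (l - 1)) ^ 2 * q ^ 2)) ((q ^ (l - 1)) ^ 2 * q ^ 2)
          ((q ^ m) ^ 2 * q ^ 2) +
      (q ^ (l - 1)) ^ 2 * q ^ 2 * q * (((q ^ (l - 1)) ^ 2 * q ^ 2 * q⁻¹ - (q ^ m) ^ 2 * q) /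
        (q - q⁻¹)) * P q (q ^ (-(2 * N))) ((q ^ (l - 1)) ^ 2) =
    q ^ 2 * (q ^ 3 * ((q ^ (l - 1)) ^ 2 * q ^ 2) * (((q ^ (l - 1)) ^ 2 * q ^ 2 * q -
        (q ^ m) ^ 2 * q⁻¹) / (q - q⁻¹)) * P q (q ^ (-(2 * N))) ((q ^ (l - 1)) ^ 2 * q ^ 2) +
      α q (R q (q ^ (-(2 * N))) ((q ^ (l - 1)) ^ 2 * q ^ 2)) ((q ^ (l - 1)) ^ 2 * q ^ 2)
        ((q ^ m) ^ 2) * R q (q ^ (-(2 * N))) ((q ^ (l - 1)) ^ 2 * q ^ 2) -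
      ((q ^ (l - 1)) ^ 2 * q ^ 2 * (q ^ m) ^ 2 - 1) / (q - q⁻¹) *
        P q (q ^ (-(2 * N))) ((q ^ (l - 1)) ^ 2)) := by
    -- The condition `m + 1 ≤ l` excludes `l = 0` and forces `m = -1/2` at `l = 1/2`.
    rcases h.cases with rfl | ⟨hl, hN, hm'⟩ | hl
    · linarith
    · have hm'' : m = -(1 / 2) := hm'.resolve_left (by linarith)
      refine AB_zero_half hq0.ne' (by positivity) (pow_sub_one_ne_zero hq0 hq1 (by norm_num))
        (pow_sub_one_ne_zero hq0 hq1 (by norm_num)) (pow_sub_one_ne_zero hq0 hq1 (by norm_num))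
        (pow_sub_one_ne_zero hq0 hq1 (by norm_num)) ?_ (rpow_neg_two_mul_cases hN) ?_
      · rw [hl, sq, ← Real.rpow_add hq0, ← Real.rpow_neg_one]; norm_num
      · rw [hm'', sq, ← Real.rpow_add hq0, ← Real.rpow_neg_one]; norm_num
    · apply key <;> exact rpow_mul_pow_sub_one_ne_zero hq0 hq1 (by push_cast; linarith)
  rw [← h.rPlus_sq hq0 hq1, ← h.rPlus_pred_sq hq0 hq1] at key
  have s0 := sqrtNum_add hq0 hq1 (l := l) (m := m) (k := 0) (K := 1) (Real.rpow_zero q)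
    (t := l + m) (by ring) (by linarith)
  have s2 := sqrtNum_add hq0 hq1 (l := l) (m := m) (k := 2) (K := q ^ 2) (by norm_num)
    (t := l + m + 2) (by ring) (by linarith)
  have t1 := sqrtNum_sub hq0 hq1 (l := l) (m := m) (k := 1) (K := q) (Real.rpow_one q)
    (t := l - m + 1) (by ring) (by linarith)
  have tm := sqrtNum_sub hq0 hq1 (l := l) (m := m) (k := -1) (K := q⁻¹) (Real.rpow_neg_one q)
    (t := l - m - 1) (by ring) (by linarith)
  rw [aPlus_eq hq0 hq1 (l := l - 1) (m := m + 1) (a := l - m - 1) (b := l + m + 1) (by ring)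
      (by ring) (by linarith),
    bMinus_eq hq0 hq1 (a := l - m) (b := l - m - 1) (k := l - 1) (by ring) (by ring)
      (by ring) (by linarith),
    bZero_eq hq0 hq1 (a := l + m + 1) (b := l - m) (by ring) (by ring) (by linarith),
    aPlus_eq hq0 hq1 (m := m + 1) (a := l - m) (b := l + m + 2) (by ring)
      (by ring) (by linarith),
    bPlus_eq hq0 hq1 (a := l + m + 1) (b := l + m + 2) (by ring) (by ring) (by linarith),
    bMinus_eq hq0 hq1 (l := l + 1) (a := l - m + 1) (b := l - m) (k := l) (by ring) (by ring)
      (by ring) (by linarith),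
    aPlus_eq hq0 hq1 (a := l - m + 1) (b := l + m + 1) (by ring) (by ring) (by linarith),
    bPlus_eq hq0 hq1 (l := l - 1) (a := l + m) (b := l + m + 1) (by ring) (by ring) (by linarith),
    aPlus_eq hq0 hq1 (l := l - 1) (a := l - m) (b := l + m) (by ring) (by ring) (by linarith),
    aZero_eq hq0 hq1, aZero_eq hq0 hq1]
  have e : q ^ (m + 1) * q ^ (l - 1) = q ^ m * q ^ l := by
    rw [← Real.rpow_add hq0, ← Real.rpow_add hq0]; congr 1; ring
  rw [e]
  rw [← rpow_sub_one_sq hq0, ← rpow_half_mul_rZero hq0] at key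
  rw [← rpow_half_mul_rZero hq0, rpow_add_one_sq hq0 (l := l)]
  have hh := rpow_half_sq hq0
  have hqi : q * q⁻¹ = 1 := mul_inv_cancel₀ hq0.ne'
  have hh0 : q ^ (1 / 2 : ℝ) ≠ 0 := (Real.rpow_pos_of_pos hq0 _).ne'
  have e2 : q ^ (l - 1) = q ^ l * q⁻¹ := by rw [Real.rpow_sub hq0, Real.rpow_one]; rfl
  have e3 : (q ^ (m + 1)) ^ 2 = (q ^ m) ^ 2 * q ^ 2 := by
    rw [Real.rpow_add hq0, Real.rpow_one, mul_pow]
  rw [e2, e3]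
  have e4 : q ^ (m + 1) = q ^ m * q := by rw [Real.rpow_add hq0, Real.rpow_one]
  rw [e4]
  generalize α q _ _ _ = a0 at *
  generalize α q _ _ _ = a1 at *
  generalize q ^ (1 / 2 : ℝ) = g at *
  simp only [div_eq_mul_inv] at *
  generalize (q - q⁻¹)⁻¹ = d at *
  -- The extra factor `q^{1/2}` turns `r⁰` into the rational function of the identity.
  apply mul_left_cancel₀ hh0
  generalize hk : q ^ m * sqrtNum q (l + m + 1) * sqrtNum q (l - m) = k
  generalize rPlus q N (l - 1) = ρ' at *
  generalize rPlus q N l = ρ at *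
  rw [inv_inv] at tm
  simp only [inv_one, mul_one] at s0
  generalize q⁻¹ = p at *
  generalize q ^ l = x at *
  generalize q ^ m = y at *
  generalize sqrtNum q (l + m + 1) = S1 at *
  generalize sqrtNum q (l - m) = T0 at *
  generalize sqrtNum q (l + m) = S0 at *
  generalize sqrtNum q (l + m + 2) = S2 at *
  generalize sqrtNum q (l - m + 1) = T1 at *
  generalize sqrtNum q (l - m - 1) = Tm at *
  subst hk
  linear_combination (y * S1 * T0) * key + (y * S1 * T0) * (x ^ 2 * q * ρ' ^ 2 * tm -
    q ^ 2 * ρ ^ 2 * s2 - q ^ 2 * x ^ 2 * q ^ 3 * ρ ^ 2 * t1 + q ^ 2 * ρ' ^ 2 * s0) +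
    (y * S1 * T0) * (y * x * x ^ 2 * Tm ^ 2 * ρ' ^ 2 - y * x * q * S2 ^ 2 * ρ ^ 2 -
      q ^ 2 * y * x * x ^ 2 * q ^ 2 * T1 ^ 2 * ρ ^ 2 + q ^ 2 * y * x * p * S0 ^ 2 * ρ' ^ 2) * hh +
    (y * S1 * T0) * q ^ 2 * y * x * ρ' ^ 2 * S0 ^ 2 * hqi

end Relations

section Relations

open PodlesIdentity

variable {q : ℝ} (hq0 : 0 < q) (hq1 : q < 1) {N l m : ℝ}
include hq0 hq1

/-! The relation `B B* = q⁻² A (1 - A)`. -/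

theorem IsWeight.BBstar_two (h : IsWeight N l m) :
    bPlus q N (l + 1) (m - 1) * bMinus q N (l + 1) (m - 1) =
      -((q ^ 2)⁻¹ * (aPlus q N (l + 1) m * aPlus q N l m)) := by
  obtain ⟨h1, h2⟩ := abs_le.mp h.m_le
  rw [bPlus_eq hq0 hq1 (l := l + 1) (m := m - 1) (a := l + m + 1) (b := l + m + 2) (by ring)
      (by ring) (by linarith),
    bMinus_eq hq0 hq1 (l := l + 1) (m := m - 1) (a := l - m + 2) (b := l - m + 1) (k := l)
      (by ring) (by ring) (by ring) (by linarith),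
    aPlus_eq hq0 hq1 (l := l + 1) (a := l - m + 2) (b := l + m + 2) (by ring) (by ring)
      (by linarith),
    aPlus_eq hq0 hq1 (a := l - m + 1) (b := l + m + 1) (by ring) (by ring) (by linarith),
    rpow_add_one_sq hq0]
  have hh := rpow_half_sq hq0
  simp only [Real.rpow_add hq0, Real.rpow_sub hq0, Real.rpow_one, ← inv_pow]
  linear_combination (q⁻¹ ^ 2 * q * (q ^ m) ^ 2 * (q ^ l) ^ 2 * sqrtNum q (l - m + 2) *
    sqrtNum q (l - m + 1) * sqrtNum q (l + m + 2) * sqrtNum q (l + m + 1) * rPlus q N l *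
    rPlus q N (l + 1)) * hh

theorem IsWeight.BBstar_one (h : IsWeight N l m) :
    bZero q N (l + 1) (m - 1) * bMinus q N (l + 1) (m - 1) +
        bPlus q N l (m - 1) * bZero q N l (m - 1) =
      (q ^ 2)⁻¹ * (aPlus q N l m - aPlus q N l m * (aZero q N l m + aZero q N (l + 1) m)) := by
  obtain ⟨h1, h2⟩ := abs_le.mp h.m_le
  have key : -(((q ^ l) ^ 2 * q ^ 2 - (q ^ m) ^ 2 * (q ^ 2)⁻¹) / (q - q⁻¹) *
        R q (q ^ (-(2 * N))) ((q ^ l) ^ 2 * q ^ 2)) +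
      ((q ^ l) ^ 2)⁻¹ * (q ^ 2)⁻¹ * (((q ^ l) ^ 2 * (q ^ m) ^ 2 - 1) / (q - q⁻¹)) *
        R q (q ^ (-(2 * N))) ((q ^ l) ^ 2) =
      -(q⁻¹ * (1 - α q (R q (q ^ (-(2 * N))) ((q ^ l) ^ 2)) ((q ^ l) ^ 2) ((q ^ m) ^ 2) -
        α q (R q (q ^ (-(2 * N))) ((q ^ l) ^ 2 * q ^ 2)) ((q ^ l) ^ 2 * q ^ 2) ((q ^ m) ^ 2))) := by
    have ha := one_sub_sq_ne_zero hq0 hq1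
    have hx := (Real.rpow_pos_of_pos hq0 l).ne'
    rcases h.nonneg.eq_or_lt' with hl | hl
    · obtain ⟨rfl, rfl⟩ := h.eq_zero hl
      exact BBstar_one_null hq0.ne' ha (by positivity)
        (pow_sub_one_ne_zero hq0 hq1 (by norm_num))
        (pow_sub_one_ne_zero hq0 hq1 (by norm_num)) (by simp [hl]) (by simp) (by simp)
    · exact PodlesIdentity.BBstar_one hq0.ne' ha (by positivity) (by positivity)
        (rpow_sq_sub_one_ne_zero hq0 hq1 hl)
        (rpow_mul_pow_sub_one_ne_zero hq0 hq1 (by push_cast; linarith))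
        (rpow_mul_pow_sub_one_ne_zero hq0 hq1 (by push_cast; linarith))
  have s0 := sqrtNum_add hq0 hq1 (l := l) (m := m) (k := 0) (K := 1) (Real.rpow_zero q)
    (t := l + m) (by ring) (by linarith)
  have t2 := sqrtNum_sub hq0 hq1 (l := l) (m := m) (k := 2) (K := q ^ 2) (by norm_num)
    (t := l - m + 2) (by ring) (by linarith)
  rw [bZero_eq hq0 hq1 (l := l + 1) (m := m - 1) (a := l + m + 1) (b := l - m + 2) (by ring)
      (by ring) (by linarith),
    bMinus_eq hq0 hq1 (l := l + 1) (m := m - 1) (a := l - m + 2) (b := l - m + 1) (k := l)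
      (by ring) (by ring) (by ring) (by linarith),
    bPlus_eq hq0 hq1 (m := m - 1) (a := l + m) (b := l + m + 1) (by ring) (by ring) (by linarith),
    bZero_eq hq0 hq1 (m := m - 1) (a := l + m) (b := l - m + 1) (by ring) (by ring) (by linarith),
    aPlus_eq hq0 hq1 (a := l - m + 1) (b := l + m + 1) (by ring) (by ring) (by linarith),
    aZero_eq hq0 hq1, aZero_eq hq0 hq1, rpow_add_one_sq hq0]
  rw [← rpow_half_mul_rZero hq0, ← rpow_add_one_sq hq0 (l := l), ← rpow_half_mul_rZero hq0]
    at key ⊢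
  rw [rpow_add_one_sq hq0 (l := l)] at key ⊢
  have hh := rpow_half_sq hq0
  have hx : q ^ l ≠ 0 := (Real.rpow_pos_of_pos hq0 _).ne'
  have hh0 : q ^ (1 / 2 : ℝ) ≠ 0 := (Real.rpow_pos_of_pos hq0 _).ne'
  have h3 : ((q ^ l) ^ 2)⁻¹ * (q ^ l) ^ 2 * q⁻¹ ^ 2 * q ^ 2 = 1 := by
    have := hq0.ne'
    field_simp
  have hqi : q * q⁻¹ = 1 := mul_inv_cancel₀ hq0.ne'
  have e2 : q ^ (m - 1) = q ^ m * q⁻¹ := by rw [Real.rpow_sub hq0, Real.rpow_one]; rfl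
  rw [e2]
  apply mul_left_cancel₀ (mul_ne_zero hh0 hx)
  generalize α q _ _ _ = a0 at *
  generalize α q _ _ _ = a1 at *
  generalize q ^ (1 / 2 : ℝ) = g at *
  simp only [div_eq_mul_inv] at *
  generalize (q - q⁻¹)⁻¹ = d at *
  simp only [inv_one, mul_one] at s0
  rw [← inv_pow q] at key t2 ⊢
  generalize ((q ^ l) ^ 2)⁻¹ = w at *
  generalize q⁻¹ = p at *
  generalize q ^ l = x at *
  generalize q ^ m = y at *
  generalize rPlus q N l = ρ at *
  generalize sqrtNum q (l + m + 1) = S1 at *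
  generalize sqrtNum q (l - m + 1) = T1 at *
  linear_combination (y * p ^ 2 * S1 * T1 * ρ) * (x ^ 2 * q ^ 2 * key -
      (x ^ 2 * y ^ 2 - 1) * d * (g * rZero q N l) * h3 - x ^ 2 * q * (1 - a0 - a1) * hqi -
      x ^ 2 * q ^ 2 * (g * rZero q N (l + 1)) * t2 + g * rZero q N l * s0 +
      x ^ 2 * (1 - a0 - a1) * hh)

/-! The relation `B* B = A (1 - q² A)`. -/

theorem IsWeight.BstarB_two (h : IsWeight N l m) :
    bPlus q N l m * bMinus q N (l + 2) m =
      -(q ^ 2 * (aPlus q N (l + 1) m * aPlus q N l m)) := by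
  obtain ⟨h1, h2⟩ := abs_le.mp h.m_le
  rw [bPlus_eq hq0 hq1 (a := l + m + 1) (b := l + m + 2) (by ring) (by ring) (by linarith),
    bMinus_eq hq0 hq1 (l := l + 2) (a := l - m + 2) (b := l - m + 1) (k := l + 1)
      (by ring) (by ring) (by ring) (by linarith),
    aPlus_eq hq0 hq1 (l := l + 1) (a := l - m + 2) (b := l + m + 2) (by ring) (by ring)
      (by linarith),
    aPlus_eq hq0 hq1 (a := l - m + 1) (b := l + m + 1) (by ring) (by ring) (by linarith)]
  have hh := rpow_half_sq hq0
  have e : q ^ (2 : ℝ) = q ^ 2 := by norm_num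
  simp only [Real.rpow_add hq0, Real.rpow_one, e]
  linear_combination (q ^ 2 * q * (q ^ m) ^ 2 * (q ^ l) ^ 2 * sqrtNum q (l - m + 2) *
    sqrtNum q (l - m + 1) * sqrtNum q (l + m + 2) * sqrtNum q (l + m + 1) * rPlus q N l *
    rPlus q N (l + 1)) * hh

theorem IsWeight.BstarB_one (h : IsWeight N l m) :
    bPlus q N l m * bZero q N (l + 1) m + bZero q N l m * bMinus q N (l + 1) m =
      aPlus q N l m - q ^ 2 * (aPlus q N l m * (aZero q N l m + aZero q N (l + 1) m)) := by
  obtain ⟨h1, h2⟩ := abs_le.mp h.m_le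
  have key : ((q ^ l) ^ 2 * (q ^ m) ^ 2 * q ^ 2 - (q ^ 2)⁻¹) / (q - q⁻¹) *
        R q (q ^ (-(2 * N))) ((q ^ l) ^ 2 * q ^ 2) -
      ((q ^ l) ^ 2 - (q ^ m) ^ 2) / (q - q⁻¹) * (q ^ l) ^ 2 * q ^ 2 *
        R q (q ^ (-(2 * N))) ((q ^ l) ^ 2) =
      -((q ^ l) ^ 2 * q * (1 - q ^ 2 *
        (α q (R q (q ^ (-(2 * N))) ((q ^ l) ^ 2)) ((q ^ l) ^ 2) ((q ^ m) ^ 2) +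
        α q (R q (q ^ (-(2 * N))) ((q ^ l) ^ 2 * q ^ 2)) ((q ^ l) ^ 2 * q ^ 2)
          ((q ^ m) ^ 2)))) := by
    have ha := one_sub_sq_ne_zero hq0 hq1
    have hx := (Real.rpow_pos_of_pos hq0 l).ne'
    rcases h.nonneg.eq_or_lt' with hl | hl
    · obtain ⟨rfl, rfl⟩ := h.eq_zero hl
      exact BstarB_one_null hq0.ne' ha (by positivity)
        (pow_sub_one_ne_zero hq0 hq1 (by norm_num))
        (pow_sub_one_ne_zero hq0 hq1 (by norm_num)) (by simp [hl]) (by simp) (by simp)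
    · exact PodlesIdentity.BstarB_one hq0.ne' ha (by positivity) (by positivity)
        (rpow_sq_sub_one_ne_zero hq0 hq1 hl)
        (rpow_mul_pow_sub_one_ne_zero hq0 hq1 (by push_cast; linarith))
        (rpow_mul_pow_sub_one_ne_zero hq0 hq1 (by push_cast; linarith))
  have t0 := sqrtNum_sub hq0 hq1 (l := l) (m := m) (k := 0) (K := 1) (Real.rpow_zero q)
    (t := l - m) (by ring) (by linarith)
  have s2 := sqrtNum_add hq0 hq1 (l := l) (m := m) (k := 2) (K := q ^ 2) (by norm_num)
    (t := l + m + 2) (by ring) (by linarith)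
  rw [bPlus_eq hq0 hq1 (a := l + m + 1) (b := l + m + 2) (by ring) (by ring) (by linarith),
    bZero_eq hq0 hq1 (l := l + 1) (a := l + m + 2) (b := l - m + 1) (by ring)
      (by ring) (by linarith),
    bZero_eq hq0 hq1 (a := l + m + 1) (b := l - m) (by ring) (by ring) (by linarith),
    bMinus_eq hq0 hq1 (l := l + 1) (a := l - m + 1) (b := l - m) (k := l)
      (by ring) (by ring) (by ring) (by linarith),
    aPlus_eq hq0 hq1 (a := l - m + 1) (b := l + m + 1) (by ring) (by ring) (by linarith),
    aZero_eq hq0 hq1, aZero_eq hq0 hq1, rpow_add_one_sq hq0]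
  rw [← rpow_half_mul_rZero hq0, ← rpow_add_one_sq hq0 (l := l), ← rpow_half_mul_rZero hq0]
    at key ⊢
  rw [rpow_add_one_sq hq0 (l := l)] at key ⊢
  have hh := rpow_half_sq hq0
  have hx : q ^ l ≠ 0 := (Real.rpow_pos_of_pos hq0 _).ne'
  have hh0 : q ^ (1 / 2 : ℝ) ≠ 0 := (Real.rpow_pos_of_pos hq0 _).ne'
  apply mul_left_cancel₀ (mul_ne_zero hh0 hx)
  generalize α q _ _ _ = a0 at *
  generalize α q _ _ _ = a1 at *
  generalize q ^ (1 / 2 : ℝ) = g at *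
  simp only [div_eq_mul_inv] at *
  generalize (q - q⁻¹)⁻¹ = d at *
  simp only [inv_one, mul_one] at t0
  generalize q ^ l = x at *
  generalize q ^ m = y at *
  generalize rPlus q N l = ρ at *
  generalize sqrtNum q (l + m + 1) = S1 at *
  generalize sqrtNum q (l - m + 1) = T1 at *
  linear_combination (y * S1 * T1 * ρ) * (key + (g * rZero q N (l + 1)) * s2 -
      x ^ 2 * q ^ 2 * (g * rZero q N l) * t0 + x ^ 2 * (1 - q ^ 2 * (a0 + a1)) * hh)

end Relations

/-! ### Diagonal entries of `BB*` and `B*B` -/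

section Relations

open PodlesIdentity

variable {q : ℝ} (hq0 : 0 < q) (hq1 : q < 1) {N l m : ℝ}
include hq0 hq1

theorem IsWeight.BBstar_zero (h : IsWeight N l m) :
    bMinus q N (l + 1) (m - 1) ^ 2 + bZero q N l (m - 1) ^ 2 + bPlus q N (l - 1) (m - 1) ^ 2 =
      (q ^ 2)⁻¹ * (aZero q N l m -
        (aZero q N l m ^ 2 + aPlus q N l m ^ 2 + aPlus q N (l - 1) m ^ 2)) := by
  obtain ⟨h1, h2⟩ := abs_le.mp h.m_le
  have key :
    (((q ^ (l - 1)) ^ 2 * q ^ 4 - (q ^ m) ^ 2 * (q ^ 2)⁻¹) * ((q ^ (l - 1)) ^ 2 *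
      q ^ 3 - (q ^ m) ^ 2 * q⁻¹) * ((q ^ (l - 1)) ^ 2 * q ^ 2) ^ 2 * q ^ 4 * P q (q ^ (-(2 *
        N))) ((q ^ (l - 1)) ^ 2 * q ^ 2) +
      ((q ^ (l - 1)) ^ 2 * (q ^ m) ^ 2 * q ^ 2 - 1) * ((q ^ (l - 1)) ^ 2 * q ^ 3 - (q ^ m) ^ 2 *
        q⁻¹) * q⁻¹ * R q (q ^ (-(2 * N))) ((q ^ (l - 1)) ^ 2 * q ^ 2) ^ 2 +
      ((q ^ (l - 1)) ^ 2 * (q ^ m) ^ 2 * q ^ 2 - 1) * ((q ^ (l - 1)) ^ 2 * (q ^ m) ^ 2 * q - q) *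
        P q (q ^ (-(2 * N))) ((q ^ (l - 1)) ^ 2)) / ((q - q⁻¹) ^ 2 * ((q ^ (l - 1)) ^ 2 * q ^ 2)) =
      α q (R q (q ^ (-(2 * N))) ((q ^ (l - 1)) ^ 2 * q ^ 2)) ((q ^ (l - 1)) ^ 2 *
        q ^ 2) ((q ^ m) ^ 2) - α q (R q (q ^ (-(2 * N))) ((q ^ (l - 1)) ^ 2 *
          q ^ 2)) ((q ^ (l - 1)) ^ 2 * q ^ 2) ((q ^ m) ^ 2) ^ 2 -
      (q * ((q ^ (l - 1)) ^ 2 * q ^ 3 - (q ^ m) ^ 2 * q⁻¹) * ((q ^ (l - 1)) ^ 2 * (q ^ m) ^ 2 *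
        q ^ 3 - q⁻¹) * P q (q ^ (-(2 * N))) ((q ^ (l - 1)) ^ 2 * q ^ 2) + q⁻¹ *
          ((q ^ (l - 1)) ^ 2 * q ^ 2 - (q ^ m) ^ 2) * ((q ^ (l - 1)) ^ 2 * (q ^ m) ^ 2 *
            q ^ 2 - 1) * P q (q ^ (-(2 * N))) ((q ^ (l - 1)) ^ 2)) / (q - q⁻¹) ^ 2 := by
    rcases h.cases with hl | ⟨hl, hN, hm'⟩ | hl
    · obtain ⟨rfl, rfl⟩ := h.eq_zero hl
      subst hl
      refine BBstar_zero_null hq0.ne' (one_sub_sq_ne_zero hq0 hq1) (by positivity)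
        (pow_sub_one_ne_zero hq0 hq1 (by norm_num)) (pow_sub_one_ne_zero hq0 hq1 (by norm_num))
        ?_ (by simp) (by simp)
      rw [zero_sub, Real.rpow_neg_one, inv_pow]
    · refine BBstar_zero_half hq0.ne' (by positivity) (pow_sub_one_ne_zero hq0 hq1 (by norm_num))
        (pow_sub_one_ne_zero hq0 hq1 (by norm_num)) (pow_sub_one_ne_zero hq0 hq1 (by norm_num))
        (pow_sub_one_ne_zero hq0 hq1 (by norm_num)) ?_ (rpow_neg_two_mul_cases hN)
        (rpow_sq_cases hq0 hm')
      rw [hl, sq, ← Real.rpow_add hq0, ← Real.rpow_neg_one]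
      norm_num
    · apply PodlesIdentity.BBstar_zero hq0.ne' (one_sub_sq_ne_zero hq0 hq1) (by positivity)
        (pow_ne_zero _ (Real.rpow_pos_of_pos hq0 _).ne') (Real.rpow_pos_of_pos hq0 _).ne' <;>
        exact rpow_mul_pow_sub_one_ne_zero hq0 hq1 (by push_cast; linarith)
  rw [← h.rPlus_sq hq0 hq1, ← h.rPlus_pred_sq hq0 hq1] at key
  have hq := hq0.ne'
  have hd := rpow_sub_rpow_ne_zero hq0 hq1
  have s0 : (q ^ (l - 1)) ^ 2 * (q ^ m) ^ 2 * q ^ 2 - 1 = (q - q⁻¹) * (q ^ l * q ^ m *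
    sqrtNum q (l + m) ^ 2) := by
    rw [sqrtNum_add hq0 hq1 (k := 0) (K := 1) (Real.rpow_zero q) (by ring) (by linarith),
      mul_div_cancel₀ _ hd, rpow_sub_one_sq hq0 (l := l)]
    field_simp
  have s1 : (q ^ (l - 1)) ^ 2 * (q ^ m) ^ 2 * q ^ 3 - q⁻¹ = (q - q⁻¹) * (q ^ l * q ^ m *
    sqrtNum q (l + m + 1) ^ 2) := by
    rw [sqrtNum_add hq0 hq1 (k := 1) (K := q) (Real.rpow_one q) (by ring) (by linarith),
      mul_div_cancel₀ _ hd, rpow_sub_one_sq hq0 (l := l)]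
    field_simp
  have t0 : (q ^ (l - 1)) ^ 2 * q ^ 2 - (q ^ m) ^ 2 = (q - q⁻¹) * (q ^ l * q ^ m *
    sqrtNum q (l - m) ^ 2) := by
    rw [sqrtNum_sub hq0 hq1 (k := 0) (K := 1) (Real.rpow_zero q) (by ring) (by linarith),
      mul_div_cancel₀ _ hd, rpow_sub_one_sq hq0 (l := l)]
    field_simp
  have t1 : (q ^ (l - 1)) ^ 2 * q ^ 3 - (q ^ m) ^ 2 * q⁻¹ = (q - q⁻¹) * (q ^ l * q ^ m *
    sqrtNum q (l - m + 1) ^ 2) := by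
    rw [sqrtNum_sub hq0 hq1 (k := 1) (K := q) (Real.rpow_one q) (by ring) (by linarith),
      mul_div_cancel₀ _ hd, rpow_sub_one_sq hq0 (l := l)]
    field_simp
  have t2 : (q ^ (l - 1)) ^ 2 * q ^ 4 - (q ^ m) ^ 2 * (q ^ 2)⁻¹ = (q - q⁻¹) * (q ^ l * q ^ m *
    sqrtNum q (l - m + 2) ^ 2) := by
    rw [sqrtNum_sub hq0 hq1 (k := 2) (K := q ^ 2) (by norm_num) (by ring) (by linarith),
      mul_div_cancel₀ _ hd, rpow_sub_one_sq hq0 (l := l)]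
    field_simp
  -- At `l + m = 0` the number `[l + m - 1] = [-1]` is negative and `sqrtNum` truncates it to `0`;
  -- the product is still right because `[l + m]` vanishes. Hence the two factors are treated
  -- together.
  have sm : ((q ^ (l - 1)) ^ 2 * (q ^ m) ^ 2 * q ^ 2 - 1) * ((q ^ (l - 1)) ^ 2 * (q ^ m) ^ 2 *
    q - q) =
      (q - q⁻¹) ^ 2 * ((q ^ l * q ^ m * sqrtNum q (l + m) ^ 2) *
        (q ^ l * q ^ m * sqrtNum q (l + m - 1) ^ 2)) := by
    rcases h.add_cases with h0 | h0
    · rw [s0, h0, sqrtNum_zero]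
      ring
    · have e : (q ^ (l - 1)) ^ 2 * (q ^ m) ^ 2 * q - q = (q - q⁻¹) * (q ^ l * q ^ m *
      sqrtNum q (l + m - 1) ^ 2) := by
        rw [sqrtNum_add hq0 hq1 (k := -1) (K := q⁻¹) (Real.rpow_neg_one q) (by ring) (by linarith),
          mul_div_cancel₀ _ hd, rpow_sub_one_sq hq0 (l := l)]
        field_simp
      rw [s0, e]
      ring
  rw [sm, s0, s1, t0, t1, t2] at key
  rw [bMinus_eq hq0 hq1 (l := l + 1) (m := m - 1) (a := l - m + 2) (b := l - m + 1) (k := l)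
      (by ring) (by ring) (by ring) (by linarith),
    bZero_eq hq0 hq1 (m := m - 1) (a := l + m) (b := l - m + 1) (by ring) (by ring) (by linarith),
    bPlus_eq' hq0 hq1 (l := l - 1) (m := m - 1) (a := l + m - 1) (b := l + m) (by ring) (by ring)
      (by linarith),
    aPlus_eq hq0 hq1 (a := l - m + 1) (b := l + m + 1) (by ring) (by ring) (by linarith),
    aPlus_eq hq0 hq1 (l := l - 1) (a := l - m) (b := l + m) (by ring) (by ring) (by linarith),
    aZero_eq hq0 hq1, rpow_add_one_sq hq0]
  rw [← rpow_sub_one_sq hq0 (l := l), ← rpow_half_mul_rZero hq0] at key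
  rw [← rpow_half_mul_rZero hq0]
  have hh := rpow_half_sq hq0
  have hqi : q * q⁻¹ = 1 := mul_inv_cancel₀ hq0.ne'
  have hx : q ^ l ≠ 0 := (Real.rpow_pos_of_pos hq0 _).ne'
  have hy : q ^ m ≠ 0 := (Real.rpow_pos_of_pos hq0 _).ne'
  have e1 : q ^ (l - 1) = q ^ l * q⁻¹ := by rw [Real.rpow_sub hq0, Real.rpow_one]; rfl
  have e2 : q ^ (m - 1) = q ^ m * q⁻¹ := by rw [Real.rpow_sub hq0, Real.rpow_one]; rfl
  rw [e1, e2]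
  clear sm s0 s1 t0 t1 t2 e1 e2
  generalize α q _ _ _ = a0 at *
  generalize q ^ (1 / 2 : ℝ) = g at *
  generalize q ^ l = x at *
  generalize q ^ m = y at *
  generalize q - q⁻¹ = d at *
  -- Replacing `q` by `g²` removes the half-integral powers before denominators are cleared.
  have hg : q = g ^ 2 := by rw [← hh, sq]
  rw [hg] at key ⊢
  have hg0 : g ≠ 0 := by rintro rfl; simp at hg; exact hq hg
  field_simp at key ⊢
  linear_combination key

/-- The left side is the squared norm of `B|l,m⟩`. Besides verifying the relation, this identity of
sums of squares supplies the bounds for all coefficients. -/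
theorem IsWeight.BstarB_zero (h : IsWeight N l m) :
    bPlus q N l m ^ 2 + bZero q N l m ^ 2 + bMinus q N l m ^ 2 =
      aZero q N l m -
        q ^ 2 * (aZero q N l m ^ 2 + aPlus q N l m ^ 2 + aPlus q N (l - 1) m ^ 2) := by
  obtain ⟨h1, h2⟩ := abs_le.mp h.m_le
  have key :
    (((q ^ (l - 1)) ^ 2 * (q ^ m) ^ 2 * q ^ 3 - q⁻¹) * ((q ^ (l - 1)) ^ 2 * (q ^ m) ^ 2 *
      q ^ 4 - (q ^ 2)⁻¹) * P q (q ^ (-(2 * N))) ((q ^ (l - 1)) ^ 2 * q ^ 2) +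
      ((q ^ (l - 1)) ^ 2 * (q ^ m) ^ 2 * q ^ 3 - q⁻¹) * ((q ^ (l - 1)) ^ 2 *
        q ^ 2 - (q ^ m) ^ 2) * q⁻¹ * R q (q ^ (-(2 * N))) ((q ^ (l - 1)) ^ 2 * q ^ 2) ^ 2 +
      ((q ^ (l - 1)) ^ 2 * q ^ 2 - (q ^ m) ^ 2) * ((q ^ (l - 1)) ^ 2 * q - (q ^ m) ^ 2 * q) *
        ((q ^ (l - 1)) ^ 2 * q ^ 2) ^ 2 * P q (q ^ (-(2 *
          N))) ((q ^ (l - 1)) ^ 2)) / ((q - q⁻¹) ^ 2 * ((q ^ (l - 1)) ^ 2 * q ^ 2)) =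
      α q (R q (q ^ (-(2 * N))) ((q ^ (l - 1)) ^ 2 * q ^ 2)) ((q ^ (l - 1)) ^ 2 *
        q ^ 2) ((q ^ m) ^ 2) - q ^ 2 * (α q (R q (q ^ (-(2 * N))) ((q ^ (l - 1)) ^ 2 *
          q ^ 2)) ((q ^ (l - 1)) ^ 2 * q ^ 2) ((q ^ m) ^ 2) ^ 2 +
      (q * ((q ^ (l - 1)) ^ 2 * q ^ 3 - (q ^ m) ^ 2 * q⁻¹) * ((q ^ (l - 1)) ^ 2 * (q ^ m) ^ 2 *
        q ^ 3 - q⁻¹) * P q (q ^ (-(2 * N))) ((q ^ (l - 1)) ^ 2 * q ^ 2) + q⁻¹ *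
          ((q ^ (l - 1)) ^ 2 * q ^ 2 - (q ^ m) ^ 2) * ((q ^ (l - 1)) ^ 2 * (q ^ m) ^ 2 *
            q ^ 2 - 1) * P q (q ^ (-(2 * N))) ((q ^ (l - 1)) ^ 2)) / (q - q⁻¹) ^ 2) := by
    rcases h.cases with hl | ⟨hl, hN, hm'⟩ | hl
    · obtain ⟨rfl, rfl⟩ := h.eq_zero hl
      subst hl
      refine BstarB_zero_null hq0.ne' (one_sub_sq_ne_zero hq0 hq1) (by positivity)
        (pow_sub_one_ne_zero hq0 hq1 (by norm_num)) (pow_sub_one_ne_zero hq0 hq1 (by norm_num))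
        ?_ (by simp) (by simp)
      rw [zero_sub, Real.rpow_neg_one, inv_pow]
    · refine BstarB_zero_half hq0.ne' (by positivity) (pow_sub_one_ne_zero hq0 hq1 (by norm_num))
        (pow_sub_one_ne_zero hq0 hq1 (by norm_num)) (pow_sub_one_ne_zero hq0 hq1 (by norm_num))
        (pow_sub_one_ne_zero hq0 hq1 (by norm_num)) ?_ (rpow_neg_two_mul_cases hN)
        (rpow_sq_cases hq0 hm')
      rw [hl, sq, ← Real.rpow_add hq0, ← Real.rpow_neg_one]
      norm_num
    · apply PodlesIdentity.BstarB_zero hq0.ne' (one_sub_sq_ne_zero hq0 hq1) (by positivity)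
        (pow_ne_zero _ (Real.rpow_pos_of_pos hq0 _).ne') (Real.rpow_pos_of_pos hq0 _).ne' <;>
        exact rpow_mul_pow_sub_one_ne_zero hq0 hq1 (by push_cast; linarith)
  rw [← h.rPlus_sq hq0 hq1, ← h.rPlus_pred_sq hq0 hq1] at key
  have hq := hq0.ne'
  have hd := rpow_sub_rpow_ne_zero hq0 hq1
  have s0 : (q ^ (l - 1)) ^ 2 * (q ^ m) ^ 2 * q ^ 2 - 1 = (q - q⁻¹) * (q ^ l * q ^ m *
    sqrtNum q (l + m) ^ 2) := by
    rw [sqrtNum_add hq0 hq1 (k := 0) (K := 1) (Real.rpow_zero q) (by ring) (by linarith),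
      mul_div_cancel₀ _ hd, rpow_sub_one_sq hq0 (l := l)]
    field_simp
  have s1 : (q ^ (l - 1)) ^ 2 * (q ^ m) ^ 2 * q ^ 3 - q⁻¹ = (q - q⁻¹) * (q ^ l * q ^ m *
    sqrtNum q (l + m + 1) ^ 2) := by
    rw [sqrtNum_add hq0 hq1 (k := 1) (K := q) (Real.rpow_one q) (by ring) (by linarith),
      mul_div_cancel₀ _ hd, rpow_sub_one_sq hq0 (l := l)]
    field_simp
  have t0 : (q ^ (l - 1)) ^ 2 * q ^ 2 - (q ^ m) ^ 2 = (q - q⁻¹) * (q ^ l * q ^ m *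
    sqrtNum q (l - m) ^ 2) := by
    rw [sqrtNum_sub hq0 hq1 (k := 0) (K := 1) (Real.rpow_zero q) (by ring) (by linarith),
      mul_div_cancel₀ _ hd, rpow_sub_one_sq hq0 (l := l)]
    field_simp
  have t1 : (q ^ (l - 1)) ^ 2 * q ^ 3 - (q ^ m) ^ 2 * q⁻¹ = (q - q⁻¹) * (q ^ l * q ^ m *
    sqrtNum q (l - m + 1) ^ 2) := by
    rw [sqrtNum_sub hq0 hq1 (k := 1) (K := q) (Real.rpow_one q) (by ring) (by linarith),
      mul_div_cancel₀ _ hd, rpow_sub_one_sq hq0 (l := l)]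
    field_simp
  have s2 : (q ^ (l - 1)) ^ 2 * (q ^ m) ^ 2 * q ^ 4 - (q ^ 2)⁻¹ = (q - q⁻¹) * (q ^ l * q ^ m *
    sqrtNum q (l + m + 2) ^ 2) := by
    rw [sqrtNum_add hq0 hq1 (k := 2) (K := q ^ 2) (by norm_num) (by ring) (by linarith),
      mul_div_cancel₀ _ hd, rpow_sub_one_sq hq0 (l := l)]
    field_simp
  -- As for `BB*`: at `l - m = 0` the truncated root of `[l - m - 1]` is harmless only because of
  -- the factor `[l - m] = 0`.
  have tm : ((q ^ (l - 1)) ^ 2 * q ^ 2 - (q ^ m) ^ 2) * ((q ^ (l - 1)) ^ 2 * q - (q ^ m) ^ 2 * q) =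
      (q - q⁻¹) ^ 2 * ((q ^ l * q ^ m * sqrtNum q (l - m) ^ 2) *
        (q ^ l * q ^ m * sqrtNum q (l - m - 1) ^ 2)) := by
    rcases h.sub_cases with h0 | h0
    · rw [t0, h0, sqrtNum_zero]
      ring
    · have e : (q ^ (l - 1)) ^ 2 * q - (q ^ m) ^ 2 * q = (q - q⁻¹) * (q ^ l * q ^ m *
      sqrtNum q (l - m - 1) ^ 2) := by
        rw [sqrtNum_sub hq0 hq1 (k := -1) (K := q⁻¹) (Real.rpow_neg_one q) (by ring) (by linarith),
          mul_div_cancel₀ _ hd, rpow_sub_one_sq hq0 (l := l)]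
        field_simp
      rw [t0, e]
      ring
  rw [tm, s2, s0, s1, t0, t1] at key
  rw [bPlus_eq hq0 hq1 (a := l + m + 1) (b := l + m + 2) (by ring) (by ring) (by linarith),
    bZero_eq hq0 hq1 (a := l + m + 1) (b := l - m) (by ring) (by ring) (by linarith),
    bMinus_eq hq0 hq1 (a := l - m) (b := l - m - 1) (k := l - 1)
      (by ring) (by ring) (by ring) (by linarith),
    aPlus_eq hq0 hq1 (a := l - m + 1) (b := l + m + 1) (by ring) (by ring) (by linarith),
    aPlus_eq hq0 hq1 (l := l - 1) (a := l - m) (b := l + m) (by ring) (by ring) (by linarith),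
    aZero_eq hq0 hq1]
  rw [← rpow_sub_one_sq hq0 (l := l), ← rpow_half_mul_rZero hq0] at key
  rw [← rpow_half_mul_rZero hq0]
  have hh := rpow_half_sq hq0
  have hqi : q * q⁻¹ = 1 := mul_inv_cancel₀ hq0.ne'
  have hx : q ^ l ≠ 0 := (Real.rpow_pos_of_pos hq0 _).ne'
  have hy : q ^ m ≠ 0 := (Real.rpow_pos_of_pos hq0 _).ne'
  have e1 : q ^ (l - 1) = q ^ l * q⁻¹ := by rw [Real.rpow_sub hq0, Real.rpow_one]; rfl
  rw [e1]
  clear tm s0 s1 t0 t1 s2 e1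
  generalize α q _ _ _ = a0 at *
  generalize q ^ (1 / 2 : ℝ) = g at *
  generalize q ^ l = x at *
  generalize q ^ m = y at *
  generalize q - q⁻¹ = d at *
  have hg : q = g ^ 2 := by rw [← hh, sq]
  rw [hg] at key ⊢
  have hg0 : g ≠ 0 := by rintro rfl; simp at hg; exact hq hg
  field_simp at key ⊢
  linear_combination key

end Relations

/-! ### Weighted shifts -/

section WeightedShift

variable {ι D : Type}

/-- The standard orthonormal basis of `ℓ²(ι)`. -/
noncomputable def stdBasis (ι : Type) : HilbertBasis ι ℂ (lp (fun _ : ι => ℂ) 2) :=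
  ⟨LinearIsometryEquiv.refl ℂ _⟩

open scoped Classical in
theorem stdBasis_apply (i : ι) : stdBasis ι i = lp.single 2 i (1 : ℂ) := by
  have := (stdBasis ι).repr_self i
  exact this

open scoped Classical in
theorem inner_stdBasis (i : ι) (x : lp (fun _ : ι => ℂ) 2) : inner ℂ (stdBasis ι i) x = x i := by
  rw [stdBasis_apply, lp.inner_single_left]
  simp

theorem inner_stdBasis_right (i : ι) (x : lp (fun _ : ι => ℂ) 2) :
    inner ℂ x (stdBasis ι i) = conj (x i) := by
  rw [← inner_conj_symm, inner_stdBasis]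

open scoped Classical in
theorem stdBasis_coe (i j : ι) : stdBasis ι i j = if j = i then 1 else 0 := by
  rw [← inner_stdBasis j, orthonormal_iff_ite.mp (stdBasis ι).orthonormal]

theorem clm_ext_basis {E F : Type*} [NormedAddCommGroup E] [InnerProductSpace ℂ E]
    [NormedAddCommGroup F] [NormedSpace ℂ F] (b : HilbertBasis ι ℂ E) {S T : E →L[ℂ] F}
    (h : ∀ i, S (b i) = T (b i)) : S = T := by
  apply ContinuousLinearMap.ext_on (s := Set.range b)
  · have := b.dense_span
    rw [Submodule.dense_iff_topologicalClosure_eq_top]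
    exact this
  · rintro _ ⟨i, rfl⟩
    exact h i

/-- The weighted restriction `x ↦ (f d * x (u d))_d` along an injective map `u`. -/
noncomputable def lpRestrict {u : D → ι} (hu : Function.Injective u) {f : D → ℂ} {C : ℝ}
    (hf : ∀ d, ‖f d‖ ≤ C) : lp (fun _ : ι => ℂ) 2 →L[ℂ] lp (fun _ : D => ℂ) 2 :=
  have hs : ∀ (x : lp (fun _ : ι => ℂ) 2) (s : Finset D),
      ∑ d ∈ s, ‖f d * x (u d)‖ ^ (2 : ENNReal).toReal ≤ (|C| * ‖x‖) ^ (2 : ENNReal).toReal := by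
    intro x s
    have h1 : ∑ d ∈ s, ‖x (u d)‖ ^ (2 : ENNReal).toReal ≤ ‖x‖ ^ (2 : ENNReal).toReal := by
      have := lp.sum_rpow_le_norm_rpow (p := 2) (by simp) x (s.map ⟨u, hu⟩)
      rwa [Finset.sum_map] at this
    have h2 : ∀ d ∈ s, ‖f d * x (u d)‖ ^ (2 : ENNReal).toReal ≤
        |C| ^ (2 : ENNReal).toReal * ‖x (u d)‖ ^ (2 : ENNReal).toReal := by
      intro d _
      rw [← Real.mul_rpow (abs_nonneg _) (norm_nonneg _), norm_mul]
      gcongr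
      exact (hf d).trans (le_abs_self C)
    refine (Finset.sum_le_sum h2).trans ?_
    rw [← Finset.mul_sum, Real.mul_rpow (abs_nonneg _) (norm_nonneg _)]
    gcongr
  LinearMap.mkContinuous
    { toFun := fun x => ⟨fun d => f d * x (u d), memℓp_gen' (hs x)⟩
      map_add' := fun x y => by ext d; exact mul_add _ _ _
      map_smul' := fun c x => by ext d; exact mul_left_comm _ _ _ }
    |C| (fun x => lp.norm_le_of_forall_sum_le (by simp) (by positivity) (hs x))

theorem lpRestrict_apply {u : D → ι} (hu : Function.Injective u) {f : D → ℂ} {C : ℝ}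
    (hf : ∀ d, ‖f d‖ ≤ C) (x : lp (fun _ : ι => ℂ) 2) (d : D) :
    lpRestrict hu hf x d = f d * x (u d) := rfl

theorem lpRestrict_stdBasis {u : D → ι} (hu : Function.Injective u) {f : D → ℂ} {C : ℝ}
    (hf : ∀ d, ‖f d‖ ≤ C) (d : D) :
    lpRestrict hu hf (stdBasis ι (u d)) = f d • stdBasis D d := by
  classical
  ext d'
  rw [lpRestrict_apply, lp.coeFn_smul, Pi.smul_apply, stdBasis_coe, stdBasis_coe, hu.eq_iff]
  split_ifs with h <;> simp [h]

theorem lpRestrict_stdBasis_of_notMem {u : D → ι} (hu : Function.Injective u) {f : D → ℂ} {C : ℝ}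
    (hf : ∀ d, ‖f d‖ ≤ C) {i : ι} (hi : ∀ d, u d ≠ i) :
    lpRestrict hu hf (stdBasis ι i) = 0 := by
  classical
  ext d'
  rw [lpRestrict_apply, stdBasis_coe, if_neg (hi d')]
  simp

theorem adjoint_lpRestrict_stdBasis {u : D → ι} (hu : Function.Injective u) {f : D → ℂ} {C : ℝ}
    (hf : ∀ d, ‖f d‖ ≤ C) (d : D) :
    ContinuousLinearMap.adjoint (lpRestrict hu hf) (stdBasis D d) =
      conj (f d) • stdBasis ι (u d) := by
  refine ext_inner_left ℂ fun x => ?_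
  rw [ContinuousLinearMap.adjoint_inner_right, inner_stdBasis_right, lpRestrict_apply,
    inner_smul_right, inner_stdBasis_right, map_mul]

/-- The operator that maps the basis vector `u d` to `f d` times the basis vector `t d`, and
the basis vectors outside of the range of `u` to zero. -/
noncomputable def weightedShift {u t : D → ι} (hu : Function.Injective u)
    (ht : Function.Injective t) {f : D → ℂ} {C : ℝ} (hf : ∀ d, ‖f d‖ ≤ C) :
    lp (fun _ : ι => ℂ) 2 →L[ℂ] lp (fun _ : ι => ℂ) 2 :=
  ContinuousLinearMap.adjoint
    (lpRestrict ht (f := fun _ => 1) (C := 1) (fun _ => by simp)) ∘L lpRestrict hu hf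

variable {u t : D → ι} (hu : Function.Injective u) (ht : Function.Injective t) {f : D → ℂ} {C : ℝ}
  (hf : ∀ d, ‖f d‖ ≤ C)

theorem weightedShift_apply (d : D) :
    weightedShift hu ht hf (stdBasis ι (u d)) = f d • stdBasis ι (t d) := by
  rw [weightedShift, ContinuousLinearMap.comp_apply, lpRestrict_stdBasis, map_smul,
    adjoint_lpRestrict_stdBasis]
  simp

theorem weightedShift_apply_of_notMem {i : ι} (hi : ∀ d, u d ≠ i) :
    weightedShift hu ht hf (stdBasis ι i) = 0 := by
  rw [weightedShift, ContinuousLinearMap.comp_apply, lpRestrict_stdBasis_of_notMem _ _ hi, map_zero]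

theorem adjoint_weightedShift_apply (d : D) :
    ContinuousLinearMap.adjoint (weightedShift hu ht hf) (stdBasis ι (t d)) =
      conj (f d) • stdBasis ι (u d) := by
  rw [weightedShift, ContinuousLinearMap.adjoint_comp, ContinuousLinearMap.adjoint_adjoint,
    ContinuousLinearMap.comp_apply, lpRestrict_stdBasis ht, one_smul, adjoint_lpRestrict_stdBasis]

theorem adjoint_weightedShift_apply_of_notMem {i : ι} (hi : ∀ d, t d ≠ i) :
    ContinuousLinearMap.adjoint (weightedShift hu ht hf) (stdBasis ι i) = 0 := by
  rw [weightedShift, ContinuousLinearMap.adjoint_comp, ContinuousLinearMap.adjoint_adjoint,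
    ContinuousLinearMap.comp_apply, lpRestrict_stdBasis_of_notMem ht _ hi, map_zero]

end WeightedShift

/-! ### Shifts of the labels `(2l, 2m)` -/

section SpinShift

/-- `(L, M) = (2l, 2m)` is the label of a basis vector of the representations with `|N| = n/2`. -/
def Admissible (n : ℕ) (L M : ℤ) : Prop :=
  ((n : ℤ) ≤ L ∧ (2 : ℤ) ∣ L - n) ∧ |M| ≤ L ∧ (2 : ℤ) ∣ L - M

theorem admissible_iff {n : ℕ} {L M : ℤ} :
    Admissible n L M ↔ (n : ℤ) ≤ L ∧ (2 : ℤ) ∣ L - n ∧ -L ≤ M ∧ M ≤ L ∧ (2 : ℤ) ∣ L - M := by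
  rw [Admissible, abs_le]
  tauto

/-- The label `(L, M)`. -/
def SpinIdx.mk {n : ℕ} (L M : ℤ) (h : Admissible n L M) : SpinIdx n := ⟨(L, M), h⟩

theorem SpinIdx.mk_inj {n : ℕ} {L M L' M' : ℤ} {h : Admissible n L M} {h' : Admissible n L' M'} :
    SpinIdx.mk L M h = SpinIdx.mk L' M' h' ↔ L = L' ∧ M = M' :=
  Subtype.ext_iff.trans Prod.ext_iff

open scoped Classical in
/-- The basis vector with label `(L, M)`, or `0` if there is none. -/
noncomputable def spinVec (n : ℕ) (L M : ℤ) : SpinSpace n :=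
  if h : Admissible n L M then stdBasis (SpinIdx n) (.mk L M h) else 0

theorem spinVec_of_admissible {n : ℕ} {L M : ℤ} (h : Admissible n L M) :
    spinVec n L M = stdBasis (SpinIdx n) (.mk L M h) := dif_pos h

theorem spinVec_of_not {n : ℕ} {L M : ℤ} (h : ¬ Admissible n L M) : spinVec n L M = 0 := dif_neg h

theorem spinVec_idx {n : ℕ} (i : SpinIdx n) : spinVec n i.1.1 i.1.2 = stdBasis (SpinIdx n) i :=
  spinVec_of_admissible i.2

theorem SpinIdx.admissible {n : ℕ} (i : SpinIdx n) : Admissible n i.1.1 i.1.2 := i.2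

theorem ket_eq_spinVec {n : ℕ} (i : SpinIdx n) (a b : ℤ) :
    ket i a b = spinVec n (i.1.1 + 2 * a) (i.1.2 + 2 * b) := by
  classical
  by_cases h : Admissible n (i.1.1 + 2 * a) (i.1.2 + 2 * b)
  · rw [spinVec_of_admissible h, stdBasis_apply]
    exact (dif_pos h).trans (by congr)
  · rw [spinVec_of_not h]
    exact dif_neg h

open scoped Classical in
/-- The coefficient `f` where both ends of the arrow `(L, M) → (L + a, M + b)` are admissible. -/
noncomputable def truncated (n : ℕ) (a b : ℤ) (f : ℝ → ℝ → ℝ) (L M : ℤ) : ℝ :=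
  if Admissible n L M ∧ Admissible n (L + a) (M + b) then f ((L : ℝ) / 2) ((M : ℝ) / 2) else 0

/-- `f` is bounded, and it vanishes on the arrows with exactly one admissible end. -/
structure IsShiftCoeff (n : ℕ) (a b : ℤ) (f : ℝ → ℝ → ℝ) (C : ℝ) : Prop where
  bound : ∀ L M, Admissible n L M → |f ((L : ℝ) / 2) ((M : ℝ) / 2)| ≤ C
  source : ∀ L M, Admissible n L M → ¬ Admissible n (L + a) (M + b) →
    f ((L : ℝ) / 2) ((M : ℝ) / 2) = 0
  target : ∀ L M, ¬ Admissible n L M → Admissible n (L + a) (M + b) →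
    f ((L : ℝ) / 2) ((M : ℝ) / 2) = 0

variable {n : ℕ} {a b : ℤ} {f : ℝ → ℝ → ℝ} {C : ℝ}

/-- As soon as one end of an arrow is admissible, truncation changes nothing, because the closed
formula already vanishes when the other end is missing. The scalar identities therefore hold up to
the edge of the label range. -/
theorem IsShiftCoeff.truncated_eq (hf : IsShiftCoeff n a b f C) {L M : ℤ} {l m : ℝ}
    (h : Admissible n L M ∨ Admissible n (L + a) (M + b))
    (hl : (L : ℝ) / 2 = l := by push_cast; linarith)
    (hm : (M : ℝ) / 2 = m := by push_cast; linarith) : truncated n a b f L M = f l m := by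
  rw [truncated, ← hl, ← hm]
  split_ifs with h'
  · rfl
  · by_cases h1 : Admissible n L M
    · exact (hf.source L M h1 fun h2 => h' ⟨h1, h2⟩).symm
    · exact (hf.target L M h1 (h.resolve_left h1)).symm

/-- The arrows `(L, M) → (L + a, M + b)` between admissible labels. -/
def ShiftArrow (n : ℕ) (a b : ℤ) : Type :=
  {p : ℤ × ℤ // Admissible n p.1 p.2 ∧ Admissible n (p.1 + a) (p.2 + b)}

/-- The initial point of an arrow. -/
def ShiftArrow.source (p : ShiftArrow n a b) : SpinIdx n := .mk p.1.1 p.1.2 p.2.1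

/-- The end point of an arrow. -/
def ShiftArrow.target (p : ShiftArrow n a b) : SpinIdx n := .mk (p.1.1 + a) (p.1.2 + b) p.2.2

theorem ShiftArrow.source_injective : Function.Injective (source : ShiftArrow n a b → SpinIdx n) :=
  by
  intro p p' h
  obtain ⟨h1, h2⟩ := SpinIdx.mk_inj.mp h
  exact Subtype.ext (Prod.ext h1 h2)

theorem ShiftArrow.target_injective : Function.Injective (target : ShiftArrow n a b → SpinIdx n) :=
  by
  intro p p' h
  obtain ⟨h1, h2⟩ := SpinIdx.mk_inj.mp h
  exact Subtype.ext (Prod.ext (add_right_cancel h1) (add_right_cancel h2))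

/-- The operator `|L,M⟩ ↦ f(L/2, M/2) |L + a, M + b⟩`. -/
noncomputable def spinShift (hf : IsShiftCoeff n a b f C) : SpinSpace n →L[ℂ] SpinSpace n :=
  weightedShift (D := ShiftArrow n a b) ShiftArrow.source_injective ShiftArrow.target_injective
    (f := fun p => (f ((p.1.1 : ℝ) / 2) ((p.1.2 : ℝ) / 2) : ℂ)) (C := C)
    (fun p => by rw [Complex.norm_real]; exact hf.bound _ _ p.2.1)

theorem spinShift_source (hf : IsShiftCoeff n a b f C) (p : ShiftArrow n a b) :
    spinShift hf (stdBasis (SpinIdx n) p.source) =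
      (f ((p.1.1 : ℝ) / 2) ((p.1.2 : ℝ) / 2) : ℂ) • stdBasis (SpinIdx n) p.target :=
  weightedShift_apply _ _ _ p

theorem spinShift_of_notMem (hf : IsShiftCoeff n a b f C) {i : SpinIdx n}
    (hi : ∀ p : ShiftArrow n a b, p.source ≠ i) : spinShift hf (stdBasis (SpinIdx n) i) = 0 :=
  weightedShift_apply_of_notMem _ _ _ hi

theorem adjoint_spinShift_target (hf : IsShiftCoeff n a b f C) (p : ShiftArrow n a b) :
    ContinuousLinearMap.adjoint (spinShift hf) (stdBasis (SpinIdx n) p.target) =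
      (f ((p.1.1 : ℝ) / 2) ((p.1.2 : ℝ) / 2) : ℂ) • stdBasis (SpinIdx n) p.source := by
  refine (adjoint_weightedShift_apply _ _ _ p).trans ?_
  rw [Complex.conj_ofReal]

theorem adjoint_spinShift_of_notMem (hf : IsShiftCoeff n a b f C) {i : SpinIdx n}
    (hi : ∀ p : ShiftArrow n a b, p.target ≠ i) :
    ContinuousLinearMap.adjoint (spinShift hf) (stdBasis (SpinIdx n) i) = 0 :=
  adjoint_weightedShift_apply_of_notMem _ _ _ hi

/-- Valid for all integer labels: truncation and the convention that missing basis vectors are `0`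
absorb the boundary cases. -/
theorem spinShift_spinVec (hf : IsShiftCoeff n a b f C) (L M : ℤ) :
    spinShift hf (spinVec n L M) =
      ((truncated n a b f L M : ℝ) : ℂ) • spinVec n (L + a) (M + b) := by
  by_cases h1 : Admissible n L M
  · by_cases h2 : Admissible n (L + a) (M + b)
    · rw [truncated, if_pos ⟨h1, h2⟩, spinVec_of_admissible h1, spinVec_of_admissible h2]
      exact spinShift_source hf ⟨(L, M), h1, h2⟩
    · rw [spinVec_of_not h2, smul_zero, spinVec_of_admissible h1]
      refine spinShift_of_notMem hf fun p h => ?_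
      obtain ⟨h3, h4⟩ := SpinIdx.mk_inj.mp h
      exact h2 (h3 ▸ h4 ▸ p.2.2)
  · rw [spinVec_of_not h1, truncated, if_neg fun h => h1 h.1]
    simp

theorem adjoint_spinShift_spinVec (hf : IsShiftCoeff n a b f C) (L M : ℤ) :
    ContinuousLinearMap.adjoint (spinShift hf) (spinVec n L M) =
      ((truncated n a b f (L - a) (M - b) : ℝ) : ℂ) • spinVec n (L - a) (M - b) := by
  obtain ⟨L, rfl⟩ : ∃ L', L = L' + a := ⟨L - a, by ring⟩
  obtain ⟨M, rfl⟩ : ∃ M', M = M' + b := ⟨M - b, by ring⟩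
  rw [add_sub_cancel_right, add_sub_cancel_right]
  by_cases h2 : Admissible n (L + a) (M + b)
  · by_cases h1 : Admissible n L M
    · rw [truncated, if_pos ⟨h1, h2⟩, spinVec_of_admissible h1, spinVec_of_admissible h2]
      exact adjoint_spinShift_target hf ⟨(L, M), h1, h2⟩
    · rw [spinVec_of_not h1, smul_zero, spinVec_of_admissible h2]
      refine adjoint_spinShift_of_notMem hf fun p h => ?_
      obtain ⟨h3, h4⟩ := SpinIdx.mk_inj.mp h
      rw [add_left_inj] at h3 h4
      exact h1 (h3 ▸ h4 ▸ p.2.1)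
  · rw [spinVec_of_not h2, truncated, if_neg fun h => h2 h.2]
    simp

theorem spin_clm_ext {S T : SpinSpace n →L[ℂ] SpinSpace n}
    (h : ∀ L M, Admissible n L M → S (spinVec n L M) = T (spinVec n L M)) : S = T := by
  refine clm_ext_basis (stdBasis (SpinIdx n)) fun i => ?_
  rw [← spinVec_idx]
  exact h _ _ i.2

/-- Coefficients only have to be compared at targets that exist; admissibility of the target is what
supplies the inequalities for the scalar identities. -/
theorem smul_spinVec_congr {L M : ℤ} {c c' : ℂ} (h : Admissible n L M → c = c') :
    c • spinVec n L M = c' • spinVec n L M := by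
  by_cases hp : Admissible n L M
  · rw [h hp]
  · rw [spinVec_of_not hp, smul_zero, smul_zero]

end SpinShift

/-! ### The representations -/

section Representation

/-- Parity of the integer labels `(2l, 2m)` gives the gaps: below `l = 1` only `l = 0` and `l = 1/2`
are possible, and `l ± m` is an integer. -/
theorem Admissible.isWeight {n : ℕ} {L M : ℤ} (h : Admissible n L M) {N l m : ℝ}
    (hN : |N| = n / 2) (hl : (L : ℝ) / 2 = l) (hm : (M : ℝ) / 2 = m) : IsWeight N l m := by
  subst hl hm
  rw [admissible_iff] at h
  obtain ⟨h1, h2, h3, h4, h5⟩ := h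
  have c1 : (n : ℝ) ≤ L := by exact_mod_cast h1
  have c2 : -(L : ℝ) ≤ M := by exact_mod_cast h3
  have c3 : (M : ℝ) ≤ L := by exact_mod_cast h4
  refine ⟨by rw [hN]; linarith, abs_le.mpr ⟨by linarith, by linarith⟩, ?_, ?_, ?_⟩
  · have h6 : L = 0 ∨ (L = 1 ∧ n = 1 ∧ (M = 1 ∨ M = -1)) ∨ 2 ≤ L := by omega
    rcases h6 with rfl | ⟨rfl, rfl, hM⟩ | hL
    · simp
    · refine Or.inr (Or.inl ⟨by norm_num, ?_, ?_⟩)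
      · have := eq_or_eq_neg_of_abs_eq hN
        simpa using this
      · rcases hM with rfl | rfl
        · left; norm_num
        · right; norm_num
    · right; right
      have : (2 : ℝ) ≤ L := by exact_mod_cast hL
      linarith
  · have h6 : L + M = 0 ∨ 2 ≤ L + M := by omega
    rcases h6 with h6 | h6
    · left
      have : (L : ℝ) + M = 0 := by exact_mod_cast h6
      linarith
    · right
      have : (2 : ℝ) ≤ (L : ℝ) + M := by exact_mod_cast h6
      linarith
  · have h6 : L - M = 0 ∨ 2 ≤ L - M := by omega
    rcases h6 with h6 | h6
    · left
      have : (L : ℝ) - M = 0 := by exact_mod_cast h6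
      linarith
    · right
      have : (2 : ℝ) ≤ (L : ℝ) - M := by exact_mod_cast h6
      linarith

/-- One of the factors `[l + 1 ± N]` vanishes at `l = |N| - 1`: this decouples the lowest level
`|N|` from the absent level below it. -/
theorem rPlus_eq_zero {q N l : ℝ} (h : |N| = l + 1) : rPlus q N l = 0 := by
  rcases eq_or_eq_neg_of_abs_eq h with rfl | rfl
  · rw [rPlus, show l - (l + 1) + 1 = 0 by ring, qNum_zero]
    simp
  · rw [rPlus, show l + -(l + 1) + 1 = 0 by ring, qNum_zero]
    simp

variable {q : ℝ} (hq0 : 0 < q) (hq1 : q < 1) {n : ℕ} {N : ℝ} (hN : |N| = n / 2)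
include hq0 hq1

/-- The diagonal entry of `B*B = A(1 - q²A)` says that a sum of squares equals `a - q²(a² + s² +
t²)`, with `a` the diagonal entry of `A` and `s`, `t` its neighbours. Nonnegativity gives `0 ≤ a ≤
q⁻²`, and the remaining coefficients are then bounded as well; no asymptotics are needed. -/
theorem IsWeight.bounds {l m : ℝ} (h : IsWeight N l m) :
    |bPlus q N l m| ≤ (q ^ 2)⁻¹ ∧ |bZero q N l m| ≤ (q ^ 2)⁻¹ ∧ |bMinus q N l m| ≤ (q ^ 2)⁻¹ ∧
      |aPlus q N l m| ≤ (q ^ 2)⁻¹ ∧ |aZero q N l m| ≤ (q ^ 2)⁻¹ := by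
  have key := h.BstarB_zero hq0 hq1
  generalize bPlus q N l m = x at *
  generalize bZero q N l m = y at *
  generalize bMinus q N l m = z at *
  generalize aPlus q N l m = s at *
  generalize aPlus q N (l - 1) m = t at *
  generalize aZero q N l m = a at *
  have hc : 1 ≤ (q ^ 2)⁻¹ := (one_le_inv₀ (by positivity)).mpr (by nlinarith)
  have hcq : q ^ 2 * (q ^ 2)⁻¹ = 1 := mul_inv_cancel₀ (by positivity)
  have hq2 : 0 < q ^ 2 := by positivity
  generalize (q ^ 2)⁻¹ = c at *
  generalize q ^ 2 = r at *
  have e0 : 0 ≤ r * a ^ 2 := by positivity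
  have e1 : 0 ≤ r * s ^ 2 := by positivity
  have e2 : 0 ≤ r * t ^ 2 := by positivity
  have ha0 : 0 ≤ a := by nlinarith
  have ha1 : a ≤ c := by
    rcases ha0.eq_or_lt with h0 | h0
    · linarith
    · have : r * a ≤ 1 := by
        by_contra hcon
        push Not at hcon
        nlinarith [sq_nonneg x, sq_nonneg y, sq_nonneg z]
      nlinarith
  have hcc : c ≤ c ^ 2 := by nlinarith
  have hs : r * s ^ 2 ≤ c := by nlinarith [sq_nonneg x, sq_nonneg y, sq_nonneg z]
  refine ⟨abs_le_of_sq_le_sq ?_ (by linarith), abs_le_of_sq_le_sq ?_ (by linarith),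
    abs_le_of_sq_le_sq ?_ (by linarith), abs_le_of_sq_le_sq ?_ (by linarith), ?_⟩
  · nlinarith [sq_nonneg x, sq_nonneg y, sq_nonneg z]
  · nlinarith [sq_nonneg x, sq_nonneg y, sq_nonneg z]
  · nlinarith [sq_nonneg x, sq_nonneg y, sq_nonneg z]
  · calc s ^ 2 = c * (r * s ^ 2) := by linear_combination (-(s ^ 2)) * hcq
      _ ≤ c * c := by gcongr
      _ = c ^ 2 := by ring
  · rw [abs_of_nonneg ha0]; exact ha1

include hN

/-- Raising `l` and `m` together never leaves the label range. An arrow entering it from outside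
starts on the level below `|N|`, where `r⁺ = 0`, or at `m = -l - 1` or `m = -l - 2`, where `[0]`
occurs under the root. -/
theorem bPlus_isShiftCoeff : IsShiftCoeff n 2 2 (bPlus q N) (q ^ 2)⁻¹ where
  bound L M h := ((h.isWeight hN rfl rfl).bounds hq0 hq1).1
  source L M h h' := absurd h' (by rw [admissible_iff] at *; omega)
  target L M h h' := by
    have : L + 2 = n ∨ M = -L - 2 ∨ M = -L - 4 := by rw [admissible_iff] at *; omega
    rcases this with h1 | rfl | rfl
    · rw [bPlus, rPlus_eq_zero, mul_zero]
      rw [hN, ← Int.cast_natCast, ← h1]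
      push_cast
      ring
    · rw [bPlus, show ((L : ℝ) / 2 + ((-L - 2 : ℤ) : ℝ) / 2 + 1) = 0 by push_cast; ring, qNum_zero]
      simp
    · rw [bPlus, show ((L : ℝ) / 2 + ((-L - 4 : ℤ) : ℝ) / 2 + 2) = 0 by push_cast; ring, qNum_zero]
      simp

theorem bZero_isShiftCoeff : IsShiftCoeff n 0 2 (bZero q N) (q ^ 2)⁻¹ where
  bound L M h := ((h.isWeight hN rfl rfl).bounds hq0 hq1).2.1
  source L M h h' := by
    have : M = L := by rw [admissible_iff] at *; omega
    rw [bZero, this, sub_self, qNum_zero]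
    simp
  target L M h h' := by
    have : M = -L - 2 := by rw [admissible_iff] at *; omega
    subst this
    rw [bZero, show ((L : ℝ) / 2 + ((-L - 2 : ℤ) : ℝ) / 2 + 1) = 0 by push_cast; ring, qNum_zero]
    simp

theorem bMinus_isShiftCoeff : IsShiftCoeff n (-2) 2 (bMinus q N) (q ^ 2)⁻¹ where
  bound L M h := ((h.isWeight hN rfl rfl).bounds hq0 hq1).2.2.1
  source L M h h' := by
    have : L = n ∨ M = L ∨ M = L - 2 := by rw [admissible_iff] at *; omega
    rcases this with h1 | rfl | rfl
    · rw [bMinus, rMinus, rPlus_eq_zero]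
      · simp
      · rw [hN, ← Int.cast_natCast, ← h1]
        ring
    · rw [bMinus, sub_self, qNum_zero]
      simp
    · rw [bMinus, show ((L : ℝ) / 2 - ((L - 2 : ℤ) : ℝ) / 2 - 1) = 0 by push_cast; ring, qNum_zero]
      simp
  target L M h h' := absurd h' (by rw [admissible_iff] at *; omega)

theorem aPlus_isShiftCoeff : IsShiftCoeff n 2 0 (aPlus q N) (q ^ 2)⁻¹ where
  bound L M h := ((h.isWeight hN rfl rfl).bounds hq0 hq1).2.2.2.1
  source L M h h' := absurd h' (by rw [admissible_iff] at *; omega)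
  target L M h h' := by
    have : L + 2 = n ∨ M = L + 2 ∨ M = -L - 2 := by rw [admissible_iff] at *; omega
    rcases this with h1 | rfl | rfl
    · rw [aPlus, rPlus_eq_zero, mul_zero, neg_zero]
      rw [hN, ← Int.cast_natCast, ← h1]
      push_cast
      ring
    · rw [aPlus, show ((L : ℝ) / 2 - ((L + 2 : ℤ) : ℝ) / 2 + 1) = 0 by push_cast; ring, qNum_zero]
      simp
    · rw [aPlus, show ((L : ℝ) / 2 + ((-L - 2 : ℤ) : ℝ) / 2 + 1) = 0 by push_cast; ring, qNum_zero]
      simp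

theorem aZero_isShiftCoeff : IsShiftCoeff n 0 0 (aZero q N) (q ^ 2)⁻¹ where
  bound L M h := ((h.isWeight hN rfl rfl).bounds hq0 hq1).2.2.2.2
  source L M h h' := absurd h (by simpa using h')
  target L M h h' := absurd h (by simpa using h')

/-- The operator of `B`. -/
noncomputable def opB : SpinSpace n →L[ℂ] SpinSpace n :=
  spinShift (bPlus_isShiftCoeff hq0 hq1 hN) + spinShift (bZero_isShiftCoeff hq0 hq1 hN) +
    spinShift (bMinus_isShiftCoeff hq0 hq1 hN)

/-- The operator of `A`. -/
noncomputable def opA : SpinSpace n →L[ℂ] SpinSpace n :=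
  spinShift (aPlus_isShiftCoeff hq0 hq1 hN) + spinShift (aZero_isShiftCoeff hq0 hq1 hN) +
    star (spinShift (aPlus_isShiftCoeff hq0 hq1 hN))

theorem opB_spinVec (L M : ℤ) : opB hq0 hq1 hN (spinVec n L M) =
    ((truncated n 2 2 (bPlus q N) L M : ℝ) : ℂ) • spinVec n (L + 2) (M + 2) +
    ((truncated n 0 2 (bZero q N) L M : ℝ) : ℂ) • spinVec n L (M + 2) +
    ((truncated n (-2) 2 (bMinus q N) L M : ℝ) : ℂ) • spinVec n (L - 2) (M + 2) := by
  rw [opB, add_apply, add_apply, spinShift_spinVec,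
    spinShift_spinVec, spinShift_spinVec, add_zero, ← sub_eq_add_neg]

theorem star_opB_spinVec (L M : ℤ) : star (opB hq0 hq1 hN) (spinVec n L M) =
    ((truncated n (-2) 2 (bMinus q N) (L + 2) (M - 2) : ℝ) : ℂ) • spinVec n (L + 2) (M - 2) +
    ((truncated n 0 2 (bZero q N) L (M - 2) : ℝ) : ℂ) • spinVec n L (M - 2) +
    ((truncated n 2 2 (bPlus q N) (L - 2) (M - 2) : ℝ) : ℂ) • spinVec n (L - 2) (M - 2) := by
  rw [opB, star_add, star_add, add_apply, add_apply]
  simp only [ContinuousLinearMap.star_eq_adjoint, adjoint_spinShift_spinVec, sub_zero,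
    sub_neg_eq_add]
  abel

theorem opA_spinVec (L M : ℤ) : opA hq0 hq1 hN (spinVec n L M) =
    ((truncated n 2 0 (aPlus q N) L M : ℝ) : ℂ) • spinVec n (L + 2) M +
    ((truncated n 0 0 (aZero q N) L M : ℝ) : ℂ) • spinVec n L M +
    ((truncated n 2 0 (aPlus q N) (L - 2) M : ℝ) : ℂ) • spinVec n (L - 2) M := by
  rw [opA, add_apply, add_apply, spinShift_spinVec,
    spinShift_spinVec, ContinuousLinearMap.star_eq_adjoint, adjoint_spinShift_spinVec]
  simp only [add_zero, sub_zero]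

/-- On a basis vector both sides have components with `l` changed by `2, 1, 0, -1, -2`; the five
facts `k2`, `k1`, `k0`, `j1`, `j2` are the corresponding scalar identities. The labels are `2l`,
`2m`, so a change of `l` by one appears as `2`. -/
theorem opA_mul_opB : opA hq0 hq1 hN * opB hq0 hq1 hN =
    ((q : ℂ) ^ 2) • (opB hq0 hq1 hN * opA hq0 hq1 hN) := by
  have hbP := bPlus_isShiftCoeff hq0 hq1 hN
  have hbZ := bZero_isShiftCoeff hq0 hq1 hN
  have hbM := bMinus_isShiftCoeff hq0 hq1 hN
  have haP := aPlus_isShiftCoeff hq0 hq1 hN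
  have haZ := aZero_isShiftCoeff hq0 hq1 hN
  refine spin_clm_ext fun L M hp => ?_
  simp only [smul_apply, mul_apply_eq_comp, opB_spinVec,
    opA_spinVec,
    map_add, map_smul,
    smul_add, smul_smul, add_sub_cancel_right, sub_add_cancel]
  have hw := hp.isWeight hN rfl rfl
  have hp' := admissible_iff.mp hp
  have k2 : ((truncated n 2 2 (bPlus q N) L M : ℂ) * (truncated n 2 0 (aPlus q N) (L + 2) (M +
    2) : ℂ)) •
      spinVec n (L + 2 + 2) (M + 2) = ((q : ℂ) ^ 2 * ((truncated n 2 0 (aPlus q N) L M : ℂ) *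
        (truncated n 2 2 (bPlus q N) (L + 2) M : ℂ))) •
      spinVec n (L + 2 + 2) (M + 2) := by
    refine smul_spinVec_congr fun ht => ?_
    have key := hw.AB_two hq0 hq1
    rw [hbP.truncated_eq (L := L) (M := M) (l := (L : ℝ) / 2) (m := (M : ℝ) / 2)
        (.inl hp),
      haP.truncated_eq (L := L + 2) (M := M + 2) (l := (L : ℝ) / 2 + 1) (m := (M : ℝ) / 2 + 1)
        (.inr (by simpa using ht)),
      haP.truncated_eq (L := L) (M := M) (l := (L : ℝ) / 2) (m := (M : ℝ) / 2)
        (.inl hp),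
      hbP.truncated_eq (L := L + 2) (M := M) (l := (L : ℝ) / 2 + 1) (m := (M : ℝ) / 2)
        (.inr (by simpa using ht))]
    have key := congrArg (fun x : ℝ => (x : ℂ)) key
    push_cast at key
    linear_combination key
  have k1 : ((truncated n 2 2 (bPlus q N) L M : ℂ) * (truncated n 0 0 (aZero q N) (L + 2) (M +
    2) : ℂ) +
        (truncated n 0 2 (bZero q N) L M : ℂ) * (truncated n 2 0 (aPlus q N) L (M + 2) : ℂ)) •
      spinVec n (L + 2) (M + 2) = ((q : ℂ) ^ 2 * ((truncated n 2 0 (aPlus q N) L M : ℂ) *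
        (truncated n 0 2 (bZero q N) (L + 2) M : ℂ) +
        (truncated n 0 0 (aZero q N) L M : ℂ) * (truncated n 2 2 (bPlus q N) L M : ℂ))) •
      spinVec n (L + 2) (M + 2) := by
    refine smul_spinVec_congr fun ht => ?_
    have key := hw.AB_one hq0 hq1
    rw [hbP.truncated_eq (L := L) (M := M) (l := (L : ℝ) / 2) (m := (M : ℝ) / 2)
        (.inl hp),
      haZ.truncated_eq (L := L + 2) (M := M + 2) (l := (L : ℝ) / 2 + 1) (m := (M : ℝ) / 2 + 1)
        (.inl ht),
      hbZ.truncated_eq (L := L) (M := M) (l := (L : ℝ) / 2) (m := (M : ℝ) / 2)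
        (.inl hp),
      haP.truncated_eq (L := L) (M := M + 2) (l := (L : ℝ) / 2) (m := (M : ℝ) / 2 + 1)
        (.inr (by simpa using ht)),
      haP.truncated_eq (L := L) (M := M) (l := (L : ℝ) / 2) (m := (M : ℝ) / 2)
        (.inl hp),
      hbZ.truncated_eq (L := L + 2) (M := M) (l := (L : ℝ) / 2 + 1) (m := (M : ℝ) / 2)
        (.inr (by simpa using ht)),
      haZ.truncated_eq (L := L) (M := M) (l := (L : ℝ) / 2) (m := (M : ℝ) / 2)
        (.inl hp)]
    have key := congrArg (fun x : ℝ => (x : ℂ)) key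
    push_cast at key
    linear_combination key
  have k0 : ((truncated n 2 2 (bPlus q N) L M : ℂ) * (truncated n 2 0 (aPlus q N) L (M + 2) : ℂ) +
        (truncated n 0 2 (bZero q N) L M : ℂ) * (truncated n 0 0 (aZero q N) L (M + 2) : ℂ) +
        (truncated n (-2) 2 (bMinus q N) L M : ℂ) * (truncated n 2 0 (aPlus q N) (L - 2) (M +
          2) : ℂ)) •
      spinVec n L (M + 2) = ((q : ℂ) ^ 2 * ((truncated n 2 0 (aPlus q N) L M : ℂ) *
        (truncated n (-2) 2 (bMinus q N) (L + 2) M : ℂ) +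
        (truncated n 0 0 (aZero q N) L M : ℂ) * (truncated n 0 2 (bZero q N) L M : ℂ) +
        (truncated n 2 0 (aPlus q N) (L - 2) M : ℂ) *
          (truncated n 2 2 (bPlus q N) (L - 2) M : ℂ))) •
      spinVec n L (M + 2) := by
    refine smul_spinVec_congr fun ht => ?_
    have ht' := admissible_iff.mp ht
    have h3 : (M : ℝ) / 2 + 1 ≤ (L : ℝ) / 2 := by
      have : M + 2 ≤ L := by omega
      have : (M : ℝ) + 2 ≤ L := by exact_mod_cast this
      linarith
    have key := hw.AB_zero hq0 hq1 h3
    rw [hbP.truncated_eq (L := L) (M := M) (l := (L : ℝ) / 2) (m := (M : ℝ) / 2)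
        (.inl hp),
      haP.truncated_eq (L := L) (M := M + 2) (l := (L : ℝ) / 2) (m := (M : ℝ) / 2 + 1)
        (.inl ht),
      hbZ.truncated_eq (L := L) (M := M) (l := (L : ℝ) / 2) (m := (M : ℝ) / 2)
        (.inl hp),
      haZ.truncated_eq (L := L) (M := M + 2) (l := (L : ℝ) / 2) (m := (M : ℝ) / 2 + 1)
        (.inl ht),
      hbM.truncated_eq (L := L) (M := M) (l := (L : ℝ) / 2) (m := (M : ℝ) / 2)
        (.inl hp),
      haP.truncated_eq (L := L - 2) (M := M + 2) (l := (L : ℝ) / 2 - 1) (m := (M : ℝ) / 2 + 1)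
        (.inr (by simpa using ht)),
      haP.truncated_eq (L := L) (M := M) (l := (L : ℝ) / 2) (m := (M : ℝ) / 2)
        (.inl hp),
      hbM.truncated_eq (L := L + 2) (M := M) (l := (L : ℝ) / 2 + 1) (m := (M : ℝ) / 2)
        (.inr (by simpa [sub_eq_add_neg] using ht)),
      haZ.truncated_eq (L := L) (M := M) (l := (L : ℝ) / 2) (m := (M : ℝ) / 2)
        (.inl hp),
      haP.truncated_eq (L := L - 2) (M := M) (l := (L : ℝ) / 2 - 1) (m := (M : ℝ) / 2)
        (.inr (by simpa using hp)),
      hbP.truncated_eq (L := L - 2) (M := M) (l := (L : ℝ) / 2 - 1) (m := (M : ℝ) / 2)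
        (.inr (by simpa using ht))]
    have key := congrArg (fun x : ℝ => (x : ℂ)) key
    push_cast at key
    linear_combination key
  have j1 : ((truncated n 0 2 (bZero q N) L M : ℂ) * (truncated n 2 0 (aPlus q N) (L - 2) (M +
    2) : ℂ) +
        (truncated n (-2) 2 (bMinus q N) L M : ℂ) * (truncated n 0 0 (aZero q N) (L - 2) (M +
          2) : ℂ)) •
      spinVec n (L - 2) (M + 2) = ((q : ℂ) ^ 2 * ((truncated n 0 0 (aZero q N) L M : ℂ) *
        (truncated n (-2) 2 (bMinus q N) L M : ℂ) +
        (truncated n 2 0 (aPlus q N) (L - 2) M : ℂ) *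
          (truncated n 0 2 (bZero q N) (L - 2) M : ℂ))) •
      spinVec n (L - 2) (M + 2) := by
    refine smul_spinVec_congr fun ht => ?_
    -- The scalar identity for this component is based at the lower level, which is that of the
    -- target.
    obtain ⟨b, hb⟩ : ∃ b, b = (L : ℝ) / 2 - 1 := ⟨_, rfl⟩
    have key := IsWeight.AB_neg_one hq0 hq1 (ht.isWeight hN (l := b) (m := (M : ℝ) / 2 + 1)
      (by push_cast; linarith) (by push_cast; ring))
    have ht' := admissible_iff.mp ht
    rw [hbZ.truncated_eq (L := L) (M := M) (l := b + 1) (m := (M : ℝ) / 2)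
        (.inl hp),
      haP.truncated_eq (L := L - 2) (M := M + 2) (l := b) (m := (M : ℝ) / 2 + 1)
        (.inl ht),
      hbM.truncated_eq (L := L) (M := M) (l := b + 1) (m := (M : ℝ) / 2)
        (.inl hp),
      haZ.truncated_eq (L := L - 2) (M := M + 2) (l := b) (m := (M : ℝ) / 2 + 1)
        (.inl ht),
      haZ.truncated_eq (L := L) (M := M) (l := b + 1) (m := (M : ℝ) / 2)
        (.inl hp),
      haP.truncated_eq (L := L - 2) (M := M) (l := b) (m := (M : ℝ) / 2)
        (.inr (by simpa using hp)),
      hbZ.truncated_eq (L := L - 2) (M := M) (l := b) (m := (M : ℝ) / 2)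
        (.inr (by simpa using ht))]
    have key := congrArg (fun x : ℝ => (x : ℂ)) key
    push_cast at key
    linear_combination key
  have j2 : ((truncated n (-2) 2 (bMinus q N) L M : ℂ) *
    (truncated n 2 0 (aPlus q N) (L - 2 - 2) (M + 2) : ℂ)) •
      spinVec n (L - 2 - 2) (M + 2) = ((q : ℂ) ^ 2 *
        ((truncated n 2 0 (aPlus q N) (L - 2) M : ℂ) *
          (truncated n (-2) 2 (bMinus q N) (L - 2) M : ℂ))) •
      spinVec n (L - 2 - 2) (M + 2) := by
    refine smul_spinVec_congr fun ht => ?_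
    have ht' := admissible_iff.mp ht
    have h3 : (0 : ℝ) ≤ (L : ℝ) / 2 - M / 2 - 3 := by
      have : (6 : ℤ) ≤ L - M := by omega
      have : (6 : ℝ) ≤ (L : ℝ) - M := by exact_mod_cast this
      linarith
    have key := IsWeight.AB_neg_two hq0 hq1 (N := N) h3
    rw [hbM.truncated_eq (L := L) (M := M) (l := (L : ℝ) / 2) (m := (M : ℝ) / 2)
        (.inl hp),
      haP.truncated_eq (L := L - 2 - 2) (M := M + 2) (l := (L : ℝ) / 2 - 2) (m := (M : ℝ) / 2 + 1)
        (.inl ht),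
      haP.truncated_eq (L := L - 2) (M := M) (l := (L : ℝ) / 2 - 1) (m := (M : ℝ) / 2)
        (.inr (by simpa using hp)),
      hbM.truncated_eq (L := L - 2) (M := M) (l := (L : ℝ) / 2 - 1) (m := (M : ℝ) / 2)
        (.inr (by simpa [sub_eq_add_neg] using ht))]
    have key := congrArg (fun x : ℝ => (x : ℂ)) key
    push_cast at key
    linear_combination key
  linear_combination (norm := module) k2 + k1 + k0 + j1 + j2

theorem opB_mul_star_opB : opB hq0 hq1 hN * star (opB hq0 hq1 hN) =
    (((q : ℂ) ^ 2)⁻¹) • (opA hq0 hq1 hN * (1 - opA hq0 hq1 hN)) := by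
  have hbP := bPlus_isShiftCoeff hq0 hq1 hN
  have hbZ := bZero_isShiftCoeff hq0 hq1 hN
  have hbM := bMinus_isShiftCoeff hq0 hq1 hN
  have haP := aPlus_isShiftCoeff hq0 hq1 hN
  have haZ := aZero_isShiftCoeff hq0 hq1 hN
  refine spin_clm_ext fun L M hp => ?_
  simp only [smul_apply, mul_apply_eq_comp, star_opB_spinVec,
    opB_spinVec, opA_spinVec,
    sub_apply, one_apply_eq_self, map_sub, map_add, map_smul,
    smul_add, smul_sub, smul_smul, add_sub_cancel_right, sub_add_cancel]
  have hw := hp.isWeight hN rfl rfl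
  have hp' := admissible_iff.mp hp
  have k2 : ((truncated n (-2) 2 (bMinus q N) (L + 2) (M - 2) : ℂ) *
    (truncated n 2 2 (bPlus q N) (L + 2) (M - 2) : ℂ)) •
      spinVec n (L + 2 + 2) M = (((q : ℂ) ^ 2)⁻¹ * (-((truncated n 2 0 (aPlus q N) L M : ℂ) *
        (truncated n 2 0 (aPlus q N) (L + 2) M : ℂ)))) •
      spinVec n (L + 2 + 2) M := by
    refine smul_spinVec_congr fun ht => ?_
    have key := hw.BBstar_two hq0 hq1
    rw [hbM.truncated_eq (L := L + 2) (M := M - 2) (l := (L : ℝ) / 2 + 1) (m := (M : ℝ) / 2 - 1)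
        (.inr (by simpa using hp)),
      hbP.truncated_eq (L := L + 2) (M := M - 2) (l := (L : ℝ) / 2 + 1) (m := (M : ℝ) / 2 - 1)
        (.inr (by simpa using ht)),
      haP.truncated_eq (L := L) (M := M) (l := (L : ℝ) / 2) (m := (M : ℝ) / 2)
        (.inl hp),
      haP.truncated_eq (L := L + 2) (M := M) (l := (L : ℝ) / 2 + 1) (m := (M : ℝ) / 2)
        (.inr (by simpa using ht))]
    have key := congrArg (fun x : ℝ => (x : ℂ)) key
    push_cast at key
    linear_combination key
  have k1 : ((truncated n (-2) 2 (bMinus q N) (L + 2) (M - 2) : ℂ) *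
    (truncated n 0 2 (bZero q N) (L + 2) (M - 2) : ℂ) +
        (truncated n 0 2 (bZero q N) L (M - 2) : ℂ) * (truncated n 2 2 (bPlus q N) L (M - 2) : ℂ)) •
      spinVec n (L + 2) M = (((q : ℂ) ^ 2)⁻¹ *
        ((truncated n 2 0 (aPlus q N) L M : ℂ) - ((truncated n 2 0 (aPlus q N) L M : ℂ) *
          (truncated n 0 0 (aZero q N) (L + 2) M : ℂ) +
        (truncated n 0 0 (aZero q N) L M : ℂ) * (truncated n 2 0 (aPlus q N) L M : ℂ)))) •
      spinVec n (L + 2) M := by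
    refine smul_spinVec_congr fun ht => ?_
    have key := hw.BBstar_one hq0 hq1
    rw [hbM.truncated_eq (L := L + 2) (M := M - 2) (l := (L : ℝ) / 2 + 1) (m := (M : ℝ) / 2 - 1)
        (.inr (by simpa using hp)),
      hbZ.truncated_eq (L := L + 2) (M := M - 2) (l := (L : ℝ) / 2 + 1) (m := (M : ℝ) / 2 - 1)
        (.inr (by simpa using ht)),
      hbZ.truncated_eq (L := L) (M := M - 2) (l := (L : ℝ) / 2) (m := (M : ℝ) / 2 - 1)
        (.inr (by simpa using hp)),
      hbP.truncated_eq (L := L) (M := M - 2) (l := (L : ℝ) / 2) (m := (M : ℝ) / 2 - 1)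
        (.inr (by simpa using ht)),
      haP.truncated_eq (L := L) (M := M) (l := (L : ℝ) / 2) (m := (M : ℝ) / 2)
        (.inl hp),
      haZ.truncated_eq (L := L + 2) (M := M) (l := (L : ℝ) / 2 + 1) (m := (M : ℝ) / 2)
        (.inl ht),
      haZ.truncated_eq (L := L) (M := M) (l := (L : ℝ) / 2) (m := (M : ℝ) / 2)
        (.inl hp)]
    have key := congrArg (fun x : ℝ => (x : ℂ)) key
    push_cast at key
    linear_combination key
  have k0 : ((truncated n (-2) 2 (bMinus q N) (L + 2) (M - 2) : ℂ) *
    (truncated n (-2) 2 (bMinus q N) (L + 2) (M - 2) : ℂ) +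
        (truncated n 0 2 (bZero q N) L (M - 2) : ℂ) * (truncated n 0 2 (bZero q N) L (M - 2) : ℂ) +
        (truncated n 2 2 (bPlus q N) (L - 2) (M - 2) : ℂ) *
          (truncated n 2 2 (bPlus q N) (L - 2) (M - 2) : ℂ)) •
      spinVec n L M = (((q : ℂ) ^ 2)⁻¹ *
        ((truncated n 0 0 (aZero q N) L M : ℂ) - ((truncated n 2 0 (aPlus q N) L M : ℂ) *
          (truncated n 2 0 (aPlus q N) L M : ℂ) +
        (truncated n 0 0 (aZero q N) L M : ℂ) * (truncated n 0 0 (aZero q N) L M : ℂ) +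
        (truncated n 2 0 (aPlus q N) (L - 2) M : ℂ) *
          (truncated n 2 0 (aPlus q N) (L - 2) M : ℂ)))) •
      spinVec n L M := by
    refine smul_spinVec_congr fun ht => ?_
    have key := hw.BBstar_zero hq0 hq1
    rw [hbM.truncated_eq (L := L + 2) (M := M - 2) (l := (L : ℝ) / 2 + 1) (m := (M : ℝ) / 2 - 1)
        (.inr (by simpa using hp)),
      hbZ.truncated_eq (L := L) (M := M - 2) (l := (L : ℝ) / 2) (m := (M : ℝ) / 2 - 1)
        (.inr (by simpa using hp)),
      hbP.truncated_eq (L := L - 2) (M := M - 2) (l := (L : ℝ) / 2 - 1) (m := (M : ℝ) / 2 - 1)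
        (.inr (by simpa using hp)),
      haP.truncated_eq (L := L) (M := M) (l := (L : ℝ) / 2) (m := (M : ℝ) / 2)
        (.inl hp),
      haZ.truncated_eq (L := L) (M := M) (l := (L : ℝ) / 2) (m := (M : ℝ) / 2)
        (.inl hp),
      haP.truncated_eq (L := L - 2) (M := M) (l := (L : ℝ) / 2 - 1) (m := (M : ℝ) / 2)
        (.inr (by simpa using hp))]
    have key := congrArg (fun x : ℝ => (x : ℂ)) key
    push_cast at key
    linear_combination key
  have j1 : ((truncated n 0 2 (bZero q N) L (M - 2) : ℂ) *
    (truncated n (-2) 2 (bMinus q N) L (M - 2) : ℂ) +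
        (truncated n 2 2 (bPlus q N) (L - 2) (M - 2) : ℂ) *
          (truncated n 0 2 (bZero q N) (L - 2) (M - 2) : ℂ)) •
      spinVec n (L - 2) M = (((q : ℂ) ^ 2)⁻¹ *
        ((truncated n 2 0 (aPlus q N) (L - 2) M : ℂ) - ((truncated n 0 0 (aZero q N) L M : ℂ) *
          (truncated n 2 0 (aPlus q N) (L - 2) M : ℂ) +
        (truncated n 2 0 (aPlus q N) (L - 2) M : ℂ) *
          (truncated n 0 0 (aZero q N) (L - 2) M : ℂ)))) •
      spinVec n (L - 2) M := by
    refine smul_spinVec_congr fun ht => ?_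
    -- Both sides are self-adjoint with real entries, so the component lowering `l` is the raising
    -- identity read from the level `b` of the target. The same device is used for the change by two
    -- and for `B*B`.
    obtain ⟨b, hb⟩ : ∃ b, b = (L : ℝ) / 2 - 1 := ⟨_, rfl⟩
    have key := IsWeight.BBstar_one hq0 hq1 (ht.isWeight hN (l := b) (m := (M : ℝ) / 2)
      (by push_cast; linarith) (by ring))
    have ht' := admissible_iff.mp ht
    rw [hbZ.truncated_eq (L := L) (M := M - 2) (l := b + 1) (m := (M : ℝ) / 2 - 1)
        (.inr (by simpa using hp)),
      hbM.truncated_eq (L := L) (M := M - 2) (l := b + 1) (m := (M : ℝ) / 2 - 1)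
        (.inr (by simpa [sub_eq_add_neg] using ht)),
      hbP.truncated_eq (L := L - 2) (M := M - 2) (l := b) (m := (M : ℝ) / 2 - 1)
        (.inr (by simpa using hp)),
      hbZ.truncated_eq (L := L - 2) (M := M - 2) (l := b) (m := (M : ℝ) / 2 - 1)
        (.inr (by simpa using ht)),
      haZ.truncated_eq (L := L) (M := M) (l := b + 1) (m := (M : ℝ) / 2)
        (.inl hp),
      haP.truncated_eq (L := L - 2) (M := M) (l := b) (m := (M : ℝ) / 2)
        (.inl ht),
      haZ.truncated_eq (L := L - 2) (M := M) (l := b) (m := (M : ℝ) / 2)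
        (.inl ht)]
    have key := congrArg (fun x : ℝ => (x : ℂ)) key
    push_cast at key
    linear_combination key
  have j2 : ((truncated n 2 2 (bPlus q N) (L - 2) (M - 2) : ℂ) *
    (truncated n (-2) 2 (bMinus q N) (L - 2) (M - 2) : ℂ)) •
      spinVec n (L - 2 - 2) M = (((q : ℂ) ^ 2)⁻¹ *
        (-((truncated n 2 0 (aPlus q N) (L - 2) M : ℂ) *
          (truncated n 2 0 (aPlus q N) (L - 2 - 2) M : ℂ)))) •
      spinVec n (L - 2 - 2) M := by
    refine smul_spinVec_congr fun ht => ?_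
    obtain ⟨b, hb⟩ : ∃ b, b = (L : ℝ) / 2 - 2 := ⟨_, rfl⟩
    have key := IsWeight.BBstar_two hq0 hq1 (ht.isWeight hN (l := b) (m := (M : ℝ) / 2)
      (by push_cast; linarith) (by ring))
    have ht' := admissible_iff.mp ht
    rw [hbP.truncated_eq (L := L - 2) (M := M - 2) (l := b + 1) (m := (M : ℝ) / 2 - 1)
        (.inr (by simpa using hp)),
      hbM.truncated_eq (L := L - 2) (M := M - 2) (l := b + 1) (m := (M : ℝ) / 2 - 1)
        (.inr (by simpa [sub_eq_add_neg] using ht)),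
      haP.truncated_eq (L := L - 2) (M := M) (l := b + 1) (m := (M : ℝ) / 2)
        (.inr (by simpa using hp)),
      haP.truncated_eq (L := L - 2 - 2) (M := M) (l := b) (m := (M : ℝ) / 2)
        (.inl ht)]
    have key := congrArg (fun x : ℝ => (x : ℂ)) key
    push_cast at key
    linear_combination key
  linear_combination (norm := module) k2 + k1 + k0 + j1 + j2

theorem star_opB_mul_opB : star (opB hq0 hq1 hN) * opB hq0 hq1 hN =
    opA hq0 hq1 hN * (1 - ((q : ℂ) ^ 2) • opA hq0 hq1 hN) := by
  have hbP := bPlus_isShiftCoeff hq0 hq1 hN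
  have hbZ := bZero_isShiftCoeff hq0 hq1 hN
  have hbM := bMinus_isShiftCoeff hq0 hq1 hN
  have haP := aPlus_isShiftCoeff hq0 hq1 hN
  have haZ := aZero_isShiftCoeff hq0 hq1 hN
  refine spin_clm_ext fun L M hp => ?_
  simp only [smul_apply, mul_apply_eq_comp, star_opB_spinVec,
    opB_spinVec, opA_spinVec,
    sub_apply, one_apply_eq_self, map_sub, map_add, map_smul,
    smul_add, smul_smul, add_sub_cancel_right, sub_add_cancel]
  have hw := hp.isWeight hN rfl rfl
  have hp' := admissible_iff.mp hp
  have k2 : ((truncated n 2 2 (bPlus q N) L M : ℂ) * (truncated n (-2) 2 (bMinus q N) (L + 2 +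
    2) M : ℂ)) •
      spinVec n (L + 2 + 2) M = (-(q : ℂ) ^ 2 * ((truncated n 2 0 (aPlus q N) L M : ℂ) *
        (truncated n 2 0 (aPlus q N) (L + 2) M : ℂ))) •
      spinVec n (L + 2 + 2) M := by
    refine smul_spinVec_congr fun ht => ?_
    have key := hw.BstarB_two hq0 hq1
    rw [hbP.truncated_eq (L := L) (M := M) (l := (L : ℝ) / 2) (m := (M : ℝ) / 2)
        (.inl hp),
      hbM.truncated_eq (L := L + 2 + 2) (M := M) (l := (L : ℝ) / 2 + 2) (m := (M : ℝ) / 2)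
        (.inl ht),
      haP.truncated_eq (L := L) (M := M) (l := (L : ℝ) / 2) (m := (M : ℝ) / 2)
        (.inl hp),
      haP.truncated_eq (L := L + 2) (M := M) (l := (L : ℝ) / 2 + 1) (m := (M : ℝ) / 2)
        (.inr (by simpa using ht))]
    have key := congrArg (fun x : ℝ => (x : ℂ)) key
    push_cast at key
    linear_combination key
  have k1 : ((truncated n 2 2 (bPlus q N) L M : ℂ) * (truncated n 0 2 (bZero q N) (L + 2) M : ℂ) +
        (truncated n 0 2 (bZero q N) L M : ℂ) * (truncated n (-2) 2 (bMinus q N) (L + 2) M : ℂ)) •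
      spinVec n (L + 2) M = ((truncated n 2 0 (aPlus q N) L M : ℂ) - (q : ℂ) ^ 2 *
        ((truncated n 2 0 (aPlus q N) L M : ℂ) * (truncated n 0 0 (aZero q N) (L + 2) M : ℂ) +
        (truncated n 0 0 (aZero q N) L M : ℂ) * (truncated n 2 0 (aPlus q N) L M : ℂ))) •
      spinVec n (L + 2) M := by
    refine smul_spinVec_congr fun ht => ?_
    have key := hw.BstarB_one hq0 hq1
    rw [hbP.truncated_eq (L := L) (M := M) (l := (L : ℝ) / 2) (m := (M : ℝ) / 2)
        (.inl hp),
      hbZ.truncated_eq (L := L + 2) (M := M) (l := (L : ℝ) / 2 + 1) (m := (M : ℝ) / 2)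
        (.inl ht),
      hbZ.truncated_eq (L := L) (M := M) (l := (L : ℝ) / 2) (m := (M : ℝ) / 2)
        (.inl hp),
      hbM.truncated_eq (L := L + 2) (M := M) (l := (L : ℝ) / 2 + 1) (m := (M : ℝ) / 2)
        (.inl ht),
      haP.truncated_eq (L := L) (M := M) (l := (L : ℝ) / 2) (m := (M : ℝ) / 2)
        (.inl hp),
      haZ.truncated_eq (L := L + 2) (M := M) (l := (L : ℝ) / 2 + 1) (m := (M : ℝ) / 2)
        (.inl ht),
      haZ.truncated_eq (L := L) (M := M) (l := (L : ℝ) / 2) (m := (M : ℝ) / 2)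
        (.inl hp)]
    have key := congrArg (fun x : ℝ => (x : ℂ)) key
    push_cast at key
    linear_combination key
  have k0 : ((truncated n 2 2 (bPlus q N) L M : ℂ) * (truncated n 2 2 (bPlus q N) L M : ℂ) +
        (truncated n 0 2 (bZero q N) L M : ℂ) * (truncated n 0 2 (bZero q N) L M : ℂ) +
        (truncated n (-2) 2 (bMinus q N) L M : ℂ) * (truncated n (-2) 2 (bMinus q N) L M : ℂ)) •
      spinVec n L M = ((truncated n 0 0 (aZero q N) L M : ℂ) - (q : ℂ) ^ 2 *
        ((truncated n 2 0 (aPlus q N) L M : ℂ) * (truncated n 2 0 (aPlus q N) L M : ℂ) +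
        (truncated n 0 0 (aZero q N) L M : ℂ) * (truncated n 0 0 (aZero q N) L M : ℂ) +
        (truncated n 2 0 (aPlus q N) (L - 2) M : ℂ) *
          (truncated n 2 0 (aPlus q N) (L - 2) M : ℂ))) •
      spinVec n L M := by
    refine smul_spinVec_congr fun ht => ?_
    have key := hw.BstarB_zero hq0 hq1
    rw [hbP.truncated_eq (L := L) (M := M) (l := (L : ℝ) / 2) (m := (M : ℝ) / 2)
        (.inl hp),
      hbZ.truncated_eq (L := L) (M := M) (l := (L : ℝ) / 2) (m := (M : ℝ) / 2)
        (.inl hp),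
      hbM.truncated_eq (L := L) (M := M) (l := (L : ℝ) / 2) (m := (M : ℝ) / 2)
        (.inl hp),
      haP.truncated_eq (L := L) (M := M) (l := (L : ℝ) / 2) (m := (M : ℝ) / 2)
        (.inl hp),
      haZ.truncated_eq (L := L) (M := M) (l := (L : ℝ) / 2) (m := (M : ℝ) / 2)
        (.inl hp),
      haP.truncated_eq (L := L - 2) (M := M) (l := (L : ℝ) / 2 - 1) (m := (M : ℝ) / 2)
        (.inr (by simpa using hp))]
    have key := congrArg (fun x : ℝ => (x : ℂ)) key
    push_cast at key
    linear_combination key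
  have j1 : ((truncated n 0 2 (bZero q N) L M : ℂ) * (truncated n 2 2 (bPlus q N) (L - 2) M : ℂ) +
        (truncated n (-2) 2 (bMinus q N) L M : ℂ) * (truncated n 0 2 (bZero q N) (L - 2) M : ℂ)) •
      spinVec n (L - 2) M = ((truncated n 2 0 (aPlus q N) (L - 2) M : ℂ) - (q : ℂ) ^ 2 *
        ((truncated n 0 0 (aZero q N) L M : ℂ) * (truncated n 2 0 (aPlus q N) (L - 2) M : ℂ) +
        (truncated n 2 0 (aPlus q N) (L - 2) M : ℂ) *
          (truncated n 0 0 (aZero q N) (L - 2) M : ℂ))) •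
      spinVec n (L - 2) M := by
    refine smul_spinVec_congr fun ht => ?_
    obtain ⟨b, hb⟩ : ∃ b, b = (L : ℝ) / 2 - 1 := ⟨_, rfl⟩
    have key := IsWeight.BstarB_one hq0 hq1 (ht.isWeight hN (l := b) (m := (M : ℝ) / 2)
      (by push_cast; linarith) (by ring))
    have ht' := admissible_iff.mp ht
    rw [hbZ.truncated_eq (L := L) (M := M) (l := b + 1) (m := (M : ℝ) / 2)
        (.inl hp),
      hbP.truncated_eq (L := L - 2) (M := M) (l := b) (m := (M : ℝ) / 2)
        (.inl ht),
      hbM.truncated_eq (L := L) (M := M) (l := b + 1) (m := (M : ℝ) / 2)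
        (.inl hp),
      hbZ.truncated_eq (L := L - 2) (M := M) (l := b) (m := (M : ℝ) / 2)
        (.inl ht),
      haZ.truncated_eq (L := L) (M := M) (l := b + 1) (m := (M : ℝ) / 2)
        (.inl hp),
      haP.truncated_eq (L := L - 2) (M := M) (l := b) (m := (M : ℝ) / 2)
        (.inl ht),
      haZ.truncated_eq (L := L - 2) (M := M) (l := b) (m := (M : ℝ) / 2)
        (.inl ht)]
    have key := congrArg (fun x : ℝ => (x : ℂ)) key
    push_cast at key
    linear_combination key
  have j2 : ((truncated n (-2) 2 (bMinus q N) L M : ℂ) *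
    (truncated n 2 2 (bPlus q N) (L - 2 - 2) M : ℂ)) •
      spinVec n (L - 2 - 2) M = (-(q : ℂ) ^ 2 * ((truncated n 2 0 (aPlus q N) (L - 2) M : ℂ) *
        (truncated n 2 0 (aPlus q N) (L - 2 - 2) M : ℂ))) •
      spinVec n (L - 2 - 2) M := by
    refine smul_spinVec_congr fun ht => ?_
    obtain ⟨b, hb⟩ : ∃ b, b = (L : ℝ) / 2 - 2 := ⟨_, rfl⟩
    have key := IsWeight.BstarB_two hq0 hq1 (ht.isWeight hN (l := b) (m := (M : ℝ) / 2)
      (by push_cast; linarith) (by ring))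
    have ht' := admissible_iff.mp ht
    rw [hbM.truncated_eq (L := L) (M := M) (l := b + 2) (m := (M : ℝ) / 2)
        (.inl hp),
      hbP.truncated_eq (L := L - 2 - 2) (M := M) (l := b) (m := (M : ℝ) / 2)
        (.inl ht),
      haP.truncated_eq (L := L - 2) (M := M) (l := b + 1) (m := (M : ℝ) / 2)
        (.inr (by simpa using hp)),
      haP.truncated_eq (L := L - 2 - 2) (M := M) (l := b) (m := (M : ℝ) / 2)
        (.inl ht)]
    have key := congrArg (fun x : ℝ => (x : ℂ)) key
    push_cast at key
    linear_combination key
  linear_combination (norm := module) k2 + k1 + k0 + j1 + j2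

end Representation

/-! ### The `*`-representation and its matrix coefficients -/

section PodlesRep

variable {q : ℝ} (hq0 : 0 < q) (hq1 : q < 1) {n : ℕ} {N : ℝ} (hN : |N| = n / 2)

theorem star_opA : star (opA hq0 hq1 hN) = opA hq0 hq1 hN := by
  have h : star (spinShift (aZero_isShiftCoeff hq0 hq1 hN)) =
      spinShift (aZero_isShiftCoeff hq0 hq1 hN) := by
    refine spin_clm_ext fun L M _ => ?_
    rw [ContinuousLinearMap.star_eq_adjoint, adjoint_spinShift_spinVec, spinShift_spinVec]
    simp only [sub_zero, add_zero]
  rw [opA, star_add, star_add, star_star, h]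
  abel

/-- The adjoint of `AB = q²BA`, as `A` is self-adjoint and `q` is real. -/
theorem opA_mul_star_opB : ((q : ℂ) ^ 2) • (opA hq0 hq1 hN * star (opB hq0 hq1 hN)) =
    star (opB hq0 hq1 hN) * opA hq0 hq1 hN := by
  have h := congrArg star (opA_mul_opB hq0 hq1 hN)
  rw [star_mul, star_smul, star_mul, star_opA] at h
  rw [h]
  simp

/-- The operators of the generators. -/
noncomputable def opGen : PodlesGen → (SpinSpace n →L[ℂ] SpinSpace n)
  | .A => opA hq0 hq1 hN
  | .B => opB hq0 hq1 hN
  | .Bstar => star (opB hq0 hq1 hN)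

/-- The representation, as a homomorphism of algebras. -/
noncomputable def podlesAlgHom : PodlesSphere q →ₐ[ℂ] (SpinSpace n →L[ℂ] SpinSpace n) :=
  RingQuot.liftAlgHom ℂ ⟨FreeAlgebra.lift ℂ (opGen hq0 hq1 hN), by
    intro x y h
    cases h with
    | AB => simpa [opGen] using opA_mul_opB hq0 hq1 hN
    | ABstar => simpa [opGen] using opA_mul_star_opB hq0 hq1 hN
    | BBstar => simpa [opGen] using opB_mul_star_opB hq0 hq1 hN
    | BstarB => simpa [opGen] using star_opB_mul_opB hq0 hq1 hN⟩

theorem podlesAlgHom_gen (g : PodlesGen) :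
    podlesAlgHom hq0 hq1 hN (PodlesSphere.gen q g) = opGen hq0 hq1 hN g := by
  refine (RingQuot.liftAlgHom_mkAlgHom_apply ℂ _ _ _).trans ?_
  exact FreeAlgebra.lift_ι_apply _ _

/-- Induction on the elements of `𝒜(S²_q)`. -/
theorem PodlesSphere.induction {P : PodlesSphere q → Prop}
    (scalar : ∀ c : ℂ, P (algebraMap ℂ _ c)) (gen : ∀ g, P (gen q g))
    (mul : ∀ a b, P a → P b → P (a * b)) (add : ∀ a b, P a → P b → P (a + b))
    (x : PodlesSphere q) : P x := by
  obtain ⟨y, rfl⟩ := RingQuot.mkAlgHom_surjective ℂ (PodlesRel q) x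
  induction y using FreeAlgebra.induction with
  | grade0 c =>
    have h : RingQuot.mkAlgHom ℂ (PodlesRel q) (algebraMap ℂ _ c) =
      algebraMap ℂ (PodlesSphere q) c := AlgHom.commutes _ _
    exact h ▸ scalar c
  | grade1 g => exact gen g
  | mul a b ha hb =>
    have h : RingQuot.mkAlgHom ℂ (PodlesRel q) (a * b) =
      (show PodlesSphere q from RingQuot.mkAlgHom ℂ (PodlesRel q) a) *
      (show PodlesSphere q from RingQuot.mkAlgHom ℂ (PodlesRel q) b) := map_mul _ _ _
    exact h ▸ mul _ _ ha hb
  | add a b ha hb =>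
    have h : RingQuot.mkAlgHom ℂ (PodlesRel q) (a + b) =
      (show PodlesSphere q from RingQuot.mkAlgHom ℂ (PodlesRel q) a) +
      (show PodlesSphere q from RingQuot.mkAlgHom ℂ (PodlesRel q) b) := map_add _ _ _
    exact h ▸ add _ _ ha hb

theorem PodlesSphere.star_Bstar : star (PodlesSphere.Bstar q) = PodlesSphere.B q :=
  PodlesSphere.starFun_gen q .Bstar

theorem podlesAlgHom_star (x : PodlesSphere q) :
    podlesAlgHom hq0 hq1 hN (star x) = star (podlesAlgHom hq0 hq1 hN x) := by
  induction x using PodlesSphere.induction with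
  | scalar c =>
    have h : star (algebraMap ℂ (PodlesSphere q) c) = algebraMap ℂ _ (conj c) :=
      PodlesSphere.starFun_algebraMap q c
    rw [h, AlgHom.commutes, AlgHom.commutes, Algebra.algebraMap_eq_smul_one,
      Algebra.algebraMap_eq_smul_one, star_smul, star_one]
    rfl
  | gen g =>
    cases g with
    | A =>
      change podlesAlgHom hq0 hq1 hN (star (PodlesSphere.A q)) = _
      rw [PodlesSphere.star_A, PodlesSphere.A, podlesAlgHom_gen]
      exact (star_opA hq0 hq1 hN).symm
    | B =>
      change podlesAlgHom hq0 hq1 hN (star (PodlesSphere.B q)) = _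
      rw [PodlesSphere.star_B, PodlesSphere.Bstar, podlesAlgHom_gen, podlesAlgHom_gen]
      rfl
    | Bstar =>
      change podlesAlgHom hq0 hq1 hN (star (PodlesSphere.Bstar q)) = _
      rw [PodlesSphere.star_Bstar, PodlesSphere.B, podlesAlgHom_gen, podlesAlgHom_gen]
      exact (star_star _).symm
  | mul a b ha hb => rw [star_mul, map_mul, map_mul, star_mul, ha, hb]
  | add a b ha hb => rw [star_add, map_add, map_add, star_add, ha, hb]

/-- The representation `π_N` of `𝒜(S²_q)`. -/
noncomputable def podlesRep : PodlesSphere q →⋆ₐ[ℂ] (SpinSpace n →L[ℂ] SpinSpace n) :=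
  { podlesAlgHom hq0 hq1 hN with map_star' := podlesAlgHom_star hq0 hq1 hN }

theorem podlesRep_gen (g : PodlesGen) :
    podlesRep hq0 hq1 hN (PodlesSphere.gen q g) = opGen hq0 hq1 hN g :=
  podlesAlgHom_gen hq0 hq1 hN g

/-- The prescribed coefficients of `B*` are those of `B` read along the reversed arrows; this
identity and the next two make the match. -/
theorem bMinus_add_one_sub_one (q N l m : ℝ) : bMinus q N (l + 1) (m - 1) =
    q ^ (m - 1) * √(qNum q (l - m + 2) * qNum q (l - m + 1)) * rMinus q N (l + 1) := by
  rw [bMinus, show l + 1 - (m - 1) - 1 = l - m + 1 by ring,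
    show l + 1 - (m - 1) = l - m + 2 by ring]

theorem bZero_sub_one (q N l m : ℝ) : bZero q N l (m - 1) =
    q ^ (m - 1) * √(qNum q (l + m) * qNum q (l - m + 1)) * rZero q N l := by
  rw [bZero, show l + (m - 1) + 1 = l + m by ring, show l - (m - 1) = l - m + 1 by ring]

theorem bPlus_sub_one_sub_one (q N l m : ℝ) : bPlus q N (l - 1) (m - 1) =
    q ^ (m - 1) * √(qNum q (l + m) * qNum q (l + m - 1)) * rPlus q N (l - 1) := by
  rw [bPlus, show l - 1 + (m - 1) + 1 = l + m - 1 by ring,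
    show l - 1 + (m - 1) + 2 = l + m by ring, mul_comm (qNum q (l + m))]

/-- The prescribed lowering coefficient of `A` is the raising coefficient from the level below: the
factor `q^{2l}` in `r⁻` and its sign account for the different form. -/
theorem aPlus_sub_one (hq0 : 0 < q) (N l m : ℝ) : aPlus q N (l - 1) m =
    q ^ (m - l - 1 / 2) * √(qNum q (l - m) * qNum q (l + m)) * rMinus q N l := by
  have h : q ^ (m + (l - 1) + 1 / 2) = q ^ (m - l - 1 / 2) * q ^ (2 * l) := by
    rw [← Real.rpow_add hq0]
    congr 1
    ring
  rw [aPlus, rMinus, show l - 1 - m + 1 = l - m by ring, show l - 1 + m + 1 = l + m by ring, h]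
  ring

theorem isPodlesRep_podlesRep : IsPodlesRep q n N (podlesRep hq0 hq1 hN) where
  apply_B i := by
    have h := podlesRep_gen hq0 hq1 hN .B
    rw [PodlesSphere.B, h]
    simp only [ket_eq_spinVec, mul_zero, mul_one, add_zero, mul_neg, ← sub_eq_add_neg]
    refine (opB_spinVec hq0 hq1 hN _ _).trans ?_
    rw [(bPlus_isShiftCoeff hq0 hq1 hN).truncated_eq (.inl i.admissible) rfl rfl,
      (bZero_isShiftCoeff hq0 hq1 hN).truncated_eq (.inl i.admissible) rfl rfl,
      (bMinus_isShiftCoeff hq0 hq1 hN).truncated_eq (.inl i.admissible) rfl rfl]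
    rfl
  apply_Bstar i := by
    have h := podlesRep_gen hq0 hq1 hN .Bstar
    rw [PodlesSphere.Bstar, h]
    simp only [ket_eq_spinVec, mul_zero, mul_one, add_zero, mul_neg, ← sub_eq_add_neg]
    refine (star_opB_spinVec hq0 hq1 hN _ _).trans ?_
    rw [(bMinus_isShiftCoeff hq0 hq1 hN).truncated_eq (l := i.l + 1) (m := i.m - 1)
        (.inr (by simpa using i.admissible)) (by rw [SpinIdx.l]; push_cast; ring)
        (by rw [SpinIdx.m]; push_cast; ring),
      (bZero_isShiftCoeff hq0 hq1 hN).truncated_eq (l := i.l) (m := i.m - 1)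
        (.inr (by simpa using i.admissible)) rfl (by rw [SpinIdx.m]; push_cast; ring),
      (bPlus_isShiftCoeff hq0 hq1 hN).truncated_eq (l := i.l - 1) (m := i.m - 1)
        (.inr (by simpa using i.admissible)) (by rw [SpinIdx.l]; push_cast; ring)
        (by rw [SpinIdx.m]; push_cast; ring),
      bMinus_add_one_sub_one, bZero_sub_one, bPlus_sub_one_sub_one]
  apply_A i := by
    have h := podlesRep_gen hq0 hq1 hN .A
    rw [PodlesSphere.A, h]
    simp only [ket_eq_spinVec, mul_zero, mul_one, add_zero, mul_neg, ← sub_eq_add_neg]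
    refine (opA_spinVec hq0 hq1 hN _ _).trans ?_
    rw [(aPlus_isShiftCoeff hq0 hq1 hN).truncated_eq (l := i.l) (m := i.m)
        (.inl i.admissible) rfl rfl,
      (aZero_isShiftCoeff hq0 hq1 hN).truncated_eq (l := i.l) (m := i.m)
        (.inl i.admissible) rfl rfl,
      (aPlus_isShiftCoeff hq0 hq1 hN).truncated_eq (l := i.l - 1) (m := i.m)
        (.inr (by simpa using i.admissible)) (by rw [SpinIdx.l]; push_cast; ring) rfl,
      aPlus_sub_one hq0]
    rfl

end PodlesRep

/-! ### Decay of the coefficients -/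

section Decay

open PodlesIdentity

variable {q : ℝ} (hq0 : 0 < q) (hq1 : q < 1)
include hq0 hq1

theorem inv_sub_self_pos : 0 < q⁻¹ - q := by
  have : q < q⁻¹ := lt_trans hq1 ((one_lt_inv₀ hq0).mpr hq1)
  linarith

theorem qNum_le (t : ℝ) : qNum q t ≤ (q⁻¹ - q)⁻¹ * q ^ (-t) := by
  have h := inv_sub_self_pos hq0 hq1
  have h1 : qNum q t = (q⁻¹ - q)⁻¹ * (q ^ (-t) - q ^ t) := by
    rw [qNum, ← neg_sub (q ^ (-t)), ← neg_sub q⁻¹, neg_div_neg_eq, div_eq_inv_mul]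
  rw [h1]
  have := Real.rpow_pos_of_pos hq0 t
  gcongr
  linarith

/-- For `t ≥ 1` one has `q^t ≤ q^{2-t}`, so `q^{-t} - q^t` dominates `q^{-t} - q^{2-t} = (q⁻¹ - q)
q^{1-t}`. Together with the upper bound, `[t]` grows exactly like `q^{-t}`. -/
theorem le_qNum {t : ℝ} (ht : 1 ≤ t) : q ^ (1 - t) ≤ qNum q t := by
  have h := inv_sub_self_pos hq0 hq1
  rw [qNum, ← neg_sub (q ^ (-t)), ← neg_sub q⁻¹, neg_div_neg_eq, le_div_iff₀ h]
  have e1 : q ^ (1 - t) * q⁻¹ = q ^ (-t) := by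
    rw [← Real.rpow_neg_one, ← Real.rpow_add hq0]
    congr 1
    ring
  have e2 : q ^ (1 - t) * q = q ^ (2 - t) := by
    nth_rewrite 2 [← Real.rpow_one q]
    rw [← Real.rpow_add hq0]
    congr 1
    ring
  have e3 : q ^ t ≤ q ^ (2 - t) := Real.rpow_le_rpow_of_exponent_ge hq0 hq1.le (by linarith)
  rw [mul_sub, e1, e2]
  linarith

theorem sqrt_qNum_mul_le {s : ℝ} (hs : 0 ≤ s) (t : ℝ) :
    √(qNum q s * qNum q t) ≤ (q⁻¹ - q)⁻¹ * q ^ (-(s + t) / 2) := by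
  have h := inv_sub_self_pos hq0 hq1
  have hp := Real.rpow_pos_of_pos hq0 (-(s + t) / 2)
  refine Real.sqrt_le_iff.mpr ⟨by positivity, ?_⟩
  have e : (q ^ (-(s + t) / 2)) ^ 2 = q ^ (-s) * q ^ (-t) := by
    rw [sq, ← Real.rpow_add hq0, ← Real.rpow_add hq0]
    congr 1
    ring
  calc qNum q s * qNum q t ≤ qNum q s * ((q⁻¹ - q)⁻¹ * q ^ (-t)) :=
        mul_le_mul_of_nonneg_left (qNum_le hq0 hq1 t) (qNum_nonneg hq0 hq1 hs)
    _ ≤ ((q⁻¹ - q)⁻¹ * q ^ (-s)) * ((q⁻¹ - q)⁻¹ * q ^ (-t)) := by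
        have := Real.rpow_pos_of_pos hq0 (-t)
        exact mul_le_mul_of_nonneg_right (qNum_le hq0 hq1 s) (by positivity)
    _ = ((q⁻¹ - q)⁻¹ * q ^ (-(s + t) / 2)) ^ 2 := by
        rw [mul_pow, e]
        ring

/-- Count exponents: the prefactor and the root in the numerator give `-2l - 5/2 - N`, and the two
denominators are at least `q^{-1-2l}` each. -/
theorem abs_rPlus_le {N l : ℝ} (hl : 0 ≤ l) (hN : |N| ≤ l) :
    |rPlus q N l| ≤ (q⁻¹ - q)⁻¹ * q ^ (2 * l - 1 / 2 - N) := by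
  obtain ⟨hN1, hN2⟩ := abs_le.mp hN
  have h := inv_sub_self_pos hq0 hq1
  have hp : ∀ t : ℝ, 0 < q ^ t := Real.rpow_pos_of_pos hq0
  have h1 : q ^ (-1 - 2 * l) ≤ qNum q (2 * l + 2) := by
    convert le_qNum hq0 hq1 (t := 2 * l + 2) (by linarith) using 2
    ring
  have h2 : q ^ (-1 - 2 * l) ≤ √(qNum q (2 * l + 1) * qNum q (2 * l + 3)) := by
    refine Real.le_sqrt_of_sq_le ?_
    have e : (q ^ (-1 - 2 * l)) ^ 2 = q ^ (1 - (2 * l + 1)) * q ^ (1 - (2 * l + 3)) := by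
      rw [sq, ← Real.rpow_add hq0, ← Real.rpow_add hq0]
      congr 1
      ring
    rw [e]
    exact mul_le_mul (le_qNum hq0 hq1 (by linarith)) (le_qNum hq0 hq1 (by linarith)) (hp _).le
      (qNum_nonneg hq0 hq1 (by linarith))
  have h3 : √(qNum q (l + N + 1) * qNum q (l - N + 1)) ≤ (q⁻¹ - q)⁻¹ * q ^ (-l - 1) := by
    refine (sqrt_qNum_mul_le hq0 hq1 (by linarith) _).trans_eq ?_
    congr 2
    ring
  have h4 : 0 ≤ rPlus q N l := mul_nonneg
    (div_nonneg (hp _).le (qNum_nonneg hq0 hq1 (by linarith)))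
    (div_nonneg (Real.sqrt_nonneg _) (Real.sqrt_nonneg _))
  rw [abs_of_nonneg h4, rPlus]
  calc _ ≤ q ^ (-l - 3 / 2 - N) / q ^ (-1 - 2 * l) *
        ((q⁻¹ - q)⁻¹ * q ^ (-l - 1) / q ^ (-1 - 2 * l)) := by
        gcongr
    _ = (q⁻¹ - q)⁻¹ * (q ^ (-l - 3 / 2 - N) * q ^ (-l - 1) / q ^ (-1 - 2 * l) / q ^ (-1 - 2 *
      l)) := by
        ring
    _ = _ := by
        rw [← Real.rpow_add hq0, ← Real.rpow_sub hq0, ← Real.rpow_sub hq0]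
        congr 2
        ring

theorem IsWeight.abs_bPlus_le {N l m : ℝ} (h : IsWeight N l m) :
    |bPlus q N l m| ≤ (q⁻¹ - q)⁻¹ ^ 2 * q ^ (-2 - N) * q ^ l := by
  obtain ⟨h1, h2⟩ := abs_le.mp h.m_le
  have hp : ∀ t : ℝ, 0 < q ^ t := Real.rpow_pos_of_pos hq0
  rw [bPlus, abs_mul, abs_mul, abs_of_pos (hp m), abs_of_nonneg (Real.sqrt_nonneg _)]
  calc _ ≤ q ^ m * ((q⁻¹ - q)⁻¹ * q ^ (-(l + m + 1 + (l + m + 2)) / 2)) *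
        ((q⁻¹ - q)⁻¹ * q ^ (2 * l - 1 / 2 - N)) := by
        have hδ := inv_sub_self_pos hq0 hq1
        have hs := sqrt_qNum_mul_le hq0 hq1 (show 0 ≤ l + m + 1 by linarith) (l + m + 2)
        have hr := abs_rPlus_le hq0 hq1 h.nonneg h.N_le
        gcongr
    _ = (q⁻¹ - q)⁻¹ ^ 2 * (q ^ m * q ^ (-(l + m + 1 + (l + m + 2)) / 2) *
        q ^ (2 * l - 1 / 2 - N)) := by ring
    _ = _ := by
        rw [mul_assoc ((q⁻¹ - q)⁻¹ ^ 2), ← Real.rpow_add hq0, ← Real.rpow_add hq0,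
          ← Real.rpow_add hq0]
        congr 2
        ring

theorem IsWeight.abs_aPlus_le {N l m : ℝ} (h : IsWeight N l m) :
    |aPlus q N l m| ≤ (q⁻¹ - q)⁻¹ ^ 2 * q ^ (-2 - N) * q ^ l := by
  obtain ⟨h1, h2⟩ := abs_le.mp h.m_le
  have hp : ∀ t : ℝ, 0 < q ^ t := Real.rpow_pos_of_pos hq0
  rw [aPlus, abs_neg, abs_mul, abs_mul, abs_of_pos (hp _), abs_of_nonneg (Real.sqrt_nonneg _)]
  calc _ ≤ q ^ (m + l + 1 / 2) * ((q⁻¹ - q)⁻¹ * q ^ (-(l - m + 1 + (l + m + 1)) / 2)) *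
        ((q⁻¹ - q)⁻¹ * q ^ (2 * l - 1 / 2 - N)) := by
        have hδ := inv_sub_self_pos hq0 hq1
        have hs := sqrt_qNum_mul_le hq0 hq1 (show 0 ≤ l - m + 1 by linarith) (l + m + 1)
        have hr := abs_rPlus_le hq0 hq1 h.nonneg h.N_le
        gcongr
    _ = (q⁻¹ - q)⁻¹ ^ 2 * (q ^ (m + l + 1 / 2) * q ^ (-(l - m + 1 + (l + m + 1)) / 2) *
        q ^ (2 * l - 1 / 2 - N)) := by ring
    _ ≤ _ := by
        rw [mul_assoc ((q⁻¹ - q)⁻¹ ^ 2), ← Real.rpow_add hq0, ← Real.rpow_add hq0,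
          ← Real.rpow_add hq0]
        gcongr ?_ * ?_
        exact Real.rpow_le_rpow_of_exponent_ge hq0 hq1.le (by linarith)

/-- The stronger condition on `N` makes `l - 1` a level too, so that `r⁺(l - 1)` is controlled. The
exponent comes out as `3l + 2m - 2 - N`, which is at least `l - 2 - N` because `m ≥ -l`. -/
theorem IsWeight.abs_bMinus_le {N l m : ℝ} (h : IsWeight N l m) (hl : |N| ≤ l - 1) :
    |bMinus q N l m| ≤ (q⁻¹ - q)⁻¹ ^ 2 * q ^ (-2 - N) * q ^ l := by
  obtain ⟨h1, h2⟩ := abs_le.mp h.m_le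
  have hp : ∀ t : ℝ, 0 < q ^ t := Real.rpow_pos_of_pos hq0
  rw [bMinus, rMinus, abs_mul, abs_mul, abs_neg, abs_mul, abs_of_pos (hp _), abs_of_pos (hp _),
    abs_of_nonneg (Real.sqrt_nonneg _)]
  have hκ := (inv_pos.mpr (inv_sub_self_pos hq0 hq1)).le
  calc _ ≤ q ^ m * ((q⁻¹ - q)⁻¹ * q ^ (-(l - m + (l - m - 1)) / 2)) *
        (q ^ (2 * l) * ((q⁻¹ - q)⁻¹ * q ^ (2 * (l - 1) - 1 / 2 - N))) := by
        have hδ := inv_sub_self_pos hq0 hq1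
        have hs := sqrt_qNum_mul_le hq0 hq1 (show 0 ≤ l - m by linarith) (l - m - 1)
        have hr := abs_rPlus_le hq0 hq1 ((abs_nonneg _).trans hl) hl
        gcongr
    _ = (q⁻¹ - q)⁻¹ ^ 2 * (q ^ m * q ^ (-(l - m + (l - m - 1)) / 2) *
        (q ^ (2 * l) * q ^ (2 * (l - 1) - 1 / 2 - N))) := by ring
    _ ≤ _ := by
        rw [mul_assoc ((q⁻¹ - q)⁻¹ ^ 2), ← Real.rpow_add hq0, ← Real.rpow_add hq0,
          ← Real.rpow_add hq0, ← Real.rpow_add hq0]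
        gcongr ?_ * ?_
        exact Real.rpow_le_rpow_of_exponent_ge hq0 hq1.le (by linarith)

/-- `C` enters `R` linearly, so the part of `r⁰` that does not involve `C` cancels; the rest has two
growing `q`-numbers in the denominator. This is why `π_N` and `π_{-N}` are close although neither
`r⁰` part is small. -/
theorem R_sub_R {C C' l : ℝ} :
    R q C ((q ^ l) ^ 2) - R q C' ((q ^ l) ^ 2) =
      (C' - C) * (q + q⁻¹) / ((q - q⁻¹) * (qNum q (2 * l) * qNum q (2 * l + 2))) := by
  have hd := rpow_sub_rpow_ne_zero hq0 hq1
  have e1 : q ^ (2 * l) = (q ^ l) ^ 2 := by rw [two_mul, Real.rpow_add hq0, sq]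
  have e2 : q ^ (2 * l + 2) = (q ^ l) ^ 2 * q ^ 2 := by
    rw [Real.rpow_add hq0, e1]; norm_num
  rw [qNum_eq hq0, qNum_eq hq0, e1, e2, R, R, ← sub_div]
  generalize (q ^ l) ^ 2 - ((q ^ l) ^ 2)⁻¹ = x
  generalize (q ^ l) ^ 2 * q ^ 2 - ((q ^ l) ^ 2 * q ^ 2)⁻¹ = y
  generalize q - q⁻¹ = d at *
  generalize q + q⁻¹ = s at *
  rcases eq_or_ne x 0 with rfl | hx
  · simp
  rcases eq_or_ne y 0 with rfl | hy
  · simp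
  field_simp
  ring

theorem IsWeight.abs_R_sub_R_le {C C' N l m : ℝ} (h : IsWeight N l m) :
    |R q C ((q ^ l) ^ 2) - R q C' ((q ^ l) ^ 2)| ≤
      |C' - C| * (q + q⁻¹) * (q⁻¹ - q)⁻¹ * q ^ (4 * l) := by
  have hd := inv_sub_self_pos hq0 hq1
  have hp : ∀ t : ℝ, 0 < q ^ t := Real.rpow_pos_of_pos hq0
  have hs : 0 < q + q⁻¹ := by positivity
  have h0 : 0 ≤ |C' - C| * (q + q⁻¹) * (q⁻¹ - q)⁻¹ * q ^ (4 * l) := by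
    have := hp (4 * l)
    positivity
  rw [R_sub_R hq0 hq1]
  -- At `l = 0` the factor `[2l]` is zero and the difference is `0` by the convention on division by
  -- zero.
  rcases h.nonneg.eq_or_lt' with hl | hl
  · rw [hl, mul_zero, qNum_zero, zero_mul, mul_zero, div_zero, abs_zero]
    exact hl ▸ h0
  have hl' : 1 / 2 ≤ l := by
    rcases h.cases with h1 | ⟨h1, -⟩ | h1 <;> linarith
  have h1 := le_qNum hq0 hq1 (t := 2 * l) (by linarith)
  have h2 := le_qNum hq0 hq1 (t := 2 * l + 2) (by linarith)
  have h3 : q ^ (1 - 2 * l) * q ^ (1 - (2 * l + 2)) ≤ qNum q (2 * l) * qNum q (2 * l + 2) :=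
    mul_le_mul h1 h2 (hp _).le ((hp _).le.trans h1)
  have e : q ^ (1 - 2 * l) * q ^ (1 - (2 * l + 2)) = (q ^ (4 * l))⁻¹ := by
    rw [← Real.rpow_add hq0, ← Real.rpow_neg hq0.le]
    congr 1
    ring
  rw [e] at h3
  have hX : 0 < (q ^ (4 * l))⁻¹ := inv_pos.mpr (hp _)
  rw [abs_div, abs_mul, abs_mul, abs_of_pos hs, abs_of_pos (hX.trans_le h3), ← neg_sub q⁻¹ q,
    abs_neg, abs_of_pos hd]
  calc _ ≤ |C' - C| * (q + q⁻¹) / ((q⁻¹ - q) * (q ^ (4 * l))⁻¹) := by gcongr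
    _ = _ := by rw [div_eq_mul_inv, mul_inv, inv_inv]; ring

/-- The factor `q^m` and the square root cost at most `q^{m-l}` up to a constant, and the difference
of `r⁰` gains `q^{4l}`; the total `q^{3l+m}` is at most `q^{2l}`. -/
theorem IsWeight.abs_bZero_sub_le {N l m : ℝ} (h : IsWeight N l m) :
    |bZero q N l m - bZero q (-N) l m| ≤ |q ^ (2 * N) - q ^ (-(2 * N))| * (q + q⁻¹) *
      (q⁻¹ - q)⁻¹ ^ 2 * q⁻¹ * q ^ l := by
  obtain ⟨h1, h2⟩ := abs_le.mp h.m_le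
  have hp : ∀ t : ℝ, 0 < q ^ t := Real.rpow_pos_of_pos hq0
  have hh : (q ^ (1 / 2 : ℝ))⁻¹ * q ^ (1 / 2 : ℝ) = 1 := inv_mul_cancel₀ (hp _).ne'
  have e : bZero q N l m - bZero q (-N) l m = q ^ m * √(qNum q (l + m + 1) * qNum q (l - m)) *
      ((q ^ (1 / 2 : ℝ))⁻¹ * (R q (q ^ (-(2 * N))) ((q ^ l) ^ 2) -
        R q (q ^ (2 * N)) ((q ^ l) ^ 2))) := by
    have e1 := rpow_half_mul_rZero hq0 (N := N) (l := l)
    have e2 := rpow_half_mul_rZero hq0 (N := -N) (l := l)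
    rw [mul_neg, neg_neg] at e2
    rw [← e1, ← e2, bZero, bZero]
    linear_combination (-(q ^ m * √(qNum q (l + m + 1) * qNum q (l - m)) *
      (rZero q N l - rZero q (-N) l))) * hh
  rw [e, abs_mul, abs_mul, abs_mul, abs_of_pos (hp m), abs_of_nonneg (Real.sqrt_nonneg _),
    abs_of_pos (inv_pos.mpr (hp _)), ← Real.rpow_neg hq0.le]
  calc _ ≤ q ^ m * ((q⁻¹ - q)⁻¹ * q ^ (-(l + m + 1 + (l - m)) / 2)) * (q ^ (-(1 / 2) : ℝ) *
        (|q ^ (2 * N) - q ^ (-(2 * N))| * (q + q⁻¹) * (q⁻¹ - q)⁻¹ * q ^ (4 * l))) := by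
        have hδ := inv_sub_self_pos hq0 hq1
        have hs := sqrt_qNum_mul_le hq0 hq1 (show 0 ≤ l + m + 1 by linarith) (l - m)
        have hr := h.abs_R_sub_R_le hq0 hq1 (C := q ^ (-(2 * N))) (C' := q ^ (2 * N))
        gcongr
    _ = |q ^ (2 * N) - q ^ (-(2 * N))| * (q + q⁻¹) * (q⁻¹ - q)⁻¹ ^ 2 *
        (q ^ m * q ^ (-(l + m + 1 + (l - m)) / 2) * q ^ (-(1 / 2) : ℝ) * q ^ (4 * l)) := by ring
    _ ≤ _ := by
        rw [mul_assoc _ q⁻¹, ← Real.rpow_neg_one, ← Real.rpow_add hq0, ← Real.rpow_add hq0,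
          ← Real.rpow_add hq0, ← Real.rpow_add hq0, Real.rpow_neg_one]
        gcongr ?_ * ?_
        exact Real.rpow_le_rpow_of_exponent_ge hq0 hq1.le (by linarith [h.nonneg])

theorem aZero_sub {N l m : ℝ} : aZero q N l m - aZero q (-N) l m = q / (1 - q ^ 2) *
      ((q ^ l) ^ 2 * q + ((q ^ l) ^ 2 * q)⁻¹ - (q ^ m) ^ 2 * (q + q⁻¹)) *
      (R q (q ^ (-(2 * N))) ((q ^ l) ^ 2) - R q (q ^ (2 * N)) ((q ^ l) ^ 2)) / (1 + q ^ 2) := by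
  rw [aZero_eq hq0 hq1, aZero_eq hq0 hq1, mul_neg, neg_neg, α, α]
  ring

/-- The bracket multiplying `r⁰` grows like `q^{-2l}`, against `q^{4l}` from the difference of `r⁰`.
-/
theorem IsWeight.abs_aZero_sub_le {N l m : ℝ} (h : IsWeight N l m) :
    |aZero q N l m - aZero q (-N) l m| ≤ q / (1 - q ^ 2) * (2 * (q + q⁻¹)) *
      (|q ^ (2 * N) - q ^ (-(2 * N))| * (q + q⁻¹) * (q⁻¹ - q)⁻¹) / (1 + q ^ 2) * q ^ l := by
  obtain ⟨h1, h2⟩ := abs_le.mp h.m_le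
  have hp : ∀ t : ℝ, 0 < q ^ t := Real.rpow_pos_of_pos hq0
  have h3 : 0 < 1 - q ^ 2 := by nlinarith
  have h4 : 0 < 1 + q ^ 2 := by positivity
  have b : |(q ^ l) ^ 2 * q + ((q ^ l) ^ 2 * q)⁻¹ - (q ^ m) ^ 2 * (q + q⁻¹)| ≤
      2 * (q + q⁻¹) * q ^ (-(2 * l)) := by
    have hqi : 0 < q⁻¹ := by positivity
    have e1 : (q ^ l) ^ 2 = q ^ (2 * l) := by rw [two_mul, Real.rpow_add hq0, sq]
    have e2 : (q ^ m) ^ 2 = q ^ (2 * m) := by rw [two_mul, Real.rpow_add hq0, sq]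
    rw [e1, e2, mul_inv, ← Real.rpow_neg hq0.le]
    have c1 : q ^ (2 * l) ≤ q ^ (-(2 * l)) :=
      Real.rpow_le_rpow_of_exponent_ge hq0 hq1.le (by linarith [h.nonneg])
    have c2 : q ^ (2 * m) ≤ q ^ (-(2 * l)) :=
      Real.rpow_le_rpow_of_exponent_ge hq0 hq1.le (by linarith [h.nonneg])
    have p1 := hp (2 * l)
    have p2 := hp (2 * m)
    have p3 := hp (-(2 * l))
    generalize q ^ (2 * l) = u at *
    generalize q ^ (2 * m) = v at *
    generalize q ^ (-(2 * l)) = w at *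
    have m1 : u * q ≤ w * q := by gcongr
    have m2 : v * (q + q⁻¹) ≤ w * (q + q⁻¹) := by gcongr
    have m3 : 0 < u * q := by positivity
    have m4 : 0 < w * q⁻¹ := by positivity
    have m5 : 0 < v * (q + q⁻¹) := by positivity
    have m6 : 0 < w * (q + q⁻¹) := by positivity
    rw [abs_le]
    constructor <;> nlinarith
  rw [aZero_sub hq0 hq1, abs_div, abs_mul, abs_mul, abs_of_pos h4, abs_of_pos (div_pos hq0 h3)]
  calc _ ≤ q / (1 - q ^ 2) * (2 * (q + q⁻¹) * q ^ (-(2 * l))) *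
        (|q ^ (2 * N) - q ^ (-(2 * N))| * (q + q⁻¹) * (q⁻¹ - q)⁻¹ * q ^ (4 * l)) / (1 + q ^ 2) := by
        have hδ := inv_sub_self_pos hq0 hq1
        have hr := h.abs_R_sub_R_le hq0 hq1 (C := q ^ (-(2 * N))) (C' := q ^ (2 * N))
        gcongr
    _ = q / (1 - q ^ 2) * (2 * (q + q⁻¹)) * (|q ^ (2 * N) - q ^ (-(2 * N))| * (q + q⁻¹) *
        (q⁻¹ - q)⁻¹) / (1 + q ^ 2) * (q ^ (-(2 * l)) * q ^ (4 * l)) := by ring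
    _ ≤ _ := by
        rw [← Real.rpow_add hq0]
        have := (inv_pos.mpr (inv_sub_self_pos hq0 hq1)).le
        gcongr ?_ * ?_
        exact Real.rpow_le_rpow_of_exponent_ge hq0 hq1.le (by linarith [h.nonneg])

end Decay

/-! ### The difference of the representations `π_N` and `π_{-N}` -/

section Difference

variable {q : ℝ} {n : ℕ}

/-- `T` maps `|l,m⟩` to a vector of norm `O(q^l)`. -/
def HasDecay (q : ℝ) (T : SpinSpace n →L[ℂ] SpinSpace n) : Prop :=
  ∃ C, ∀ L M, Admissible n L M → ‖T (spinVec n L M)‖ ≤ C * q ^ ((L : ℝ) / 2)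

theorem HasDecay.zero : HasDecay q (0 : SpinSpace n →L[ℂ] SpinSpace n) := ⟨0, by simp⟩

theorem HasDecay.add {S T : SpinSpace n →L[ℂ] SpinSpace n} (hS : HasDecay q S)
    (hT : HasDecay q T) : HasDecay q (S + T) := by
  obtain ⟨C, hC⟩ := hS
  obtain ⟨C', hC'⟩ := hT
  refine ⟨C + C', fun L M h => ?_⟩
  rw [add_mul]
  exact (norm_add_le _ _).trans (add_le_add (hC L M h) (hC' L M h))

theorem HasDecay.smul {T : SpinSpace n →L[ℂ] SpinSpace n} (hT : HasDecay q T) (c : ℂ) :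
    HasDecay q (c • T) := by
  obtain ⟨C, hC⟩ := hT
  refine ⟨‖c‖ * C, fun L M h => ?_⟩
  rw [smul_apply, norm_smul, mul_assoc]
  gcongr
  exact hC L M h

theorem HasDecay.mul_left {T : SpinSpace n →L[ℂ] SpinSpace n} (hT : HasDecay q T)
    (S : SpinSpace n →L[ℂ] SpinSpace n) : HasDecay q (S * T) := by
  obtain ⟨C, hC⟩ := hT
  refine ⟨‖S‖ * C, fun L M h => ?_⟩
  rw [mul_assoc]
  exact (S.le_opNorm _).trans (mul_le_mul_of_nonneg_left (hC L M h) (norm_nonneg _))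

/-- Right multiplication by `S` preserves decay. -/
def PreservesDecay (q : ℝ) (S : SpinSpace n →L[ℂ] SpinSpace n) : Prop :=
  ∀ T, HasDecay q T → HasDecay q (T * S)

theorem PreservesDecay.add {S S' : SpinSpace n →L[ℂ] SpinSpace n} (hS : PreservesDecay q S)
    (hS' : PreservesDecay q S') : PreservesDecay q (S + S') := fun T hT => by
  rw [mul_add]
  exact (hS T hT).add (hS' T hT)

theorem PreservesDecay.mul {S S' : SpinSpace n →L[ℂ] SpinSpace n} (hS : PreservesDecay q S)
    (hS' : PreservesDecay q S') : PreservesDecay q (S * S') := fun T hT => by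
  rw [← mul_assoc]
  exact hS' _ (hS T hT)

theorem norm_spinVec_le (L M : ℤ) : ‖spinVec n L M‖ ≤ 1 := by
  by_cases h : Admissible n L M
  · rw [spinVec_of_admissible h, (stdBasis _).orthonormal.1]
  · rw [spinVec_of_not h, norm_zero]
    exact zero_le_one

/-- A shift moves the label by a fixed amount, which changes the decay factor only by the constant
`q^{a/2}`. -/
theorem preservesDecay_of_band (hq0 : 0 < q) {S : SpinSpace n →L[ℂ] SpinSpace n} (a b : ℤ) {K : ℝ}
    {c : ℤ → ℤ → ℂ} (hc : ∀ L M, ‖c L M‖ ≤ K)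
    (hS : ∀ L M, S (spinVec n L M) = c L M • spinVec n (L + a) (M + b)) : PreservesDecay q S := by
  rintro T ⟨C, hC⟩
  have hK : 0 ≤ K := (norm_nonneg _).trans (hc 0 0)
  refine ⟨K * (|C| * q ^ ((a : ℝ) / 2)), fun L M _ => ?_⟩
  rw [mul_apply_eq_comp, hS, map_smul, norm_smul, mul_assoc]
  have hp : ∀ t : ℝ, 0 < q ^ t := Real.rpow_pos_of_pos hq0
  have h : ‖T (spinVec n (L + a) (M + b))‖ ≤ |C| * q ^ ((a : ℝ) / 2) * q ^ ((L : ℝ) / 2) := by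
    by_cases h : Admissible n (L + a) (M + b)
    · refine (hC _ _ h).trans ?_
      rw [mul_assoc, ← Real.rpow_add hq0]
      have e : ((L + a : ℤ) : ℝ) / 2 = (a : ℝ) / 2 + (L : ℝ) / 2 := by
        push_cast
        ring
      rw [e]
      exact mul_le_mul_of_nonneg_right (le_abs_self C) (hp _).le
    · rw [spinVec_of_not h, map_zero, norm_zero]
      positivity
  exact mul_le_mul (hc L M) h (norm_nonneg _) hK

theorem IsShiftCoeff.norm_truncated_le {a b : ℤ} {f : ℝ → ℝ → ℝ} {C : ℝ}
    (hf : IsShiftCoeff n a b f C) (L M : ℤ) : ‖((truncated n a b f L M : ℝ) : ℂ)‖ ≤ |C| := by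
  rw [Complex.norm_real, truncated, Real.norm_eq_abs]
  split_ifs with h
  · exact (hf.bound _ _ h.1).trans (le_abs_self C)
  · rw [abs_zero]
    exact abs_nonneg C

theorem preservesDecay_spinShift (hq0 : 0 < q) {a b : ℤ} {f : ℝ → ℝ → ℝ} {C : ℝ}
    (hf : IsShiftCoeff n a b f C) : PreservesDecay q (spinShift hf) :=
  preservesDecay_of_band hq0 a b hf.norm_truncated_le (spinShift_spinVec hf)

theorem preservesDecay_star_spinShift (hq0 : 0 < q) {a b : ℤ} {f : ℝ → ℝ → ℝ} {C : ℝ}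
    (hf : IsShiftCoeff n a b f C) : PreservesDecay q (star (spinShift hf)) :=
  preservesDecay_of_band hq0 (-a) (-b) (fun L M => hf.norm_truncated_le (L - a) (M - b))
    (fun L M => adjoint_spinShift_spinVec hf L M)

variable (hq0 : 0 < q) (hq1 : q < 1) {N : ℝ} (hN : |N| = n / 2)

/-- Decay is clearly stable under left multiplication by bounded operators, but not under right
multiplication. Elements of the algebra are built from finitely many shifts with bounded
coefficients, and these do preserve it. -/
theorem preservesDecay_podlesRep (x : PodlesSphere q) :
    PreservesDecay q (podlesRep hq0 hq1 hN x) := by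
  induction x using PodlesSphere.induction with
  | scalar c =>
    intro T hT
    rw [AlgHomClass.commutes, ← Algebra.commutes, ← Algebra.smul_def]
    exact hT.smul c
  | gen g =>
    rw [podlesRep_gen]
    cases g with
    | A =>
      exact ((preservesDecay_spinShift hq0 _).add (preservesDecay_spinShift hq0 _)).add
        (preservesDecay_star_spinShift hq0 _)
    | B =>
      exact ((preservesDecay_spinShift hq0 _).add (preservesDecay_spinShift hq0 _)).add
        (preservesDecay_spinShift hq0 _)
    | Bstar =>
      have h : opGen hq0 hq1 hN .Bstar = star (spinShift (bPlus_isShiftCoeff hq0 hq1 hN)) +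
          star (spinShift (bZero_isShiftCoeff hq0 hq1 hN)) +
          star (spinShift (bMinus_isShiftCoeff hq0 hq1 hN)) := by
        rw [opGen, opB, star_add, star_add]
      rw [h]
      exact ((preservesDecay_star_spinShift hq0 _).add (preservesDecay_star_spinShift hq0 _)).add
        (preservesDecay_star_spinShift hq0 _)
  | mul a b ha hb => rw [map_mul]; exact ha.mul hb
  | add a b ha hb => rw [map_add]; exact ha.add hb

theorem hasDecay_of_three {T : SpinSpace n →L[ℂ] SpinSpace n} {c₁ c₂ c₃ : ℤ → ℤ → ℝ}
    {L₁ L₂ L₃ M₁ M₂ M₃ : ℤ → ℤ → ℤ} {C₁ C₂ C₃ : ℝ}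
    (hT : ∀ L M, T (spinVec n L M) = ((c₁ L M : ℝ) : ℂ) • spinVec n (L₁ L M) (M₁ L M) +
      ((c₂ L M : ℝ) : ℂ) • spinVec n (L₂ L M) (M₂ L M) +
      ((c₃ L M : ℝ) : ℂ) • spinVec n (L₃ L M) (M₃ L M))
    (h₁ : ∀ L M, |c₁ L M| ≤ C₁ * q ^ ((L : ℝ) / 2))
    (h₂ : ∀ L M, |c₂ L M| ≤ C₂ * q ^ ((L : ℝ) / 2))
    (h₃ : ∀ L M, |c₃ L M| ≤ C₃ * q ^ ((L : ℝ) / 2)) : HasDecay q T := by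
  have key : ∀ (c C t : ℝ) (L M : ℤ), |c| ≤ C * t → ‖((c : ℝ) : ℂ) • spinVec n L M‖ ≤ C * t := by
    intro c C t L M h
    rw [norm_smul, Complex.norm_real, Real.norm_eq_abs]
    exact (mul_le_of_le_one_right (abs_nonneg _) (norm_spinVec_le L M)).trans h
  refine ⟨C₁ + C₂ + C₃, fun L M _ => ?_⟩
  rw [hT, add_mul, add_mul]
  exact (norm_add₃_le).trans (add_le_add_three (key _ _ _ _ _ (h₁ L M)) (key _ _ _ _ _ (h₂ L M))
    (key _ _ _ _ _ (h₃ L M)))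

theorem abs_truncated_sub_le {a b : ℤ} {f g : ℝ → ℝ → ℝ} {C : ℝ} (hC : 0 ≤ C) (hq0 : 0 < q)
    (h : ∀ L M, Admissible n L M → Admissible n (L + a) (M + b) →
      |f ((L : ℝ) / 2) ((M : ℝ) / 2) - g ((L : ℝ) / 2) ((M : ℝ) / 2)| ≤ C * q ^ ((L : ℝ) / 2))
    (L M : ℤ) : |truncated n a b f L M - truncated n a b g L M| ≤ C * q ^ ((L : ℝ) / 2) := by
  rw [truncated, truncated]
  split_ifs with h'
  · exact h L M h'.1 h'.2
  · rw [sub_zero, abs_zero]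
    have := Real.rpow_pos_of_pos hq0 ((L : ℝ) / 2)
    positivity

/-- The estimate for the reversed arrows, which occur in `B*` and in the lowering part of `A`. -/
theorem abs_truncated_neg_sub_le {a b : ℤ} {f g : ℝ → ℝ → ℝ} {C : ℝ} (hq0 : 0 < q)
    (h : ∀ L M, |truncated n a b f L M - truncated n a b g L M| ≤ C * q ^ ((L : ℝ) / 2))
    (L M : ℤ) : |truncated n a b f (L - a) (M - b) - truncated n a b g (L - a) (M - b)| ≤
      C * q ^ (-(a : ℝ) / 2) * q ^ ((L : ℝ) / 2) := by
  refine (h (L - a) (M - b)).trans_eq ?_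
  rw [mul_assoc, ← Real.rpow_add hq0]
  congr 2
  push_cast
  ring

end Difference

/-! ### Decay, nuclearity and the trace property of `π_N - π_{-N}` -/

section RepDiff

variable {q : ℝ} {n : ℕ} (hq0 : 0 < q) (hq1 : q < 1) {N : ℝ} (hN : |N| = n / 2)

theorem abs_neg_eq_half (hN : |N| = n / 2) : |-N| = n / 2 := (abs_neg N).trans hN

/-- The difference of the representations `π_N` and `π_{-N}`. -/
noncomputable def repDiff (x : PodlesSphere q) : SpinSpace n →L[ℂ] SpinSpace n :=
  podlesRep hq0 hq1 hN x - podlesRep hq0 hq1 (abs_neg_eq_half hN) x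

theorem repDiff_add (x y : PodlesSphere q) :
    repDiff hq0 hq1 hN (x + y) = repDiff hq0 hq1 hN x + repDiff hq0 hq1 hN y := by
  rw [repDiff, map_add, map_add, add_sub_add_comm, repDiff, repDiff]

theorem repDiff_smul (c : ℂ) (x : PodlesSphere q) :
    repDiff hq0 hq1 hN (c • x) = c • repDiff hq0 hq1 hN x := by
  rw [repDiff, map_smul, map_smul, ← smul_sub, repDiff]

theorem repDiff_algebraMap (c : ℂ) : repDiff hq0 hq1 hN (algebraMap ℂ _ c) = 0 := by
  rw [repDiff, AlgHomClass.commutes, AlgHomClass.commutes, sub_self]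

/-- Insert `π_{-N}(x) π_N(y)`. This twisted Leibniz rule spreads decay from generators to products
and makes the trace of the difference cyclic. -/
theorem repDiff_mul (x y : PodlesSphere q) : repDiff hq0 hq1 hN (x * y) =
    repDiff hq0 hq1 hN x * podlesRep hq0 hq1 hN y +
      podlesRep hq0 hq1 (abs_neg_eq_half hN) x * repDiff hq0 hq1 hN y := by
  simp only [repDiff, map_mul]
  noncomm_ring

theorem repDiff_A_spinVec (L M : ℤ) :
    repDiff hq0 hq1 hN (PodlesSphere.A q) (spinVec n L M) =
    ((truncated n 2 0 (aPlus q N) L M - truncated n 2 0 (aPlus q (-N)) L M : ℝ) : ℂ) •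
      spinVec n (L + 2) M +
    ((truncated n 0 0 (aZero q N) L M - truncated n 0 0 (aZero q (-N)) L M : ℝ) : ℂ) •
      spinVec n L M +
    ((truncated n 2 0 (aPlus q N) (L - 2) (M - 0) -
      truncated n 2 0 (aPlus q (-N)) (L - 2) (M - 0) : ℝ) : ℂ) • spinVec n (L - 2) M := by
  rw [repDiff, PodlesSphere.A, podlesRep_gen, podlesRep_gen, sub_apply, opGen, opGen,
    opA_spinVec, opA_spinVec, sub_zero]
  push_cast
  module

theorem repDiff_B_spinVec (L M : ℤ) :
    repDiff hq0 hq1 hN (PodlesSphere.B q) (spinVec n L M) =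
    ((truncated n 2 2 (bPlus q N) L M - truncated n 2 2 (bPlus q (-N)) L M : ℝ) : ℂ) •
      spinVec n (L + 2) (M + 2) +
    ((truncated n 0 2 (bZero q N) L M - truncated n 0 2 (bZero q (-N)) L M : ℝ) : ℂ) •
      spinVec n L (M + 2) +
    ((truncated n (-2) 2 (bMinus q N) L M - truncated n (-2) 2 (bMinus q (-N)) L M : ℝ) : ℂ) •
      spinVec n (L - 2) (M + 2) := by
  rw [repDiff, PodlesSphere.B, podlesRep_gen, podlesRep_gen, sub_apply, opGen, opGen,
    opB_spinVec, opB_spinVec]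
  push_cast
  module

theorem repDiff_Bstar_spinVec (L M : ℤ) :
    repDiff hq0 hq1 hN (PodlesSphere.Bstar q) (spinVec n L M) =
    ((truncated n (-2) 2 (bMinus q N) (L - (-2)) (M - 2) -
      truncated n (-2) 2 (bMinus q (-N)) (L - (-2)) (M - 2) : ℝ) : ℂ) •
      spinVec n (L + 2) (M - 2) +
    ((truncated n 0 2 (bZero q N) (L - 0) (M - 2) -
      truncated n 0 2 (bZero q (-N)) (L - 0) (M - 2) : ℝ) : ℂ) • spinVec n L (M - 2) +
    ((truncated n 2 2 (bPlus q N) (L - 2) (M - 2) -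
      truncated n 2 2 (bPlus q (-N)) (L - 2) (M - 2) : ℝ) : ℂ) • spinVec n (L - 2) (M - 2) := by
  rw [repDiff, PodlesSphere.Bstar, podlesRep_gen, podlesRep_gen, sub_apply, opGen, opGen,
    star_opB_spinVec, star_opB_spinVec, sub_zero, sub_neg_eq_add]
  push_cast
  module

theorem abs_truncated_sub_le_add (hq0 : 0 < q) {a b : ℤ} {f g : ℝ → ℝ → ℝ} {C C' : ℝ}
    (hC : 0 ≤ C) (hC' : 0 ≤ C')
    (hf : ∀ L M, Admissible n L M → Admissible n (L + a) (M + b) →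
      |f ((L : ℝ) / 2) ((M : ℝ) / 2)| ≤ C * q ^ ((L : ℝ) / 2))
    (hg : ∀ L M, Admissible n L M → Admissible n (L + a) (M + b) →
      |g ((L : ℝ) / 2) ((M : ℝ) / 2)| ≤ C' * q ^ ((L : ℝ) / 2)) (L M : ℤ) :
    |truncated n a b f L M - truncated n a b g L M| ≤ (C + C') * q ^ ((L : ℝ) / 2) := by
  refine abs_truncated_sub_le (by positivity) hq0 (fun L M h h' => ?_) L M
  rw [add_mul]
  exact (abs_sub _ _).trans (add_le_add (hf L M h h') (hg L M h h'))

/-- On generators, coefficients that change `l` decay for `N` and `-N` separately, and those that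
keep `l` decay in the difference. Products follow from the Leibniz rule, since decay survives
multiplication by the representations on either side. -/
theorem hasDecay_repDiff (x : PodlesSphere q) : HasDecay q (repDiff hq0 hq1 hN x) := by
  have hδ := inv_sub_self_pos hq0 hq1
  have hK : ∀ t : ℝ, 0 ≤ (q⁻¹ - q)⁻¹ ^ 2 * q ^ t := fun t => by
    have := Real.rpow_pos_of_pos hq0 t
    positivity
  have hN' := abs_neg_eq_half hN
  -- An arrow that lowers `l` ends on an existing level, so `|N| ≤ l - 1`; the remaining arrows are
  -- removed by the truncation.
  have hl : ∀ {N : ℝ} {L M : ℤ}, |N| = n / 2 → Admissible n (L + -2) (M + 2) →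
      |N| ≤ (L : ℝ) / 2 - 1 := by
    intro N L M hN h
    have h1 : ((n : ℤ) : ℝ) ≤ ((L + -2 : ℤ) : ℝ) := Int.cast_le.mpr h.1.1
    push_cast at h1
    rw [hN]
    linarith
  have bP := abs_truncated_sub_le_add hq0 (n := n) (a := 2) (b := 2) (hK (-2 - N)) (hK (-2 - -N))
    (fun L M h _ => (h.isWeight hN rfl rfl).abs_bPlus_le hq0 hq1)
    (fun L M h _ => (h.isWeight hN' rfl rfl).abs_bPlus_le hq0 hq1)
  have bM := abs_truncated_sub_le_add hq0 (n := n) (a := -2) (b := 2) (hK (-2 - N)) (hK (-2 - -N))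
    (fun L M h h' => (h.isWeight hN rfl rfl).abs_bMinus_le hq0 hq1 (hl hN h'))
    (fun L M h h' => (h.isWeight hN' rfl rfl).abs_bMinus_le hq0 hq1 (hl hN' h'))
  have aP := abs_truncated_sub_le_add hq0 (n := n) (a := 2) (b := 0) (hK (-2 - N)) (hK (-2 - -N))
    (fun L M h _ => (h.isWeight hN rfl rfl).abs_aPlus_le hq0 hq1)
    (fun L M h _ => (h.isWeight hN' rfl rfl).abs_aPlus_le hq0 hq1)
  have hb : 0 ≤ |q ^ (2 * N) - q ^ (-(2 * N))| * (q + q⁻¹) * (q⁻¹ - q)⁻¹ ^ 2 * q⁻¹ := by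
    positivity
  have bZ := abs_truncated_sub_le hb hq0 (n := n) (a := 0) (b := 2)
    (fun L M h _ => (h.isWeight hN rfl rfl).abs_bZero_sub_le hq0 hq1)
  have ha : 0 ≤ q / (1 - q ^ 2) * (2 * (q + q⁻¹)) * (|q ^ (2 * N) - q ^ (-(2 * N))| * (q + q⁻¹) *
      (q⁻¹ - q)⁻¹) / (1 + q ^ 2) := by
    have : 0 < 1 - q ^ 2 := by nlinarith
    positivity
  have aZ := abs_truncated_sub_le ha hq0 (n := n) (a := 0) (b := 0)
    (fun L M h _ => (h.isWeight hN rfl rfl).abs_aZero_sub_le hq0 hq1)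
  induction x using PodlesSphere.induction with
  | scalar c => rw [repDiff_algebraMap]; exact .zero
  | gen g =>
    cases g with
    | A =>
      exact hasDecay_of_three (repDiff_A_spinVec hq0 hq1 hN) aP aZ
        (abs_truncated_neg_sub_le hq0 aP)
    | B => exact hasDecay_of_three (repDiff_B_spinVec hq0 hq1 hN) bP bZ bM
    | Bstar =>
      exact hasDecay_of_three (repDiff_Bstar_spinVec hq0 hq1 hN)
        (abs_truncated_neg_sub_le hq0 bM)
        (abs_truncated_neg_sub_le hq0 bZ)
        (abs_truncated_neg_sub_le hq0 bP)
  | mul a b ha hb =>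
    rw [repDiff_mul]
    exact (preservesDecay_podlesRep hq0 hq1 hN b _ ha).add (hb.mul_left _)
  | add a b ha hb => rw [repDiff_add]; exact ha.add hb

/-- The label with `l = n/2 + k` and `m = j - l`. -/
def spinIdxOfFin (n : ℕ) (p : Σ k : ℕ, Fin (n + 2 * k + 1)) : SpinIdx n :=
  .mk (n + 2 * p.1) (2 * (p.2 : ℕ) - (n + 2 * p.1)) (by
    have := p.2.2
    rw [admissible_iff]
    omega)

theorem spinIdxOfFin_bijective (n : ℕ) : Function.Bijective (spinIdxOfFin n) := by
  constructor
  · rintro ⟨k, j⟩ ⟨k', j'⟩ h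
    obtain ⟨h1, h2⟩ := SpinIdx.mk_inj.mp h
    dsimp only at h1 h2
    obtain rfl : k = k' := by omega
    obtain rfl : j = j' := Fin.ext (by omega)
    rfl
  · rintro ⟨⟨L, M⟩, h⟩
    obtain ⟨h1, h2, h3, h4, h5⟩ := admissible_iff.mp h
    dsimp only at *
    refine ⟨⟨((L - n) / 2).toNat, ⟨((M + L) / 2).toNat, by omega⟩⟩, ?_⟩
    refine SpinIdx.mk_inj.mpr ⟨?_, ?_⟩ <;> dsimp only <;> omega

/-- The labels of the basis vectors, sorted by `l`. -/
noncomputable def spinIdxEquiv (n : ℕ) : (Σ k : ℕ, Fin (n + 2 * k + 1)) ≃ SpinIdx n :=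
  .ofBijective _ (spinIdxOfFin_bijective n)

theorem spinIdxEquiv_l (p : Σ k : ℕ, Fin (n + 2 * k + 1)) :
    (spinIdxEquiv n p).l = (n : ℝ) / 2 + p.1 := by
  change (((n + 2 * p.1 : ℤ) : ℝ)) / 2 = _
  push_cast
  ring

theorem spinIdxEquiv_m (p : Σ k : ℕ, Fin (n + 2 * k + 1)) :
    (spinIdxEquiv n p).m = (p.2 : ℕ) - ((n : ℝ) / 2 + p.1) := by
  change (((2 * (p.2 : ℕ) - (n + 2 * p.1) : ℤ) : ℝ)) / 2 = _
  push_cast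
  ring

/-- The level `l = n/2 + k` carries `n + 2k + 1` vectors, so the sum is an arithmetic-geometric
series. -/
theorem summable_rpow_l (hq0 : 0 < q) (hq1 : q < 1) : Summable fun i : SpinIdx n => q ^ i.l := by
  rw [← (spinIdxEquiv n).summable_iff]
  have h : ((fun i : SpinIdx n => q ^ i.l) ∘ spinIdxEquiv n) =
      fun p : Σ k : ℕ, Fin (n + 2 * k + 1) => q ^ ((n : ℝ) / 2) * q ^ p.1 := by
    funext p
    rw [Function.comp_apply, spinIdxEquiv_l, Real.rpow_add hq0, Real.rpow_natCast]
  rw [h, summable_sigma_of_nonneg fun p => by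
    have := Real.rpow_pos_of_pos hq0 ((n : ℝ) / 2)
    positivity]
  refine ⟨fun k => (hasSum_fintype _).summable, ?_⟩
  have h1 : Summable fun k : ℕ => (k : ℝ) * q ^ k := by
    simpa using summable_pow_mul_geometric_of_norm_lt_one 1
      (r := q) (by rwa [Real.norm_eq_abs, abs_of_pos hq0])
  have h2 : Summable fun k : ℕ => q ^ k := summable_geometric_of_lt_one hq0.le hq1
  refine ((h1.mul_left (2 * q ^ ((n : ℝ) / 2))).add
    (h2.mul_left (((n : ℝ) + 1) * q ^ ((n : ℝ) / 2)))).congr fun k => ?_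
  dsimp only
  rw [tsum_fintype, Finset.sum_const, Finset.card_univ, Fintype.card_fin, nsmul_eq_mul]
  push_cast
  ring

theorem HasDecay.isNuclear (hq0 : 0 < q) (hq1 : q < 1) {T : SpinSpace n →L[ℂ] SpinSpace n}
    (hT : HasDecay q T) : IsNuclear T := by
  obtain ⟨C, hC⟩ := hT
  refine IsNuclear.of_summable_norm (stdBasis (SpinIdx n)) ?_
  refine Summable.of_nonneg_of_le (fun _ => norm_nonneg _) (fun i => ?_)
    ((summable_rpow_l hq0 hq1).mul_left C)
  rw [← spinVec_idx]
  exact hC _ _ i.admissible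

theorem isNuclear_repDiff (x : PodlesSphere q) : IsNuclear (repDiff hq0 hq1 hN x) :=
  (hasDecay_repDiff hq0 hq1 hN x).isNuclear hq0 hq1

/-- Expand by the Leibniz rule and replace `π_N` by `π_{-N} + δ`. By cyclicity the trace of `δ(xy)`
is that of `π_{-N}(y)δ(x) + π_{-N}(x)δ(y) + δ(x)δ(y)`, which is symmetric in `x` and `y`. -/
theorem nuclearTrace_repDiff_mul_comm (x y : PodlesSphere q) :
    nuclearTrace (repDiff hq0 hq1 hN (x * y)) = nuclearTrace (repDiff hq0 hq1 hN (y * x)) := by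
  have hx := isNuclear_repDiff hq0 hq1 hN x
  have hy := isNuclear_repDiff hq0 hq1 hN y
  set ρ := podlesRep hq0 hq1 hN with hρ
  set ρ' := podlesRep hq0 hq1 (abs_neg_eq_half hN) with hρ'
  have e : ∀ z, ρ z = ρ' z + repDiff hq0 hq1 hN z := fun z => by rw [repDiff]; abel
  rw [repDiff_mul, repDiff_mul, nuclearTrace_add (hx.mul_right _) (hy.mul_left _),
    nuclearTrace_add (hy.mul_right _) (hx.mul_left _), ← hρ, ← hρ', e x, e y, mul_add, mul_add,
    nuclearTrace_add (hx.mul_right _) (hx.mul_right _),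
    nuclearTrace_add (hy.mul_right _) (hy.mul_right _),
    nuclearTrace_mul_comm hx (ρ' y), nuclearTrace_mul_comm hy (ρ' x),
    nuclearTrace_mul_comm hx (repDiff hq0 hq1 hN y)]
  ring

end RepDiff

/-! ### The trace of the difference -/

section Trace

open PodlesIdentity

variable {q : ℝ} {n : ℕ} (hq0 : 0 < q) (hq1 : q < 1)
include hq0 hq1

omit hq0 hq1 in
theorem qNum_neg (t : ℝ) : qNum q (-t) = -qNum q t := by
  rw [qNum, qNum, neg_neg]
  ring

theorem qNum_pos {t : ℝ} (ht : 0 < t) : 0 < qNum q t := by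
  have h := inv_sub_self_pos hq0 hq1
  rw [qNum, ← neg_div_neg_eq, neg_sub, neg_sub]
  exact div_pos (sub_pos.mpr (Real.rpow_lt_rpow_of_exponent_gt hq0 hq1 (by linarith))) h

/-- The `q`-dimension of the level: the geometric sum of `q^{2m}` over `m = -L/2, …, L/2`. -/
theorem sum_rpow_eq_qNum (L : ℕ) :
    ∑ j : Fin (L + 1), (q ^ ((j : ℕ) - (L : ℝ) / 2)) ^ 2 = qNum q (L + 1) := by
  have hd := rpow_sub_rpow_ne_zero hq0 hq1
  have h1 := one_sub_sq_ne_zero hq0 hq1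
  have hq := hq0.ne'
  have e : ∀ j : ℕ, (q ^ ((j : ℕ) - (L : ℝ) / 2)) ^ 2 = (q ^ L)⁻¹ * (q ^ 2) ^ j := by
    intro j
    rw [← Real.rpow_natCast (q ^ _), ← Real.rpow_mul hq0.le, ← pow_mul, ← Real.rpow_natCast q L,
      ← Real.rpow_natCast q (2 * j), ← Real.rpow_neg hq0.le, ← Real.rpow_add hq0]
    congr 1
    push_cast
    ring
  have hs := Fin.sum_univ_eq_sum_range (fun j : ℕ => (q ^ ((j : ℕ) - (L : ℝ) / 2)) ^ 2) (L + 1)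
  have hn : q ^ 2 ≠ 1 := fun h => h1 (by rw [h, sub_self])
  rw [hs, Finset.sum_congr rfl fun j _ => e j, ← Finset.mul_sum, geom_sum_eq hn, qNum,
    Real.rpow_neg hq0.le, ← Nat.cast_add_one, Real.rpow_natCast]
  have h2 : q ^ 2 - 1 ≠ 0 := sub_ne_zero.mpr hn
  field_simp
  ring

theorem aZero_sub_aZero_neg (N l m : ℝ) : aZero q N l m - aZero q (-N) l m =
    qNum q (2 * N) / (1 - q ^ 2) * (q ^ (2 * l + 1) + q ^ (-(2 * l + 1)) -
      (q ^ m) ^ 2 * (q + q⁻¹)) / (qNum q (2 * l) * qNum q (2 * l + 2)) := by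
  have hd := rpow_sub_rpow_ne_zero hq0 hq1
  have h1 := one_sub_sq_ne_zero hq0 hq1
  have h2 : 1 + q ^ 2 ≠ 0 := by positivity
  have h3 : q * (q + q⁻¹) = 1 + q ^ 2 := by
    field_simp
    ring
  have e : (q ^ l) ^ 2 * q = q ^ (2 * l + 1) := by
    rw [Real.rpow_add hq0, Real.rpow_one, two_mul, Real.rpow_add hq0, sq]
  have e2 : q ^ (2 * N) - q ^ (-(2 * N)) = (q - q⁻¹) * qNum q (2 * N) := by
    rw [qNum, mul_div_cancel₀ _ hd]
  rw [aZero_sub hq0 hq1, R_sub_R hq0 hq1, e, ← Real.rpow_neg hq0.le, e2]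
  generalize q ^ (2 * l + 1) + q ^ (-(2 * l + 1)) - (q ^ m) ^ 2 * (q + q⁻¹) = X
  rw [mul_assoc (q - q⁻¹), mul_div_mul_left _ _ hd]
  calc _ = (q * (q + q⁻¹)) / (1 + q ^ 2) * (qNum q (2 * N) / (1 - q ^ 2) * X /
        (qNum q (2 * l) * qNum q (2 * l + 2))) := by ring
    _ = _ := by rw [h3, div_self h2, one_mul]

/-- The telescoping identity, used at `x = 2l + 1`. Over the common denominator it follows from
`[x+1] - [x-1] = q^x + q^{-x}` and `[x+1] + [x-1] = (q + q⁻¹)[x]`. -/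
theorem div_qNum_sub_div_qNum {x : ℝ} (hx : 1 < x) :
    (x * (q ^ x + q ^ (-x)) - qNum q x * (q + q⁻¹)) / (qNum q (x - 1) * qNum q (x + 1)) =
      (x - 1) / qNum q (x - 1) - (x + 1) / qNum q (x + 1) := by
  have hd := rpow_sub_rpow_ne_zero hq0 hq1
  have h1 := (qNum_pos hq0 hq1 (show 0 < x - 1 by linarith)).ne'
  have h2 := (qNum_pos hq0 hq1 (show 0 < x + 1 by linarith)).ne'
  rw [div_sub_div _ _ h1 h2]
  congr 1
  have hX := (Real.rpow_pos_of_pos hq0 x).ne'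
  have hq := hq0.ne'
  have h3 : q ^ 2 - 1 ≠ 0 := sub_ne_zero.mpr fun h => one_sub_sq_ne_zero hq0 hq1 (by rw [h,
    sub_self])
  simp only [qNum, neg_sub, neg_add, Real.rpow_add hq0, Real.rpow_sub hq0, Real.rpow_neg hq0.le,
    Real.rpow_one]
  field_simp
  ring

/-- The upper end of the telescoping sum vanishes in the limit: `[j] ≥ q^{1-j}`, so the quotient is
at most `j q^{j-1}`. -/
theorem tendsto_div_qNum : Filter.Tendsto (fun k : ℕ => ((n : ℝ) + 2 * k) / qNum q (n + 2 * k))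
    Filter.atTop (nhds 0) := by
  have h1 : Filter.Tendsto (fun j : ℕ => (j : ℝ) * q ^ j) Filter.atTop (nhds 0) :=
    tendsto_self_mul_const_pow_of_lt_one hq0.le hq1
  have h2 : Filter.Tendsto (fun k : ℕ => n + 2 * k) Filter.atTop Filter.atTop :=
    Filter.tendsto_atTop_mono (fun k => by dsimp only [id]; omega) Filter.tendsto_id
  have h3 := (h1.comp h2).const_mul q⁻¹
  rw [mul_zero] at h3
  refine squeeze_zero (fun k => ?_) (fun k => ?_) h3
  · exact div_nonneg (by positivity) (qNum_nonneg hq0 hq1 (by positivity))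
  · have e : ((n : ℝ) + 2 * k) = ((n + 2 * k : ℕ) : ℝ) := by push_cast; rfl
    rw [e, Function.comp_apply]
    generalize n + 2 * k = j
    rcases Nat.eq_zero_or_pos j with rfl | hj
    · simp
    have hj' : (1 : ℝ) ≤ j := by exact_mod_cast hj
    have h4 := le_qNum hq0 hq1 hj'
    have h5 : 0 < q ^ (1 - (j : ℝ)) := Real.rpow_pos_of_pos hq0 _
    calc (j : ℝ) / qNum q j ≤ j / q ^ (1 - (j : ℝ)) := by gcongr
      _ = _ := by
        rw [Real.rpow_sub hq0, Real.rpow_one, Real.rpow_natCast]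
        field_simp

variable {N : ℝ} (hN : |N| = n / 2)

omit hq0 hq1 in
theorem spinVec_orthonormal {L M L' M' : ℤ} (h : Admissible n L M) (hne : (L, M) ≠ (L', M')) :
    inner ℂ (spinVec n L M) (spinVec n L' M') = 0 := by
  by_cases h' : Admissible n L' M'
  · rw [spinVec_of_admissible h, spinVec_of_admissible h']
    refine (stdBasis _).orthonormal.2 fun e => hne ?_
    obtain ⟨h1, h2⟩ := SpinIdx.mk_inj.mp e
    exact Prod.ext h1 h2
  · rw [spinVec_of_not h', inner_zero_right]

theorem inner_repDiff_A (i : SpinIdx n) :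
    inner ℂ (stdBasis _ i) (repDiff hq0 hq1 hN (PodlesSphere.A q) (stdBasis _ i)) =
      ((aZero q N i.l i.m - aZero q (-N) i.l i.m : ℝ) : ℂ) := by
  have hi := i.admissible
  have h1 : inner ℂ (spinVec n i.1.1 i.1.2) (spinVec n i.1.1 i.1.2) = 1 := by
    rw [spinVec_idx, inner_self_eq_norm_sq_to_K, (stdBasis _).orthonormal.1]
    simp
  rw [← spinVec_idx, repDiff_A_spinVec, inner_add_right, inner_add_right, inner_smul_right,
    inner_smul_right, inner_smul_right,
    spinVec_orthonormal hi (L' := i.1.1 + 2) (M' := i.1.2) 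
      (fun e => by have := congrArg Prod.fst e; dsimp only at this; omega),
    spinVec_orthonormal hi (L' := i.1.1 - 2) (M' := i.1.2)
      (fun e => by have := congrArg Prod.fst e; dsimp only at this; omega), h1,
    (aZero_isShiftCoeff hq0 hq1 hN).truncated_eq (.inl hi) rfl rfl,
    (aZero_isShiftCoeff hq0 hq1 (abs_neg_eq_half hN)).truncated_eq (.inl hi) rfl rfl]
  rw [mul_zero, mul_zero, add_zero, zero_add, mul_one]
  rfl

theorem sum_aZero_sub (hn : n ≠ 0) (k : ℕ) :
    ∑ j : Fin (n + 2 * k + 1), (aZero q N (spinIdxEquiv n ⟨k, j⟩).l (spinIdxEquiv n ⟨k, j⟩).m -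
      aZero q (-N) (spinIdxEquiv n ⟨k, j⟩).l (spinIdxEquiv n ⟨k, j⟩).m) =
    qNum q (2 * N) / (1 - q ^ 2) * ((n + 2 * k) / qNum q (n + 2 * k) -
      (n + 2 * (k + 1 : ℕ)) / qNum q (n + 2 * (k + 1 : ℕ))) := by
  have hn' : (1 : ℝ) ≤ n := by exact_mod_cast Nat.one_le_iff_ne_zero.mpr hn
  have hk : (0 : ℝ) ≤ k := Nat.cast_nonneg k
  have h1 := sum_rpow_eq_qNum hq0 hq1 (n + 2 * k)
  have h2 := div_qNum_sub_div_qNum hq0 hq1 (x := n + 2 * k + 1) (by linarith)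
  have e1 : (n : ℝ) + 2 * k + 1 - 1 = n + 2 * k := by ring
  have e2 : (n : ℝ) + 2 * k + 1 + 1 = n + 2 * (k + 1 : ℕ) := by push_cast; ring
  have e3 : 2 * ((n : ℝ) / 2 + k) = n + 2 * k := by ring
  have e4 : (n : ℝ) + 2 * k + 2 = n + 2 * (k + 1 : ℕ) := by push_cast; ring
  have e5 : ((n + 2 * k : ℕ) : ℝ) / 2 = (n : ℝ) / 2 + k := by push_cast; ring
  have e6 : ((n + 2 * k : ℕ) : ℝ) + 1 = n + 2 * k + 1 := by push_cast; ring
  rw [e1, e2] at h2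
  rw [e5, e6] at h1
  rw [← h2, ← h1]
  simp only [aZero_sub_aZero_neg hq0 hq1, spinIdxEquiv_l, spinIdxEquiv_m, e3, e4]
  rw [← Finset.sum_div, ← Finset.mul_sum, Finset.sum_sub_distrib, ← Finset.sum_mul,
    Finset.sum_const, Finset.card_univ, Fintype.card_fin, nsmul_eq_mul, mul_div_assoc,
    Nat.cast_add_one, e6]

/-- Only the diagonal entries count. Summed over `m` on each level they telescope in `l`, and what
remains is the lowest term `[2N]/(1 - q²) · n/[n]` with `n = |2N|`; since `[·]` is odd, it equals
`2N/(1 - q²)` for either sign. -/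
theorem nuclearTrace_repDiff_A :
    nuclearTrace (repDiff hq0 hq1 hN (PodlesSphere.A q)) = ((2 * N / (1 - q ^ 2) : ℝ) : ℂ) := by
  -- For `N = 0` the lowest term would be `0/[0]`; there the two representations coincide and the
  -- trace is `0`.
  rcases Nat.eq_zero_or_pos n with rfl | hn
  · have h0 : N = 0 := by simpa using hN
    subst h0
    have : repDiff hq0 hq1 hN (PodlesSphere.A q) = 0 := by
      refine spin_clm_ext fun L M _ => ?_
      rw [repDiff_A_spinVec]
      simp
    rw [this, nuclearTrace_zero]
    simp
  have h := ((spinIdxEquiv n).hasSum_iff.mpr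
    ((isNuclear_repDiff hq0 hq1 hN (PodlesSphere.A q)).hasSum_trace (stdBasis (SpinIdx n)))).sigma
      fun k => hasSum_fintype _
  have h' := h.tendsto_sum_nat
  refine tendsto_nhds_unique h' ?_
  have e : ∀ K : ℕ, ∑ k ∈ Finset.range K, ∑ j : Fin (n + 2 * k + 1),
      ((fun i => inner ℂ (stdBasis (SpinIdx n) i)
        (repDiff hq0 hq1 hN (PodlesSphere.A q) (stdBasis (SpinIdx n) i))) ∘ spinIdxEquiv n) ⟨k, j⟩ =
      ((qNum q (2 * N) / (1 - q ^ 2) * ((n + 2 * (0 : ℕ)) / qNum q (n + 2 * (0 : ℕ)) -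
        (n + 2 * K) / qNum q (n + 2 * K)) : ℝ) : ℂ) := by
    intro K
    rw [← Finset.sum_range_sub' (fun k : ℕ => ((n : ℝ) + 2 * k) / qNum q (n + 2 * k)),
      Finset.mul_sum, Complex.ofReal_sum]
    refine Finset.sum_congr rfl fun k _ => ?_
    rw [← sum_aZero_sub hq0 hq1 hn.ne', Complex.ofReal_sum]
    exact Finset.sum_congr rfl fun j _ => inner_repDiff_A hq0 hq1 hN _
  have hv : 2 * N / (1 - q ^ 2) = qNum q (2 * N) / (1 - q ^ 2) *
      (((n : ℝ) + 2 * (0 : ℕ)) / qNum q (n + 2 * (0 : ℕ)) - 0) := by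
    have hp : 0 < qNum q n := qNum_pos hq0 hq1 (by exact_mod_cast hn)
    rw [Nat.cast_zero, mul_zero, add_zero, sub_zero]
    rcases eq_or_eq_neg_of_abs_eq hN with rfl | rfl
    · rw [mul_div_cancel₀ _ two_ne_zero]
      field_simp
    · rw [mul_neg, mul_div_cancel₀ _ two_ne_zero, qNum_neg]
      field_simp
  rw [hv]
  refine Filter.Tendsto.congr (fun K => (e K).symm) ?_
  exact (Complex.continuous_ofReal.tendsto _).comp
    ((tendsto_const_nhds.sub (tendsto_div_qNum hq0 hq1)).const_mul _)

end Trace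

/-! ### Block operators on `ℋ_N ⊕ ℋ_{-N}` -/

section Block

open ContinuousLinearMap

variable {E : Type} [NormedAddCommGroup E] [InnerProductSpace ℂ E] [CompleteSpace E]

/-- The first coordinate. -/
noncomputable def sumFst (E : Type) [NormedAddCommGroup E] [InnerProductSpace ℂ E] :
    WithLp 2 (E × E) →L[ℂ] E := WithLp.fstL 2 ℂ E E

/-- The second coordinate. -/
noncomputable def sumSnd (E : Type) [NormedAddCommGroup E] [InnerProductSpace ℂ E] :
    WithLp 2 (E × E) →L[ℂ] E := WithLp.sndL 2 ℂ E E

/-- The operator with matrix `[a, b; c, d]`. -/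
noncomputable def block (a b c d : E →L[ℂ] E) : WithLp 2 (E × E) →L[ℂ] WithLp 2 (E × E) :=
  adjoint (sumFst E) ∘L (a ∘L sumFst E + b ∘L sumSnd E) +
    adjoint (sumSnd E) ∘L (c ∘L sumFst E + d ∘L sumSnd E)

theorem adjoint_sumFst_apply (u : E) : adjoint (sumFst E) u = WithLp.toLp 2 (u, 0) := by
  refine ext_inner_left ℂ fun v => ?_
  rw [adjoint_inner_right, WithLp.prod_inner_apply]
  simp [sumFst]

theorem adjoint_sumSnd_apply (u : E) : adjoint (sumSnd E) u = WithLp.toLp 2 (0, u) := by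
  refine ext_inner_left ℂ fun v => ?_
  rw [adjoint_inner_right, WithLp.prod_inner_apply]
  simp [sumSnd]

theorem block_apply (a b c d : E →L[ℂ] E) (u v : E) :
    block a b c d (WithLp.toLp 2 (u, v)) = WithLp.toLp 2 (a u + b v, c u + d v) := by
  have h1 : sumFst E (WithLp.toLp 2 (u, v)) = u := rfl
  have h2 : sumSnd E (WithLp.toLp 2 (u, v)) = v := rfl
  rw [block]
  simp only [add_apply, comp_apply, h1, h2, adjoint_sumFst_apply, adjoint_sumSnd_apply]
  rw [← WithLp.toLp_add, Prod.mk_add_mk, add_zero, zero_add]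

omit [CompleteSpace E] in
theorem block_ext {S T : WithLp 2 (E × E) →L[ℂ] WithLp 2 (E × E)}
    (h : ∀ u v, S (WithLp.toLp 2 (u, v)) = T (WithLp.toLp 2 (u, v))) : S = T := by
  ext1 w
  exact h w.fst w.snd

variable (a b c d a' b' c' d' : E →L[ℂ] E)

theorem block_mul : block a b c d * block a' b' c' d' =
    block (a * a' + b * c') (a * b' + b * d') (c * a' + d * c') (c * b' + d * d') := by
  refine block_ext fun u v => ?_
  rw [mul_apply_eq_comp, block_apply, block_apply, block_apply]
  simp only [add_apply, mul_apply_eq_comp, map_add]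
  congr 2 <;> abel

theorem block_add : block a b c d + block a' b' c' d' =
    block (a + a') (b + b') (c + c') (d + d') := by
  refine block_ext fun u v => ?_
  rw [add_apply, block_apply, block_apply, block_apply, ← WithLp.toLp_add, Prod.mk_add_mk]
  simp only [add_apply]
  congr 2 <;> abel

theorem smul_block (z : ℂ) : z • block a b c d = block (z • a) (z • b) (z • c) (z • d) := by
  refine block_ext fun u v => ?_
  rw [smul_apply, block_apply, block_apply, ← WithLp.toLp_smul, Prod.smul_mk]
  simp only [smul_apply, smul_add]

theorem block_neg : -block a b c d = block (-a) (-b) (-c) (-d) := by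
  refine block_ext fun u v => ?_
  rw [neg_apply, block_apply, block_apply, ← WithLp.toLp_neg, Prod.neg_mk]
  simp only [neg_apply, neg_add]

theorem block_sub : block a b c d - block a' b' c' d' =
    block (a - a') (b - b') (c - c') (d - d') := by
  rw [sub_eq_add_neg, block_neg, block_add]
  simp only [sub_eq_add_neg]

theorem block_one : block (1 : E →L[ℂ] E) 0 0 1 = 1 := by
  refine block_ext fun u v => ?_
  rw [block_apply]
  simp

theorem block_zero : block (0 : E →L[ℂ] E) 0 0 0 = 0 := by
  refine block_ext fun u v => ?_
  rw [block_apply]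
  simp

theorem star_block : star (block a b c d) = block (star a) (star c) (star b) (star d) := by
  simp only [block, star_eq_adjoint, map_add, adjoint_comp, adjoint_adjoint, comp_add, comp_assoc]
  abel

variable {a b c d}

theorem isNuclear_block (ha : IsNuclear a) (hb : IsNuclear b) (hc : IsNuclear c)
    (hd : IsNuclear d) : IsNuclear (block a b c d) :=
  (((ha.comp_clm _).add (hb.comp_clm _)).clm_comp _).add
    (((hc.comp_clm _).add (hd.comp_clm _)).clm_comp _)

theorem nuclearTrace_block_diag (ha : IsNuclear a) (hd : IsNuclear d) :
    nuclearTrace (block a 0 0 d) = nuclearTrace a + nuclearTrace d := by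
  have h1 : sumFst E ∘L adjoint (sumFst E) = 1 := by
    ext u
    rw [comp_apply, adjoint_sumFst_apply]
    rfl
  have h2 : sumSnd E ∘L adjoint (sumSnd E) = 1 := by
    ext u
    rw [comp_apply, adjoint_sumSnd_apply]
    rfl
  rw [block, zero_comp, zero_comp, add_zero, zero_add,
    nuclearTrace_add ((ha.comp_clm _).clm_comp _) ((hd.comp_clm _).clm_comp _),
    nuclearTrace_comp_comm (ha.comp_clm _), nuclearTrace_comp_comm (hd.comp_clm _), comp_assoc,
    comp_assoc, h1, h2]
  rfl

end Block

/-! ### The Fredholm module -/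

section Module

open ContinuousLinearMap

variable {q : ℝ} {n : ℕ} (hq0 : 0 < q) (hq1 : q < 1) {N : ℝ} (hN : |N| = n / 2)

/-- The representation `π_N ⊕ π_{-N}`. -/
noncomputable def doubleRep : PodlesSphere q →⋆ₙₐ[ℂ] (DoubleSpace n →L[ℂ] DoubleSpace n) where
  toFun x := block (podlesRep hq0 hq1 hN x) 0 0 (podlesRep hq0 hq1 (abs_neg_eq_half hN) x)
  map_smul' z x := by
    rw [map_smul, map_smul, MonoidHom.id_apply, smul_block, smul_zero]
  map_zero' := by rw [map_zero, map_zero, block_zero]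
  map_add' x y := by rw [map_add, map_add, block_add, add_zero]
  map_mul' x y := by
    rw [map_mul, map_mul, block_mul]
    simp only [mul_zero, zero_mul, add_zero, zero_add]
  map_star' x := by rw [map_star, map_star, star_block, star_zero]

theorem doubleRep_eq (x : PodlesSphere q) : doubleRep hq0 hq1 hN x =
    block (podlesRep hq0 hq1 hN x) 0 0 (podlesRep hq0 hq1 (abs_neg_eq_half hN) x) := rfl

/-- The operator `u ⊕ v ↦ w̄ v ⊕ w u`. -/
noncomputable def phaseSwap (n : ℕ) (w : ℂ) : DoubleSpace n →L[ℂ] DoubleSpace n :=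
  block 0 (conj w • 1) (w • 1) 0

/-- The grading `u ⊕ v ↦ u ⊕ -v`. -/
noncomputable def spinGrading (n : ℕ) : DoubleSpace n →L[ℂ] DoubleSpace n := block 1 0 0 (-1)

variable {w : ℂ}

theorem conj_mul_self_of_norm_one (hw : ‖w‖ = 1) : conj w * w = 1 := by
  rw [← Complex.normSq_eq_conj_mul_self, Complex.normSq_eq_norm_sq, hw]
  norm_num

/-- `F` exchanges the summands, so its commutator with `π_N ⊕ π_{-N}` measures exactly how far the
two representations differ. -/
theorem phaseSwap_commutator (x : PodlesSphere q) :
    phaseSwap n w * doubleRep hq0 hq1 hN x - doubleRep hq0 hq1 hN x * phaseSwap n w =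
      block 0 (-(conj w • repDiff hq0 hq1 hN x)) (w • repDiff hq0 hq1 hN x) 0 := by
  rw [doubleRep_eq, phaseSwap, block_mul, block_mul, block_sub, repDiff]
  simp only [mul_zero, zero_mul, add_zero, zero_add, smul_mul_assoc, one_mul, mul_one,
    mul_smul_comm, sub_self, smul_sub, neg_sub, smul_zero]

theorem isNuclear_phaseSwap_commutator (x : PodlesSphere q) :
    IsNuclear (phaseSwap n w * doubleRep hq0 hq1 hN x - doubleRep hq0 hq1 hN x * phaseSwap n w) :=
      by
  have h := isNuclear_repDiff hq0 hq1 hN x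
  rw [phaseSwap_commutator]
  exact isNuclear_block .zero (h.smul _).neg (h.smul _) .zero

/-- The phase cancels because `w` is unimodular, so the cocycle does not depend on `d_N`; the signs
from `γ` and from the commutator cancel too, which gives the factor `2` in the trace. -/
theorem spinGrading_phaseSwap_commutator (hw : ‖w‖ = 1) (x : PodlesSphere q) :
    spinGrading n * phaseSwap n w *
      (phaseSwap n w * doubleRep hq0 hq1 hN x - doubleRep hq0 hq1 hN x * phaseSwap n w) =
      block (repDiff hq0 hq1 hN x) 0 0 (repDiff hq0 hq1 hN x) := by
  have h := conj_mul_self_of_norm_one hw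
  have h' : w * conj w = 1 := by rw [mul_comm, h]
  rw [phaseSwap_commutator, spinGrading, phaseSwap, block_mul, block_mul]
  simp only [mul_zero, zero_mul, add_zero, zero_add, smul_mul_assoc, one_mul,
    mul_smul_comm, smul_smul, neg_mul, mul_neg, smul_neg, neg_neg, neg_zero, h, h', one_smul]

/-- The Fredholm module on `ℋ_N ⊕ ℋ_{-N}` with `F = [0, w̄; w, 0]`. -/
noncomputable def podlesModule (hw : ‖w‖ = 1) :
    EvenFredholmModule (PodlesSphere q) (DoubleSpace n) where
  π := doubleRep hq0 hq1 hN
  F := phaseSwap n w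
  γ := spinGrading n
  F_selfAdjoint := by
    rw [isSelfAdjoint_iff, phaseSwap, star_block, star_smul, star_smul, star_one, star_zero]
    simp
  F_mul_F := by
    have h := conj_mul_self_of_norm_one hw
    have h' : w * conj w = 1 := by rw [mul_comm, h]
    rw [phaseSwap, block_mul, ← block_one]
    simp only [mul_zero, zero_mul, add_zero, zero_add, smul_mul_assoc, one_mul,
      mul_smul_comm, smul_smul, h, h', one_smul, smul_zero]
  γ_selfAdjoint := by
    rw [isSelfAdjoint_iff, spinGrading, star_block, star_neg, star_one, star_zero]
  γ_mul_γ := by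
    rw [spinGrading, block_mul, ← block_one]
    simp
  γ_mul_F := by
    rw [spinGrading, phaseSwap, block_mul, block_mul, block_neg]
    simp
  γ_mul_π x := by
    rw [doubleRep_eq, spinGrading, block_mul, block_mul]
    simp
  compact_commutator x := (isNuclear_phaseSwap_commutator hq0 hq1 hN x).isCompactOperator

/-- The trace cocycle. -/
noncomputable def traceCocycle : PodlesSphere q →ₗ[ℂ] ℂ where
  toFun x := 2 * nuclearTrace (repDiff hq0 hq1 hN x)
  map_add' x y := by
    rw [repDiff_add, nuclearTrace_add (isNuclear_repDiff hq0 hq1 hN x)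
      (isNuclear_repDiff hq0 hq1 hN y), mul_add]
  map_smul' c x := by
    rw [repDiff_smul, nuclearTrace_smul (isNuclear_repDiff hq0 hq1 hN x), RingHom.id_apply,
      smul_eq_mul]
    ring

theorem traceCocycle_apply (x : PodlesSphere q) :
    traceCocycle hq0 hq1 hN x = 2 * nuclearTrace (repDiff hq0 hq1 hN x) := rfl

theorem hasTrace_podlesModule (hw : ‖w‖ = 1) (x : PodlesSphere q) :
    HasTrace (spinGrading n * phaseSwap n w *
      (phaseSwap n w * doubleRep hq0 hq1 hN x - doubleRep hq0 hq1 hN x * phaseSwap n w))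
      (traceCocycle hq0 hq1 hN x) := by
  have h := isNuclear_repDiff hq0 hq1 hN x
  rw [traceCocycle_apply, two_mul, ← nuclearTrace_block_diag h h,
    spinGrading_phaseSwap_commutator _ _ _ hw]
  exact (isNuclear_block h .zero .zero h).hasTrace

/-- The unit contributes nothing, so the sum of the diagonal is `-(1 - q²)` times the value at `A`,
and the denominator `1 - q²` cancels. -/
theorem traceCocycle_projector :
    traceCocycle hq0 hq1 hN (PodlesSphere.projector q 0 0) +
      traceCocycle hq0 hq1 hN (PodlesSphere.projector q 1 1) = -(4 * N : ℝ) := by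
  have h1 : traceCocycle hq0 hq1 hN 1 = 0 := by
    have := repDiff_algebraMap hq0 hq1 hN 1
    rw [map_one] at this
    rw [traceCocycle_apply, this, nuclearTrace_zero, mul_zero]
  have hA : traceCocycle hq0 hq1 hN (PodlesSphere.A q) = 2 * ((2 * N / (1 - q ^ 2) : ℝ) : ℂ) := by
    rw [traceCocycle_apply, nuclearTrace_repDiff_A]
  have e0 : PodlesSphere.projector q 0 0 = 1 - PodlesSphere.A q := rfl
  have e1 : PodlesSphere.projector q 1 1 = ((q : ℂ) ^ 2) • PodlesSphere.A q := rfl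
  rw [e0, e1, map_sub, map_smul, h1, hA, smul_eq_mul]
  have hq : 1 - q ^ 2 ≠ 0 := one_sub_sq_ne_zero hq0 hq1
  norm_cast
  field_simp
  ring

end Module

/-! ### The sign of the Dirac operator -/

section Dirac

variable {q : ℝ} {n : ℕ}

theorem growth_apply (x : (growth q n).domain) (i : SpinIdx n) :
    growth q n x i = ((q ^ (-i.l) : ℝ) : ℂ) * (x : SpinSpace n) i := rfl

theorem inner_growth_nonneg (hq0 : 0 < q) (x : (growth q n).domain) :
    0 ≤ (inner ℂ (x : SpinSpace n) (growth q n x)).re := by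
  have h := Complex.hasSum_re (lp.hasSum_inner (x : SpinSpace n) (growth q n x))
  refine h.nonneg fun i => ?_
  rw [growth_apply, RCLike.inner_apply, mul_assoc, Complex.mul_conj, ← Complex.ofReal_mul,
    Complex.ofReal_re]
  exact mul_nonneg (Real.rpow_pos_of_pos hq0 _).le (Complex.normSq_nonneg _)

theorem mem_dirac_domain {d : ℂ} {x : DoubleSpace n} : x ∈ (dirac q d n).domain ↔
    x.fst ∈ (growth q n).domain ∧ x.snd ∈ (growth q n).domain := Submodule.mem_prod

theorem dirac_apply {d : ℂ} (x : (dirac q d n).domain) : dirac q d n x = WithLp.toLp 2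
    (conj d • growth q n ⟨(x : DoubleSpace n).snd, (mem_dirac_domain.mp x.2).2⟩,
      d • growth q n ⟨(x : DoubleSpace n).fst, (mem_dirac_domain.mp x.2).1⟩) := rfl

theorem phaseSwap_apply (w : ℂ) (u v : SpinSpace n) :
    phaseSwap n w (WithLp.toLp 2 (u, v)) = WithLp.toLp 2 (conj w • v, w • u) := by
  rw [phaseSwap, block_apply]
  simp

theorem phaseSwap_apply' (w : ℂ) (x : DoubleSpace n) :
    phaseSwap n w x = WithLp.toLp 2 (conj w • x.snd, w • x.fst) := phaseSwap_apply w x.fst x.snd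

/-- The phase of `d`. -/
noncomputable def phase (d : ℂ) : ℂ := ((‖d‖⁻¹ : ℝ) : ℂ) * d

theorem norm_phase {d : ℂ} (hd : d ≠ 0) : ‖phase d‖ = 1 := by
  rw [phase, norm_mul, Complex.norm_real, norm_inv, norm_norm,
    inv_mul_cancel₀ (norm_ne_zero_iff.mpr hd)]

theorem conj_phase_mul {d : ℂ} (hd : d ≠ 0) : conj (phase d) * d = ‖d‖ := by
  have h : (‖d‖ : ℂ) ≠ 0 := Complex.ofReal_ne_zero.mpr (norm_ne_zero_iff.mpr hd)
  rw [phase, map_mul, Complex.conj_ofReal, mul_assoc, Complex.conj_mul', Complex.ofReal_inv]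
  field_simp

theorem phase_mul_conj {d : ℂ} (hd : d ≠ 0) : phase d * conj d = ‖d‖ := by
  have := congrArg conj (conj_phase_mul hd)
  rwa [map_mul, Complex.conj_conj, Complex.conj_ofReal] at this

theorem phaseSwap_dirac {d : ℂ} (hd : d ≠ 0) (x : (dirac q d n).domain) :
    phaseSwap n (phase d) (dirac q d n x) = WithLp.toLp 2
      ((‖d‖ : ℂ) • growth q n ⟨(x : DoubleSpace n).fst, (mem_dirac_domain.mp x.2).1⟩,
        (‖d‖ : ℂ) • growth q n ⟨(x : DoubleSpace n).snd, (mem_dirac_domain.mp x.2).2⟩) := by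
  rw [dirac_apply, phaseSwap_apply, smul_smul, smul_smul, conj_phase_mul hd, phase_mul_conj hd]

/-- `F D` is multiplication by `|d| q^{-l}` on both summands, because the phase of `d` times the
conjugate of `d` is `|d|`; so `F D` is positive. The domain is symmetric in the summands, hence
preserved. -/
theorem isSignOf_phaseSwap {n : ℕ} (hq0 : 0 < q) {d : ℂ} (hd : d ≠ 0)
    (hs : IsSelfAdjoint (phaseSwap n (phase d))) (hm : phaseSwap n (phase d) *
      phaseSwap n (phase d) = 1) :
    IsSignOf (phaseSwap n (phase d)) (dirac q d n) where
  isSelfAdjoint := hs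
  mul_self := hm
  mem_domain x := by
    obtain ⟨h1, h2⟩ := mem_dirac_domain.mp x.2
    rw [phaseSwap_apply', mem_dirac_domain]
    exact ⟨Submodule.smul_mem _ _ h2, Submodule.smul_mem _ _ h1⟩
  comm x := by
    obtain ⟨h1, h2⟩ := mem_dirac_domain.mp x.2
    have e : ∀ (c : ℂ) (u : (growth q n).domain), growth q n (c • u) = c • growth q n u :=
      fun c u => (growth q n).map_smul c u
    rw [phaseSwap_dirac hd, dirac_apply]
    have e1 := e (phase d) ⟨_, h1⟩
    have e2 := e (conj (phase d)) ⟨_, h2⟩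
    have k1 : conj d • phase d • growth q n ⟨_, h1⟩ = (‖d‖ : ℂ) • growth q n ⟨_, h1⟩ := by
      rw [smul_smul, mul_comm, phase_mul_conj hd]
    have k2 : d • conj (phase d) • growth q n ⟨_, h2⟩ = (‖d‖ : ℂ) • growth q n ⟨_, h2⟩ := by
      rw [smul_smul, mul_comm, conj_phase_mul hd]
    rw [← k1, ← k2, ← e1, ← e2]
    have hF := phaseSwap_apply' (phase d) (x : DoubleSpace n)
    congr 4
    · exact Subtype.ext (congrArg WithLp.snd hF)
    · exact Subtype.ext (congrArg WithLp.fst hF)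
  nonneg x := by
    rw [phaseSwap_dirac hd, WithLp.prod_inner_apply, inner_smul_right, inner_smul_right,
      ← mul_add, Complex.re_ofReal_mul, Complex.add_re]
    exact mul_nonneg (norm_nonneg _)
      (add_nonneg (inner_growth_nonneg hq0 _) (inner_growth_nonneg hq0 _))

end Dirac

/-! ### The projector -/

/-- Each entry of `p² = p` is one defining relation: those for `BB*` and `B*B` on the diagonal,
those for `AB` and `AB*` off it. -/
theorem PodlesSphere.isStarProjection_projector {q : ℝ} (hq0 : 0 < q) :
    IsStarProjection (PodlesSphere.projector q) := by
  have hq : ((q : ℂ) ^ 2) ≠ 0 := pow_ne_zero 2 (Complex.ofReal_ne_zero.mpr hq0.ne')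
  have h1 := A_mul_B q
  have h2 := A_mul_Bstar q
  have h3 : ((q : ℂ) ^ 2) • (B q * Bstar q) = A q * (1 - A q) := by
    rw [B_mul_Bstar, smul_inv_smul₀ hq]
  have h4 := Bstar_mul_B q
  simp only [mul_sub, mul_one, mul_smul_comm] at h3 h4
  constructor
  · rw [IsIdempotentElem, projector, Matrix.mul_fin_two]
    simp only [mul_sub, sub_mul, one_mul, mul_one, smul_mul_assoc, mul_smul_comm, smul_sub]
    rw [h1, ← h2]
    have e1 : 1 - A q - (A q - A q * A q) + (q : ℂ) • (q : ℂ) • (B q * Bstar q) = 1 - A q := by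
      linear_combination (norm := module) h3
    have e2 : (q : ℂ) • B q - (q : ℂ) • (q : ℂ) ^ 2 • (B q * A q) +
        (q : ℂ) ^ 2 • (q : ℂ) • (B q * A q) = (q : ℂ) • B q := by module
    have e3 : (q : ℂ) • Bstar q - (q : ℂ) • (q : ℂ) ^ 2 • (A q * Bstar q) +
        (q : ℂ) • (q : ℂ) ^ 2 • (A q * Bstar q) = (q : ℂ) • Bstar q := by module
    have e4 : (q : ℂ) • (q : ℂ) • (Bstar q * B q) + (q : ℂ) ^ 2 • (q : ℂ) ^ 2 • (A q * A q) =
        (q : ℂ) ^ 2 • A q := by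
      linear_combination (norm := module) ((q : ℂ) ^ 2) • h4
    rw [e1, e2, e3, e4]
  · rw [IsSelfAdjoint, Matrix.star_eq_conjTranspose]
    ext i j
    rw [Matrix.conjTranspose_apply]
    fin_cases i <;> fin_cases j
    · change star (1 - A q) = 1 - A q
      rw [star_sub, star_one, star_A]
    · change star ((q : ℂ) • Bstar q) = (q : ℂ) • B q
      rw [star_smul, star_Bstar, Complex.star_def, Complex.conj_ofReal]
    · change star ((q : ℂ) • B q) = (q : ℂ) • Bstar q
      rw [star_smul, star_B, Complex.star_def, Complex.conj_ofReal]
    · change star (((q : ℂ) ^ 2) • A q) = ((q : ℂ) ^ 2) • A q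
      rw [star_smul, star_A, Complex.star_def, map_pow, Complex.conj_ofReal]

/-! ### The index of the module and the main theorem -/

theorem abs_half_eq_natAbs_half (z : ℤ) : |(z : ℝ) / 2| = (z.natAbs : ℝ) / 2 := by
  rw [abs_div, abs_two, Nat.cast_natAbs, Int.cast_abs]

theorem isPodlesFredholmModule_podlesModule {q : ℝ} (hq0 : 0 < q) (hq1 : q < 1) {d : ℂ} (hd : d ≠ 0)
    (z : ℤ) : IsPodlesFredholmModule q d z
      (podlesModule hq0 hq1 (abs_half_eq_natAbs_half z) (norm_phase hd)) where
  rep := ⟨podlesRep hq0 hq1 (abs_half_eq_natAbs_half z),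
    podlesRep hq0 hq1 (abs_neg_eq_half (abs_half_eq_natAbs_half z)),
    isPodlesRep_podlesRep hq0 hq1 _, isPodlesRep_podlesRep hq0 hq1 _, fun a u v => by
      refine (block_apply _ _ _ _ u v).trans ?_
      simp⟩
  sign := isSignOf_phaseSwap hq0 hd
    (podlesModule hq0 hq1 (abs_half_eq_natAbs_half z) (norm_phase hd)).F_selfAdjoint
    (podlesModule hq0 hq1 (abs_half_eq_natAbs_half z) (norm_phase hd)).F_mul_F
  grading u v := by
    refine (block_apply _ _ _ _ u v).trans ?_
    simp

/-- Twice the index is `φ_N(p₁₁ + p₂₂) = -4N`, and `2N = z`. -/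
theorem index_podlesModule {q : ℝ} (hq0 : 0 < q) (hq1 : q < 1) {w : ℂ} (hw : ‖w‖ = 1) (z : ℤ) :
    (podlesModule hq0 hq1 (abs_half_eq_natAbs_half z) hw).bundle.index
      (PodlesSphere.projector q) = -z := by
  have h := (podlesModule hq0 hq1 (abs_half_eq_natAbs_half z) hw).two_mul_index
    (PodlesSphere.isStarProjection_projector hq0) (isNuclear_phaseSwap_commutator hq0 hq1 _)
  have ht : ∀ x, nuclearTrace (spinGrading z.natAbs * phaseSwap z.natAbs w *
      (phaseSwap z.natAbs w * doubleRep hq0 hq1 (abs_half_eq_natAbs_half z) x -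
        doubleRep hq0 hq1 (abs_half_eq_natAbs_half z) x * phaseSwap z.natAbs w)) =
      traceCocycle hq0 hq1 (abs_half_eq_natAbs_half z) x := fun x => by
    have hx := isNuclear_repDiff hq0 hq1 (abs_half_eq_natAbs_half z) x
    rw [spinGrading_phaseSwap_commutator _ _ _ hw, nuclearTrace_block_diag hx hx, ← two_mul,
      traceCocycle_apply]
  have h' : (2 * (podlesModule hq0 hq1 (abs_half_eq_natAbs_half z) hw).bundle.index
      (PodlesSphere.projector q) : ℂ) = -(4 * ((z : ℝ) / 2) : ℝ) := by
    rw [h, Fin.sum_univ_two, ← traceCocycle_projector hq0 hq1 (abs_half_eq_natAbs_half z), ← ht,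
      ← ht]
    rfl
  have h2 : (2 * (podlesModule hq0 hq1 (abs_half_eq_natAbs_half z) hw).bundle.index
      (PodlesSphere.projector q) : ℂ) = 2 * ((-z : ℤ) : ℂ) := by
    rw [h']
    push_cast
    ring
  exact_mod_cast mul_left_cancel₀ two_ne_zero h2

theorem mainTheorem7 (q : ℝ) (hq0 : 0 < q) (hq1 : q < 1) (d : ℤ → ℂ) (hd : ∀ z, d z ≠ 0) :
    IsStarProjection (PodlesSphere.projector q) ∧
    ∃ M : ∀ z : ℤ, EvenFredholmModule (PodlesSphere q) (DoubleSpace z.natAbs),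
      (∀ z, IsPodlesFredholmModule q (d z) z (M z)) ∧
      (∀ z a, IsTraceClass ((M z).F * (M z).π a - (M z).π a * (M z).F)) ∧
      (∀ z, ∃ φ : PodlesSphere q →ₗ[ℂ] ℂ,
        (∀ x, HasTrace ((M z).γ * (M z).F * ((M z).F * (M z).π x - (M z).π x * (M z).F)) (φ x)) ∧
        (∀ x y, φ (x * y) = φ (y * x)) ∧
        cocyclePairing φ ((1 / 2 : ℂ) • PodlesSphere.projector q) = -(2 * ((z : ℂ) / 2)) ∧
        cocyclePairing ((1 / 2 : ℂ) • φ) (PodlesSphere.projector q) = -(2 * ((z : ℂ) / 2))) ∧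
      (∀ z z', z ≠ z' → ¬ SameKHomologyClass (M z).bundle (M z').bundle) := by
  have hp := PodlesSphere.isStarProjection_projector hq0
  refine ⟨hp, fun z => podlesModule hq0 hq1 (abs_half_eq_natAbs_half z) (norm_phase (hd z)),
    fun z => isPodlesFredholmModule_podlesModule hq0 hq1 (hd z) z,
    fun z a => (isNuclear_phaseSwap_commutator hq0 hq1 _ a).isTraceClass, fun z => ?_, ?_⟩
  · have h := traceCocycle_projector hq0 hq1 (abs_half_eq_natAbs_half z)
    refine ⟨traceCocycle hq0 hq1 (abs_half_eq_natAbs_half z),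
      hasTrace_podlesModule hq0 hq1 _ (norm_phase (hd z)), fun x y => ?_, ?_, ?_⟩
    · rw [traceCocycle_apply, traceCocycle_apply, nuclearTrace_repDiff_mul_comm]
    · rw [cocyclePairing, Fin.sum_univ_two, Matrix.smul_apply, Matrix.smul_apply, map_smul,
        map_smul, ← smul_add, h, smul_eq_mul]
      push_cast
      ring
    · rw [cocyclePairing, Fin.sum_univ_two, LinearMap.smul_apply, LinearMap.smul_apply,
        ← smul_add, h, smul_eq_mul]
      push_cast
      ring
  -- The index pairing with the projector depends only on the K-homology class and recovers the
  -- integer label.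
  · intro z z' hz hs
    have h := hs.index_eq hp
    rw [index_podlesModule, index_podlesModule, neg_inj] at h
    exact hz h
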